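/- **Model.** Let $\alpha\in(0,1)$, $\beta\in(0,1-\alpha)$, $p\in(0,1]$, and let $n,m\ge 1$ be integers. Let $S$ be the unit hypercube $[0,1]^m$ with opposite faces identified, with the torus metric derived from the $L_\infty$ metric. Consider the following Markov chain. Its state consists of $n$ nodes located at points of $S$, a ranking of the nodes (a bijection onto $\{1,\dots,n\}$) and a graph on the nodes. The *influence region* of a node of rank $r$ is the ball around it of volume $r^{-\alpha}n^{-\beta}$. At each time-step: 1. a new node $v$ is placed uniformly at random in $S$, and, independently for every existing node $u$ whose influence region contains $v$, the edge $uv$ is created with probability $p$; 2. one of the $n$ old nodes, chosen uniformly at random, is deleted together with its edges; 3. the new node is inserted into the ranking at a rank chosen uniformly at random from $\{1,\dots,n\}$, the remaining old nodes keeping their relative order. All these choices are independent of each other and of the past. $\text{GEO-P}(\alpha,\beta,m,p)$ on $n$ nodes is the random graph given by the stationary distribution of this chain. Let $D$ be its diameter. **Theorem.** Let $\alpha\in(0,1)$, $\beta\in(0,1-\alpha)$ and $p\in(0,1]$. The stationary distribution exists and is unique for all $n,m\ge1$, and the following hold. (a) There are constants $c,C,\kappa>0$ and $N$, depending only on $\alpha,\beta,p$,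 such that for all $n\ge N$ and all $m\ge 1$, with probability at least $1-\exp(-\kappa\log^2 n)$, the graph is connected and $$c\,n^{\frac{\beta}{(1-\alpha)m}}(\log n)^{-\frac{\alpha}{m}}\;\le\; D\;\le\; C\,n^{\frac{\beta}{(1-\alpha)m}}(\log n)^{\frac{2\alpha}{(1-\alpha)m}} .$$ (b) For every $K>0$ there are constants $C,\kappa>0$ and $N$, depending only on $\alpha,\beta,p,K$, such that for all $n\ge N$ and all integers $1\le m\le K\log\log n$ (in particular for every fixed $m$ and all large $n$), with probability at least $1-\exp(-\kappa\log^2 n)$, the graph is connected and $$\Bigl|\log D-\frac{\beta}{(1-\alpha)m}\log n\Bigr|\;\le\; C\,\frac{\log\log n}{m}.$$ (c) For every $K>0$ there are constants $M$, $\kappa>0$ and $N$, depending only on $\alpha,\beta,p,K$, such that for all $n\ge N$ and all integers $m\ge 1$ with $m\ge K\log n$, with probability at least $1-\exp(-\kappa\log^2 n)$, the graph is connected and $D\le M$. -/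

import Mathlib

open MeasureTheory ProbabilityTheory

namespace GeoP

/-- Rank functions are bijections of `Fin n`; this finite type carries the discrete σ-algebra. -/
instance instMeasurableSpacePerm (n : ℕ) : MeasurableSpace (Equiv.Perm (Fin n)) := ⊤

/-- A state of the chain with `n` nodes in dimension `m`. The nodes alive are labelled by `Fin n`
(a newborn node takes over the label of the node that dies); the three components are
* the positions of the nodes in the unit hypercube with opposite faces identified; the distance of
  `UnitAddTorus (Fin m)` is the torus metric derived from the `L∞` metric, its `volume` is the
  uniform distribution;
* the ranks, counted from `0`: the node `i` has rank `σ i + 1 ∈ {1, …, n}`;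
* the graph. -/
abbrev State (n m : ℕ) : Type :=
  (Fin n → UnitAddTorus (Fin m)) × Equiv.Perm (Fin n) × SimpleGraph (Fin n)

/-- The randomness of one time-step: the label of the dying node, the initial rank (counted from
`0`) of the newborn node, the position of the newborn node, and for every node a coin. -/
abbrev Innovation (n m : ℕ) : Type :=
  Fin n × Fin n × UnitAddTorus (Fin m) × (Fin n → Bool)

/-- The influence region of a node at `x` of rank `r ∈ {1, …, n}`: the ball around `x` of volume
`r ^ (-α) * n ^ (-β)` (a cube whose side is the `m`-th root of this volume). -/
noncomputable def region (α β : ℝ) (n : ℕ) {m : ℕ} (x : UnitAddTorus (Fin m)) (r : ℕ) :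
    Set (UnitAddTorus (Fin m)) :=
  Metric.closedBall x ((((r : ℝ) ^ (-α) * (n : ℝ) ^ (-β)) ^ (1 / (m : ℝ))) / 2)

/-- The influence region has the required volume. -/
theorem volume_region {α β : ℝ} (hα : 0 ≤ α) (hβ : 0 ≤ β) {n m r : ℕ} (hn : 1 ≤ n) (hm : 1 ≤ m)
    (hr : 1 ≤ r) (x : UnitAddTorus (Fin m)) :
    volume (region α β n x r) = ENNReal.ofReal ((r : ℝ) ^ (-α) * (n : ℝ) ^ (-β)) := by
  have h0 : 0 ≤ (r : ℝ) ^ (-α) * (n : ℝ) ^ (-β) := by positivity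
  have h1 : (r : ℝ) ^ (-α) * (n : ℝ) ^ (-β) ≤ 1 :=
    mul_le_one₀ (Real.rpow_le_one_of_one_le_of_nonpos (by exact_mod_cast hr) (by linarith))
      (by positivity) (Real.rpow_le_one_of_one_le_of_nonpos (by exact_mod_cast hn) (by linarith))
  have h2 : ((r : ℝ) ^ (-α) * (n : ℝ) ^ (-β)) ^ (1 / (m : ℝ)) ≤ 1 :=
    Real.rpow_le_one h0 h1 (by positivity)
  have hm' : (m : ℝ) ≠ 0 := by positivity
  rw [region, closedBall_pi _ (by positivity), volume_pi_pi]
  simp only [AddCircle.volume_closedBall, Finset.prod_const, Finset.card_univ, Fintype.card_fin]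
  rw [mul_div_cancel₀ _ two_ne_zero, min_eq_right h2, ← ENNReal.ofReal_pow (by positivity),
    ← Real.rpow_natCast, ← Real.rpow_mul h0, one_div_mul_cancel hm', Real.rpow_one]

/-- The new ranks, when node `u` dies and the newborn node, which takes over the label `u`, gets
initial rank `R`; the other nodes keep their relative order. -/
def newRank {n : ℕ} (σ : Equiv.Perm (Fin n)) (u R : Fin n) : Equiv.Perm (Fin n) :=
  σ.trans ((Fin.cycleRange (σ u)).trans (Fin.cycleRange R).symm)

theorem newRank_self {n : ℕ} (σ : Equiv.Perm (Fin n)) (u R : Fin n) : newRank σ u R u = R := by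
  have : NeZero n := ⟨fun h => by subst h; exact u.elim0⟩
  simp [newRank]

/-- A surviving node loses `γ` because of the death and gains `δ` because of the birth. -/
theorem newRank_of_ne {n : ℕ} (σ : Equiv.Perm (Fin n)) {u w : Fin n} (R : Fin n) (h : w ≠ u) :
    ∃ γ δ : ℤ, (γ = if σ u < σ w then 1 else 0) ∧
      (δ = if (R : ℤ) ≤ (σ w : ℤ) - γ then 1 else 0) ∧
      (newRank σ u R w : ℤ) = (σ w : ℤ) - γ + δ := by
  have : NeZero n := ⟨fun h => by subst h; exact u.elim0⟩
  refine ⟨_, _, rfl, rfl, ?_⟩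
  have hne : σ w ≠ σ u := fun e => h (σ.injective e)
  obtain ⟨v, hv⟩ : ∃ v, v = newRank σ u R w := ⟨_, rfl⟩
  have key : Fin.cycleRange R v = Fin.cycleRange (σ u) (σ w) := by
    rw [hv]; simp [newRank]
  rw [← hv]
  have key' := congrArg Fin.val key
  have hL : ((Fin.cycleRange R v : Fin n) : ℕ) =
      if v < R then (v : ℕ) + 1 else if v = R then 0 else v := by
    split_ifs with h1 h2
    · exact Fin.coe_cycleRange_of_lt h1
    · rw [h2]; simp
    · rw [Fin.cycleRange_of_gt (lt_of_le_of_ne (not_lt.1 h1) (Ne.symm h2))]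
  have hR : ((Fin.cycleRange (σ u) (σ w) : Fin n) : ℕ) =
      if σ w < σ u then (σ w : ℕ) + 1 else σ w := by
    split_ifs with h1
    · exact Fin.coe_cycleRange_of_lt h1
    · rw [Fin.cycleRange_of_gt (lt_of_le_of_ne (not_lt.1 h1) hne.symm)]
  rw [hL, hR] at key'
  simp only [Fin.lt_def, Fin.ext_iff, ne_eq] at *
  split_ifs at * <;> omega

/-- The graph after one time-step: the newborn node at `y`, which takes over the label `u`, is
joined to a surviving node `j` if `y` lies in the influence region of `j` (at the preceding time)
and the coin of `j` shows `true`; edges between survivors are kept. -/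
def newGraph (α β : ℝ) {n m : ℕ} (s : State n m) (ξ : Innovation n m) : SimpleGraph (Fin n) where
  Adj i j :=
    let u := ξ.1
    let link : Fin n → Prop := fun k =>
      ξ.2.2.2 k = true ∧ ξ.2.2.1 ∈ region α β n (s.1 k) ((s.2.1 k : ℕ) + 1)
    (i ≠ u ∧ j ≠ u ∧ s.2.2.Adj i j) ∨ (i = u ∧ j ≠ u ∧ link j) ∨ (j = u ∧ i ≠ u ∧ link i)
  symm := ⟨by
    intro i j h
    rcases h with ⟨hi, hj, h⟩ | ⟨hi, hj, h⟩ | ⟨hi, hj, h⟩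
    · exact Or.inl ⟨hj, hi, h.symm⟩
    · exact Or.inr (Or.inr ⟨hi, hj, h⟩)
    · exact Or.inr (Or.inl ⟨hi, hj, h⟩)⟩
  loopless := ⟨by
    intro i h
    rcases h with ⟨_, _, h⟩ | ⟨hi, hj, _⟩ | ⟨hi, hj, _⟩
    · exact h.ne rfl
    · exact hj hi
    · exact hj hi⟩

/-- One time-step of the process. -/
def step (α β : ℝ) {n m : ℕ} (s : State n m) (ξ : Innovation n m) : State n m :=
  (Function.update s.1 ξ.1 ξ.2.2.1, newRank s.2.1 ξ.1 ξ.2.1, newGraph α β s ξ)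

/-- The law of the randomness of a time-step: dying node, initial rank and position of the newborn
node are uniform, the coins show `true` with probability `p`, and all these are independent. -/
noncomputable def innovationLaw (n m : ℕ) (p : unitInterval) : Measure (Innovation n m) :=
  (uniformOn Set.univ).prod ((uniformOn Set.univ).prod
    (volume.prod (Measure.pi fun _ => bernoulliMeasure true false p)))

/-- The law of the next state, if the present state has law `π`. -/
noncomputable def stepLaw (α β : ℝ) (p : unitInterval) {n m : ℕ} (π : Measure (State n m)) :
    Measure (State n m) :=
  (π.prod (innovationLaw n m p)).map fun q => step α β q.1 q.2

/-- `π` is a stationary distribution of the chain; the component `s.2.2` of a state `s` with law `π`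
is then the geo-protean random graph GEO-P(α, β, m, p) on `n` nodes. -/
def IsStationary (α β : ℝ) (p : unitInterval) {n m : ℕ} (π : Measure (State n m)) : Prop :=
  IsProbabilityMeasure π ∧ stepLaw α β p π = π

/-- The time-step is measurable, so that `stepLaw` is the law it should be. -/
theorem measurable_step (α β : ℝ) (n m : ℕ) :
    Measurable fun q : State n m × Innovation n m => step α β q.1 q.2 := by
  have hperm : DiscreteMeasurableSpace (Equiv.Perm (Fin n)) := ⟨fun _ => trivial⟩
  have hu : ∀ i : Fin n, MeasurableSet {q : State n m × Innovation n m | i = q.2.1} := fun i =>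
    measurableSet_eq_fun measurable_const (by fun_prop)
  refine Measurable.prodMk ?_ (Measurable.prodMk ?_ ?_)
  · refine measurable_pi_lambda _ fun i => ?_
    simp only [Function.update_apply]
    exact Measurable.ite (hu i) (by fun_prop) (by fun_prop)
  · have h : Measurable fun t : Equiv.Perm (Fin n) × Fin n × Fin n => newRank t.1 t.2.1 t.2.2 :=
      measurable_from_prod_countable_right fun _ => Measurable.of_discrete
    exact h.comp (f := fun q : State n m × Innovation n m => (q.1.2.1, q.2.1, q.2.2.1))
      (by fun_prop)
  · have hlink : ∀ k : Fin n, MeasurableSet {q : State n m × Innovation n m |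
        q.2.2.2.2 k = true ∧ q.2.2.2.1 ∈ region α β n (q.1.1 k) ((q.1.2.1 k : ℕ) + 1)} := by
      intro k
      have hrad : Measurable fun q : State n m × Innovation n m =>
          (((((q.1.2.1 k : ℕ) + 1 : ℕ) : ℝ) ^ (-α) * (n : ℝ) ^ (-β)) ^ (1 / (m : ℝ))) / 2 :=
        (Measurable.of_discrete (f := fun τ : Equiv.Perm (Fin n) =>
          (((((τ k : ℕ) + 1 : ℕ) : ℝ) ^ (-α) * (n : ℝ) ^ (-β)) ^ (1 / (m : ℝ))) / 2)).comp
            (f := fun τ : State n m × Innovation n m => τ.1.2.1) (by fun_prop)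
      refine MeasurableSet.inter (measurableSet_eq_fun (by fun_prop) measurable_const) ?_
      exact measurableSet_le (f := fun q : State n m × Innovation n m =>
        dist q.2.2.2.1 (q.1.1 k)) (Measurable.dist (by fun_prop) (by fun_prop)) hrad
    refine SimpleGraph.measurable_iff_adj.2 fun i j => measurableSet_setOfPred.1 ?_
    have hadj : MeasurableSet {q : State n m × Innovation n m | q.1.2.2.Adj i j} :=
      measurableSet_setOfPred.2 (by fun_prop)
    exact ((hu i).compl.inter ((hu j).compl.inter hadj)).union
      (((hu i).inter ((hu j).compl.inter (hlink j))).union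
        ((hu j).inter ((hu i).compl.inter (hlink i))))

end GeoP

namespace GeoP

/-! ### Product measures: resampling, Chernoff bound, disjoint sets of coins. -/

section PiTools

variable {ι X : Type*} [Fintype ι] [MeasurableSpace X]

theorem measurable_update_prod [DecidableEq ι] (i : ι) :
    Measurable fun q : (ι → X) × X => Function.update q.1 i q.2 := by
  refine measurable_pi_lambda _ fun j => ?_
  by_cases h : j = i
  · subst h; simpa using measurable_snd
  · simp only [Function.update_of_ne h]
    exact (measurable_pi_apply j).comp measurable_fst

/-- Resampling one coordinate does not change a product law. This is why the marks stay independent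
when a newborn node takes over a label, and it also serves to condition on single coordinates. -/
theorem map_update_pi [DecidableEq ι] (μ : Measure X) [IsProbabilityMeasure μ] (i : ι) :
    ((Measure.pi fun _ : ι => μ).prod μ).map (fun q => Function.update q.1 i q.2) =
      Measure.pi fun _ => μ := by
  symm
  refine Measure.pi_eq fun s hs => ?_
  rw [Measure.map_apply (measurable_update_prod i) (MeasurableSet.univ_pi hs)]
  have : (fun q : (ι → X) × X => Function.update q.1 i q.2) ⁻¹' (Set.univ.pi s) =
      (Set.univ.pi (Function.update s i Set.univ)) ×ˢ s i := by
    ext q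
    simp only [Set.mem_preimage, Set.mem_pi, Set.mem_univ, true_imp_iff, Set.mem_prod]
    constructor
    · intro h
      refine ⟨fun j => ?_, by simpa using h i⟩
      by_cases hj : j = i
      · subst hj; simp
      · simpa [Function.update_of_ne hj] using h j
    · rintro ⟨h, h'⟩ j
      by_cases hj : j = i
      · subst hj; simpa using h'
      · simpa [Function.update_of_ne hj] using h j
  rw [this, Measure.prod_prod, Measure.pi_pi, ← Finset.mul_prod_erase _ _ (Finset.mem_univ i),
    ← Finset.mul_prod_erase _ (fun j => μ (s j)) (Finset.mem_univ i)]
  simp only [Function.update_self, measure_univ, one_mul]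
  rw [mul_comm]
  congr 1
  refine Finset.prod_congr rfl fun j hj => ?_
  rw [Function.update_of_ne (Finset.ne_of_mem_erase hj)]

theorem lintegral_pi_update [DecidableEq ι] (μ : Measure X) [IsProbabilityMeasure μ] (i : ι)
    {f : (ι → X) → ENNReal} (hf : Measurable f) :
    ∫⁻ ω, f ω ∂(Measure.pi fun _ : ι => μ) =
      ∫⁻ ω, ∫⁻ y, f (Function.update ω i y) ∂μ ∂(Measure.pi fun _ : ι => μ) := by
  conv_lhs => rw [← map_update_pi μ i]
  rw [lintegral_map hf (measurable_update_prod i), lintegral_prod]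
  exact (hf.comp (measurable_update_prod i)).aemeasurable

theorem map_precomp_pi {κ : Type*} [Fintype κ] (μ : Measure X) [IsProbabilityMeasure μ]
    {e : κ → ι} (he : Function.Injective e) :
    (Measure.pi fun _ : ι => μ).map (fun ω => ω ∘ e) = Measure.pi fun _ : κ => μ := by
  have h : iIndepFun (fun (i : ι) (ω : ι → X) => ω i) (Measure.pi fun _ : ι => μ) :=
    iIndepFun_pi (X := fun _ => id) fun _ => aemeasurable_id
  have h2 := (iIndepFun_iff_map_fun_eq_pi_map (fun k => (measurable_pi_apply (e k)).aemeasurable)).1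
    (h.precomp he)
  have h3 : (fun ω : ι → X => ω ∘ e) = fun ω i => ω (e i) := rfl
  rw [h3, h2]
  congr 1
  funext k
  exact (measurePreserving_eval (fun _ : ι => μ) (e k)).map_eq

theorem pi_apply_eval (μ : Measure X) [IsProbabilityMeasure μ] (i : ι) {s : Set X}
    (hs : MeasurableSet s) : (Measure.pi fun _ : ι => μ) {ω | ω i ∈ s} = μ s := by
  conv_rhs => rw [← (measurePreserving_eval (fun _ : ι => μ) i).map_eq,
    Measure.map_apply (measurable_pi_apply i) hs]
  rfl

/-- The lower tail of the number of independent points that fall into a set. -/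
theorem pi_card_lt_le (μ : Measure X) [IsProbabilityMeasure μ] (I : Finset ι) {s : Set X}
    (hs : MeasurableSet s) [DecidablePred (· ∈ s)] (N : ℝ) :
    (Measure.pi fun _ : ι => μ) {ω | ((I.filter fun i => ω i ∈ s).card : ℝ) < N} ≤
      ENNReal.ofReal (Real.exp (N - I.card * μ.real s / 2)) := by
  classical
  -- Chernoff's bound with exponent `1`: each point in `s` contributes a factor `exp (-1) ≤ 1 / 2`,
  -- so the mean of `g` is at most `1 - μ s / 2`.
  set g : X → ENNReal := fun x => if x ∈ s then ENNReal.ofReal (Real.exp (-1)) else 1 with hg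
  have hgm : Measurable g := Measurable.ite hs measurable_const measurable_const
  have hgi : ∫⁻ x, g x ∂μ ≤ ENNReal.ofReal (Real.exp (-(μ.real s / 2))) := by
    have h1 : ∫⁻ x, g x ∂μ = ENNReal.ofReal (Real.exp (-1)) * μ s + μ sᶜ := by
      have : g = fun x => s.indicator (fun _ => ENNReal.ofReal (Real.exp (-1))) x +
          sᶜ.indicator (fun _ => 1) x := by
        funext x; by_cases hx : x ∈ s <;> simp [hg, hx]
      rw [this, lintegral_add_left (measurable_const.indicator hs),
        lintegral_indicator_const hs, lintegral_indicator_const hs.compl, one_mul]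
    rw [h1]
    have h2 : μ s = ENNReal.ofReal (μ.real s) := by simp [Measure.real]
    have h3 : μ sᶜ = ENNReal.ofReal (1 - μ.real s) := by
      rw [← probReal_compl_eq_one_sub hs]; simp [Measure.real]
    have h4 : μ.real s ≤ 1 := measureReal_le_one
    have h5 : 0 ≤ μ.real s := measureReal_nonneg
    rw [h2, h3, ← ENNReal.ofReal_mul (Real.exp_pos _).le, ← ENNReal.ofReal_add (by positivity)
      (by linarith)]
    apply ENNReal.ofReal_le_ofReal
    have h6 : Real.exp (-1) ≤ 1 / 2 := by
      rw [Real.exp_neg, inv_eq_one_div]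
      apply one_div_le_one_div_of_le (by norm_num)
      have := Real.add_one_le_exp 1; linarith
    have h7 := Real.add_one_le_exp (-(μ.real s / 2))
    nlinarith
  have hprod : ∫⁻ ω, ∏ i ∈ I, g (ω i) ∂(Measure.pi fun _ : ι => μ) ≤
      ENNReal.ofReal (Real.exp (-(I.card * μ.real s / 2))) := by
    have h := iIndepFun_pi (μ := fun _ : ι => μ) (X := fun _ => g) fun _ => hgm.aemeasurable
    have e : ∫⁻ ω, ∏ i ∈ I, g (ω i) ∂(Measure.pi fun _ : ι => μ) =
        ∫⁻ ω, ∏ i, (if i ∈ I then g (ω i) else 1) ∂(Measure.pi fun _ : ι => μ) := by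
      congr 1; funext ω; rw [Finset.prod_ite_mem]; simp
    rw [e]
    have h' := iIndepFun_pi (μ := fun _ : ι => μ) (X := fun i => if i ∈ I then g else fun _ => 1)
      (fun i => by split_ifs; exacts [hgm.aemeasurable, aemeasurable_const])
    have h2 := lintegral_prod_eq_prod_lintegral_of_indepFun (μ := Measure.pi fun _ : ι => μ)
      (Finset.univ) (fun i ω => (if i ∈ I then g else fun _ => 1) (ω i)) h' (fun i => by
        split_ifs
        exacts [hgm.comp (measurable_pi_apply i), measurable_const])
    have h3 : ∀ i, ∀ ω : ι → X, (if i ∈ I then g (ω i) else 1) =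
      (if i ∈ I then g else fun _ => 1) (ω i) := by intro i ω; split_ifs <;> rfl
    simp_rw [h3]
    rw [h2]
    have h4 : ∀ i, ∫⁻ ω, (if i ∈ I then g else fun _ => 1) (ω i) ∂(Measure.pi fun _ : ι => μ) =
        if i ∈ I then ∫⁻ x, g x ∂μ else 1 := by
      intro i
      split_ifs
      · rw [← lintegral_map hgm (measurable_pi_apply i),
          (measurePreserving_eval (fun _ : ι => μ) i).map_eq]
      · simp
    simp_rw [h4]
    rw [Finset.prod_ite_mem, Finset.univ_inter, Finset.prod_const]
    calc (∫⁻ x, g x ∂μ) ^ I.card ≤ ENNReal.ofReal (Real.exp (-(μ.real s / 2))) ^ I.card := by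
          gcongr
      _ = _ := by
          rw [← ENNReal.ofReal_pow (Real.exp_pos _).le, ← Real.exp_nat_mul]
          congr 2; ring
  have hm : Measurable fun ω : ι → X => ∏ i ∈ I, g (ω i) :=
    Finset.measurable_prod _ fun i _ => hgm.comp (measurable_pi_apply i)
  have hsub : {ω : ι → X | ((I.filter fun i => ω i ∈ s).card : ℝ) < N} ⊆
      {ω | ENNReal.ofReal (Real.exp (-N)) ≤ ∏ i ∈ I, g (ω i)} := by
    intro ω hω
    simp only [Set.mem_ofPred_eq] at hω ⊢
    rw [hg]
    simp only
    rw [Finset.prod_ite, Finset.prod_const, Finset.prod_const_one, mul_one,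
      ← ENNReal.ofReal_pow (Real.exp_pos _).le, ← Real.exp_nat_mul]
    apply ENNReal.ofReal_le_ofReal
    apply Real.exp_le_exp.2
    linarith
  refine (measure_mono hsub).trans ((meas_ge_le_lintegral_div hm.aemeasurable ?_ ?_).trans ?_)
  · simp [Real.exp_pos]
  · simp
  · rw [ENNReal.div_le_iff (by simp [Real.exp_pos]) (by simp)]
    refine hprod.trans ?_
    rw [← ENNReal.ofReal_mul (Real.exp_pos _).le, ← Real.exp_add]
    apply ENNReal.ofReal_le_ofReal
    apply Real.exp_le_exp.2
    linarith

/-- Disjoint sets of coins: the probability that none of them shows `true` throughout. -/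
theorem pi_forall_exists_false_le (ν : Measure Bool) [IsProbabilityMeasure ν] {A : Type*}
    (S : Finset A) (E : A → Finset ι) (hE : (S : Set A).PairwiseDisjoint E) (k : ℕ)
    (hk : ∀ a ∈ S, (E a).card ≤ k) :
    (Measure.pi fun _ : ι => ν) {c | ∀ a ∈ S, ∃ e ∈ E a, c e = false} ≤
      ENNReal.ofReal ((1 - ν.real {true} ^ k) ^ S.card) := by
  classical
  have hind : iIndepFun (fun (i : ι) (c : ι → Bool) => c i) (Measure.pi fun _ : ι => ν) :=
    iIndepFun_pi (X := fun _ => id) fun _ => aemeasurable_id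
  have h1 : ∀ F : Finset ι, (Measure.pi fun _ : ι => ν) {c | ∃ e ∈ F, c e = false} =
      ENNReal.ofReal (1 - ν.real {true} ^ F.card) := by
    intro F
    have e1 : {c : ι → Bool | ∃ e ∈ F, c e = false} =
        (⋂ e ∈ F, (fun c : ι → Bool => c e) ⁻¹' {true})ᶜ := by
      ext c; simp
    have hmeas : MeasurableSet (⋂ e ∈ F, (fun c : ι → Bool => c e) ⁻¹' {true}) :=
      MeasurableSet.biInter (Set.to_countable _) fun e _ => measurable_pi_apply e (by trivial)
    rw [e1, prob_compl_eq_one_sub hmeas, hind.measure_inter_preimage_eq_mul F (fun _ _ => trivial)]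
    have : ∀ e, (Measure.pi fun _ : ι => ν) ((fun c : ι → Bool => c e) ⁻¹' {true}) = ν {true} :=
      fun e => pi_apply_eval ν e (by trivial)
    simp_rw [this]
    rw [Finset.prod_const, ENNReal.ofReal_sub _ (by positivity), ENNReal.ofReal_one,
      ENNReal.ofReal_pow measureReal_nonneg]
    simp [Measure.real]
  have hp1 : ν.real {true} ≤ 1 := measureReal_le_one
  have hp0 : 0 ≤ ν.real {true} := measureReal_nonneg
  suffices H : ∀ S' : Finset A, S' ⊆ S →
      (Measure.pi fun _ : ι => ν) {c | ∀ a ∈ S', ∃ e ∈ E a, c e = false} ≤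
      ENNReal.ofReal ((1 - ν.real {true} ^ k) ^ S'.card) from H S subset_rfl
  intro S'
  induction S' using Finset.induction_on with
  | empty => intro _; simp
  | insert a S' ha ih =>
    intro hS
    have hd : Disjoint (E a) (S'.biUnion E) := by
      rw [Finset.disjoint_biUnion_right]
      intro b hb
      exact hE (hS (Finset.mem_insert_self a S')) (hS (Finset.mem_insert_of_mem hb))
        (fun h => ha (h ▸ hb))
    have hI := hind.indepFun_finset (E a) (S'.biUnion E) hd (fun i => measurable_pi_apply i)
    -- One event concerns only the coins in `E a`, the other only those in the disjoint union of the
    -- remaining sets, so the probabilities multiply.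
    have e2 : {c : ι → Bool | ∀ b ∈ insert a S', ∃ e ∈ E b, c e = false} =
        ((fun c (i : E a) => c i) ⁻¹' {c | ∃ e, c e = false}) ∩
        ((fun c (i : (S'.biUnion E : Finset ι)) => c i) ⁻¹'
          {c | ∀ b, ∀ hb : b ∈ S', ∃ e, ∃ he : e ∈ E b,
            c ⟨e, Finset.mem_biUnion.2 ⟨b, hb, he⟩⟩ = false}) := by
      ext c; simp
    rw [e2, hI.measure_inter_preimage_eq_mul _ _ (Set.to_countable _).measurableSet
      (Set.to_countable _).measurableSet]
    have e3 : ((fun (c : ι → Bool) (i : E a) => c i) ⁻¹' {c | ∃ e, c e = false}) =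
      {c | ∃ e ∈ E a, c e = false} := by ext c; simp
    have e4 : ((fun (c : ι → Bool) (i : (S'.biUnion E : Finset ι)) => c i) ⁻¹'
          {c | ∀ b, ∀ hb : b ∈ S', ∃ e, ∃ he : e ∈ E b,
            c ⟨e, Finset.mem_biUnion.2 ⟨b, hb, he⟩⟩ = false}) =
      {c | ∀ b ∈ S', ∃ e ∈ E b, c e = false} := by ext c; simp
    rw [e3, e4, h1, Finset.card_insert_of_notMem ha, pow_succ', ENNReal.ofReal_mul
      (by have := pow_le_one₀ (n := k) hp0 hp1; linarith)]
    refine mul_le_mul' (ENNReal.ofReal_le_ofReal ?_) (ih ((Finset.subset_insert a S').trans hS))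
    have := pow_le_pow_of_le_one hp0 hp1 (hk a (hS (Finset.mem_insert_self a S')))
    linarith

end PiTools


/-! ### Random dynamical systems and Doeblin's theorem. -/

section Doeblin

variable {S Ξ : Type*} [MeasurableSpace S] [MeasurableSpace Ξ]

/-- The state after `k` steps of the dynamics `f`. -/
def iterState (f : S × Ξ → S) : (k : ℕ) → S → (Fin k → Ξ) → S
  | 0, s, _ => s
  | k + 1, s, ω => f (iterState f k s (Fin.init ω), ω (Fin.last k))

theorem measurable_iterState {f : S × Ξ → S} (hf : Measurable f) (k : ℕ) :
    Measurable fun q : S × (Fin k → Ξ) => iterState f k q.1 q.2 := by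
  induction k with
  | zero => exact measurable_fst
  | succ k ih =>
    have h1 : Measurable fun q : S × (Fin (k + 1) → Ξ) => ((q.1, Fin.init q.2) : S × (Fin k → Ξ)) :=
      measurable_fst.prodMk (measurable_pi_lambda _ fun i =>
        (measurable_pi_apply _).comp measurable_snd)
    exact hf.comp ((ih.comp h1).prodMk ((measurable_pi_apply _).comp measurable_snd))

theorem lintegral_pi_fin_succ (ν : Measure Ξ) [IsProbabilityMeasure ν] (k : ℕ)
    {g : (Fin k → Ξ) × Ξ → ENNReal} (hg : Measurable g) :
    ∫⁻ ω, g (Fin.init ω, ω (Fin.last k)) ∂(Measure.pi fun _ : Fin (k + 1) => ν) =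
      ∫⁻ ω, ∫⁻ ξ, g (ω, ξ) ∂ν ∂(Measure.pi fun _ : Fin k => ν) := by
  have h := measurePreserving_piFinSuccAbove (fun _ : Fin (k + 1) => ν) (Fin.last k)
  have h2 : ∀ ω : Fin (k + 1) → Ξ, g (Fin.init ω, ω (Fin.last k)) =
      (fun q : Ξ × (Fin k → Ξ) => g (q.2, q.1))
        (MeasurableEquiv.piFinSuccAbove (fun _ : Fin (k + 1) => Ξ) (Fin.last k) ω) := by
    intro ω
    simp [MeasurableEquiv.piFinSuccAbove, Fin.insertNthEquiv, Fin.removeNth_last]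
  simp_rw [h2]
  rw [h.lintegral_comp (f := fun q : Ξ × (Fin k → Ξ) => g (q.2, q.1))
    (hg.comp measurable_swap), lintegral_prod_symm]
  exact (hg.comp measurable_swap).aemeasurable

theorem lintegral_map_prod {f : S × Ξ → S} (hf : Measurable f) (μ : Measure S) (ν : Measure Ξ)
    [SFinite ν] {g : S → ENNReal} (hg : Measurable g) :
    ∫⁻ s, g s ∂((μ.prod ν).map f) = ∫⁻ s, ∫⁻ ξ, g (f (s, ξ)) ∂ν ∂μ := by
  rw [lintegral_map hg hf, lintegral_prod]
  exact (hg.comp hf).aemeasurable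

/-- Turns `k` steps into a single step driven by a block of `k` independent innovations, so that
events about the whole block can split the `k`-step operator. -/
theorem iterate_map_prod {f : S × Ξ → S} (hf : Measurable f) (ν : Measure Ξ)
    [IsProbabilityMeasure ν] (k : ℕ) (μ : Measure S) :
    (fun μ : Measure S => (μ.prod ν).map f)^[k] μ =
      (μ.prod (Measure.pi fun _ : Fin k => ν)).map fun q => iterState f k q.1 q.2 := by
  induction k with
  | zero =>
    simp only [Function.iterate_zero, id_eq, iterState]
    rw [Measure.map_fst_prod]; simp
  | succ k ih =>
    rw [Function.iterate_succ_apply', ih]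
    refine Measure.ext_of_lintegral _ fun g hg => ?_
    have hm := measurable_iterState hf k
    rw [lintegral_map_prod hf _ _ hg, lintegral_map (f := fun s => ∫⁻ ξ, g (f (s, ξ)) ∂ν)
      (hg.comp hf).lintegral_prod_right' hm, lintegral_prod, lintegral_map hg
      (measurable_iterState hf (k + 1)), lintegral_prod]
    rotate_left
    · exact (hg.comp (measurable_iterState hf (k + 1))).aemeasurable
    · exact ((hg.comp hf).lintegral_prod_right'.comp hm).aemeasurable
    refine lintegral_congr fun s => ?_
    exact (lintegral_pi_fin_succ ν k
      (g := fun q => g (f (iterState f k s q.1, q.2)))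
      (hg.comp (hf.comp ((hm.comp (measurable_const.prodMk measurable_fst)).prodMk
        measurable_snd)))).symm

/-- Doeblin's theorem for a random dynamical system that forgets its initial state with positive
probability. -/
theorem existsUnique_stationary [Nonempty S] {f : S × Ξ → S} (hf : Measurable f) (ν : Measure Ξ)
    [IsProbabilityMeasure ν] (k : ℕ) {E : Set (Fin k → Ξ)} (hE : MeasurableSet E)
    (hpos : (Measure.pi fun _ : Fin k => ν) E ≠ 0)
    (hforget : ∀ ω ∈ E, ∀ s s', iterState f k s ω = iterState f k s' ω) :
    ∃! π : Measure S, IsProbabilityMeasure π ∧ (π.prod ν).map f = π := by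
  set P := Measure.pi fun _ : Fin k => ν with hP
  set F : S × (Fin k → Ξ) → S := fun q => iterState f k q.1 q.2 with hF
  have hFm : Measurable F := measurable_iterState hf k
  set L : Measure S → Measure S := fun μ => (μ.prod ν).map f with hL
  obtain ⟨s0⟩ := ‹Nonempty S›
  set A : Measure S → Measure S := fun μ => (μ.prod (P.restrict Eᶜ)).map F with hA
  set ν0 : Measure S := (P.restrict E).map fun ω => F (s0, ω) with hν0
  have hgm : Measurable fun ω => F (s0, ω) := hFm.comp (measurable_const.prodMk measurable_id)
  -- On `E` the initial state is forgotten, so this part of the `k`-step law is the fixed measure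
  -- `ν0` times the mass of `μ`; `A` carries the rest.
  have hLk : ∀ μ : Measure S, L^[k] μ = A μ + μ Set.univ • ν0 := by
    intro μ
    rw [hL, iterate_map_prod hf ν k μ]
    refine Measure.ext_of_lintegral _ fun g hg => ?_
    rw [lintegral_map_prod hFm _ _ hg, lintegral_add_measure, lintegral_map_prod hFm _ _ hg,
      lintegral_smul_measure, lintegral_map hg hgm, smul_eq_mul, mul_comm, ← lintegral_const,
      ← lintegral_add_right _ measurable_const]
    refine lintegral_congr fun s => ?_
    rw [← lintegral_add_compl _ hE, add_comm]
    congr 1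
    refine setLIntegral_congr_fun hE fun ω hω => ?_
    simp only [hF]
    rw [hforget ω hω s s0]
  have hAadd : ∀ μ μ' : Measure S, A (μ + μ') = A μ + A μ' := by
    intro μ μ'
    refine Measure.ext_of_lintegral _ fun g hg => ?_
    rw [lintegral_add_measure, lintegral_map_prod hFm _ _ hg, lintegral_map_prod hFm _ _ hg,
      lintegral_map_prod hFm _ _ hg, lintegral_add_measure]
  have hAuniv : ∀ μ : Measure S, A μ Set.univ = P Eᶜ * μ Set.univ := by
    intro μ
    have := lintegral_map_prod hFm μ (P.restrict Eᶜ) (g := fun _ => 1) measurable_const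
    simpa using this
  -- The Neumann series that solves `π = A π + ν0`. Since `A` scales masses by `P Eᶜ`, its mass is a
  -- geometric series with sum one.
  set π0 : Measure S := Measure.sum fun j => A^[j] ν0 with hπ0
  have hν0u : ν0 Set.univ = P E := by
    rw [hν0, Measure.map_apply hgm MeasurableSet.univ]; simp
  have hjuniv : ∀ j, (A^[j] ν0) Set.univ = P Eᶜ ^ j * P E := by
    intro j
    induction j with
    | zero => simpa using hν0u
    | succ j ih => rw [Function.iterate_succ_apply', hAuniv, ih, pow_succ']; ring
  have hprob : IsProbabilityMeasure π0 := by
    constructor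
    rw [hπ0, Measure.sum_apply _ MeasurableSet.univ]
    simp_rw [hjuniv]
    rw [ENNReal.tsum_mul_right, ENNReal.tsum_geometric, prob_compl_eq_one_sub hE,
      ENNReal.sub_sub_cancel ENNReal.one_ne_top prob_le_one]
    exact ENNReal.inv_mul_cancel hpos (measure_ne_top _ _)
  have hLπ0 : L^[k] π0 = π0 := by
    rw [hLk, measure_univ, one_smul]
    refine Measure.ext_of_lintegral _ fun g hg => ?_
    rw [lintegral_add_measure, lintegral_map_prod hFm _ _ hg, hπ0, lintegral_sum_measure,
      lintegral_sum_measure, tsum_eq_zero_add' (f := fun j => ∫⁻ a, g a ∂(A^[j] ν0))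
        ENNReal.summable, add_comm]
    congr 1
    refine tsum_congr fun j => ?_
    rw [Function.iterate_succ_apply', lintegral_map_prod hFm _ _ hg]
  have huniq : ∀ π : Measure S, IsProbabilityMeasure π → L^[k] π = π → π = π0 := by
    intro π hπ hLπ
    have h1 : π = A π + ν0 := by
      conv_lhs => rw [← hLπ, hLk, measure_univ, one_smul]
    -- Unrolling `π = A π + ν0` shows that a fixed point dominates all partial sums, hence `π0`;
    -- both have mass one.
    have h2 : ∀ J : ℕ, ∀ s, ∑ j ∈ Finset.range J, (A^[j] ν0) s ≤ π s := by
      have : ∀ J : ℕ, ∀ s, π s = (A^[J] π) s + ∑ j ∈ Finset.range J, (A^[j] ν0) s := by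
        intro J s
        have hAi : ∀ (J : ℕ) (μ μ' : Measure S), A^[J] (μ + μ') = A^[J] μ + A^[J] μ' := by
          intro J
          induction J with
          | zero => intro μ μ'; rfl
          | succ J ih => intro μ μ'; simp only [Function.iterate_succ_apply, hAadd, ih]
        induction J with
        | zero => simp
        | succ J ih =>
          rw [ih, Finset.sum_range_succ]
          conv_lhs => rw [h1, hAi]
          rw [Function.iterate_succ_apply, Measure.add_apply]
          ring
      intro J s
      rw [this J s]
      exact le_add_self
    have h3 : π0 ≤ π := by
      refine Measure.le_iff.2 fun s hs => ?_
      rw [hπ0, Measure.sum_apply _ hs]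
      exact ENNReal.tsum_le_of_sum_range_le fun J => h2 J s
    exact (Measure.eq_of_le_of_measure_univ_eq h3 (by simp)).symm
  have hLprob : ∀ π : Measure S, IsProbabilityMeasure π → IsProbabilityMeasure (L π) := by
    intro π hπ
    exact Measure.isProbabilityMeasure_map hf.aemeasurable
  refine ⟨π0, ⟨hprob, ?_⟩, ?_⟩
  -- `L π0` is again fixed by `L^[k]`, so uniqueness for `k` steps gives stationarity for one step.
  · refine huniq _ (hLprob _ hprob) ?_
    change L^[k] (L π0) = L π0
    rw [← Function.iterate_succ_apply, Function.iterate_succ_apply', hLπ0]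
  · rintro π ⟨hπ, hπL⟩
    refine huniq π hπ ?_
    exact Function.iterate_fixed (f := L) hπL k

end Doeblin


/-! ### The law of the marks, and coalescence of the chain. -/

instance instIsProbabilityMeasureTorus (m : ℕ) :
    IsProbabilityMeasure (volume : Measure (UnitAddTorus (Fin m))) := by
  have : IsProbabilityMeasure (volume : Measure UnitAddCircle) := ⟨by simp⟩
  rw [volume_pi]
  infer_instance

/-- The data a newborn node brings along: its initial rank, its position and its coins. -/
abbrev Mark (n m : ℕ) : Type := Fin n × UnitAddTorus (Fin m) × (Fin n → Bool)

/-- The law of the data of a newborn node. -/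
noncomputable def markLaw (n m : ℕ) (p : unitInterval) : Measure (Mark n m) :=
  (uniformOn Set.univ).prod (volume.prod (Measure.pi fun _ => bernoulliMeasure true false p))

instance instIsProbabilityMeasureMarkLaw (n m : ℕ) [NeZero n] (p : unitInterval) :
    IsProbabilityMeasure (markLaw n m p) := by
  have : IsProbabilityMeasure (uniformOn (Set.univ : Set (Fin n))) :=
    isProbabilityMeasure_uniformOn Set.finite_univ Set.univ_nonempty
  unfold markLaw
  infer_instance

theorem innovationLaw_eq (n m : ℕ) (p : unitInterval) :
    innovationLaw n m p = (uniformOn Set.univ).prod (markLaw n m p) := rfl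

instance instIsProbabilityMeasureInnovationLaw (n m : ℕ) [NeZero n] (p : unitInterval) :
    IsProbabilityMeasure (innovationLaw n m p) := by
  have : IsProbabilityMeasure (uniformOn (Set.univ : Set (Fin n))) :=
    isProbabilityMeasure_uniformOn Set.finite_univ Set.univ_nonempty
  rw [innovationLaw_eq]
  infer_instance

theorem uniformOn_univ_singleton {n : ℕ} (i : Fin n) :
    uniformOn (Set.univ : Set (Fin n)) {i} = (n : ENNReal)⁻¹ := by
  rw [uniformOn_univ]
  simp

theorem newRank_zero_of_lt {n : ℕ} [NeZero n] (σ : Equiv.Perm (Fin n)) {u w : Fin n}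
    (h : σ w < σ u) : (newRank σ u 0 w : ℕ) = σ w + 1 := by
  have hne : w ≠ u := fun e => by subst e; exact lt_irrefl _ h
  obtain ⟨γ, δ, hγ, hδ, e⟩ := newRank_of_ne σ 0 hne
  rw [if_neg (not_lt.2 h.le)] at hγ
  subst hγ
  rw [if_pos (by simp)] at hδ
  subst hδ
  have : (newRank σ u 0 w : ℤ) = (σ w : ℤ) + 1 := by rw [e]; ring
  exact_mod_cast this

section Coupling

variable {n m : ℕ} {α β : ℝ}

/-- If the nodes die in the order of their labels and newborn nodes get the first rank, then after
`t` steps positions and ranks of the nodes born meanwhile do not depend on the initial state. -/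
theorem iterState_agree_first [NeZero n] (t : ℕ) (ht : t ≤ n) (ω : Fin t → Innovation n m)
    (hω : ∀ i, ((ω i).1 : ℕ) = i ∧ (ω i).2.1 = 0) (s s' : State n m) :
    ∀ i : Fin n, (i : ℕ) < t →
      (iterState (fun q => step α β q.1 q.2) t s ω).1 i =
        (iterState (fun q => step α β q.1 q.2) t s' ω).1 i ∧
      ((iterState (fun q => step α β q.1 q.2) t s ω).2.1 i : ℕ) + i + 1 = t ∧
      ((iterState (fun q => step α β q.1 q.2) t s' ω).2.1 i : ℕ) + i + 1 = t := by
  induction t with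
  | zero => intro i hi; omega
  | succ t ih =>
    have ih' := ih (by omega) (Fin.init ω) (fun i => by
      have := hω i.castSucc; simpa [Fin.init] using this)
    obtain ⟨hu, hR⟩ := hω (Fin.last t)
    intro i hi
    simp only [iterState, step]
    set x := iterState (fun q => step α β q.1 q.2) t s (Fin.init ω)
    set x' := iterState (fun q => step α β q.1 q.2) t s' (Fin.init ω)
    have hperm : ∀ y : State n m, (∀ i : Fin n, (i : ℕ) < t → (y.2.1 i : ℕ) + i + 1 = t) →
        (newRank y.2.1 (ω (Fin.last t)).1 (ω (Fin.last t)).2.1 i : ℕ) + i + 1 = t + 1 := by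
      intro y hy
      rw [hR]
      by_cases hiu : i = (ω (Fin.last t)).1
      · rw [hiu, newRank_self]; simp at hu ⊢; omega
      · have hit : (i : ℕ) < t := by
          rcases Nat.lt_succ_iff_lt_or_eq.1 hi with h | h
          · exact h
          · exact absurd (Fin.ext (by simp at hu; omega)) hiu
        -- The nodes born so far occupy exactly the ranks `0, …, t - 1`, so the dying node comes
        -- after them. Its death moves none of them, and the birth at rank `0` moves each by one.
        have hge : t ≤ (y.2.1 (ω (Fin.last t)).1 : ℕ) := by
          by_contra hlt
          push Not at hlt
          set r := (y.2.1 (ω (Fin.last t)).1 : ℕ)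
          have hr : t - 1 - r < n := by omega
          have h1 := hy ⟨t - 1 - r, hr⟩ (by simp; omega)
          have h2 : y.2.1 ⟨t - 1 - r, hr⟩ = y.2.1 (ω (Fin.last t)).1 :=
            Fin.ext (by simp at h1; omega)
          have h3 := congrArg Fin.val (y.2.1.injective h2)
          simp at h3 hu
          omega
        have h1 := hy i hit
        rw [newRank_zero_of_lt _ (Fin.lt_def.2 (by omega))]
        omega
    refine ⟨?_, hperm x fun i hi => (ih' i hi).2.1, hperm x' fun i hi => (ih' i hi).2.2⟩
    by_cases hiu : i = (ω (Fin.last t)).1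
    · rw [hiu]; simp
    · have hit : (i : ℕ) < t := by
        rcases Nat.lt_succ_iff_lt_or_eq.1 hi with h | h
        · exact h
        · exact absurd (Fin.ext (by simp at hu; omega)) hiu
      rw [Function.update_of_ne hiu, Function.update_of_ne hiu]
      exact (ih' i hit).1

theorem newGraph_adj_congr {s s' : State n m} (h1 : s.1 = s'.1) (h2 : s.2.1 = s'.2.1)
    (ξ : Innovation n m) {i j : Fin n}
    (h : i = ξ.1 ∨ j = ξ.1 ∨ (s.2.2.Adj i j ↔ s'.2.2.Adj i j)) :
    (newGraph α β s ξ).Adj i j ↔ (newGraph α β s' ξ).Adj i j := by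
  simp only [newGraph, h1, h2]
  rcases h with h | h | h
  · simp [h]
  · simp [h]
  · rw [h]

/-- After a first round of `n` deaths, positions and ranks agree. In the second round each newborn
node redraws all its edges from common data, so agreement of the edges spreads label by label. -/
theorem iterState_agree_second [NeZero n] (t : ℕ) (ht : t ≤ n)
    (ω : Fin (n + t) → Innovation n m)
    (hω : ∀ i, ((ω i).1 : ℕ) = (i : ℕ) % n ∧ (ω i).2.1 = 0) (s s' : State n m) :
    (iterState (fun q => step α β q.1 q.2) (n + t) s ω).1 =
        (iterState (fun q => step α β q.1 q.2) (n + t) s' ω).1 ∧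
      (iterState (fun q => step α β q.1 q.2) (n + t) s ω).2.1 =
        (iterState (fun q => step α β q.1 q.2) (n + t) s' ω).2.1 ∧
      ∀ i j : Fin n, ((i : ℕ) < t ∨ (j : ℕ) < t) →
        ((iterState (fun q => step α β q.1 q.2) (n + t) s ω).2.2.Adj i j ↔
          (iterState (fun q => step α β q.1 q.2) (n + t) s' ω).2.2.Adj i j) := by
  induction t with
  | zero =>
    have h := iterState_agree_first (α := α) (β := β) n le_rfl ω (fun i => by
      have := hω i
      rwa [Nat.mod_eq_of_lt i.2] at this) s s'
    refine ⟨funext fun i => (h i i.2).1, Equiv.ext fun i => Fin.ext ?_, by simp⟩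
    have h1 := (h i i.2).2.1
    have h2 := (h i i.2).2.2
    simp only [Nat.add_zero]
    omega
  | succ t ih =>
    obtain ⟨e1, e2, e3⟩ := ih (by omega) (Fin.init ω) (fun i => by
      have := hω i.castSucc; simpa [Fin.init] using this)
    have hu := (hω (Fin.last (n + t))).1
    have hu' : (((ω (Fin.last (n + t))).1 : Fin n) : ℕ) = t := by
      rw [hu]
      simp [Nat.mod_eq_of_lt (show t < n by omega)]
    refine ⟨?_, ?_, ?_⟩
    · change Function.update _ _ _ = Function.update _ _ _
      exact congrArg (fun z => Function.update z _ _) e1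
    · change newRank _ _ _ = newRank _ _ _
      exact congrArg (fun z => newRank z _ _) e2
    · intro i j hij
      refine newGraph_adj_congr e1 e2 (ω (Fin.last (n + t))) ?_
      by_cases hi : i = (ω (Fin.last (n + t))).1
      · exact Or.inl hi
      by_cases hj : j = (ω (Fin.last (n + t))).1
      · exact Or.inr (Or.inl hj)
      refine Or.inr (Or.inr (e3 i j ?_))
      rw [Fin.ext_iff, hu'] at hi hj
      omega

/-- Two rounds of deaths in the order of the labels, with all births at the first rank, form an
event about `2n` innovations that has positive probability and forgets the initial state. -/
theorem existsUnique_isStationary (α β : ℝ) (p : unitInterval) {n m : ℕ} (hn : 1 ≤ n) :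
    ∃! π : Measure (State n m), IsStationary α β p π := by
  have : NeZero n := ⟨by omega⟩
  have : Nonempty (State n m) := ⟨(fun _ => 0, 1, ⊥)⟩
  set D : Fin (n + n) → Set (Innovation n m) := fun i =>
    {(⟨(i : ℕ) % n, Nat.mod_lt _ (by omega)⟩ : Fin n)} ×ˢ ({(0 : Fin n)} ×ˢ Set.univ) with hD
  have hDm : ∀ i, MeasurableSet (D i) := fun i =>
    (MeasurableSet.of_discrete).prod ((MeasurableSet.of_discrete).prod MeasurableSet.univ)
  refine existsUnique_stationary (measurable_step α β n m) (innovationLaw n m p) (n + n)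
    (E := Set.univ.pi D) (MeasurableSet.univ_pi hDm) ?_ ?_
  · rw [Measure.pi_pi]
    refine Finset.prod_ne_zero_iff.2 fun i _ => ?_
    have : IsProbabilityMeasure (uniformOn (Set.univ : Set (Fin n))) :=
      isProbabilityMeasure_uniformOn Set.finite_univ Set.univ_nonempty
    rw [innovationLaw, Measure.prod_prod, Measure.prod_prod, uniformOn_univ_singleton,
      uniformOn_univ_singleton, measure_univ]
    simp
  · intro ω hω s s'
    have hω' : ∀ i, ((ω i).1 : ℕ) = (i : ℕ) % n ∧ (ω i).2.1 = 0 := by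
      intro i
      have := hω i trivial
      simp only [hD, Set.mem_prod, Set.mem_singleton_iff, Set.mem_univ, and_true] at this
      exact ⟨by rw [this.1], this.2⟩
    obtain ⟨e1, e2, e3⟩ := iterState_agree_second (α := α) (β := β) n le_rfl ω hω' s s'
    refine Prod.ext e1 (Prod.ext e2 (SimpleGraph.ext ?_))
    funext i j
    exact propext (e3 i j (Or.inl i.2))

end Coupling


/-! ### The chain augmented by marks, birth times and a flag for ranks out of range. -/

/-- The radius of the influence region of a node of rank `r`. -/
noncomputable def radius (α β : ℝ) (n m : ℕ) (r : ℝ) : ℝ :=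
  ((r ^ (-α) * (n : ℝ) ^ (-β)) ^ (1 / (m : ℝ))) / 2

theorem radius_anti {α β : ℝ} (hα : 0 ≤ α) {n m : ℕ} {r r' : ℝ} (hr : 0 < r) (h : r ≤ r') :
    radius α β n m r' ≤ radius α β n m r := by
  unfold radius
  have : r' ^ (-α) ≤ r ^ (-α) := Real.rpow_le_rpow_of_nonpos hr h (by linarith)
  have h' : 0 ≤ r' ^ (-α) := (Real.rpow_pos_of_pos (hr.trans_le h) _).le
  gcongr

/-- A graph is compatible with birth times `b` and marks `M`, if the edges are created as in the
model, up to the knowledge that the rank of a node with initial rank `R` stays between `lo R` and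
`hi R`. -/
def Compatible (α β : ℝ) {n m : ℕ} (lo hi : Fin n → ℝ) (b : Fin n → ℕ) (M : Fin n → Mark n m)
    (G : SimpleGraph (Fin n)) : Prop :=
  ∀ i j, b i < b j →
    (G.Adj i j → dist (M j).2.1 (M i).2.1 ≤ radius α β n m (lo (M i).1)) ∧
    ((M j).2.2 i = true → dist (M j).2.1 (M i).2.1 ≤ radius α β n m (hi (M i).1) → G.Adj i j)

/-- The state of the chain together with the marks, the birth times of the nodes, a flag and a
clock. -/
abbrev Aug (n m : ℕ) : Type :=
  State n m × (Fin n → Mark n m) × (Fin n → ℕ) × Bool × ℕ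

open Classical in
/-- Some node that was born has left its range of ranks. -/
noncomputable def violation {n : ℕ} (lo hi : Fin n → ℝ)
    (q : Equiv.Perm (Fin n) × (Fin n → Fin n) × (Fin n → ℕ)) : Bool :=
  decide (∃ i, 0 < q.2.2 i ∧ ¬(lo (q.2.1 i) ≤ (q.1 i : ℝ) + 1 ∧ (q.1 i : ℝ) + 1 ≤ hi (q.2.1 i)))

/-- One time-step of the augmented chain. -/
noncomputable def augStep (α β : ℝ) {n m : ℕ} (lo hi : Fin n → ℝ) (q : Aug n m × Innovation n m) :
    Aug n m :=
  (step α β q.1.1 q.2, Function.update q.1.2.1 q.2.1 q.2.2,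
    Function.update q.1.2.2.1 q.2.1 (q.1.2.2.2.2 + 1),
    q.1.2.2.2.1 || violation lo hi ((step α β q.1.1 q.2).2.1,
      (fun i => (Function.update q.1.2.1 q.2.1 q.2.2 i).1),
      Function.update q.1.2.2.1 q.2.1 (q.1.2.2.2.2 + 1)),
    q.1.2.2.2.2 + 1)

instance instDiscreteMeasurableSpacePerm (n : ℕ) :
    DiscreteMeasurableSpace (Equiv.Perm (Fin n)) := ⟨fun _ => trivial⟩

theorem measurable_update_apply {n : ℕ} {A Y : Type*} [MeasurableSpace A] [MeasurableSpace Y]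
    {f : A → Fin n → Y} {u : A → Fin n} {y : A → Y} (hf : Measurable f) (hu : Measurable u)
    (hy : Measurable y) : Measurable fun a => Function.update (f a) (u a) (y a) := by
  refine measurable_pi_lambda _ fun i => ?_
  simp only [Function.update_apply]
  exact Measurable.ite (measurableSet_eq_fun measurable_const hu) hy
    ((measurable_pi_apply i).comp hf)

theorem measurable_augStep (α β : ℝ) {n m : ℕ} (lo hi : Fin n → ℝ) :
    Measurable (augStep α β (m := m) lo hi) := by
  have h1 : Measurable fun q : Aug n m × Innovation n m => step α β q.1.1 q.2 :=
    (measurable_step α β n m).comp (f := fun q : Aug n m × Innovation n m => (q.1.1, q.2))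
      (by fun_prop)
  have h2 : Measurable fun q : Aug n m × Innovation n m =>
      Function.update q.1.2.1 q.2.1 q.2.2 :=
    measurable_update_apply (by fun_prop) (by fun_prop) (by fun_prop)
  have h3 : Measurable fun q : Aug n m × Innovation n m =>
      Function.update q.1.2.2.1 q.2.1 (q.1.2.2.2.2 + 1) :=
    measurable_update_apply (by fun_prop) (by fun_prop) (by fun_prop)
  have h4 : Measurable (violation lo hi) := Measurable.of_discrete
  have h5 : Measurable fun q : Bool × Bool => q.1 || q.2 := Measurable.of_discrete
  refine h1.prodMk (h2.prodMk (h3.prodMk (Measurable.prodMk ?_ (by fun_prop))))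
  refine h5.comp (Measurable.prodMk (by fun_prop) (h4.comp ?_))
  refine Measurable.prodMk (by fun_prop) (Measurable.prodMk ?_ h3)
  exact measurable_pi_lambda _ fun i => ((measurable_pi_apply i).comp h2).fst

section Invariants

variable {α β : ℝ} {n m : ℕ} {lo hi : Fin n → ℝ}

/-- What the augmented chain remembers about the graph. -/
structure AugInv (α β : ℝ) {n m : ℕ} (lo hi : Fin n → ℝ) (a : Aug n m) : Prop where
  clock : ∀ i, a.2.2.1 i ≤ a.2.2.2.2
  pos : ∀ i, 0 < a.2.2.1 i → a.1.1 i = (a.2.1 i).2.1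
  inj : ∀ i j, 0 < a.2.2.1 i → a.2.2.1 i = a.2.2.1 j → i = j
  rank : a.2.2.2.1 = false → ∀ i, 0 < a.2.2.1 i →
    lo (a.2.1 i).1 ≤ (a.1.2.1 i : ℝ) + 1 ∧ (a.1.2.1 i : ℝ) + 1 ≤ hi (a.2.1 i).1
  adj : a.2.2.2.1 = false → ∀ i j, 0 < a.2.2.1 i → a.2.2.1 i < a.2.2.1 j →
    (a.1.2.2.Adj i j →
      dist (a.2.1 j).2.1 (a.2.1 i).2.1 ≤ radius α β n m (lo (a.2.1 i).1)) ∧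
    ((a.2.1 j).2.2 i = true →
      dist (a.2.1 j).2.1 (a.2.1 i).2.1 ≤ radius α β n m (hi (a.2.1 i).1) → a.1.2.2.Adj i j)

/-- An edge is created according to the rank of the older node just before the step, and it is then
kept as long as both ends live. The flag is never reset, so an unset flag after the step guarantees
the range of ranks before it. -/
theorem AugInv.augStep (hα : 0 ≤ α) (hlo : ∀ R, 0 < lo R) {a : Aug n m}
    (h : AugInv α β lo hi a) (ξ : Innovation n m) :
    AugInv α β lo hi (augStep α β lo hi (a, ξ)) := by
  obtain ⟨s, M, b, f, c⟩ := a
  obtain ⟨u, ξ⟩ := ξ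
  have hclock : ∀ i, b i ≤ c := h.clock
  have hflag : (GeoP.augStep α β lo hi ((s, M, b, f, c), (u, ξ))).2.2.2.1 = false →
      f = false := by
    intro hf
    simp only [GeoP.augStep, Bool.or_eq_false_iff] at hf
    exact hf.1
  refine ⟨?_, ?_, ?_, ?_, ?_⟩
  · intro i
    simp only [GeoP.augStep]
    by_cases hi : i = u
    · subst hi; simp
    · rw [Function.update_of_ne hi]; have := hclock i; omega
  · intro i
    simp only [GeoP.augStep, step]
    by_cases hi : i = u
    · subst hi; simp
    · simp only [Function.update_of_ne hi]
      exact h.pos i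
  · intro i j
    simp only [GeoP.augStep]
    by_cases hi : i = u <;> by_cases hj : j = u
    · intros; rw [hi, hj]
    · subst hi
      rw [Function.update_self, Function.update_of_ne hj]
      have := hclock j; omega
    · subst hj
      rw [Function.update_self, Function.update_of_ne hi]
      have := hclock i; omega
    · rw [Function.update_of_ne hi, Function.update_of_ne hj]
      exact h.inj i j
  · intro hf i hi
    simp only [GeoP.augStep, Bool.or_eq_false_iff, violation, decide_eq_false_iff_not,
      not_exists, not_and] at hf
    by_contra hc
    exact hf.2 i hi fun h1 h2 => hc ⟨h1, h2⟩
  · intro hf i j hi hij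
    have hf0 := hflag hf
    simp only [GeoP.augStep] at hi hij ⊢
    by_cases hju : j = u
    · subst hju
      have hiu : i ≠ j := by rintro rfl; exact lt_irrefl _ hij
      simp only [Function.update_self, Function.update_of_ne hiu] at hi hij ⊢
      obtain ⟨hr1, hr2⟩ := h.rank hf0 i hi
      have hp := h.pos i hi
      simp only at hr1 hr2 hp
      have hreg : ξ.2.1 ∈ region α β n (s.1 i) ((s.2.1 i : ℕ) + 1) ↔
          dist ξ.2.1 (M i).2.1 ≤ radius α β n m ((s.2.1 i : ℝ) + 1) := by
        rw [← hp, region, radius, Metric.mem_closedBall]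
        push_cast
        rfl
      have hadj : (step α β s (j, ξ)).2.2.Adj i j ↔
          ξ.2.2 i = true ∧ dist ξ.2.1 (M i).2.1 ≤ radius α β n m ((s.2.1 i : ℝ) + 1) := by
        rw [← hreg]
        simp [step, newGraph, hiu]
      rw [hadj]
      refine ⟨fun hd => hd.2.trans (radius_anti hα (hlo _) hr1), fun hc hd => ⟨hc, hd.trans ?_⟩⟩
      exact radius_anti hα (by positivity) hr2
    · by_cases hiu : i = u
      · subst hiu
        rw [Function.update_self, Function.update_of_ne hju] at hij
        have := hclock j
        omega
      · simp only [Function.update_of_ne hiu, Function.update_of_ne hju] at hi hij ⊢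
        have hadj : (step α β s (u, ξ)).2.2.Adj i j ↔ s.2.2.Adj i j := by
          simp [step, newGraph, hiu, hju]
        rw [hadj]
        exact h.adj hf0 i j hi hij

theorem AugInv.iterState (hα : 0 ≤ α) (hlo : ∀ R, 0 < lo R) {a : Aug n m}
    (h : AugInv α β lo hi a) (k : ℕ) (ω : Fin k → Innovation n m) :
    AugInv α β lo hi (iterState (GeoP.augStep α β lo hi) k a ω) := by
  induction k with
  | zero => exact h
  | succ k ih => exact (ih _).augStep hα hlo _

theorem augInv_init (s : State n m) (M : Fin n → Mark n m) :
    AugInv α β lo hi (s, M, (fun _ => 0), false, 0) :=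
  ⟨by simp, by simp, by simp, by simp, by simp⟩

end Invariants


/-! ### Exponential moments of a rank after one step. -/

theorem lintegral_uniformOn_univ {n : ℕ} (f : Fin n → ENNReal) :
    ∫⁻ i, f i ∂(uniformOn (Set.univ : Set (Fin n))) = (n : ENNReal)⁻¹ * ∑ i, f i := by
  rw [lintegral_fintype, Finset.mul_sum]
  refine Finset.sum_congr rfl fun i _ => ?_
  rw [uniformOn_univ_singleton, mul_comm]

theorem exp_le_one_add_self_add_sq {θ : ℝ} (h : |θ| ≤ 1) : Real.exp θ ≤ 1 + θ + θ ^ 2 := by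
  have := (abs_le.1 (Real.abs_exp_sub_one_sub_id_le h)).2
  linarith

/-- The exponential moment of the rank of a surviving node after one time-step. -/
theorem sum_exp_newRank_le {n : ℕ} (σ : Equiv.Perm (Fin n)) (i : Fin n) {θ : ℝ} (hθ : |θ| ≤ 1) :
    ∑ u, ∑ R, (if u = i then 0 else Real.exp (θ * newRank σ u R i)) ≤
      (n : ℝ) ^ 2 * Real.exp (θ * σ i + 2 * θ ^ 2 * σ i / n + 2 * max θ 0 / n) := by
  set r : ℕ := (σ i : ℕ) with hr
  have hrn : r < n := (σ i).2
  have hn : (0 : ℝ) < n := by exact_mod_cast (Nat.zero_le r).trans_lt hrn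
  set x := Real.exp θ with hx
  have hx0 : 0 < x := Real.exp_pos θ
  set y := Real.exp (-θ) with hy
  have hy0 : 0 < y := Real.exp_pos _
  have hxy : x * y = 1 := by rw [hx, hy, ← Real.exp_add]; simp
  have hcount : ∀ k : ℕ, k ≤ n → ∀ A B : ℝ,
      ∑ R : Fin n, (if (R : ℕ) < k then A else B) = k * A + (n - k) * B := by
    intro k hk A B
    rw [Fin.sum_univ_eq_sum_range (fun R => if R < k then A else B) n, Finset.sum_ite,
      Finset.sum_const, Finset.sum_const]
    have e1 : (Finset.range n).filter (fun R => R < k) = Finset.range k := by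
      ext R; simp; omega
    have e2 : (Finset.range n).filter (fun R => ¬ R < k) = Finset.Ico k n := by
      ext R; simp; omega
    rw [e1, e2, Finset.card_range, Nat.card_Ico, nsmul_eq_mul, nsmul_eq_mul, Nat.cast_sub hk]
  -- Here the death lowers the rank of `i` by one, and the birth restores it exactly if `R < r`.
  have hlow : ∀ u, σ u < σ i → ∑ R, Real.exp (θ * newRank σ u R i) =
      Real.exp (θ * r) * y * (r * x + (n - r)) := by
    intro u hu
    have hne : i ≠ u := fun e => by subst e; exact lt_irrefl _ hu
    have h1 : ∀ R, Real.exp (θ * newRank σ u R i) =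
        if (R : ℕ) < r then Real.exp (θ * r) else Real.exp (θ * r) * y := by
      intro R
      obtain ⟨γ, δ, hγ, hδ, e⟩ := newRank_of_ne σ R hne
      rw [if_pos hu] at hγ
      subst hγ
      split_ifs with hR
      · rw [if_pos (by omega)] at hδ
        subst hδ
        have : ((newRank σ u R i : ℕ) : ℤ) = (r : ℤ) := by rw [e]; ring
        rw [show (newRank σ u R i : ℕ) = r by exact_mod_cast this]
      · rw [if_neg (by omega)] at hδ
        subst hδ
        have : ((newRank σ u R i : ℕ) : ℤ) = (r : ℤ) - 1 := by rw [e]; ring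
        have h2 : ((newRank σ u R i : ℕ) : ℝ) = (r : ℝ) - 1 := by exact_mod_cast this
        rw [h2, hy, ← Real.exp_add]
        congr 1; ring
    simp_rw [h1]
    rw [hcount r hrn.le]
    linear_combination (-(r : ℝ) * Real.exp (θ * r)) * hxy
  -- Here the death has no effect, and the birth raises the rank exactly if `R ≤ r`; hence the count
  -- `r + 1`.
  have hhigh : ∀ u, σ i < σ u → ∑ R, Real.exp (θ * newRank σ u R i) =
      Real.exp (θ * r) * ((r + 1) * x + (n - r - 1)) := by
    intro u hu
    have hne : i ≠ u := fun e => by subst e; exact lt_irrefl _ hu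
    have h1 : ∀ R, Real.exp (θ * newRank σ u R i) =
        if (R : ℕ) < r + 1 then Real.exp (θ * r) * x else Real.exp (θ * r) := by
      intro R
      obtain ⟨γ, δ, hγ, hδ, e⟩ := newRank_of_ne σ R hne
      rw [if_neg (not_lt.2 hu.le)] at hγ
      subst hγ
      split_ifs with hR
      · rw [if_pos (by omega)] at hδ
        subst hδ
        have : ((newRank σ u R i : ℕ) : ℤ) = (r : ℤ) + 1 := by rw [e]; ring
        have h2 : ((newRank σ u R i : ℕ) : ℝ) = (r : ℝ) + 1 := by exact_mod_cast this
        rw [h2, hx, ← Real.exp_add]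
        congr 1; ring
      · rw [if_neg (by omega)] at hδ
        subst hδ
        have : ((newRank σ u R i : ℕ) : ℤ) = (r : ℤ) := by rw [e]; ring
        rw [show (newRank σ u R i : ℕ) = r by exact_mod_cast this]
    simp_rw [h1]
    rw [hcount (r + 1) hrn]
    push_cast
    ring
  have hsum : ∑ u, ∑ R, (if u = i then 0 else Real.exp (θ * newRank σ u R i)) =
      Real.exp (θ * r) * (r * (y * (r * x + (n - r))) + (n - r - 1) * ((r + 1) * x + (n - r - 1))) := by
    set a := Real.exp (θ * r) * y * (r * x + (n - r)) with ha
    set c := Real.exp (θ * r) * ((r + 1) * x + (n - r - 1)) with hc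
    have h1 : ∀ u, ∑ R, (if u = i then 0 else Real.exp (θ * newRank σ u R i)) =
        (if (σ u : ℕ) < r then a else c) - if u = i then c else 0 := by
      intro u
      by_cases hu : u = i
      · subst hu; simp [hr]
      · simp only [hu, if_false, sub_zero]
        split_ifs with h
        · exact hlow u (Fin.lt_def.2 h)
        · refine hhigh u (lt_of_le_of_ne (not_lt.1 h) fun e => hu (σ.injective e.symm))
    simp_rw [h1]
    rw [Finset.sum_sub_distrib, Finset.sum_ite_eq' Finset.univ i, if_pos (Finset.mem_univ i),
      Equiv.sum_comp σ (fun k => if (k : ℕ) < r then a else c), hcount r hrn.le, ha, hc]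
    ring
  rw [hsum, show θ * (σ i : ℕ) + 2 * θ ^ 2 * (σ i : ℕ) / n + 2 * max θ 0 / n =
    θ * r + (2 * θ ^ 2 * r / n + 2 * max θ 0 / n) by rw [← hr]; ring, Real.exp_add]
  -- After using `x * y = 1`, the term with `x + y - 2 ≤ 2 θ²` is the variance, proportional to `r /
  -- n`. The last bracket collects drift and killing; it is harmful only for `θ > 0`, hence `max θ
  -- 0`.
  have hmain : r * (y * (r * x + (n - r))) + (n - r - 1) * ((r + 1) * x + (n - r - 1)) ≤
      (n : ℝ) ^ 2 * (1 + (2 * θ ^ 2 * r / n + 2 * max θ 0 / n)) := by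
    have e1 : (n : ℝ) ^ 2 * (1 + (2 * θ ^ 2 * r / n + 2 * max θ 0 / n)) =
        (n : ℝ) ^ 2 + 2 * θ ^ 2 * r * n + 2 * max θ 0 * n := by
      field_simp
      ring
    have e2 : (r : ℝ) * (y * (r * x + (n - r))) + (n - r - 1) * ((r + 1) * x + (n - r - 1)) =
        (n : ℝ) ^ 2 + r * (n - r) * (x + y - 2) + ((n - 2 * r - 1) * x - 2 * (n - r) + 1) := by
      linear_combination ((r : ℝ) ^ 2) * hxy
    rw [e1, e2]
    have hrn' : (r : ℝ) + 1 ≤ n := by exact_mod_cast hrn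
    have hr0 : (0 : ℝ) ≤ r := by positivity
    have hxb := exp_le_one_add_self_add_sq hθ
    have hyb := exp_le_one_add_self_add_sq (θ := -θ) (by rwa [abs_neg])
    rw [← hx] at hxb
    rw [← hy] at hyb
    have h1 : (r : ℝ) * (n - r) * (x + y - 2) ≤ 2 * θ ^ 2 * r * n := by
      have h2 : x + y - 2 ≤ 2 * θ ^ 2 := by nlinarith
      calc (r : ℝ) * (n - r) * (x + y - 2) ≤ r * (n - r) * (2 * θ ^ 2) := by
            apply mul_le_mul_of_nonneg_left h2; apply mul_nonneg hr0; linarith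
        _ ≤ r * n * (2 * θ ^ 2) := by
            apply mul_le_mul_of_nonneg_right _ (by positivity)
            apply mul_le_mul_of_nonneg_left _ hr0; linarith
        _ = _ := by ring
    have h3 : (n - 2 * r - 1) * x - 2 * (n - r) + 1 ≤ 2 * max θ 0 * n := by
      have hm0 : 0 ≤ max θ 0 := le_max_right _ _
      by_cases hs : (0 : ℝ) ≤ n - 2 * r - 1
      · have hx2 : x ≤ 1 + 2 * max θ 0 := by
          rcases le_total θ 0 with h | h
          · rw [max_eq_right h]
            have : x ≤ 1 := Real.exp_le_one_iff.2 h
            linarith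
          · rw [max_eq_left h]
            have := (abs_le.1 hθ).2
            nlinarith
        nlinarith [mul_le_mul_of_nonneg_left hx2 hs, mul_nonneg hr0 hm0]
      · push Not at hs
        nlinarith [mul_nonneg hm0 hn.le, mul_nonneg_of_nonpos_of_nonpos hs.le (by linarith : -x ≤ 0)]
    linarith
  have hexp : 1 + (2 * θ ^ 2 * r / n + 2 * max θ 0 / n) ≤
      Real.exp (2 * θ ^ 2 * r / n + 2 * max θ 0 / n) := by
    have := Real.add_one_le_exp (2 * θ ^ 2 * r / n + 2 * max θ 0 / n)
    linarith
  calc Real.exp (θ * r) * _ ≤ Real.exp (θ * r) * ((n : ℝ) ^ 2 *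
        Real.exp (2 * θ ^ 2 * r / n + 2 * max θ 0 / n)) := by
        gcongr
        exact hmain.trans (by gcongr)
    _ = _ := by ring

/-! ### Marginals of the augmented chain. -/

section AugLaw

variable {n m : ℕ}

/-- The law of the augmented chain after `t` steps. -/
noncomputable def augLaw (α β : ℝ) (p : unitInterval) (lo hi : Fin n → ℝ) (π : Measure (State n m))
    (t : ℕ) : Measure (Aug n m) :=
  (fun μ : Measure (Aug n m) => (μ.prod (innovationLaw n m p)).map (augStep α β lo hi))^[t]
    ((π.prod (Measure.pi fun _ => markLaw n m p)).map fun q => (q.1, q.2, (fun _ => 0), false, 0))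

variable {α β : ℝ} {p : unitInterval} {lo hi : Fin n → ℝ} {π : Measure (State n m)}

theorem measurable_augInit :
    Measurable fun q : State n m × (Fin n → Mark n m) =>
      ((q.1, q.2, (fun _ => 0), false, 0) : Aug n m) := by fun_prop

theorem lintegral_augLaw_succ [NeZero n] (t : ℕ) {g : Aug n m → ENNReal} (hg : Measurable g) :
    ∫⁻ a, g a ∂(augLaw α β p lo hi π (t + 1)) =
      ∫⁻ a, ∫⁻ ξ, g (augStep α β lo hi (a, ξ)) ∂(innovationLaw n m p)
        ∂(augLaw α β p lo hi π t) := by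
  rw [augLaw, Function.iterate_succ_apply',
    lintegral_map_prod (measurable_augStep α β lo hi) _ _ hg, augLaw]

theorem isProbabilityMeasure_augLaw [NeZero n] [IsProbabilityMeasure π] (t : ℕ) :
    IsProbabilityMeasure (augLaw α β p lo hi π t) := by
  induction t with
  | zero => exact Measure.isProbabilityMeasure_map measurable_augInit.aemeasurable
  | succ t ih =>
    rw [augLaw, Function.iterate_succ_apply']
    rw [augLaw] at ih
    exact Measure.isProbabilityMeasure_map (measurable_augStep α β lo hi).aemeasurable

/-- The additional components do not influence the state, so its law stays stationary. -/
theorem map_fst_augLaw [NeZero n] (hπ : IsStationary α β p π) (t : ℕ) :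
    (augLaw α β p lo hi π t).map Prod.fst = π := by
  have := hπ.1
  induction t with
  | zero =>
    rw [augLaw, Function.iterate_zero, id_eq, Measure.map_map measurable_fst measurable_augInit]
    exact (measurePreserving_fst (μ := π) (ν := Measure.pi fun _ => markLaw n m p)).map_eq
  | succ t ih =>
    have hst := hπ.2
    rw [stepLaw] at hst
    refine Measure.ext_of_lintegral _ fun g hg => ?_
    have hgs : Measurable fun z : State n m × Innovation n m => g (step α β z.1 z.2) :=
      hg.comp (measurable_step α β n m)
    conv_rhs => rw [← hst, lintegral_map_prod (measurable_step α β n m) _ _ hg, ← ih]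
    rw [lintegral_map hg measurable_fst, lintegral_augLaw_succ t
      (g := fun a => g a.1) (hg.comp measurable_fst),
      lintegral_map (f := fun s => ∫⁻ ξ, g (step α β s ξ) ∂(innovationLaw n m p))
      hgs.lintegral_prod_right' measurable_fst]
    rfl

/-- The dying label is independent of the data of the newborn node, so each step resamples one mark.
Hence the marks remain independent of each other and of the birth times. State and flag have to be
left out because they depend on the marks. -/
theorem map_marks_augLaw [NeZero n] [IsProbabilityMeasure π] (t : ℕ) :
    ∃ q : Measure ((Fin n → ℕ) × ℕ), IsProbabilityMeasure q ∧
      (augLaw α β p lo hi π t).map (fun a => (a.2.1, (a.2.2.1, a.2.2.2.2))) =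
        (Measure.pi fun _ => markLaw n m p).prod q := by
  have hproj : Measurable fun a : Aug n m => (a.2.1, (a.2.2.1, a.2.2.2.2)) := by fun_prop
  have hunif : IsProbabilityMeasure (uniformOn (Set.univ : Set (Fin n))) :=
    isProbabilityMeasure_uniformOn Set.finite_univ Set.univ_nonempty
  induction t with
  | zero =>
    refine ⟨Measure.dirac (fun _ => 0, 0), inferInstance, ?_⟩
    rw [augLaw, Function.iterate_zero, id_eq, Measure.map_map hproj measurable_augInit]
    refine Measure.ext_of_lintegral _ fun g hg => ?_
    rw [lintegral_map hg (hproj.comp measurable_augInit), lintegral_prod_symm _ (by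
      exact (hg.comp (hproj.comp measurable_augInit)).aemeasurable), lintegral_prod _
      hg.aemeasurable]
    simp only [Function.comp_def, lintegral_const, measure_univ, mul_one]
    refine lintegral_congr fun M => ?_
    rw [lintegral_dirac' _ (by fun_prop)]
  | succ t ih =>
    obtain ⟨q, hq, e⟩ := ih
    set h : ((Fin n → ℕ) × ℕ) × Fin n → (Fin n → ℕ) × ℕ :=
      fun z => (Function.update z.1.1 z.2 (z.1.2 + 1), z.1.2 + 1) with hh
    have hhm : Measurable h :=
      (measurable_update_apply (by fun_prop) (by fun_prop) (by fun_prop)).prodMk (by fun_prop)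
    refine ⟨(q.prod (uniformOn Set.univ)).map h,
      Measure.isProbabilityMeasure_map hhm.aemeasurable, ?_⟩
    refine Measure.ext_of_lintegral _ fun g hg => ?_
    rw [lintegral_map hg hproj, lintegral_augLaw_succ t
      (g := fun a => g (a.2.1, (a.2.2.1, a.2.2.2.2))) (hg.comp hproj)]
    set G : ((Fin n → Mark n m) × (Fin n → ℕ) × ℕ) × Innovation n m → ENNReal := fun z =>
      g (Function.update z.1.1 z.2.1 z.2.2, h (z.1.2, z.2.1)) with hG
    have hGm : Measurable G := hg.comp (Measurable.prodMk
      (measurable_update_apply (by fun_prop) (by fun_prop) (by fun_prop)) (hhm.comp (by fun_prop)))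
    have hgh : Measurable fun z : ((Fin n → ℕ) × ℕ) × Fin n =>
        ∫⁻ M, g (M, h z) ∂(Measure.pi fun _ => markLaw n m p) :=
      hg.lintegral_prod_left'.comp hhm
    have e1 : ∀ a : Aug n m, ∫⁻ ξ, (g ∘ fun a : Aug n m => (a.2.1, (a.2.2.1, a.2.2.2.2)))
        (augStep α β lo hi (a, ξ)) ∂(innovationLaw n m p) =
        ∫⁻ ξ, G ((a.2.1, (a.2.2.1, a.2.2.2.2)), ξ) ∂(innovationLaw n m p) := fun a => rfl
    simp only [Function.comp_apply] at e1 ⊢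
    simp_rw [e1]
    rw [← lintegral_map (f := fun z => ∫⁻ ξ, G (z, ξ) ∂(innovationLaw n m p))
      hGm.lintegral_prod_right' hproj, e, lintegral_prod_symm _
      hGm.lintegral_prod_right'.aemeasurable, lintegral_prod_symm _ hg.aemeasurable,
      lintegral_map hg.lintegral_prod_left' hhm, lintegral_prod _ hgh.aemeasurable]
    refine lintegral_congr fun z => ?_
    have e2 : ∀ M : Fin n → Mark n m, ∫⁻ ξ, G ((M, z), ξ) ∂(innovationLaw n m p) =
        ∫⁻ u, ∫⁻ y, g (Function.update M u y, h (z, u)) ∂(markLaw n m p)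
          ∂(uniformOn Set.univ) := by
      intro M
      rw [innovationLaw_eq, lintegral_prod]
      exact (hGm.comp (by fun_prop)).aemeasurable
    simp_rw [e2, lintegral_uniformOn_univ]
    rw [lintegral_const_mul, lintegral_finsetSum]
    · congr 1
      refine Finset.sum_congr rfl fun u _ => ?_
      rw [← lintegral_pi_update (markLaw n m p) u (f := fun M => g (M, h (z, u)))
        (hg.comp (by fun_prop))]
    · intro u _
      exact ((hg.comp (measurable_id.prodMk measurable_const)).comp
        (measurable_update_prod u)).lintegral_prod_right'
    · refine Finset.measurable_sum _ fun u _ => ?_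
      exact ((hg.comp (measurable_id.prodMk measurable_const)).comp
        (measurable_update_prod u)).lintegral_prod_right'

end AugLaw


/-! ### Exponential potential of the ranks, waiting time for births, and the flag. -/

theorem lintegral_innovationLaw_ranks {n m : ℕ} [NeZero n] (p : unitInterval)
    (k : Fin n → Fin n → ENNReal) :
    ∫⁻ ξ, k ξ.1 ξ.2.1 ∂(innovationLaw n m p) =
      ((n : ENNReal)⁻¹) ^ 2 * ∑ u, ∑ R, k u R := by
  have hunif : IsProbabilityMeasure (uniformOn (Set.univ : Set (Fin n))) :=
    isProbabilityMeasure_uniformOn Set.finite_univ Set.univ_nonempty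
  have hk : Measurable fun ξ : Innovation n m => k ξ.1 ξ.2.1 :=
    (Measurable.of_discrete (f := fun z : Fin n × Fin n => k z.1 z.2)).comp
      (f := fun ξ : Innovation n m => (ξ.1, ξ.2.1)) (by fun_prop)
  rw [innovationLaw_eq, lintegral_prod _ hk.aemeasurable, lintegral_uniformOn_univ, pow_two,
    mul_assoc]
  congr 1
  rw [Finset.mul_sum]
  refine Finset.sum_congr rfl fun u _ => ?_
  rw [markLaw, lintegral_prod, ← lintegral_uniformOn_univ]
  · simp
  · exact (hk.comp (by fun_prop : Measurable fun y : Mark n m => (u, y))).aemeasurable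

section Potential

variable {n m : ℕ} {α β : ℝ} {p : unitInterval} {lo hi : Fin n → ℝ} {π : Measure (State n m)}

/-- An exponential functional of the ranks of the nodes that were born. -/
noncomputable def potential (θ c : ℝ) (ψ : Fin n → ℝ) (a : Aug n m) : ENNReal :=
  ∑ i, if 0 < a.2.2.1 i then
    ENNReal.ofReal (Real.exp (θ * a.1.2.1 i + ψ (a.2.1 i).1 + c)) else 0

theorem measurable_potential (θ c : ℝ) (ψ : Fin n → ℝ) :
    Measurable (potential (m := m) θ c ψ) := by
  refine Finset.measurable_sum _ fun i _ => ?_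
  have h : Measurable fun z : ℕ × Equiv.Perm (Fin n) × Fin n => if 0 < z.1 then
    ENNReal.ofReal (Real.exp (θ * z.2.1 i + ψ z.2.2 + c)) else 0 := Measurable.of_discrete
  exact h.comp (f := fun a : Aug n m => (a.2.2.1 i, a.1.2.1, (a.2.1 i).1)) (by fun_prop)

/-- The newborn node adds at most `1`, by `h3`. For the survivors, `h1` and `h2` let the parameters
shrink just enough to absorb the variance and drift terms of `sum_exp_newRank_le`. -/
theorem lintegral_potential_augStep_le [NeZero n] {θ c θ' c' : ℝ} {ψ : Fin n → ℝ}
    (hθ : |θ'| ≤ 1) (h1 : θ' + 2 * θ' ^ 2 / n ≤ θ) (h2 : c' + 2 * max θ' 0 / n ≤ c)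
    (h3 : ∀ R : Fin n, θ' * R + ψ R + c' ≤ 0) (a : Aug n m) :
    ∫⁻ ξ, potential θ' c' ψ (augStep α β lo hi (a, ξ)) ∂(innovationLaw n m p) ≤
      potential θ c ψ a + 1 := by
  obtain ⟨s, M, b, f, k⟩ := a
  have hn0 : (n : ENNReal) ≠ 0 := by exact_mod_cast NeZero.ne n
  set g : Fin n → Fin n → Fin n → ENNReal := fun i u R =>
    if 0 < b i then (if u = i then 0 else
      ENNReal.ofReal (Real.exp (θ' * newRank s.2.1 u R i + ψ (M i).1 + c'))) else 0 with hg
  have hpt : ∀ ξ : Innovation n m, potential θ' c' ψ (augStep α β lo hi ((s, M, b, f, k), ξ)) ≤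
      1 + ∑ i, g i ξ.1 ξ.2.1 := by
    rintro ⟨u, R, ξ⟩
    have : ∀ i, (if 0 < (augStep α β lo hi ((s, M, b, f, k), (u, R, ξ))).2.2.1 i then
        ENNReal.ofReal (Real.exp (θ' * (augStep α β lo hi ((s, M, b, f, k), (u, R, ξ))).1.2.1 i +
          ψ ((augStep α β lo hi ((s, M, b, f, k), (u, R, ξ))).2.1 i).1 + c')) else 0) ≤
        (if i = u then 1 else 0) + g i u R := by
      intro i
      simp only [augStep, step, hg]
      by_cases hi : i = u
      · subst hi
        simp only [Function.update_self, newRank_self, if_true]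
        split_ifs <;> simp [h3 R]
      · simp [hi, Ne.symm hi]
    refine (Finset.sum_le_sum fun i _ => this i).trans ?_
    rw [Finset.sum_add_distrib]
    simp
  refine (lintegral_mono hpt).trans ?_
  rw [lintegral_innovationLaw_ranks (m := m) p fun u R => 1 + ∑ i, g i u R]
  have e1 : ∑ u : Fin n, ∑ R : Fin n, (1 + ∑ i, g i u R) =
      (n : ENNReal) ^ 2 + ∑ i, ∑ u, ∑ R, g i u R := by
    simp only [Finset.sum_add_distrib]
    congr 1
    · simp [pow_two]
    · rw [Finset.sum_comm' (t' := Finset.univ) (s' := fun _ => Finset.univ) (by simp)]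
      have : ∀ R : Fin n, ∑ u, ∑ i, g i u R = ∑ i, ∑ u, g i u R := fun R => Finset.sum_comm
      simp_rw [this]
      rw [Finset.sum_comm]
      exact Finset.sum_congr rfl fun i _ => Finset.sum_comm
  rw [e1, mul_add, ← mul_pow, ENNReal.inv_mul_cancel hn0 (ENNReal.natCast_ne_top n), one_pow,
    add_comm, Finset.mul_sum, potential]
  gcongr with i _
  simp only
  split_ifs with hb
  · have e2 : ∑ u, ∑ R, g i u R = ENNReal.ofReal
        (Real.exp (ψ (M i).1 + c') *
          ∑ u, ∑ R, (if u = i then 0 else Real.exp (θ' * newRank s.2.1 u R i))) := by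
      rw [Finset.mul_sum, ENNReal.ofReal_sum_of_nonneg]
      · refine Finset.sum_congr rfl fun u _ => ?_
        rw [Finset.mul_sum, ENNReal.ofReal_sum_of_nonneg]
        · refine Finset.sum_congr rfl fun R _ => ?_
          simp only [hg, hb, if_true]
          split_ifs
          · simp
          · rw [← Real.exp_add]; congr 2; ring
        · intro R _; split_ifs <;> positivity
      · intro u _
        refine mul_nonneg (Real.exp_pos _).le (Finset.sum_nonneg fun R _ => ?_)
        split_ifs <;> positivity
    have hnr : (0 : ℝ) < n := by exact_mod_cast Nat.pos_of_ne_zero (NeZero.ne n)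
    have e3 : ((n : ENNReal)⁻¹) ^ 2 = ENNReal.ofReal (((n : ℝ) ^ 2)⁻¹) := by
      rw [ENNReal.ofReal_inv_of_pos (by positivity), ENNReal.ofReal_pow hnr.le,
        ENNReal.ofReal_natCast, ENNReal.inv_pow]
    rw [e2, e3, ← ENNReal.ofReal_mul (by positivity)]
    apply ENNReal.ofReal_le_ofReal
    have hm := sum_exp_newRank_le s.2.1 i hθ
    calc ((n : ℝ) ^ 2)⁻¹ * (Real.exp (ψ (M i).1 + c') *
          ∑ u, ∑ R, (if u = i then 0 else Real.exp (θ' * newRank s.2.1 u R i)))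
        ≤ ((n : ℝ) ^ 2)⁻¹ * (Real.exp (ψ (M i).1 + c') * ((n : ℝ) ^ 2 *
          Real.exp (θ' * s.2.1 i + 2 * θ' ^ 2 * s.2.1 i / n + 2 * max θ' 0 / n))) := by gcongr
      _ = Real.exp (ψ (M i).1 + c' +
          (θ' * s.2.1 i + 2 * θ' ^ 2 * s.2.1 i / n + 2 * max θ' 0 / n)) := by
          rw [Real.exp_add (ψ (M i).1 + c')]; field_simp
      _ ≤ _ := by
          apply Real.exp_le_exp.2
          have h4 : (0 : ℝ) ≤ (s.2.1 i : ℕ) := by positivity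
          have := mul_le_mul_of_nonneg_right h1 h4
          have e : (θ' + 2 * θ' ^ 2 / n) * ((s.2.1 i : ℕ) : ℝ) =
            θ' * s.2.1 i + 2 * θ' ^ 2 * s.2.1 i / n := by ring
          linarith
  · simp [hg, hb]

theorem lintegral_potential_le [NeZero n] {θ c : ℕ → ℝ} {ψ : Fin n → ℝ} {T : ℕ}
    (hθ : ∀ t < T, |θ (t + 1)| ≤ 1)
    (h1 : ∀ t < T, θ (t + 1) + 2 * θ (t + 1) ^ 2 / n ≤ θ t)
    (h2 : ∀ t < T, c (t + 1) + 2 * max (θ (t + 1)) 0 / n ≤ c t)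
    (h3 : ∀ t < T, ∀ R : Fin n, θ (t + 1) * R + ψ R + c (t + 1) ≤ 0)
    [IsProbabilityMeasure π] (t : ℕ) (ht : t ≤ T) :
    ∫⁻ a, potential (θ t) (c t) ψ a ∂(augLaw α β p lo hi π t) ≤ t := by
  induction t with
  | zero =>
    rw [augLaw, Function.iterate_zero, id_eq,
      lintegral_map (measurable_potential _ _ _) measurable_augInit]
    simp [potential]
  | succ t ih =>
    rw [lintegral_augLaw_succ t (measurable_potential _ _ _)]
    have := isProbabilityMeasure_augLaw (α := α) (β := β) (p := p) (lo := lo) (hi := hi) (π := π) t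
    calc _ ≤ ∫⁻ a, (potential (θ t) (c t) ψ a + 1) ∂(augLaw α β p lo hi π t) :=
          lintegral_mono fun a => lintegral_potential_augStep_le (hθ t ht) (h1 t ht) (h2 t ht)
            (h3 t ht) a
      _ ≤ t + 1 := by
          rw [lintegral_add_right _ measurable_const]
          simpa using ih (by omega)
      _ = _ := by push_cast; rfl

/-- Markov's inequality for the potential, whose mean after `t` steps is at most `t` since it grows
by at most `1` per step from `0`. -/
theorem augLaw_exists_rank_le [NeZero n] {θ c : ℕ → ℝ} {ψ : Fin n → ℝ} {T : ℕ}
    (hθ : ∀ t < T, |θ (t + 1)| ≤ 1)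
    (h1 : ∀ t < T, θ (t + 1) + 2 * θ (t + 1) ^ 2 / n ≤ θ t)
    (h2 : ∀ t < T, c (t + 1) + 2 * max (θ (t + 1)) 0 / n ≤ c t)
    (h3 : ∀ t < T, ∀ R : Fin n, θ (t + 1) * R + ψ R + c (t + 1) ≤ 0)
    [IsProbabilityMeasure π] (t : ℕ) (ht : t ≤ T) (e : ℝ) :
    augLaw α β p lo hi π t {a | ∃ i, 0 < a.2.2.1 i ∧
      e ≤ θ t * a.1.2.1 i + ψ (a.2.1 i).1 + c t} ≤ t * ENNReal.ofReal (Real.exp (-e)) := by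
  have hsub : {a : Aug n m | ∃ i, 0 < a.2.2.1 i ∧ e ≤ θ t * a.1.2.1 i + ψ (a.2.1 i).1 + c t} ⊆
      {a | ENNReal.ofReal (Real.exp e) ≤ potential (θ t) (c t) ψ a} := by
    rintro a ⟨i, hi, he⟩
    refine le_trans ?_ (Finset.single_le_sum (f := fun i => if 0 < a.2.2.1 i then
      ENNReal.ofReal (Real.exp (θ t * a.1.2.1 i + ψ (a.2.1 i).1 + c t)) else 0)
      (fun _ _ => zero_le) (Finset.mem_univ i))
    simp only [hi, if_true]
    exact ENNReal.ofReal_le_ofReal (Real.exp_le_exp.2 he)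
  refine (measure_mono hsub).trans ((meas_ge_le_lintegral_div
    (measurable_potential _ _ _).aemeasurable (by simp [Real.exp_pos]) (by simp)).trans ?_)
  rw [ENNReal.div_le_iff (by simp [Real.exp_pos]) (by simp), mul_assoc,
    ← ENNReal.ofReal_mul (Real.exp_pos _).le, ← Real.exp_add]
  simpa using lintegral_potential_le hθ h1 h2 h3 t ht

/-- In every step a given label is spared with probability `1 - 1 / n`. -/
theorem augLaw_unborn_le [NeZero n] [IsProbabilityMeasure π] (i : Fin n) (t : ℕ) :
    augLaw α β p lo hi π t {a | a.2.2.1 i = 0} ≤ ENNReal.ofReal (Real.exp (-(t / n : ℝ))) := by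
  have hn : (0 : ℝ) < n := by exact_mod_cast Nat.pos_of_ne_zero (NeZero.ne n)
  have hn0 : (n : ENNReal) ≠ 0 := by exact_mod_cast NeZero.ne n
  have hm : MeasurableSet {a : Aug n m | a.2.2.1 i = 0} :=
    measurableSet_eq_fun (by fun_prop) measurable_const
  have := isProbabilityMeasure_augLaw (α := α) (β := β) (p := p) (lo := lo) (hi := hi) (π := π)
  induction t with
  | zero => simpa using prob_le_one
  | succ t ih =>
    rw [← lintegral_indicator_one hm, lintegral_augLaw_succ t (measurable_one.indicator hm)]
    have h1 : ∀ a : Aug n m, ∫⁻ ξ, ({a : Aug n m | a.2.2.1 i = 0}.indicator 1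
        (augStep α β lo hi (a, ξ)) : ENNReal) ∂(innovationLaw n m p) ≤
        ENNReal.ofReal (1 - 1 / n) * {a : Aug n m | a.2.2.1 i = 0}.indicator 1 a := by
      intro a
      by_cases ha : a.2.2.1 i = 0
      · have h2 : ∀ ξ : Innovation n m, ({a : Aug n m | a.2.2.1 i = 0}.indicator 1
            (augStep α β lo hi (a, ξ)) : ENNReal) ≤ (fun u _ => if u = i then 0 else 1) ξ.1 ξ.2.1 := by
          intro ξ
          by_cases hu : ξ.1 = i
          · rw [Set.indicator_of_notMem]
            · simp
            · simp [augStep, hu]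
          · change _ ≤ (if ξ.1 = i then (0 : ENNReal) else 1)
            rw [if_neg hu]; exact Set.indicator_apply_le' (fun _ => le_rfl) fun _ => zero_le
        refine (lintegral_mono h2).trans ?_
        rw [lintegral_innovationLaw_ranks p fun u _ => if u = i then 0 else 1]
        have e1 : (∑ u : Fin n, ∑ _R : Fin n, if u = i then (0 : ENNReal) else 1) =
            ENNReal.ofReal ((n - 1) * n) := by
          have : ∀ u, (∑ _R : Fin n, if u = i then (0 : ENNReal) else 1) =
            ENNReal.ofReal (n - if u = i then (n : ℝ) else 0) := by
            intro u; split_ifs <;> simp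
          simp_rw [this]
          rw [← ENNReal.ofReal_sum_of_nonneg]
          · congr 1; simp; ring
          · intro u _; split_ifs <;> simp
        have e2 : ((n : ENNReal)⁻¹) ^ 2 = ENNReal.ofReal (((n : ℝ) ^ 2)⁻¹) := by
          rw [ENNReal.ofReal_inv_of_pos (by positivity), ENNReal.ofReal_pow hn.le,
            ENNReal.ofReal_natCast, ENNReal.inv_pow]
        rw [e1, e2, ← ENNReal.ofReal_mul (by positivity), Set.indicator_of_mem (by exact ha)]
        simp only [Pi.one_apply, mul_one]
        apply ENNReal.ofReal_le_ofReal
        apply le_of_eq; field_simp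
      · have h2 : ∀ ξ : Innovation n m, ({a : Aug n m | a.2.2.1 i = 0}.indicator 1
            (augStep α β lo hi (a, ξ)) : ENNReal) = 0 := by
          intro ξ
          apply Set.indicator_of_notMem
          simp only [Set.mem_ofPred_eq, augStep]
          by_cases hu : i = ξ.1
          · rw [← hu]; simp
          · rw [Function.update_of_ne hu]; exact ha
        simp_rw [h2]
        simp
    refine (lintegral_mono h1).trans ?_
    rw [lintegral_const_mul _ (measurable_one.indicator hm), lintegral_indicator_one hm]
    refine (mul_le_mul' le_rfl ih).trans ?_
    rw [← ENNReal.ofReal_mul' (Real.exp_pos _).le]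
    apply ENNReal.ofReal_le_ofReal
    have h3 := Real.add_one_le_exp (-(1 / n : ℝ))
    calc (1 - 1 / n : ℝ) * Real.exp (-(t / n : ℝ)) ≤ Real.exp (-(1 / n : ℝ)) *
          Real.exp (-(t / n : ℝ)) := by gcongr; linarith
      _ = _ := by rw [← Real.exp_add]; congr 1; push_cast; ring

theorem augLaw_flag_le [NeZero n] [IsProbabilityMeasure π] (e : ENNReal) (T : ℕ)
    (h : ∀ t ≤ T, augLaw α β p lo hi π t {a | ∃ i, 0 < a.2.2.1 i ∧
      ¬(lo (a.2.1 i).1 ≤ (a.1.2.1 i : ℝ) + 1 ∧ (a.1.2.1 i : ℝ) + 1 ≤ hi (a.2.1 i).1)} ≤ e)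
    (t : ℕ) (ht : t ≤ T) : augLaw α β p lo hi π t {a | a.2.2.2.1 = true} ≤ t * e := by
  have hm : MeasurableSet {a : Aug n m | a.2.2.2.1 = true} :=
    measurableSet_eq_fun (by fun_prop) measurable_const
  have hv : Measurable fun a : Aug n m =>
      violation lo hi (a.1.2.1, (fun i => (a.2.1 i).1), a.2.2.1) :=
    (Measurable.of_discrete (f := violation lo hi)).comp (by fun_prop)
  have hmv : MeasurableSet {a : Aug n m |
      violation lo hi (a.1.2.1, (fun i => (a.2.1 i).1), a.2.2.1) = true} :=
    measurableSet_eq_fun hv measurable_const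
  have hve : {a : Aug n m | violation lo hi (a.1.2.1, (fun i => (a.2.1 i).1), a.2.2.1) = true} =
      {a | ∃ i, 0 < a.2.2.1 i ∧
      ¬(lo (a.2.1 i).1 ≤ (a.1.2.1 i : ℝ) + 1 ∧ (a.1.2.1 i : ℝ) + 1 ≤ hi (a.2.1 i).1)} := by
    ext a; simp [violation]
  induction t with
  | zero =>
    rw [augLaw, Function.iterate_zero, id_eq, Measure.map_apply measurable_augInit hm]
    simp
  | succ t ih =>
    -- A flag that is set without a present violation was set before; so each time contributes at
    -- most `e`.
    have hor : augLaw α β p lo hi π (t + 1) ({a | a.2.2.2.1 = true} ∩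
        {a | violation lo hi (a.1.2.1, (fun i => (a.2.1 i).1), a.2.2.1) = true}ᶜ) ≤
        augLaw α β p lo hi π t {a | a.2.2.2.1 = true} := by
      rw [← lintegral_indicator_one (hm.inter hmv.compl), lintegral_augLaw_succ t
        (measurable_one.indicator (hm.inter hmv.compl)), ← lintegral_indicator_one hm]
      refine lintegral_mono fun a => ?_
      by_cases ha : a.2.2.2.1 = true
      · rw [Set.indicator_of_mem (by exact ha)]
        refine (lintegral_mono (g := fun _ => 1) fun ξ => ?_).trans (by simp)
        exact Set.indicator_apply_le' (fun _ => le_rfl) fun _ => zero_le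
      · rw [Set.indicator_of_notMem (by exact ha)]
        refine le_of_eq ?_
        rw [← lintegral_zero (μ := innovationLaw n m p)]
        refine lintegral_congr fun ξ => Set.indicator_of_notMem ?_ _
        rintro ⟨h1, h2⟩
        simp only [Bool.not_eq_true] at ha
        simp only [Set.mem_ofPred_eq, augStep, ha, Bool.false_or] at h1
        exact h2 h1
    calc augLaw α β p lo hi π (t + 1) {a | a.2.2.2.1 = true}
        ≤ augLaw α β p lo hi π (t + 1) ({a | a.2.2.2.1 = true} ∩
          {a | violation lo hi (a.1.2.1, (fun i => (a.2.1 i).1), a.2.2.1) = true}ᶜ) +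
          augLaw α β p lo hi π (t + 1)
            {a | violation lo hi (a.1.2.1, (fun i => (a.2.1 i).1), a.2.2.1) = true} := by
          refine (measure_mono ?_).trans (measure_union_le _ _)
          intro a ha
          by_cases h' : violation lo hi (a.1.2.1, (fun i => (a.2.1 i).1), a.2.2.1) = true
          · exact Or.inr h'
          · exact Or.inl ⟨ha, h'⟩
      _ ≤ t * e + e := by
          refine add_le_add (hor.trans (ih (by omega))) ?_
          rw [hve]
          exact h _ ht
      _ = _ := by push_cast; ring

end Potential


/-! ### Concentration of ranks and reduction to independent marks. -/

/-- Ranks below this bound are not concentrated. -/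
noncomputable def rankCutoff (n : ℕ) : ℝ := Real.log n ^ 5

/-- A lower bound for the rank of a node with initial rank `R + 1`. -/
noncomputable def lowRank (n : ℕ) (R : Fin n) : ℝ :=
  if rankCutoff n ≤ (R : ℝ) + 1 then ((R : ℝ) + 1) / 8 else 1

/-- An upper bound for the rank of a node with initial rank `R + 1`. -/
noncomputable def hiRank (n : ℕ) (R : Fin n) : ℝ :=
  min n (8 * max ((R : ℝ) + 1) (rankCutoff n))

theorem lowRank_pos {n : ℕ} (R : Fin n) : 0 < lowRank n R := by
  unfold lowRank; split_ifs <;> positivity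

instance instDiscreteMeasurableSpaceSimpleGraph (n : ℕ) :
    DiscreteMeasurableSpace (SimpleGraph (Fin n)) := by
  have : MeasurableSingletonClass (SimpleGraph (Fin n)) := by
    refine ⟨fun G => ?_⟩
    have : ({G} : Set (SimpleGraph (Fin n))) = ⋂ i, ⋂ j, {H | H.Adj i j ↔ G.Adj i j} := by
      ext H
      simp only [Set.mem_singleton_iff, Set.mem_iInter, Set.mem_ofPred_eq]
      refine ⟨fun h i j => by rw [h], fun h => SimpleGraph.ext ?_⟩
      funext i j
      exact propext (h i j)
    rw [this]
    refine MeasurableSet.iInter fun i => MeasurableSet.iInter fun j => ?_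
    have h1 : MeasurableSet {H : SimpleGraph (Fin n) | H.Adj i j} :=
      measurableSet_setOfPred.2 (by fun_prop)
    by_cases h : G.Adj i j
    · simp only [h, iff_true]; exact h1
    · simp only [h, iff_false]; exact h1.compl
  infer_instance

theorem eventually_log_ge (A : ℝ) : ∃ N : ℕ, ∀ n ≥ N, A ≤ Real.log n := by
  have h := (Real.tendsto_log_atTop.comp tendsto_natCast_atTop_atTop).eventually_ge_atTop A
  exact Filter.eventually_atTop.1 h

section Reduction

variable {n m : ℕ} {α β : ℝ} {p : unitInterval} {π : Measure (State n m)}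

/-- The potential is used twice, with a positive parameter against large ranks and a negative one
against small ranks. The horizon of order `n log² n` forces the parameter down to order `1 / log²
n`. With the cutoff `log⁵ n` the exponent is still of order `log³ n`, more than the needed `log² n`.
-/
theorem augLaw_violation_le [NeZero n] [IsProbabilityMeasure π] (hℓ : 1 ≤ Real.log n) {T : ℕ}
    (hT : (T : ℝ) ≤ 3 * (n * Real.log n ^ 2)) (t : ℕ) (ht : t ≤ T) :
    augLaw α β p (lowRank n) (hiRank n) π t {a | ∃ i, 0 < a.2.2.1 i ∧
      ¬(lowRank n (a.2.1 i).1 ≤ (a.1.2.1 i : ℝ) + 1 ∧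
        (a.1.2.1 i : ℝ) + 1 ≤ hiRank n (a.2.1 i).1)} ≤
      T * ENNReal.ofReal (2 * Real.exp (3 / 2 - Real.log n ^ 3 / 128)) := by
  set ℓ := Real.log n with hℓdef
  have hn : (0 : ℝ) < n := by exact_mod_cast Nat.pos_of_ne_zero (NeZero.ne n)
  -- So small that the variance terms accumulated over `T ≤ 3 n ℓ²` steps change the parameter by at
  -- most `η / 2`.
  set η : ℝ := 1 / (48 * ℓ ^ 2) with hη
  have hη0 : 0 < η := by positivity
  have hη1 : η ≤ 1 / 48 := by
    rw [hη]; apply one_div_le_one_div_of_le (by norm_num); nlinarith [one_le_pow₀ (n := 2) hℓ]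
  have hηT : 8 * η ^ 2 * T / n ≤ η / 2 := by
    rw [div_le_iff₀ hn]
    have : 8 * η * T ≤ n / 2 := by
      calc 8 * η * T ≤ 8 * η * (3 * (n * ℓ ^ 2)) := by gcongr
        _ = n / 2 := by rw [hη]; field_simp; norm_num
    nlinarith
  have hηL : η * rankCutoff n = ℓ ^ 3 / 48 := by
    rw [hη, rankCutoff, ← hℓdef]; field_simp
  -- Decreases per step by `8 η² / n = 2 (2 η)² / n`, the largest variance term while the parameter
  -- is at most `2 η` in absolute value.
  set d : ℕ → ℝ := fun t => 8 * η ^ 2 * ((T : ℝ) - t) / n with hd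
  have hdrop : ∀ t : ℕ, d t - d (t + 1) = 8 * η ^ 2 / n := by
    intro t; simp only [hd]; push_cast; ring
  have hd0 : ∀ t : ℕ, t ≤ T → 0 ≤ d t := by
    intro t ht
    have : (t : ℝ) ≤ T := by exact_mod_cast ht
    have : (0 : ℝ) ≤ T - t := by linarith
    positivity
  have hd1 : ∀ t : ℕ, d t ≤ η / 2 := by
    intro t
    refine le_trans ?_ hηT
    simp only [hd]
    gcongr
    have : (0 : ℝ) ≤ t := by positivity
    linarith
  have hdt : ∀ t : ℕ, t ≤ T → 4 * η * t / n ≤ 1 / 4 := by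
    intro t ht
    have : (t : ℝ) ≤ 3 * (n * ℓ ^ 2) := le_trans (by exact_mod_cast ht) hT
    rw [div_le_iff₀ hn]
    calc 4 * η * t ≤ 4 * η * (3 * (n * ℓ ^ 2)) := by gcongr
      _ = 1 / 4 * n := by rw [hη]; field_simp; norm_num
  have hsq : ∀ x : ℝ, 0 ≤ x → x ≤ 2 * η → 2 * x ^ 2 / n ≤ 8 * η ^ 2 / n := by
    intro x hx hx2
    apply div_le_div_of_nonneg_right _ hn.le
    nlinarith
  -- Upper tail: the parameter lies between `η` and `2 η` throughout, and the total drift costs at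
  -- most `1 / 4`.
  have hup := augLaw_exists_rank_le (α := α) (β := β) (p := p) (lo := lowRank n) (hi := hiRank n)
    (π := π) (θ := fun t => η + d t) (c := fun t => -(4 * η * t / n))
    (ψ := fun R => -(2 * η * R)) (T := T)
    (by
      intro t ht
      have := hd0 (t + 1) ht; have := hd1 (t + 1)
      rw [abs_le]; constructor <;> linarith)
    (by
      intro t ht
      have := hsq (η + d (t + 1)) (by linarith [hd0 (t + 1) ht]) (by linarith [hd1 (t + 1)])
      have := hdrop t
      linarith)
    (by
      intro t ht
      rw [max_eq_left (by linarith [hd0 (t + 1) ht])]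
      have : 2 * (η + d (t + 1)) / n ≤ 2 * (2 * η) / n := by
        gcongr; linarith [hd1 (t + 1)]
      have e : (4 * η * ((t + 1 : ℕ) : ℝ) / n) = 4 * η * t / n + 2 * (2 * η) / n := by
        push_cast; ring
      rw [e]
      linarith)
    (by
      intro t ht R
      have h0 : (0 : ℝ) ≤ (R : ℕ) := by positivity
      have h1 : (0 : ℝ) ≤ 4 * η * ((t + 1 : ℕ) : ℝ) / n := by positivity
      have := mul_le_mul_of_nonneg_right (show η + d (t + 1) ≤ 2 * η by linarith [hd1 (t + 1)]) h0
      linarith)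
    t ht (ℓ ^ 3 / 128 - 3 / 2)
  -- Lower tail: the parameter lies between `-η` and `-η / 2`. Drift costs nothing for negative
  -- parameters, so `c = 0`.
  have hdown := augLaw_exists_rank_le (α := α) (β := β) (p := p) (lo := lowRank n)
    (hi := hiRank n) (π := π) (θ := fun t => -(η - d t)) (c := fun _ => 0)
    (ψ := fun R => -(-(η / 2) * R)) (T := T)
    (by
      intro t ht
      have := hd0 (t + 1) ht; have := hd1 (t + 1)
      rw [abs_le]; constructor <;> linarith)
    (by
      intro t ht
      have := hsq (η - d (t + 1)) (by linarith [hd1 (t + 1)]) (by linarith [hd0 (t + 1) ht])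
      have := hdrop t
      simp only [neg_sq]
      linarith)
    (by
      intro t ht
      rw [max_eq_right (by linarith [hd1 (t + 1)])]
      simp)
    (by
      intro t ht R
      have h0 : (0 : ℝ) ≤ (R : ℕ) := by positivity
      have := mul_le_mul_of_nonneg_right (show η / 2 ≤ η - d (t + 1) by linarith [hd1 (t + 1)]) h0
      linarith)
    t ht (ℓ ^ 3 / 128 - 3 / 2)
  have hsub : {a : Aug n m | ∃ i, 0 < a.2.2.1 i ∧
      ¬(lowRank n (a.2.1 i).1 ≤ (a.1.2.1 i : ℝ) + 1 ∧
        (a.1.2.1 i : ℝ) + 1 ≤ hiRank n (a.2.1 i).1)} ⊆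
      {a | ∃ i, 0 < a.2.2.1 i ∧ ℓ ^ 3 / 128 - 3 / 2 ≤ (η + d t) * a.1.2.1 i +
        -(2 * η * (a.2.1 i).1) + -(4 * η * t / n)} ∪
      {a | ∃ i, 0 < a.2.2.1 i ∧ ℓ ^ 3 / 128 - 3 / 2 ≤ -(η - d t) * a.1.2.1 i +
        -(-(η / 2) * (a.2.1 i).1) + 0} := by
    rintro a ⟨i, hi, hv⟩
    have hσ0 : (0 : ℝ) ≤ (a.1.2.1 i : ℕ) := by positivity
    have hR0 : (0 : ℝ) ≤ ((a.2.1 i).1 : ℕ) := by positivity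
    have hℓ3 : 0 ≤ ℓ ^ 3 := by positivity
    have hdt' := hdt t ht
    have hd0' := hd0 t ht
    by_cases hlow : lowRank n (a.2.1 i).1 ≤ (a.1.2.1 i : ℝ) + 1
    · left
      refine ⟨i, hi, ?_⟩
      have hhi : hiRank n (a.2.1 i).1 < (a.1.2.1 i : ℝ) + 1 := not_le.1 fun h => hv ⟨hlow, h⟩
      rw [hiRank, min_lt_iff] at hhi
      rcases hhi with h | h
      · have : ((a.1.2.1 i : ℕ) : ℝ) + 1 ≤ n := by exact_mod_cast (a.1.2.1 i).2
        linarith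
      · have h1 := mul_le_mul_of_nonneg_left (le_max_left (((a.2.1 i).1 : ℝ) + 1) (rankCutoff n))
          hη0.le
        have h2 := mul_le_mul_of_nonneg_left (le_max_right (((a.2.1 i).1 : ℝ) + 1) (rankCutoff n))
          hη0.le
        have h3 := mul_le_mul_of_nonneg_left h.le hη0.le
        have h4 := mul_nonneg hd0' hσ0
        rw [hηL] at h2
        nlinarith
    · right
      refine ⟨i, hi, ?_⟩
      rw [lowRank] at hlow
      split_ifs at hlow with hc
      -- The tighter of the two cases: `η (1 / 2 - 1 / 8)` times the cutoff is `3 / 8 * ℓ³ / 48 = ℓ³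
      -- / 128`.
      · have h1 := mul_le_mul_of_nonneg_left hc hη0.le
        rw [hηL] at h1
        have h2 := mul_le_mul_of_nonneg_left (not_le.1 hlow).le hη0.le
        have h4 := mul_nonneg hd0' hσ0
        nlinarith
      · exact absurd (by linarith) hlow
  refine (measure_mono hsub).trans ((measure_union_le _ _).trans ((add_le_add hup hdown).trans ?_))
  rw [← two_mul, neg_sub, ENNReal.ofReal_mul (by norm_num)]
  have : (t : ENNReal) ≤ T := by exact_mod_cast ht
  calc 2 * ((t : ENNReal) * ENNReal.ofReal (Real.exp (3 / 2 - ℓ ^ 3 / 128)))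
      ≤ 2 * ((T : ENNReal) * ENNReal.ofReal (Real.exp (3 / 2 - ℓ ^ 3 / 128))) := by gcongr
    _ = _ := by
      rw [show ENNReal.ofReal 2 = 2 by simp]
      ring

theorem stationary_le_of_compatible [NeZero n] (hα : 0 ≤ α) (hℓ : 1 ≤ Real.log n)
    (hπ : IsStationary α β p π) {T : ℕ} (hT : (T : ℝ) ≤ 3 * (n * Real.log n ^ 2))
    (Bad : Set (SimpleGraph (Fin n))) (δ : ENNReal)
    (hbad : ∀ b : Fin n → ℕ, Function.Injective b →
      (Measure.pi fun _ => markLaw n m p)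
        {M | ∃ G ∈ Bad, Compatible α β (lowRank n) (hiRank n) b M G} ≤ δ) :
    π {s | s.2.2 ∈ Bad} ≤ δ + n * ENNReal.ofReal (Real.exp (-(T / n : ℝ))) +
      T * (T * ENNReal.ofReal (2 * Real.exp (3 / 2 - Real.log n ^ 3 / 128))) := by
  have := hπ.1
  set lo := lowRank n
  set hi := hiRank n
  set μ := Measure.pi fun _ : Fin n => markLaw n m p with hμ
  set P := augLaw α β p lo hi π T with hP
  set E : (Fin n → ℕ) → Set (Fin n → Mark n m) := fun b =>
    {M | Function.Injective b ∧ ∃ G ∈ Bad, Compatible α β lo hi b M G} with hE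
  have hEδ : ∀ b, μ (E b) ≤ δ := by
    intro b
    by_cases hb : Function.Injective b
    · refine (measure_mono ?_).trans (hbad b hb)
      exact fun M hM => hM.2
    · have : E b = ∅ := by ext M; simp [hE, hb]
      rw [this]; simp
  -- The sets `E b` are replaced by measurable hulls, so that the product structure of marks and
  -- birth times can be used without their measurability.
  set Eh : Set ((Fin n → Mark n m) × (Fin n → ℕ) × ℕ) :=
    {z | z.1 ∈ toMeasurable μ (E z.2.1)} with hEh
  have hEhm : MeasurableSet Eh := by
    have : Eh = ⋃ b, (Prod.fst ⁻¹' toMeasurable μ (E b)) ∩ {z | z.2.1 = b} := by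
      ext z; simp [hEh]
    rw [this]
    exact MeasurableSet.iUnion fun b => (measurable_fst (measurableSet_toMeasurable _ _)).inter
      (measurableSet_eq_fun (by fun_prop) measurable_const)
  have hproj : Measurable fun a : Aug n m => (a.2.1, (a.2.2.1, a.2.2.2.2)) := by fun_prop
  have h1 : P ((fun a : Aug n m => (a.2.1, (a.2.2.1, a.2.2.2.2))) ⁻¹' Eh) ≤ δ := by
    obtain ⟨q, hq, e⟩ := map_marks_augLaw (α := α) (β := β) (p := p) (lo := lo) (hi := hi)
      (π := π) T
    rw [← Measure.map_apply hproj hEhm, hP, e, Measure.prod_apply_symm hEhm]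
    calc _ ≤ ∫⁻ _, δ ∂q := lintegral_mono fun z => by
          change μ (toMeasurable μ (E z.1)) ≤ δ
          rw [measure_toMeasurable]
          exact hEδ z.1
      _ = δ := by simp
  have h2 : P {a | ∃ i, a.2.2.1 i = 0} ≤ n * ENNReal.ofReal (Real.exp (-(T / n : ℝ))) := by
    have : {a : Aug n m | ∃ i, a.2.2.1 i = 0} = ⋃ i, {a | a.2.2.1 i = 0} := by ext; simp
    rw [this]
    refine (measure_iUnion_fintype_le _ _).trans ((Finset.sum_le_sum fun i _ =>
      augLaw_unborn_le i T).trans ?_)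
    simp
  have h3 : P {a | a.2.2.2.1 = true} ≤
      T * (T * ENNReal.ofReal (2 * Real.exp (3 / 2 - Real.log n ^ 3 / 128))) :=
    augLaw_flag_le _ T (fun t ht => augLaw_violation_le hℓ hT t ht) T le_rfl
  have hBadm : MeasurableSet {a : Aug n m | a.1.2.2 ∈ Bad} :=
    (show Measurable fun a : Aug n m => a.1.2.2 by fun_prop) (MeasurableSet.of_discrete (s := Bad))
  have hBad : π {s | s.2.2 ∈ Bad} = P {a | a.1.2.2 ∈ Bad} := by
    conv_lhs => rw [← map_fst_augLaw (lo := lo) (hi := hi) hπ T]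
    rw [Measure.map_apply measurable_fst]
    · rfl
    · exact (show Measurable fun s : State n m => s.2.2 by fun_prop)
        (MeasurableSet.of_discrete (s := Bad))
  set U : Set (Aug n m) := ((fun a : Aug n m => (a.2.1, (a.2.2.1, a.2.2.2.2))) ⁻¹' Eh) ∪
    {a | ∃ i, a.2.2.1 i = 0} ∪ {a | a.2.2.2.1 = true} with hU
  have hUm : MeasurableSet U := by
    refine ((hproj hEhm).union ?_).union (measurableSet_eq_fun (by fun_prop) measurable_const)
    have : {a : Aug n m | ∃ i, a.2.2.1 i = 0} = ⋃ i, {a | a.2.2.1 i = 0} := by ext; simp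
    rw [this]
    exact MeasurableSet.iUnion fun i => measurableSet_eq_fun (by fun_prop) measurable_const
  -- The invariants hold on every trajectory, so the set of innovations in question is empty.
  have h4 : P ({a | a.1.2.2 ∈ Bad} \ U) = 0 := by
    have hm := hBadm.diff hUm
    rw [hP, augLaw, iterate_map_prod (measurable_augStep α β lo hi),
      Measure.map_apply (measurable_iterState (measurable_augStep α β lo hi) T) hm,
      Measure.prod_apply (measurable_iterState (measurable_augStep α β lo hi) T hm),
      lintegral_map (measurable_measure_prodMk_left
        (measurable_iterState (measurable_augStep α β lo hi) T hm)) measurable_augInit]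
    have hempty : ∀ q : State n m × (Fin n → Mark n m), (Prod.mk
        ((q.1, q.2, (fun _ => 0), false, 0) : Aug n m) ⁻¹'
        ((fun q : Aug n m × (Fin T → Innovation n m) =>
          iterState (augStep α β lo hi) T q.1 q.2) ⁻¹' ({a | a.1.2.2 ∈ Bad} \ U))) = ∅ := by
      intro q
      rw [Set.eq_empty_iff_forall_notMem]
      rintro ω ⟨hω1, hω2⟩
      have hinv : AugInv α β lo hi (iterState (augStep α β lo hi) T
          ((q.1, q.2, (fun _ => 0), false, 0) : Aug n m) ω) :=
        (augInv_init (α := α) (β := β) (lo := lo) (hi := hi) q.1 q.2).iterState hα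
          (fun R => lowRank_pos R) T ω
      set a := iterState (augStep α β lo hi) T
          ((q.1, q.2, (fun _ => 0), false, 0) : Aug n m) ω with ha
      simp only [hU, Set.mem_union, not_or] at hω2
      obtain ⟨⟨hu1, hu2⟩, hu3⟩ := hω2
      have hb : ∀ i, 0 < a.2.2.1 i := fun i => Nat.pos_of_ne_zero fun h => hu2 ⟨i, h⟩
      refine hu1 (subset_toMeasurable μ _ ⟨fun i j hij => hinv.inj i j (hb i) hij,
        a.1.2.2, hω1, fun i j hij => ?_⟩)
      exact hinv.adj (by simpa using hu3) i j (hb i) hij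
    simp only [hempty, measure_empty, lintegral_zero]
  rw [hBad]
  calc P {a | a.1.2.2 ∈ Bad} ≤ P ({a | a.1.2.2 ∈ Bad} \ U) + P U := by
        refine (measure_mono ?_).trans (measure_union_le _ _)
        rw [Set.sdiff_union_self]; exact Set.subset_union_left
    _ ≤ 0 + (δ + n * ENNReal.ofReal (Real.exp (-(T / n : ℝ))) +
      T * (T * ENNReal.ofReal (2 * Real.exp (3 / 2 - Real.log n ^ 3 / 128)))) := by
        refine add_le_add h4.le ((measure_union_le _ _).trans (add_le_add ?_ h3))
        exact (measure_union_le _ _).trans (add_le_add h1 h2)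
    _ = _ := zero_add _

/-- Properties of the stationary graph follow from properties of the graphs that are compatible with
independent marks. -/
theorem exists_stationary_le (hα : 0 ≤ α) : ∃ N : ℕ, ∀ n ≥ N, ∀ (m : ℕ) (p : unitInterval)
    (π : Measure (State n m)), IsStationary α β p π → ∀ (Bad : Set (SimpleGraph (Fin n)))
    (δ : ENNReal), (∀ b : Fin n → ℕ, Function.Injective b →
      (Measure.pi fun _ => markLaw n m p)
        {M | ∃ G ∈ Bad, Compatible α β (lowRank n) (hiRank n) b M G} ≤ δ) →
    π {s | s.2.2 ∈ Bad} ≤ δ + ENNReal.ofReal (Real.exp (-Real.log n ^ 2)) := by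
  obtain ⟨N, hN⟩ := eventually_log_ge 200
  refine ⟨max N 1, fun n hn m p π hπ Bad δ hbad => ?_⟩
  have hℓ := hN n (le_of_max_le_left hn)
  have hn1 : 1 ≤ n := le_of_max_le_right hn
  have : NeZero n := ⟨by omega⟩
  set ℓ := Real.log n with hℓdef
  have hn0 : (0 : ℝ) < n := by exact_mod_cast hn1
  have hnexp : (n : ℝ) = Real.exp ℓ := (Real.exp_log hn0).symm
  have hn1' : (1 : ℝ) ≤ n := by exact_mod_cast hn1
  -- After this time a label is unborn with probability at most `exp (-2 ℓ²)`, which survives the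
  -- union bound over `n` labels.
  set T := ⌈2 * (n * ℓ ^ 2)⌉₊ with hTdef
  have hT1 : 2 * (n * ℓ ^ 2) ≤ T := Nat.le_ceil _
  have hT2 : (T : ℝ) ≤ 3 * (n * ℓ ^ 2) := by
    have := Nat.ceil_lt_add_one (show 0 ≤ 2 * (n * ℓ ^ 2) by positivity)
    have h1 : 1 ≤ n * ℓ ^ 2 := by nlinarith
    linarith
  refine (stationary_le_of_compatible hα (by linarith) hπ hT2 Bad δ hbad).trans ?_
  rw [add_assoc]
  gcongr
  have e1 : (n : ENNReal) * ENNReal.ofReal (Real.exp (-(T / n : ℝ))) =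
      ENNReal.ofReal (n * Real.exp (-(T / n : ℝ))) := by
    rw [ENNReal.ofReal_mul hn0.le, ENNReal.ofReal_natCast]
  have e2 : (T : ENNReal) * (T * ENNReal.ofReal (2 * Real.exp (3 / 2 - ℓ ^ 3 / 128))) =
      ENNReal.ofReal (T * (T * (2 * Real.exp (3 / 2 - ℓ ^ 3 / 128)))) := by
    rw [ENNReal.ofReal_mul (p := (T : ℝ)) (by positivity),
      ENNReal.ofReal_mul (p := (T : ℝ)) (by positivity), ENNReal.ofReal_natCast]
  rw [e1, e2, ← ENNReal.ofReal_add (by positivity) (by positivity)]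
  apply ENNReal.ofReal_le_ofReal
  have hhalf : Real.exp (-1) ≤ 1 / 2 := by
    rw [Real.exp_neg, inv_eq_one_div]
    apply one_div_le_one_div_of_le (by norm_num)
    have := Real.add_one_le_exp 1; linarith
  have hsplit : ∀ x : ℝ, x ≤ -ℓ ^ 2 - 1 → Real.exp x ≤ Real.exp (-ℓ ^ 2) / 2 := by
    intro x hx
    calc Real.exp x ≤ Real.exp (-ℓ ^ 2 + -1) := Real.exp_le_exp.2 (by linarith)
      _ = Real.exp (-ℓ ^ 2) * Real.exp (-1) := Real.exp_add _ _
      _ ≤ Real.exp (-ℓ ^ 2) * (1 / 2) := by gcongr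
      _ = _ := by ring
  have hA : n * Real.exp (-(T / n : ℝ)) ≤ Real.exp (-ℓ ^ 2) / 2 := by
    have h1 : 2 * ℓ ^ 2 ≤ T / n := by
      rw [le_div_iff₀ hn0]; linarith
    calc n * Real.exp (-(T / n : ℝ)) ≤ Real.exp ℓ * Real.exp (-(2 * ℓ ^ 2)) := by
          rw [← hnexp]; gcongr
      _ = Real.exp (ℓ + -(2 * ℓ ^ 2)) := (Real.exp_add _ _).symm
      _ ≤ _ := hsplit _ (by nlinarith)
  have hB : T * (T * (2 * Real.exp (3 / 2 - ℓ ^ 3 / 128))) ≤ Real.exp (-ℓ ^ 2) / 2 := by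
    have hℓe : ℓ ≤ Real.exp ℓ := by have := Real.add_one_le_exp ℓ; linarith
    have h3e : (3 : ℝ) ≤ Real.exp 2 := by have := Real.add_one_le_exp 2; linarith
    have h2e : (2 : ℝ) ≤ Real.exp 1 := by have := Real.add_one_le_exp 1; linarith
    have hTe : (T : ℝ) ≤ Real.exp (2 + 3 * ℓ) := by
      calc (T : ℝ) ≤ 3 * (n * ℓ ^ 2) := hT2
        _ ≤ Real.exp 2 * (Real.exp ℓ * Real.exp ℓ ^ 2) := by
            rw [← hnexp]
            gcongr
            rw [hnexp]; exact hℓe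
        _ = _ := by
            rw [← Real.exp_nat_mul, ← Real.exp_add, ← Real.exp_add]
            congr 1; push_cast; ring
    calc T * (T * (2 * Real.exp (3 / 2 - ℓ ^ 3 / 128)))
        ≤ Real.exp (2 + 3 * ℓ) * (Real.exp (2 + 3 * ℓ) * (Real.exp 1 *
          Real.exp (3 / 2 - ℓ ^ 3 / 128))) := by gcongr
      _ = Real.exp (2 + 3 * ℓ + (2 + 3 * ℓ + (1 + (3 / 2 - ℓ ^ 3 / 128)))) := by
          simp only [Real.exp_add]
      _ ≤ _ := hsplit _ (by nlinarith [mul_nonneg (sq_nonneg ℓ) (by linarith : 0 ≤ ℓ - 200)])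
  linarith


end Reduction


/-! ### Nets, chains and volumes in the torus. -/

section TorusTools

theorem unitAddCircle_norm_coe_le (t : ℝ) : ‖(t : UnitAddCircle)‖ ≤ |t| := by
  rw [UnitAddCircle.norm_eq]
  simpa using round_le t 0

theorem unitAddCircle_norm_le_half (x : UnitAddCircle) : ‖x‖ ≤ 1 / 2 := by
  simpa using AddCircle.norm_le_half_period 1 (x := x) one_ne_zero

/-- Every point of the circle has a representative that realizes its norm. -/
theorem unitAddCircle_exists_coe (x : UnitAddCircle) : ∃ t : ℝ, (t : UnitAddCircle) = x ∧
    |t| = ‖x‖ := by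
  obtain ⟨t, rfl⟩ := QuotientAddGroup.mk_surjective x
  refine ⟨t - round t, ?_, (UnitAddCircle.norm_eq (x := t)).symm⟩
  have h : ((round t : ℝ) : UnitAddCircle) = 0 := by
    rw [AddCircle.coe_eq_zero_iff]; exact ⟨round t, by simp⟩
  change ((t - round t : ℝ) : UnitAddCircle) = (t : UnitAddCircle)
  rw [AddCircle.coe_sub, h, sub_zero]

/-- The net is the grid with `⌈1 / ρ⌉` points per coordinate; the factor `2` pays for rounding up.
-/
theorem torus_exists_net (m : ℕ) {ρ : ℝ} (h0 : 0 < ρ) (h1 : ρ ≤ 1) :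
    ∃ F : Finset (UnitAddTorus (Fin m)), (F.card : ℝ) ≤ (2 / ρ) ^ m ∧
      ∀ x, ∃ g ∈ F, dist x g ≤ ρ := by
  classical
  set L := ⌈1 / ρ⌉₊ with hL
  have hL1 : 1 / ρ ≤ L := Nat.le_ceil _
  have hLpos : 0 < L := Nat.ceil_pos.2 (by positivity)
  have hLr : (0 : ℝ) < L := by exact_mod_cast hLpos
  have hL2 : (L : ℝ) ≤ 2 / ρ := by
    have := Nat.ceil_lt_add_one (show 0 ≤ 1 / ρ by positivity)
    have h2 : 1 ≤ 1 / ρ := by rw [le_div_iff₀ h0]; linarith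
    have : (2 : ℝ) / ρ = 1 / ρ + 1 / ρ := by ring
    linarith
  set e : (Fin m → Fin L) → UnitAddTorus (Fin m) := fun k i => (((k i : ℕ) / L : ℝ) : UnitAddCircle)
  have hc : ∀ x : UnitAddCircle, ∃ k : Fin L, dist x (((k : ℕ) / L : ℝ) : UnitAddCircle) ≤ ρ := by
    intro x
    obtain ⟨t, rfl⟩ := QuotientAddGroup.mk_surjective x
    have hfr : ((Int.fract t : ℝ) : UnitAddCircle) = (t : UnitAddCircle) := by
      rw [← Int.self_sub_floor, AddCircle.coe_sub]
      have h : ((⌊t⌋ : ℝ) : UnitAddCircle) = 0 := by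
        rw [AddCircle.coe_eq_zero_iff]; exact ⟨⌊t⌋, by simp⟩
      rw [h, sub_zero]
    have hf0 := Int.fract_nonneg t
    have hf1 := Int.fract_lt_one t
    have hk : ⌊Int.fract t * L⌋₊ < L := by
      rw [Nat.floor_lt (by positivity)]
      nlinarith
    refine ⟨⟨_, hk⟩, ?_⟩
    change dist (t : UnitAddCircle) _ ≤ ρ
    rw [← hfr, dist_eq_norm, ← AddCircle.coe_sub]
    refine (unitAddCircle_norm_coe_le _).trans ?_
    have h2 := Nat.floor_le (show 0 ≤ Int.fract t * L by positivity)
    have h3 := Nat.lt_floor_add_one (Int.fract t * L)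
    have h4 : (⌊Int.fract t * L⌋₊ : ℝ) / L ≤ Int.fract t := by rw [div_le_iff₀ hLr]; exact h2
    have h5 : Int.fract t - (⌊Int.fract t * L⌋₊ : ℝ) / L ≤ 1 / L := by
      rw [sub_le_iff_le_add, ← add_div, le_div_iff₀ hLr]; linarith
    have h6 : 1 / (L : ℝ) ≤ ρ := by
      rw [div_le_iff₀ hLr]; rw [div_le_iff₀ h0] at hL1; linarith
    rw [abs_of_nonneg (by simpa using h4)]
    simpa using h5.trans h6
  refine ⟨Finset.univ.image e, ?_, fun x => ?_⟩
  · calc ((Finset.univ.image e).card : ℝ) ≤ (Finset.univ : Finset (Fin m → Fin L)).card := by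
          exact_mod_cast Finset.card_image_le
      _ = (L : ℝ) ^ m := by simp
      _ ≤ _ := by gcongr
  · choose k hk using fun i => hc (x i)
    exact ⟨e k, Finset.mem_image_of_mem _ (Finset.mem_univ _), (dist_pi_le_iff h0.le).2 hk⟩

/-- Points that divide a shortest path into `J` equal pieces. -/
theorem torus_exists_chain {m : ℕ} (x y : UnitAddTorus (Fin m)) {J : ℕ} (hJ : 0 < J) :
    ∃ z : ℕ → UnitAddTorus (Fin m), z 0 = x ∧ z J = y ∧
      ∀ a, dist (z a) (z (a + 1)) ≤ 1 / (2 * J) := by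
  have hJ' : (0 : ℝ) < J := by exact_mod_cast hJ
  -- Shortest displacements, at most `1 / 2` in each coordinate; `J` equal pieces have length at
  -- most `1 / (2 J)`.
  choose t ht1 ht2 using fun i => unitAddCircle_exists_coe (y i - x i)
  refine ⟨fun a i => x i + ((a * t i / J : ℝ) : UnitAddCircle), ?_, ?_, fun a => ?_⟩
  · funext i; simp
  · funext i
    change x i + ((J * t i / J : ℝ) : UnitAddCircle) = y i
    rw [mul_div_cancel_left₀ _ hJ'.ne', ht1]; abel
  · refine (dist_pi_le_iff (by positivity)).2 fun i => ?_
    rw [dist_add_left, dist_eq_norm, ← AddCircle.coe_sub]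
    refine (unitAddCircle_norm_coe_le _).trans ?_
    have : (a * t i / J - ((a + 1 : ℕ) : ℝ) * t i / J) = -(t i / J) := by push_cast; ring
    rw [this, abs_neg, abs_div, ht2, abs_of_pos hJ']
    have := unitAddCircle_norm_le_half (y i - x i)
    calc ‖y i - x i‖ / J ≤ (1 / 2) / J := by gcongr
      _ = _ := by field_simp

theorem torus_volume_closedBall {m : ℕ} (x : UnitAddTorus (Fin m)) {r : ℝ} (h0 : 0 ≤ r)
    (h1 : 2 * r ≤ 1) : (volume : Measure (UnitAddTorus (Fin m))).real (Metric.closedBall x r) =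
      (2 * r) ^ m := by
  rw [Measure.real, closedBall_pi _ h0, volume_pi_pi]
  simp only [AddCircle.volume_closedBall, Finset.prod_const, Finset.card_univ, Fintype.card_fin]
  rw [min_eq_right h1, ENNReal.toReal_pow, ENNReal.toReal_ofReal (by positivity)]

end TorusTools

/-! ### Independence of the coins from positions and ranks. -/

section Coins

variable {n m : ℕ}

theorem lintegral_pi_prod {ι : Type*} [Fintype ι] {X : ι → Type*} [∀ i, MeasurableSpace (X i)]
    (μ : ∀ i, Measure (X i)) [∀ i, IsProbabilityMeasure (μ i)] {f : ∀ i, X i → ENNReal}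
    (hf : ∀ i, Measurable (f i)) :
    ∫⁻ x, ∏ i, f i (x i) ∂(Measure.pi μ) = ∏ i, ∫⁻ y, f i y ∂(μ i) := by
  have h := iIndepFun_pi (μ := μ) (X := f) fun i => (hf i).aemeasurable
  refine (lintegral_prod_eq_prod_lintegral_of_indepFun Finset.univ
    (fun i (x : ∀ i, X i) => f i (x i)) h
    fun i => (hf i).comp (measurable_pi_apply i)).trans ?_
  refine Finset.prod_congr rfl fun i _ => ?_
  rw [← lintegral_map (hf i) (measurable_pi_apply i), (measurePreserving_eval μ i).map_eq]

theorem measurePreserving_uncurry {ι κ X : Type*} [Fintype ι] [Fintype κ] [MeasurableSpace X]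
    (ν : Measure X) [IsProbabilityMeasure ν] :
    MeasurePreserving (fun (c : ι → κ → X) (e : ι × κ) => c e.1 e.2)
      (Measure.pi fun _ => Measure.pi fun _ => ν) (Measure.pi fun _ => ν) := by
  have hm : Measurable fun (c : ι → κ → X) (e : ι × κ) => c e.1 e.2 := by fun_prop
  refine ⟨hm, ?_⟩
  symm
  refine Measure.pi_eq fun s hs => ?_
  rw [Measure.map_apply hm (MeasurableSet.univ_pi hs)]
  have : (fun (c : ι → κ → X) (e : ι × κ) => c e.1 e.2) ⁻¹' Set.univ.pi s =
      Set.univ.pi fun i => Set.univ.pi fun k => s (i, k) := by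
    ext c; simp [Set.mem_pi]
  rw [this, Measure.pi_pi]
  simp_rw [Measure.pi_pi]
  rw [Fintype.prod_prod_type]

/-- Initial ranks and positions on the one hand, coins on the other hand are independent. -/
theorem measurePreserving_split_marks [NeZero n] (p : unitInterval) :
    MeasurePreserving (fun (M : Fin n → Mark n m) =>
        ((fun i => ((M i).1, (M i).2.1) : Fin n → Fin n × UnitAddTorus (Fin m)),
          (fun e => (M e.1).2.2 e.2 : Fin n × Fin n → Bool)))
      (Measure.pi fun _ => markLaw n m p)
      ((Measure.pi fun _ => (uniformOn Set.univ).prod volume).prod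
        (Measure.pi fun _ => bernoulliMeasure true false p)) := by
  have hunif : IsProbabilityMeasure (uniformOn (Set.univ : Set (Fin n))) :=
    isProbabilityMeasure_uniformOn Set.finite_univ Set.univ_nonempty
  set C : Measure (Fin n → Bool) := Measure.pi fun _ => bernoulliMeasure true false p with hC
  have h1 : MeasurePreserving (MeasurableEquiv.prodAssoc.symm : Mark n m ≃ᵐ _)
      (markLaw n m p) (((uniformOn Set.univ).prod volume).prod C) :=
    (measurePreserving_prodAssoc (uniformOn (Set.univ : Set (Fin n)))
      (volume : Measure (UnitAddTorus (Fin m))) C).symm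
  have h2 := measurePreserving_pi (fun _ : Fin n => markLaw n m p)
    (fun _ => ((uniformOn Set.univ).prod volume).prod C) (fun _ => h1)
  have h3 := measurePreserving_arrowProdEquivProdArrow (Fin n × UnitAddTorus (Fin m))
    (Fin n → Bool) (Fin n) (fun _ => (uniformOn Set.univ).prod volume) (fun _ => C)
  have h4 := (MeasurePreserving.id (Measure.pi fun _ : Fin n =>
    (uniformOn (Set.univ : Set (Fin n))).prod
      (volume : Measure (UnitAddTorus (Fin m))))).prod
    (measurePreserving_uncurry (ι := Fin n) (κ := Fin n) (bernoulliMeasure true false p))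
  exact h4.comp (h3.comp h2)

/-- If the conditional probability given a discrete function of the positions and initial ranks is
small, then so is the probability. -/
theorem marks_le_of_coins_le [NeZero n] (p : unitInterval) {D : Type*} [MeasurableSpace D]
    [DiscreteMeasurableSpace D] [Countable D] {φ : (Fin n → Fin n × UnitAddTorus (Fin m)) → D}
    (hφ : Measurable φ) (S : D → Set (Fin n × Fin n → Bool)) (ε : ENNReal)
    (hS : ∀ d, (Measure.pi fun _ => bernoulliMeasure true false p) (S d) ≤ ε) :
    (Measure.pi fun _ => markLaw n m p) {M | (fun e => (M e.1).2.2 e.2) ∈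
      S (φ fun i => ((M i).1, (M i).2.1))} ≤ ε := by
  have hunif : IsProbabilityMeasure (uniformOn (Set.univ : Set (Fin n))) :=
    isProbabilityMeasure_uniformOn Set.finite_univ Set.univ_nonempty
  have hmp := measurePreserving_split_marks (n := n) (m := m) p
  have hm : MeasurableSet {z : (Fin n → Fin n × UnitAddTorus (Fin m)) × (Fin n × Fin n → Bool) |
      z.2 ∈ S (φ z.1)} := by
    have : MeasurableSet {w : D × (Fin n × Fin n → Bool) | w.2 ∈ S w.1} := MeasurableSet.of_discrete
    exact (hφ.comp measurable_fst).prodMk measurable_snd this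
  have := hmp.measure_preimage hm.nullMeasurableSet
  change (Measure.pi fun _ => markLaw n m p) {M | (fun e => (M e.1).2.2 e.2) ∈
      S (φ fun i => ((M i).1, (M i).2.1))} = _ at this
  rw [this, Measure.prod_apply hm]
  calc _ ≤ ∫⁻ _ : (Fin n → Fin n × UnitAddTorus (Fin m)), ε
        ∂(Measure.pi fun _ => (uniformOn Set.univ).prod volume) :=
        lintegral_mono fun g => hS (φ g)
    _ = ε := by simp

/-- With high probability, for each of finitely many families of disjoint edge sets that is large,
one of the edge sets is open. -/
theorem coins_union_le (p : unitInterval) {I A : Type*} [Fintype I] (valid : I → Prop)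
    (S : I → Finset A) (E : I → A → Finset (Fin n × Fin n)) (k N : ℕ)
    (hE : ∀ i, valid i → (S i : Set A).PairwiseDisjoint (E i))
    (hk : ∀ i, valid i → ∀ a ∈ S i, (E i a).card ≤ k)
    (hN : ∀ i, valid i → N ≤ (S i).card) :
    (Measure.pi fun _ => bernoulliMeasure true false p)
      {c : Fin n × Fin n → Bool | ∃ i, valid i ∧ ∀ a ∈ S i, ∃ e ∈ E i a, c e = false} ≤
      ENNReal.ofReal (Fintype.card I * (1 - (p : ℝ) ^ k) ^ N) := by
  classical
  have hp1 : (p : ℝ) ≤ 1 := p.2.2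
  have hp0 : 0 ≤ (p : ℝ) := p.2.1
  have hpk : (p : ℝ) ^ k ≤ 1 := pow_le_one₀ hp0 hp1
  have hpk0 : 0 ≤ (p : ℝ) ^ k := pow_nonneg hp0 k
  have hb : (bernoulliMeasure true false p).real {true} = p := by
    rw [bernoulliMeasure_real_apply p (by trivial)]
    simp
  have : {c : Fin n × Fin n → Bool | ∃ i, valid i ∧ ∀ a ∈ S i, ∃ e ∈ E i a, c e = false} =
      ⋃ i, {c | valid i ∧ ∀ a ∈ S i, ∃ e ∈ E i a, c e = false} := by ext; simp
  rw [this]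
  refine (measure_iUnion_fintype_le _ _).trans ((Finset.sum_le_sum (g := fun _ =>
    ENNReal.ofReal ((1 - (p : ℝ) ^ k) ^ N)) fun i _ => ?_).trans ?_)
  · by_cases hv : valid i
    · have := pi_forall_exists_false_le (bernoulliMeasure true false p) (S i) (E i) (hE i hv) k
        (hk i hv)
      simp only [hv, true_and]
      refine this.trans (ENNReal.ofReal_le_ofReal ?_)
      rw [hb]
      exact pow_le_pow_of_le_one (by linarith) (by linarith) (hN i hv)
    · simp [hv]
  · rw [Finset.sum_const, Finset.card_univ, nsmul_eq_mul, ENNReal.ofReal_mul (by positivity),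
      ENNReal.ofReal_natCast]

end Coins


/-! ### Median split by age, and the deterministic backbone argument. -/

section Backbone

theorem exists_initial_segment {n : ℕ} {b : Fin n → ℕ} (hb : Function.Injective b) {k : ℕ}
    (hk : k ≤ n) : ∃ O : Finset (Fin n), O.card = k ∧ ∀ i ∈ O, ∀ j ∉ O, b i < b j := by
  classical
  induction k with
  | zero => exact ⟨∅, by simp⟩
  | succ k ih =>
    obtain ⟨O, h1, h2⟩ := ih (by omega)
    have hne : Oᶜ.Nonempty := by
      rw [← Finset.card_pos, Finset.card_compl, Fintype.card_fin]; omega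
    obtain ⟨a, ha, hmin⟩ := Finset.exists_min_image Oᶜ b hne
    have ha' : a ∉ O := by simpa using ha
    refine ⟨insert a O, by rw [Finset.card_insert_of_notMem ha', h1], fun i hi j hj => ?_⟩
    rw [Finset.mem_insert, not_or] at hj
    rw [Finset.mem_insert] at hi
    rcases hi with rfl | hi
    · exact lt_of_le_of_ne (hmin j (by simpa using hj.2)) fun e => hj.1 (hb e).symm
    · exact h2 i hi j hj.2

/-- The nodes can be split into an older and a younger half. -/
theorem exists_median_split {n : ℕ} (hn : 2 ≤ n) {b : Fin n → ℕ} (hb : Function.Injective b) :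
    ∃ O : Finset (Fin n), n ≤ 3 * O.card ∧ n ≤ 3 * Oᶜ.card ∧
      ∀ i ∈ O, ∀ j ∈ Oᶜ, b i < b j := by
  obtain ⟨O, h1, h2⟩ := exists_initial_segment hb (Nat.div_le_self n 2)
  refine ⟨O, by omega, ?_, fun i hi j hj => h2 i hi j (by simpa using hj)⟩
  rw [Finset.card_compl, Fintype.card_fin]; omega

theorem edist_le_two {V : Type*} {G : SimpleGraph V} {u v w : V} (h1 : G.Adj u w)
    (h2 : G.Adj w v) : G.edist u v ≤ 2 := by
  refine G.edist_triangle (v := w) |>.trans ?_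
  rw [SimpleGraph.edist_eq_one_iff_adj.2 h1, SimpleGraph.edist_eq_one_iff_adj.2 h2]
  norm_num

/-- If a set of nodes is dense in the torus, its nodes have common neighbours when they are close,
and all nodes are near the set, then the diameter is small. -/
theorem ediam_le_of_backbone {V : Type*} {m : ℕ} {G : SimpleGraph V}
    (x : V → UnitAddTorus (Fin m)) (B : Set V) {ρ : ℝ} {J : ℕ} (hJ : 0 < J)
    (hρ : 1 / (2 * J) ≤ ρ / 4)
    (h1 : ∀ z, ∃ u ∈ B, dist (x u) z ≤ ρ / 4)
    (h2 : ∀ u ∈ B, ∀ v ∈ B, dist (x u) (x v) ≤ 3 * ρ / 4 → G.edist u v ≤ 2)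
    (h3 : ∀ v, ∃ u ∈ B, G.edist v u ≤ 2) : G.ediam ≤ (2 * J + 8 : ℕ) := by
  -- Two edges for each of the `J` pieces of a shortest curve, and two at either end.
  have key : ∀ u ∈ B, ∀ v ∈ B, G.edist u v ≤ (2 * J + 4 : ℕ) := by
    intro u hu v hv
    obtain ⟨z, hz0, hzJ, hz⟩ := torus_exists_chain (x u) (x v) hJ
    choose w hw1 hw2 using fun a => h1 (z a)
    have hstep : ∀ a : ℕ, G.edist (w 0) (w a) ≤ (2 * a : ℕ) := by
      intro a
      induction a with
      | zero => simp
      | succ a ih =>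
        refine (G.edist_triangle (v := w a)).trans ?_
        have hd : dist (x (w a)) (x (w (a + 1))) ≤ 3 * ρ / 4 := by
          have t1 := dist_triangle4_right (x (w a)) (x (w (a + 1))) (z a) (z (a + 1))
          have t2 := hw2 a
          have t3 := hw2 (a + 1)
          have t4 := (hz a).trans hρ
          linarith
        have h2' := h2 _ (hw1 a) _ (hw1 (a + 1)) hd
        calc G.edist (w 0) (w a) + G.edist (w a) (w (a + 1)) ≤ (2 * a : ℕ) + 2 := add_le_add ih h2'
          _ = _ := by push_cast; ring
    have hρ0 : 0 ≤ ρ := by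
      have : (0 : ℝ) ≤ 1 / (2 * J) := by positivity
      linarith
    have e1 : G.edist u (w 0) ≤ 2 := h2 _ hu _ (hw1 0) (by
      rw [← hz0, dist_comm]; exact (hw2 0).trans (by linarith))
    have e2 : G.edist (w J) v ≤ 2 := h2 _ (hw1 J) _ hv (by
      rw [← hzJ]; exact (hw2 J).trans (by linarith))
    calc G.edist u v ≤ G.edist u (w 0) + G.edist (w 0) v := G.edist_triangle
      _ ≤ G.edist u (w 0) + (G.edist (w 0) (w J) + G.edist (w J) v) := by
        gcongr; exact G.edist_triangle
      _ ≤ 2 + ((2 * J : ℕ) + 2) := by gcongr; exact hstep J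
      _ = _ := by push_cast; ring
  refine SimpleGraph.ediam_le_of_edist_le fun v v' => ?_
  obtain ⟨u, hu, hvu⟩ := h3 v
  obtain ⟨u', hu', hvu'⟩ := h3 v'
  rw [SimpleGraph.edist_comm] at hvu'
  calc G.edist v v' ≤ G.edist v u + G.edist u v' := G.edist_triangle
    _ ≤ G.edist v u + (G.edist u u' + G.edist u' v') := by gcongr; exact G.edist_triangle
    _ ≤ 2 + ((2 * J + 4 : ℕ) + 2) := by gcongr; exact key u hu u' hu'
    _ = _ := by push_cast; ring

end Backbone

/-! ### Coin and counting estimates for independent marks. -/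

section MarkEstimates

variable {n m : ℕ}

/-- Conditionally on the positions and initial ranks, families of disjoint edge sets that are large
contain an open edge set. -/
theorem marks_coins_le [NeZero n] (p : unitInterval) {I A : Type*} [Fintype I] [Fintype A]
    (S : (Fin n → Fin n × UnitAddTorus (Fin m)) → I → Finset A)
    (hS : ∀ i a, MeasurableSet {g | a ∈ S g i}) (E : I → A → Finset (Fin n × Fin n)) (k N : ℕ)
    (hE : ∀ g i, (S g i : Set A).PairwiseDisjoint (E i)) (hk : ∀ i a, (E i a).card ≤ k) :
    (Measure.pi fun _ => markLaw n m p) {M | ∃ i,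
      N ≤ (S (fun j => ((M j).1, (M j).2.1)) i).card ∧
      ∀ a ∈ S (fun j => ((M j).1, (M j).2.1)) i, ∃ e ∈ E i a, (M e.1).2.2 e.2 = false} ≤
      ENNReal.ofReal (Fintype.card I * (1 - (p : ℝ) ^ k) ^ N) := by
  classical
  -- Only patterns that occur are admitted. So every `d` comes from some `g`, and the disjointness
  -- assumption `hE` applies to it.
  let D := {d : I → A → Bool // ∃ g, ∀ i a, d i a = true ↔ a ∈ S g i}
  let φ : (Fin n → Fin n × UnitAddTorus (Fin m)) → D := fun g =>
    ⟨fun i a => decide (a ∈ S g i), g, fun i a => by simp⟩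
  have hφ : Measurable φ := by
    refine Measurable.subtype_mk ?_
    refine measurable_pi_lambda _ fun i => measurable_pi_lambda _ fun a => ?_
    refine measurable_to_bool ?_
    convert hS i a using 1
    ext g; simp
  let T : D → I → Finset A := fun d i => Finset.univ.filter fun a => d.1 i a = true
  have hT : ∀ g, T (φ g) = S g := by
    intro g; funext i; ext a; simp [T, φ]
  have := marks_le_of_coins_le p hφ (fun d => {c | ∃ i, N ≤ (T d i).card ∧
    ∀ a ∈ T d i, ∃ e ∈ E i a, c e = false}) _ (fun d => coins_union_le p
      (fun i => N ≤ (T d i).card) (T d) E k N (fun i _ => ?_) (fun i _ a _ => hk i a)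
      fun i h => h)
  · simpa only [Set.mem_ofPred_eq, hT] using this
  · obtain ⟨g, hg⟩ := d.2
    have : T d = S g := by funext i; ext a; simp [T, hg]
    rw [this]; exact hE g i

/-- All balls contain many nodes of small initial rank. -/
theorem marks_net_count_le [NeZero n] (p : unitInterval) (I : Finset (Fin n)) {r ρ : ℝ}
    (hr1 : 1 ≤ r) (hrn : r ≤ n) (hρ0 : 0 < ρ) (hρ1 : 2 * ρ ≤ 1) (N : ℕ) :
    (Measure.pi fun _ => markLaw n m p) {M | ∃ z, (I.filter fun i =>
      ((M i).1 : ℝ) + 1 ≤ r ∧ dist (M i).2.1 z ≤ 2 * ρ).card < N} ≤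
    ENNReal.ofReal ((2 / ρ) ^ m *
      Real.exp (N - I.card * (r / (2 * n) * (2 * ρ) ^ m) / 2)) := by
  classical
  have hn0 : (0 : ℝ) < n := by exact_mod_cast NeZero.pos n
  have hunif : IsProbabilityMeasure (uniformOn (Set.univ : Set (Fin n))) :=
    isProbabilityMeasure_uniformOn Set.finite_univ Set.univ_nonempty
  obtain ⟨F, hF, hFn⟩ := torus_exists_net m hρ0 (by linarith)
  set A : UnitAddTorus (Fin m) → Set (Mark n m) := fun g =>
    {μ | (μ.1 : ℝ) + 1 ≤ r ∧ dist μ.2.1 g ≤ ρ} with hA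
  have hAm : ∀ g, MeasurableSet (A g) := by
    intro g
    refine MeasurableSet.inter ?_ ?_
    · exact (MeasurableSet.of_discrete (s := {R : Fin n | (R : ℝ) + 1 ≤ r})).preimage measurable_fst
    · exact measurableSet_le (f := fun μ : Mark n m => dist μ.2.1 g) (by fun_prop)
        measurable_const
  have hAp : ∀ g, r / (2 * n) * (2 * ρ) ^ m ≤ (markLaw n m p).real (A g) := by
    intro g
    have : A g = {R : Fin n | (R : ℝ) + 1 ≤ r} ×ˢ
        (Metric.closedBall g ρ ×ˢ (Set.univ : Set (Fin n → Bool))) := by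
      ext μ; simp [hA]
    rw [this, Measure.real, markLaw, Measure.prod_prod, Measure.prod_prod, ENNReal.toReal_mul,
      ENNReal.toReal_mul, measure_univ, ENNReal.toReal_one, mul_one]
    have hv := torus_volume_closedBall g hρ0.le hρ1
    rw [Measure.real] at hv
    rw [hv]
    gcongr
    have hc : {R : Fin n | (R : ℝ) + 1 ≤ r} = ((Finset.univ.filter fun R : Fin n =>
        (R : ℝ) + 1 ≤ r : Finset (Fin n)) : Set (Fin n)) := by ext; simp
    have hcard : ⌊r⌋₊ ≤ (Finset.univ.filter fun R : Fin n => (R : ℝ) + 1 ≤ r).card := by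
      have hle : ⌊r⌋₊ ≤ n := Nat.floor_le_of_le hrn
      calc ⌊r⌋₊ = (Finset.univ.image (Fin.castLE hle)).card := by
            rw [Finset.card_image_of_injective _ (Fin.castLE_injective hle)]; simp
        _ ≤ _ := by
          refine Finset.card_le_card fun R hR => ?_
          obtain ⟨k, -, rfl⟩ := Finset.mem_image.1 hR
          rw [Finset.mem_filter]
          refine ⟨Finset.mem_univ _, ?_⟩
          have h1 : ((k : ℕ) : ℝ) + 1 ≤ ⌊r⌋₊ := by exact_mod_cast k.2
          exact h1.trans (Nat.floor_le (by linarith))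
    -- Rounding down loses at most a factor `2` because `r ≥ 1`; this is the `2` in `r / (2 * n)`.
    have hfl : r / 2 ≤ ⌊r⌋₊ := by
      have h2 := Nat.lt_floor_add_one r
      have h3 : (1 : ℝ) ≤ ⌊r⌋₊ := by exact_mod_cast Nat.one_le_floor_iff r |>.2 hr1
      linarith
    rw [hc, uniformOn_univ, Measure.count_apply_finset, ENNReal.toReal_div]
    simp only [ENNReal.toReal_natCast, Fintype.card_fin]
    rw [div_mul_eq_div_div]
    have : r / 2 ≤ ((Finset.univ.filter fun R : Fin n => (R : ℝ) + 1 ≤ r).card : ℝ) :=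
      hfl.trans (by exact_mod_cast hcard)
    gcongr
  -- A ball of radius `2 * ρ` about any `z` contains the ball of radius `ρ` about a nearby net
  -- point, so finitely many centres suffice.
  have hsub : {M : Fin n → Mark n m | ∃ z, (I.filter fun i =>
      ((M i).1 : ℝ) + 1 ≤ r ∧ dist (M i).2.1 z ≤ 2 * ρ).card < N} ⊆
      ⋃ g ∈ F, {M | ((I.filter fun i => M i ∈ A g).card : ℝ) < N} := by
    rintro M ⟨z, hz⟩
    obtain ⟨g, hg, hzg⟩ := hFn z
    refine Set.mem_iUnion₂.2 ⟨g, hg, ?_⟩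
    rw [Set.mem_ofPred_eq]
    refine lt_of_le_of_lt (Nat.cast_le.2 ?_) (Nat.cast_lt (α := ℝ).2 hz)
    refine Finset.card_le_card fun i hi => ?_
    rw [Finset.mem_filter] at hi ⊢
    refine ⟨hi.1, hi.2.1, ?_⟩
    have := dist_triangle (M i).2.1 g z
    rw [dist_comm g z] at this
    have := hi.2.2
    linarith
  refine (measure_mono hsub).trans ((measure_biUnion_finset_le _ _).trans ?_)
  calc _ ≤ ∑ g ∈ F, ENNReal.ofReal (Real.exp (N - I.card * (r / (2 * n) * (2 * ρ) ^ m) / 2)) := by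
        refine Finset.sum_le_sum fun g _ => (pi_card_lt_le _ I (hAm g) N).trans
          (ENNReal.ofReal_le_ofReal ?_)
        gcongr
        exact hAp g
    _ = ENNReal.ofReal (F.card * Real.exp (N - I.card * (r / (2 * n) * (2 * ρ) ^ m) / 2)) := by
        rw [Finset.sum_const, nsmul_eq_mul, ENNReal.ofReal_mul (by positivity),
          ENNReal.ofReal_natCast]
    _ ≤ _ := by gcongr

end MarkEstimates


/-! ### Small dimension: a backbone of old nodes of small rank. -/

section SmallDimension

variable {α β : ℝ} {n m : ℕ}

theorem radius_pos (hn : 1 ≤ n) {r : ℝ} (hr : 0 < r) : 0 < radius α β n m r := by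
  have : (0 : ℝ) < n := by exact_mod_cast hn
  unfold radius; positivity

theorem radius_exp (hn : 1 ≤ n) (a : ℝ) : radius α β n m (Real.exp a) =
    Real.exp (-(α * a + β * Real.log n) / m) / 2 := by
  have hn0 : (0 : ℝ) < n := by exact_mod_cast hn
  unfold radius
  congr 1
  rw [← Real.exp_mul, Real.rpow_def_of_pos hn0, ← Real.exp_add, ← Real.exp_mul]
  congr 1; ring

theorem hiRank_pos (hn : 1 ≤ n) (R : Fin n) : 0 < hiRank n R := by
  have : (0 : ℝ) < n := by exact_mod_cast hn
  have h2 : (0 : ℝ) < (R : ℝ) + 1 := by positivity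
  exact lt_min this (by have := lt_max_of_lt_left (c := rankCutoff n) h2; positivity)

/-- Above the cutoff a rank grows at most by a factor `8`, so `radius (8 * r)` is guaranteed to
every node of initial rank at most `r`. -/
theorem Compatible.adj_of_le {b : Fin n → ℕ} {M : Fin n → Mark n m} {G : SimpleGraph (Fin n)}
    (h : Compatible α β (lowRank n) (hiRank n) b M G) (hα : 0 ≤ α) {i j : Fin n} (hb : b i < b j)
    {r : ℝ} (hr : rankCutoff n ≤ r) (hi : ((M i).1 : ℝ) + 1 ≤ r)
    (hd : dist (M j).2.1 (M i).2.1 ≤ radius α β n m (8 * r)) (hc : (M j).2.2 i = true) :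
    G.Adj i j := by
  refine (h i j hb).2 hc (hd.trans (radius_anti hα (hiRank_pos i.pos _) ?_))
  refine (min_le_right _ _).trans ?_
  have := max_le hi hr
  linarith

/-- No rank exceeds `n`, so this radius is available to every node at every time. -/
theorem Compatible.adj_of_le_radius {b : Fin n → ℕ} {M : Fin n → Mark n m}
    {G : SimpleGraph (Fin n)} (h : Compatible α β (lowRank n) (hiRank n) b M G) (hα : 0 ≤ α)
    {i j : Fin n} (hb : b i < b j) (hd : dist (M j).2.1 (M i).2.1 ≤ radius α β n m n)
    (hc : (M j).2.2 i = true) : G.Adj i j :=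
  (h i j hb).2 hc (hd.trans (radius_anti hα (hiRank_pos i.pos _) (min_le_left _ _)))

theorem measurableSet_dist_le (i j : Fin n) (c : ℝ) :
    MeasurableSet {g : Fin n → Fin n × UnitAddTorus (Fin m) | dist (g i).2 (g j).2 ≤ c} :=
  measurableSet_le (f := fun g : Fin n → Fin n × UnitAddTorus (Fin m) => dist (g i).2 (g j).2)
    (by fun_prop) measurable_const

theorem measurableSet_rank_le (i : Fin n) (r : ℝ) :
    MeasurableSet {g : Fin n → Fin n × UnitAddTorus (Fin m) | ((g i).1 : ℝ) + 1 ≤ r} :=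
  (MeasurableSet.of_discrete (s := {R : Fin n | (R : ℝ) + 1 ≤ r})).preimage
    (f := fun g : Fin n → Fin n × UnitAddTorus (Fin m) => (g i).1) (by fun_prop)

/-- The probability that the diameter is not small, in terms of the parameters of a backbone made
of the old nodes of initial rank at most `r`. -/
theorem marks_backbone_le [NeZero n] (p : unitInterval) (hα : 0 ≤ α) {b : Fin n → ℕ}
    {O : Finset (Fin n)} (hO : ∀ i ∈ O, ∀ j ∈ Oᶜ, b i < b j) {r ρ ρ' : ℝ} (hr : rankCutoff n ≤ r)
    (hρ : ρ = radius α β n m (8 * r)) (hρ' : ρ' = radius α β n m n) {N J : ℕ} (hN : 1 ≤ N)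
    (hJ : 0 < J) (hJρ : 1 / (2 * J) ≤ ρ / 4) (δ₁ δ₂ δ₃ : ENNReal)
    (h1 : (Measure.pi fun _ => markLaw n m p) {M | ∃ z, (O.filter fun i =>
      ((M i).1 : ℝ) + 1 ≤ r ∧ dist (M i).2.1 z ≤ 2 * (ρ / 8)).card < N} ≤ δ₁)
    (h2 : (Measure.pi fun _ => markLaw n m p) {M | ∃ z, (Oᶜ.filter fun i =>
      ((M i).1 : ℝ) + 1 ≤ r ∧ dist (M i).2.1 z ≤ 2 * (ρ / 8)).card < N} ≤ δ₂)
    (h3 : (Measure.pi fun _ => markLaw n m p) {M | ∃ z, (Oᶜ.filter fun i =>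
      ((M i).1 : ℝ) + 1 ≤ n ∧ dist (M i).2.1 z ≤ 2 * (ρ' / 2)).card < N} ≤ δ₃) :
    (Measure.pi fun _ => markLaw n m p) {M | ∃ G ∈ {G : SimpleGraph (Fin n) |
      ¬ G.ediam ≤ (2 * J + 8 : ℕ)}, Compatible α β (lowRank n) (hiRank n) b M G} ≤
      δ₁ + δ₂ + δ₃ + ENNReal.ofReal (3 * (n ^ 2 * (1 - (p : ℝ) ^ 2) ^ N)) := by
  classical
  have hn1 : (1 : ℝ) ≤ n := by exact_mod_cast NeZero.one_le
  have hp2 : 0 ≤ (1 - (p : ℝ) ^ 2) ^ N := by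
    have := pow_le_one₀ p.2.1 p.2.2 (n := 2)
    apply pow_nonneg; linarith
  -- Three families of edge sets: common younger neighbours of two nodes, younger neighbours of one
  -- node, and backbone neighbours of one node. Each coin names its candidate, so sets of different
  -- candidates are disjoint.
  have c1 := marks_coins_le (n := n) (m := m) p (I := Fin n × Fin n) (A := Fin n)
    (fun g u => Oᶜ.filter fun w => dist (g w).2 (g u.1).2 ≤ ρ ∧ dist (g w).2 (g u.2).2 ≤ ρ)
    (fun i a => by
      simp only [Finset.mem_filter, measurableSet_setOfPred]
      exact .and measurable_const
        (.and (measurableSet_setOfPred.1 (measurableSet_dist_le _ _ _))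
          (measurableSet_setOfPred.1 (measurableSet_dist_le _ _ _))))
    (fun u w => {(w, u.1), (w, u.2)}) 2 N
    (fun g u w _ w' _ hww => by
      simp only [Function.onFun, Finset.disjoint_left, Finset.mem_insert, Finset.mem_singleton,
        Prod.ext_iff]
      grind)
    (fun u w => Finset.card_le_two)
  have c2 := marks_coins_le (n := n) (m := m) p (I := Fin n) (A := Fin n)
    (fun g v => Oᶜ.filter fun w => dist (g w).2 (g v).2 ≤ ρ')
    (fun i a => by
      simp only [Finset.mem_filter, measurableSet_setOfPred]
      exact .and measurable_const (measurableSet_setOfPred.1 (measurableSet_dist_le _ _ _)))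
    (fun v w => {(w, v)}) 2 N
    (fun g u w _ w' _ hww => by simpa [Function.onFun] using fun h => hww h)
    (fun u w => by simp)
  have c3 := marks_coins_le (n := n) (m := m) p (I := Fin n) (A := Fin n)
    (fun g v => O.filter fun u => ((g u).1 : ℝ) + 1 ≤ r ∧ dist (g v).2 (g u).2 ≤ ρ)
    (fun i a => by
      simp only [Finset.mem_filter, measurableSet_setOfPred]
      exact .and measurable_const
        (.and (measurableSet_setOfPred.1 (measurableSet_rank_le _ _))
          (measurableSet_setOfPred.1 (measurableSet_dist_le _ _ _))))
    (fun v u => {(v, u)}) 2 N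
    (fun g u w _ w' _ hww => by simpa [Function.onFun] using fun h => hww h)
    (fun u w => by simp)
  simp only [Fintype.card_prod, Fintype.card_fin] at c1 c2 c3
  have hle1 : ENNReal.ofReal (((n * n : ℕ) : ℝ) * (1 - (p : ℝ) ^ 2) ^ N) ≤
      ENNReal.ofReal (n ^ 2 * (1 - (p : ℝ) ^ 2) ^ N) := by
    apply ENNReal.ofReal_le_ofReal; push_cast; rw [pow_two (n : ℝ)]
  have hle2 : ENNReal.ofReal (n * (1 - (p : ℝ) ^ 2) ^ N) ≤
      ENNReal.ofReal (n ^ 2 * (1 - (p : ℝ) ^ 2) ^ N) := by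
    apply ENNReal.ofReal_le_ofReal; gcongr; nlinarith
  have hsum : ENNReal.ofReal (3 * (n ^ 2 * (1 - (p : ℝ) ^ 2) ^ N)) =
      ENNReal.ofReal (n ^ 2 * (1 - (p : ℝ) ^ 2) ^ N) +
      ENNReal.ofReal (n ^ 2 * (1 - (p : ℝ) ^ 2) ^ N) +
      ENNReal.ofReal (n ^ 2 * (1 - (p : ℝ) ^ 2) ^ N) := by
    rw [← ENNReal.ofReal_add (by positivity) (by positivity),
      ← ENNReal.ofReal_add (by positivity) (by positivity)]
    congr 1; ring
  obtain ⟨C₁, hC₁, g4⟩ : ∃ C : Set (Fin n → Mark n m), (Measure.pi fun _ => markLaw n m p) C ≤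
      ENNReal.ofReal (n ^ 2 * (1 - (p : ℝ) ^ 2) ^ N) ∧ ∀ M ∉ C, ∀ u u', N ≤ (Oᶜ.filter fun w =>
        dist (M w).2.1 (M u).2.1 ≤ ρ ∧ dist (M w).2.1 (M u').2.1 ≤ ρ).card →
        ∃ w, w ∈ Oᶜ ∧ dist (M w).2.1 (M u).2.1 ≤ ρ ∧ dist (M w).2.1 (M u').2.1 ≤ ρ ∧
          (M w).2.2 u = true ∧ (M w).2.2 u' = true := by
    refine ⟨_, c1.trans hle1, fun M hM u u' hc => ?_⟩
    rw [Set.mem_ofPred_eq] at hM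
    push Not at hM
    obtain ⟨w, hw, he⟩ := hM (u, u') hc
    rw [Finset.mem_filter] at hw
    have e1 := he (w, u) (by simp)
    have e2 := he (w, u') (by simp)
    simp only [ne_eq, Bool.not_eq_false] at e1 e2
    exact ⟨w, hw.1, hw.2.1, hw.2.2, e1, e2⟩
  obtain ⟨C₂, hC₂, g5⟩ : ∃ C : Set (Fin n → Mark n m), (Measure.pi fun _ => markLaw n m p) C ≤
      ENNReal.ofReal (n ^ 2 * (1 - (p : ℝ) ^ 2) ^ N) ∧ ∀ M ∉ C, ∀ v, N ≤ (Oᶜ.filter fun w =>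
        dist (M w).2.1 (M v).2.1 ≤ ρ').card →
        ∃ w, w ∈ Oᶜ ∧ dist (M w).2.1 (M v).2.1 ≤ ρ' ∧ (M w).2.2 v = true := by
    refine ⟨_, c2.trans hle2, fun M hM v hc => ?_⟩
    rw [Set.mem_ofPred_eq] at hM
    push Not at hM
    obtain ⟨w, hw, he⟩ := hM v hc
    rw [Finset.mem_filter] at hw
    have e1 := he (w, v) (by simp)
    simp only [ne_eq, Bool.not_eq_false] at e1
    exact ⟨w, hw.1, hw.2, e1⟩
  obtain ⟨C₃, hC₃, g6⟩ : ∃ C : Set (Fin n → Mark n m), (Measure.pi fun _ => markLaw n m p) C ≤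
      ENNReal.ofReal (n ^ 2 * (1 - (p : ℝ) ^ 2) ^ N) ∧ ∀ M ∉ C, ∀ v, N ≤ (O.filter fun u =>
        ((M u).1 : ℝ) + 1 ≤ r ∧ dist (M v).2.1 (M u).2.1 ≤ ρ).card →
        ∃ u, u ∈ O ∧ ((M u).1 : ℝ) + 1 ≤ r ∧ dist (M v).2.1 (M u).2.1 ≤ ρ ∧
          (M v).2.2 u = true := by
    refine ⟨_, c3.trans hle2, fun M hM v hc => ?_⟩
    rw [Set.mem_ofPred_eq] at hM
    push Not at hM
    obtain ⟨w, hw, he⟩ := hM v hc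
    rw [Finset.mem_filter] at hw
    have e1 := he (v, w) (by simp)
    simp only [ne_eq, Bool.not_eq_false] at e1
    exact ⟨w, hw.1, hw.2.1, hw.2.2, e1⟩
  clear c1 c2 c3
  have hmem : ∀ (I : Finset (Fin n)) (r ρ : ℝ) (δ : ENNReal),
      (Measure.pi fun _ => markLaw n m p) {M | ∃ z, (I.filter fun i =>
        ((M i).1 : ℝ) + 1 ≤ r ∧ dist (M i).2.1 z ≤ ρ).card < N} ≤ δ →
      ∃ A : Set (Fin n → Mark n m), (Measure.pi fun _ => markLaw n m p) A ≤ δ ∧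
        ∀ M ∉ A, ∀ z, N ≤ (I.filter fun i =>
          ((M i).1 : ℝ) + 1 ≤ r ∧ dist (M i).2.1 z ≤ ρ).card := by
    intro I r ρ δ h
    refine ⟨_, h, fun M hM z => ?_⟩
    rw [Set.mem_ofPred_eq] at hM
    push Not at hM
    exact hM z
  obtain ⟨A₁, hA₁, g1⟩ := hmem _ _ _ _ h1
  obtain ⟨A₂, hA₂, g2⟩ := hmem _ _ _ _ h2
  obtain ⟨A₃, hA₃, g3⟩ := hmem _ _ _ _ h3
  rw [hsum]
  refine (measure_mono (t := (A₁ ∪ A₂ ∪ A₃) ∪ (C₁ ∪ C₂ ∪ C₃)) ?_).trans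
    ((measure_union_le _ _).trans (add_le_add
      ((measure_union_le _ _).trans (add_le_add ((measure_union_le _ _).trans
        (add_le_add hA₁ hA₂)) hA₃))
      ((measure_union_le _ _).trans (add_le_add ((measure_union_le _ _).trans
        (add_le_add hC₁ hC₂)) hC₃))))
  rintro M ⟨G, hG, hcomp⟩
  by_contra hcon
  simp only [Set.mem_union, not_or] at hcon
  obtain ⟨⟨⟨k1, k2⟩, k3⟩, ⟨k4, k5⟩, k6⟩ := hcon
  replace g1 := g1 M k1
  replace g2 := g2 M k2
  replace g3 := g3 M k3
  replace g4 := g4 M k4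
  replace g5 := g5 M k5
  replace g6 := g6 M k6
  have hρ4 : 2 * (ρ / 8) = ρ / 4 := by ring
  have hρ2 : 2 * (ρ' / 2) = ρ' := by ring
  rw [hρ4] at g1 g2
  rw [hρ2] at g3
  have hρ0 : 0 < ρ := by
    have : (0 : ℝ) < 1 / (2 * J) := by positivity
    linarith
  refine hG (ediam_le_of_backbone (fun i => (M i).2.1) {u | u ∈ O ∧ ((M u).1 : ℝ) + 1 ≤ r} hJ hJρ
    (fun z => ?_) (fun u hu v hv huv => ?_) (fun v => ?_))
  · obtain ⟨u, hu⟩ := Finset.card_pos.1 (hN.trans (g1 z))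
    rw [Finset.mem_filter] at hu
    exact ⟨u, ⟨hu.1, hu.2.1⟩, hu.2.2⟩
  -- A younger node within `ρ / 4` of `u` is within `ρ / 4 + 3 ρ / 4 = ρ` of `v`, hence a candidate
  -- for a common neighbour.
  · have hcard := (g2 (M u).2.1).trans (Finset.card_le_card (t := Oᶜ.filter fun w =>
      dist (M w).2.1 (M u).2.1 ≤ ρ ∧ dist (M w).2.1 (M v).2.1 ≤ ρ) fun w hw => by
        rw [Finset.mem_filter] at hw ⊢
        have := dist_triangle (M w).2.1 (M u).2.1 (M v).2.1
        exact ⟨hw.1, by linarith [hw.2.2], by linarith [hw.2.2]⟩)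
    obtain ⟨w, hw, d1, d2, e1, e2⟩ := g4 u v hcard
    exact edist_le_two (hcomp.adj_of_le hα (hO u hu.1 w hw) hr hu.2 (hρ ▸ d1) e1)
      (hcomp.adj_of_le hα (hO v hv.1 w hw) hr hv.2 (hρ ▸ d2) e2).symm
  -- Younger nodes reach the backbone by one edge. An older node uses its smallest possible radius
  -- `ρ'` to reach a younger one first.
  · have hY : ∀ v ∈ Oᶜ, ∃ u, (u ∈ O ∧ ((M u).1 : ℝ) + 1 ≤ r) ∧ G.Adj u v := by
      intro v hv
      have hcard := (g1 (M v).2.1).trans (Finset.card_le_card (t := O.filter fun u =>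
        ((M u).1 : ℝ) + 1 ≤ r ∧ dist (M v).2.1 (M u).2.1 ≤ ρ) fun w hw => by
          rw [Finset.mem_filter] at hw ⊢
          rw [dist_comm]
          exact ⟨hw.1, hw.2.1, by linarith [hw.2.2]⟩)
      obtain ⟨w, hw, hwr, d1, e1⟩ := g6 v hcard
      exact ⟨w, ⟨hw, hwr⟩, hcomp.adj_of_le hα (hO w hw v hv) hr hwr (hρ ▸ d1) e1⟩
    by_cases hv : v ∈ O
    · have hcard := (g3 (M v).2.1).trans (Finset.card_le_card (t := Oᶜ.filter fun w =>
        dist (M w).2.1 (M v).2.1 ≤ ρ') fun w hw => by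
          rw [Finset.mem_filter] at hw ⊢
          exact ⟨hw.1, hw.2.2⟩)
      obtain ⟨w, hw, d1, e1⟩ := g5 v hcard
      obtain ⟨u, hu, huw⟩ := hY w hw
      exact ⟨u, hu, edist_le_two
        (hcomp.adj_of_le_radius hα (hO v hv w hw) (hρ' ▸ d1) e1) huw.symm⟩
    · obtain ⟨u, hu, huw⟩ := hY v (by simpa using hv)
      refine ⟨u, hu, le_trans (SimpleGraph.edist_le_one_iff_adj_or_eq.2 (Or.inl huw.symm)) ?_⟩
      norm_num

end SmallDimension


/-! ### Small dimension: choice of the parameters. -/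

section SmallDimensionAsymptotics

theorem eventually_mul_pow_le_exp (C : ℝ) (k : ℕ) {ε : ℝ} (hε : 0 < ε) :
    ∀ᶠ L : ℝ in Filter.atTop, C * L ^ k ≤ Real.exp (ε * L) := by
  have h := (isLittleO_pow_exp_pos_mul_atTop k hε).const_mul_left |C|
  filter_upwards [h.bound (show (0 : ℝ) < 1 by norm_num), Filter.eventually_ge_atTop 0] with L hL h0
  rw [Real.norm_eq_abs, abs_of_nonneg (by positivity), Real.norm_eq_abs, Real.abs_exp,
    one_mul] at hL
  exact (mul_le_mul_of_nonneg_right (le_abs_self C) (by positivity)).trans hL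

theorem exists_forall_log_of_eventually {P : ℝ → Prop} (h : ∀ᶠ L in Filter.atTop, P L) :
    ∃ N : ℕ, ∀ n ≥ N, P (Real.log n) :=
  Filter.eventually_atTop.1
    ((Real.tendsto_log_atTop.comp tendsto_natCast_atTop_atTop).eventually h)

variable {α β : ℝ}

theorem log_thirty_two_pos : 0 < Real.log 32 := Real.log_pos (by norm_num)

theorem pow_eq_exp (m : ℕ) {a : ℝ} (ha : 0 < a) : a ^ m = Real.exp (m * Real.log a) := by
  rw [mul_comm, Real.exp_mul, Real.exp_log ha, Real.rpow_natCast]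

set_option maxHeartbeats 1000000 in
-- A ball of radius of order `ρ = radius (8 r)` contains about `n * (r / n) * 8^(-m) * r^(-α) *
-- n^(-β)` backbone nodes. Asking for a multiple of `log² n` fixes `r`, and the diameter is of order
-- `1 / ρ`. The restriction `m ≤ A log n` keeps `32^m` below a small power of `n`, so that `8 r ≤
-- n`.
theorem marks_small_dimension_le (hα : α ∈ Set.Ioo (0 : ℝ) 1) (hβ : β ∈ Set.Ioo (0 : ℝ) (1 - α))
    (p : unitInterval) (hp : 0 < p) : ∃ A > (0 : ℝ), ∃ C > (0 : ℝ), ∃ N₀ : ℕ, ∀ n ≥ N₀,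
    ∀ m : ℕ, 1 ≤ m → (m : ℝ) ≤ A * Real.log n → ∀ b : Fin n → ℕ, Function.Injective b →
    (Measure.pi fun _ => markLaw n m p) {M | ∃ G ∈ {G : SimpleGraph (Fin n) |
      ¬ G.ediam ≤ (⌊C * ((n : ℝ) ^ (β / ((1 - α) * m)) *
        Real.log n ^ (2 * α / ((1 - α) * m)))⌋₊ : ℕ)},
      Compatible α β (lowRank n) (hiRank n) b M G} ≤
      ENNReal.ofReal (6 * Real.exp (-Real.log n ^ 2)) := by
  obtain ⟨hα0, hα1⟩ := hα
  obtain ⟨hβ0, hβ1⟩ := hβ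
  have hp0 : (0 : ℝ) < p := hp
  have hp1 : (p : ℝ) ≤ 1 := p.2.2
  set δ : ℝ := 1 - α - β with hδ
  have hδ0 : 0 < δ := by linarith
  set γ : ℝ := 1 - α with hγ
  have hγ0 : 0 < γ := by linarith
  have hγ1 : γ ≤ 1 := by linarith
  set c₁ : ℝ := 2 / (p : ℝ) ^ 2 with hc₁
  have hc₁0 : 0 < c₁ := by positivity
  set B : ℝ := 96 * (c₁ + 6) with hB
  have hB1 : 1 ≤ B := by linarith
  have hlB : 0 ≤ Real.log B := Real.log_nonneg hB1
  set l8 := Real.log 8 with hl8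
  have hl80 : 0 < l8 := Real.log_pos (by norm_num)
  set l2 := Real.log 2 with hl2
  have hl20 : 0 < l2 := Real.log_pos (by norm_num)
  have hl832 : l8 ≤ Real.log 32 := Real.log_le_log (by norm_num) (by norm_num)
  have hl232 : l2 ≤ Real.log 32 := Real.log_le_log (by norm_num) (by norm_num)
  set C : ℝ := 18 * Real.exp (α * l8 + α / γ * Real.log B + α / γ * l8) with hC
  refine ⟨δ / (4 * Real.log 32), by have := log_thirty_two_pos; positivity, C, by positivity, ?_⟩
  have ev : ∀ᶠ L : ℝ in Filter.atTop, 3 ≤ L ∧ 1 * L ^ 5 ≤ Real.exp (β * L) ∧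
      8 * B * L ^ 2 ≤ Real.exp (3 / 4 * δ * L) ∧
      12 * (c₁ + 6) * L ^ 2 ≤ Real.exp (3 / 4 * δ * L) := by
    filter_upwards [Filter.eventually_ge_atTop 3, eventually_mul_pow_le_exp 1 5 hβ0,
      eventually_mul_pow_le_exp (8 * B) 2 (show 0 < 3 / 4 * δ by positivity),
      eventually_mul_pow_le_exp (12 * (c₁ + 6)) 2 (show 0 < 3 / 4 * δ by positivity)]
      with L h1 h2 h3 h4 using ⟨h1, h2, h3, h4⟩
  obtain ⟨N₀, hN₀⟩ := exists_forall_log_of_eventually ev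
  refine ⟨max N₀ 2, fun n hn m hm hmA b hb => ?_⟩
  obtain ⟨hL3, hL5, hL8, hL12⟩ := hN₀ n (le_of_max_le_left hn)
  have hn2 : 2 ≤ n := le_of_max_le_right hn
  have : NeZero n := ⟨by omega⟩
  have hn0 : (0 : ℝ) < n := by exact_mod_cast (by omega : 0 < n)
  set L := Real.log n with hLdef
  have hL0 : 0 < L := by linarith
  have hnexp : (n : ℝ) = Real.exp L := (Real.exp_log hn0).symm
  have hm0 : (0 : ℝ) < m := by exact_mod_cast hm
  have hm1 : (1 : ℝ) ≤ m := by exact_mod_cast hm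
  have hm32 : m * Real.log 32 ≤ δ * L / 4 := by
    have := log_thirty_two_pos
    calc m * Real.log 32 ≤ δ / (4 * Real.log 32) * L * Real.log 32 := by gcongr
      _ = _ := by field_simp
  have hm8 : m * l8 ≤ δ * L / 4 := le_trans (by gcongr) hm32
  have hm2 : m * l2 ≤ δ * L / 4 := le_trans (by gcongr) hm32
  have hδL : δ * L ≤ L := mul_le_of_le_one_left hL0.le (by linarith)
  have hL2 : 3 * L ≤ L ^ 2 := by rw [pow_two]; exact mul_le_mul_of_nonneg_right hL3 hL0.le
  have hβL : β * L ≤ L := mul_le_of_le_one_left hL0.le (by linarith)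
  have hαL : α * L ≤ L := mul_le_of_le_one_left hL0.le (by linarith)
  -- Solves `r^(1-α) = B * 8^m * n^β * L²` for `r = exp (t / γ)`.
  set t : ℝ := Real.log B + m * l8 + β * L + 2 * Real.log L with ht
  have hlogL : 0 ≤ Real.log L := Real.log_nonneg (by linarith)
  have hexpB : Real.exp (Real.log B) = B := Real.exp_log (by linarith)
  have hexpL : Real.exp (2 * Real.log L) = L ^ 2 := by
    rw [mul_comm, Real.exp_mul, Real.exp_log hL0]; norm_cast
  have ht0 : 0 ≤ t := by positivity
  set r := Real.exp (t / γ) with hr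
  have hrt : t ≤ t / γ := le_div_self ht0 hγ0 hγ1
  have hr1 : 1 ≤ r := Real.one_le_exp (by positivity)
  have hcut : rankCutoff n ≤ r := by
    rw [rankCutoff]
    refine (by linarith : L ^ 5 ≤ Real.exp (β * L)).trans (Real.exp_le_exp.2 (le_trans ?_ hrt))
    have : 0 ≤ m * l8 := by positivity
    linarith
  have h8r : l8 + t / γ ≤ L := by
    have h1 : Real.exp (l8 + Real.log B + 2 * Real.log L) ≤ Real.exp (3 / 4 * δ * L) := by
      rw [Real.exp_add, Real.exp_add, hexpB, hexpL, Real.exp_log (by norm_num)]; exact hL8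
    rw [Real.exp_le_exp] at h1
    have h2 : γ * l8 + t ≤ γ * L := by
      have : γ * l8 ≤ l8 := mul_le_of_le_one_left hl80.le hγ1
      have : γ = δ + β := by rw [hδ, hγ]; ring
      rw [this, add_mul]
      linarith
    have : l8 + t / γ = (γ * l8 + t) / γ := by field_simp
    rw [this, div_le_iff₀ hγ0]; linarith
  have hrn : r ≤ n := by rw [hnexp]; exact Real.exp_le_exp.2 (by linarith)
  -- `exp (-s)` is the volume of the influence region at rank `8 * r`, that is, `(2 ρ)^m`.
  set s : ℝ := α * (l8 + t / γ) + β * L with hs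
  have hs0 : 0 ≤ s := by positivity
  have h8r' : 8 * r = Real.exp (l8 + t / γ) := by
    rw [Real.exp_add, Real.exp_log (by norm_num)]
  set ρ := Real.exp (-s / m) / 2 with hρdef
  have hρ : ρ = radius α β n m (8 * r) := by rw [h8r', radius_exp (by omega)]
  set s' : ℝ := α * L + β * L with hs'
  have hs'0 : 0 ≤ s' := by positivity
  set ρ' := Real.exp (-s' / m) / 2 with hρ'def
  have hρ' : ρ' = radius α β n m n := by
    rw [hnexp, radius_exp (by omega)]
  have hρ0 : 0 < ρ := by positivity
  have hρ'0 : 0 < ρ' := by positivity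
  have hρ1 : 2 * ρ ≤ 1 := by
    have : Real.exp (-s / m) ≤ 1 := Real.exp_le_one_iff.2 (by
      rw [neg_div]; simp; positivity)
    linarith
  have hρ'1 : 2 * ρ' ≤ 1 := by
    have : Real.exp (-s' / m) ≤ 1 := Real.exp_le_one_iff.2 (by
      rw [neg_div]; simp; positivity)
    linarith
  set N := ⌈c₁ * L ^ 2⌉₊ with hNdef
  have hN1 : c₁ * L ^ 2 ≤ N := Nat.le_ceil _
  have hN2 : (N : ℝ) ≤ c₁ * L ^ 2 + 1 := (Nat.ceil_lt_add_one (by positivity)).le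
  have hNpos : 1 ≤ N := Nat.ceil_pos.2 (by positivity)
  set J := ⌈2 / ρ⌉₊ with hJdef
  have hJ1 : 2 / ρ ≤ J := Nat.le_ceil _
  have hJ2 : (J : ℝ) ≤ 2 / ρ + 1 := (Nat.ceil_lt_add_one (by positivity)).le
  have hJpos : 0 < J := Nat.ceil_pos.2 (by positivity)
  have hJρ : 1 / (2 * J) ≤ ρ / 4 := by
    have : (0 : ℝ) < J := by exact_mod_cast hJpos
    rw [div_le_iff₀ hρ0] at hJ1
    rw [div_le_iff₀ (by positivity)]
    linarith
  obtain ⟨O, hO1, hO2, hO⟩ := exists_median_split hn2 hb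
  have hexpm : ∀ a : ℝ, Real.exp (a / m) ^ m = Real.exp a := by
    intro a
    rw [← Real.exp_nat_mul]; congr 1; field_simp
  have hmain : ∀ I : Finset (Fin n), n ≤ 3 * I.card →
      (2 / (ρ / 8)) ^ m * Real.exp (N - I.card * (r / (2 * n) * (2 * (ρ / 8)) ^ m) / 2) ≤
        Real.exp (-L ^ 2) := by
    intro I hI
    have hI' : (n : ℝ) / 3 ≤ I.card := by
      rw [div_le_iff₀ (by norm_num)]; exact_mod_cast (by omega : n ≤ I.card * 3)
    have e1 : (2 / (ρ / 8)) ^ m = Real.exp (m * Real.log 32 + s) := by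
      have : 2 / (ρ / 8) = 32 * Real.exp (s / m) := by
        rw [hρdef, neg_div, Real.exp_neg]; field_simp; norm_num
      rw [this, mul_pow, hexpm, pow_eq_exp m (by norm_num : (0 : ℝ) < 32), ← Real.exp_add]
    have e2 : (2 * (ρ / 8)) ^ m = Real.exp (-(m * l8) - s) := by
      have : 2 * (ρ / 8) = 8⁻¹ * Real.exp (-s / m) := by rw [hρdef]; ring
      rw [this, mul_pow, hexpm, inv_pow, pow_eq_exp m (by norm_num : (0 : ℝ) < 8), ← Real.exp_neg,
        ← Real.exp_add]
      rfl
    have e3 : r * Real.exp (-(m * l8) - s) ≥ B * L ^ 2 / 8 := by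
      have : B * L ^ 2 / 8 = Real.exp (Real.log B + 2 * Real.log L - l8) := by
        rw [Real.exp_sub, Real.exp_add, hexpB, hexpL, Real.exp_log (by norm_num)]
      rw [this, hr, ← Real.exp_add, ge_iff_le, Real.exp_le_exp, hs]
      have h1 : t / γ - α * (t / γ) = t := by
        have : t / γ - α * (t / γ) = γ * (t / γ) := by rw [hγ]; ring
        rw [this]; field_simp
      have h2 : α * l8 ≤ l8 := mul_le_of_le_one_left hl80.le hα1.le
      linarith
    rw [e1, e2, ← Real.exp_add, Real.exp_le_exp]
    have e4 : B * L ^ 2 / 96 ≤ I.card * (r / (2 * n) * Real.exp (-(m * l8) - s)) / 2 := by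
      calc B * L ^ 2 / 96 ≤ (r * Real.exp (-(m * l8) - s)) / 12 := by linarith
        _ = (n / 3) * (r / (2 * n) * Real.exp (-(m * l8) - s)) / 2 := by field_simp; norm_num
        _ ≤ _ := by gcongr
    have e5 : s ≤ 2 * L := by
      have : α * (l8 + t / γ) ≤ α * L := mul_le_mul_of_nonneg_left h8r hα0.le
      linarith
    have e6 : B * L ^ 2 / 96 = c₁ * L ^ 2 + 6 * L ^ 2 := by rw [hB]; ring
    linarith
  have hmain' : (2 / (ρ' / 2)) ^ m * Real.exp (N - Oᶜ.card * (n / (2 * n) *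
      (2 * (ρ' / 2)) ^ m) / 2) ≤ Real.exp (-L ^ 2) := by
    have hI' : (n : ℝ) / 3 ≤ Oᶜ.card := by
      rw [div_le_iff₀ (by norm_num)]; exact_mod_cast (by omega : n ≤ Oᶜ.card * 3)
    have e1 : (2 / (ρ' / 2)) ^ m = Real.exp (m * l8 + s') := by
      have : 2 / (ρ' / 2) = 8 * Real.exp (s' / m) := by
        rw [hρ'def, neg_div, Real.exp_neg]; field_simp; norm_num
      rw [this, mul_pow, hexpm, pow_eq_exp m (by norm_num : (0 : ℝ) < 8), ← Real.exp_add]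
    have e2 : (2 * (ρ' / 2)) ^ m = Real.exp (-(m * l2) - s') := by
      have : 2 * (ρ' / 2) = 2⁻¹ * Real.exp (-s' / m) := by rw [hρ'def]; ring
      rw [this, mul_pow, hexpm, inv_pow, pow_eq_exp m (by norm_num : (0 : ℝ) < 2), ← Real.exp_neg,
        ← Real.exp_add]
      rfl
    have e3 : n * Real.exp (-(m * l2) - s') ≥ 12 * (c₁ + 6) * L ^ 2 := by
      refine hL12.trans ?_
      rw [hnexp, ← Real.exp_add, Real.exp_le_exp, hs']
      have : δ * L = L - α * L - β * L := by rw [hδ]; ring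
      linarith
    rw [e1, e2, ← Real.exp_add, Real.exp_le_exp]
    have e4 : (c₁ + 6) * L ^ 2 ≤ Oᶜ.card * (n / (2 * n) * Real.exp (-(m * l2) - s')) / 2 := by
      calc (c₁ + 6) * L ^ 2 ≤ (n * Real.exp (-(m * l2) - s')) / 12 := by linarith
        _ = (n / 3) * (n / (2 * n) * Real.exp (-(m * l2) - s')) / 2 := by field_simp; norm_num
        _ ≤ _ := by gcongr
    have e5 : s' ≤ 2 * L := by linarith
    have e6 : (c₁ + 6) * L ^ 2 = c₁ * L ^ 2 + 6 * L ^ 2 := by ring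
    linarith
  have hcoin : 3 * ((n : ℝ) ^ 2 * (1 - (p : ℝ) ^ 2) ^ N) ≤ 3 * Real.exp (-L ^ 2) := by
    have h1 : (1 - (p : ℝ) ^ 2) ≤ Real.exp (-(p : ℝ) ^ 2) := by
      have := Real.add_one_le_exp (-(p : ℝ) ^ 2); linarith
    have h0 : 0 ≤ 1 - (p : ℝ) ^ 2 := by
      have := pow_le_one₀ hp0.le hp1 (n := 2); linarith
    have h2 : (1 - (p : ℝ) ^ 2) ^ N ≤ Real.exp (-(2 * L ^ 2)) := by
      refine (pow_le_pow_left₀ h0 h1 N).trans ?_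
      rw [← Real.exp_nat_mul, Real.exp_le_exp]
      have : 2 * L ^ 2 ≤ N * (p : ℝ) ^ 2 := by
        calc 2 * L ^ 2 = c₁ * L ^ 2 * (p : ℝ) ^ 2 := by rw [hc₁]; field_simp
          _ ≤ _ := by gcongr
      linarith
    have h3 : (n : ℝ) ^ 2 = Real.exp (2 * L) := by
      rw [hnexp, ← Real.exp_nat_mul]; norm_cast
    gcongr
    rw [h3]
    refine (mul_le_mul_of_nonneg_left h2 (Real.exp_pos _).le).trans ?_
    rw [← Real.exp_add, Real.exp_le_exp]; linarith
  have hfloor : 2 * J + 8 ≤ ⌊C * ((n : ℝ) ^ (β / (γ * m)) * L ^ (2 * α / (γ * m)))⌋₊ := by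
    apply Nat.le_floor
    push_cast
    have h1 : (2 * J + 8 : ℝ) ≤ 9 / ρ := by
      have : 2 ≤ 1 / ρ := by rw [le_div_iff₀ hρ0]; linarith
      have h4 : 2 / ρ = 2 * (1 / ρ) := by ring
      have h9 : 9 / ρ = 9 * (1 / ρ) := by ring
      rw [h9]; linarith
    refine h1.trans ?_
    have h2 : 9 / ρ = 18 * Real.exp (s / m) := by
      rw [hρdef, neg_div, Real.exp_neg]; field_simp; norm_num
    rw [h2, hC, mul_assoc, hnexp, ← Real.exp_mul, Real.rpow_def_of_pos hL0, ← Real.exp_add,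
      ← Real.exp_add]
    gcongr
    -- The term `m * l8` in `t` is divided by `m` and leaves only a constant factor; the terms `β *
    -- L` and `2 log L` give the two powers in the bound.
    have h3 : s / m = (α * l8 + α / γ * Real.log B) / m + α / γ * l8 +
        (L * (β / (γ * m)) + Real.log L * (2 * α / (γ * m))) := by
      have e1 : β / γ = α / γ * β + β := by
        have : α = 1 - γ := by rw [hγ]; ring
        rw [this]; field_simp; ring
      have e2 : s = (α * l8 + α / γ * Real.log B) + m * (α / γ * l8) +
          (L * (β / γ) + Real.log L * (2 * α / γ)) := by
        rw [hs, ht, e1]; ring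
      rw [e2]; field_simp
    rw [h3]
    have h4 : (α * l8 + α / γ * Real.log B) / m ≤ α * l8 + α / γ * Real.log B :=
      div_le_self (by positivity) hm1
    linarith
  refine le_trans (measure_mono ?_) ((marks_backbone_le p hα0.le hO hcut hρ hρ' hNpos hJpos hJρ _ _
    _ (marks_net_count_le p O hr1 hrn (by positivity) (by linarith) N)
    (marks_net_count_le p Oᶜ hr1 hrn (by positivity) (by linarith) N)
    (marks_net_count_le p Oᶜ (by exact_mod_cast (by omega : 1 ≤ n)) le_rfl (by positivity)
      (by linarith) N)).trans ?_)
  · rintro M ⟨G, hG, hc⟩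
    exact ⟨G, fun h => hG (h.trans (by exact_mod_cast hfloor)), hc⟩
  · have h6 : 6 * Real.exp (-L ^ 2) = Real.exp (-L ^ 2) + Real.exp (-L ^ 2) + Real.exp (-L ^ 2) +
        3 * Real.exp (-L ^ 2) := by ring
    rw [h6, ENNReal.ofReal_add (by positivity) (by positivity),
      ENNReal.ofReal_add (by positivity) (by positivity),
      ENNReal.ofReal_add (by positivity) (by positivity)]
    gcongr
    exacts [hmain O hO1, hmain Oᶜ hO2]

end SmallDimensionAsymptotics


/-! ### Iterated kernels and weighted path counts. -/

section Kernel

variable {X : Type*} [MeasurableSpace X] (μ : Measure X) (b : X → X → ENNReal)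

/-- The integral operator with kernel `b`. -/
noncomputable def kerOp (ψ : X → ENNReal) : X → ENNReal := fun w => ∫⁻ z, b w z * ψ z ∂μ

/-- The kernel of the `(j + 1)`-st power of the integral operator with kernel `b`. -/
noncomputable def kerIter (j : ℕ) (w z : X) : ENNReal := (kerOp μ b)^[j] (fun u => b u z) w

theorem kerIter_zero (w z : X) : kerIter μ b 0 w z = b w z := rfl

theorem kerIter_succ (j : ℕ) (w z : X) :
    kerIter μ b (j + 1) w z = ∫⁻ u, b w u * kerIter μ b j u z ∂μ := by
  rw [kerIter, Function.iterate_succ_apply']; rfl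

variable {b} {x : X} {N : ℕ}

section

variable [SFinite μ] (hb : Measurable (Function.uncurry b))
include hb

theorem measurable_kerOp {ψ : X → ENNReal} (hψ : Measurable ψ) : Measurable (kerOp μ b ψ) := by
  refine Measurable.lintegral_prod_right' (f := fun q : X × X => b q.1 q.2 * ψ q.2) ?_
  exact hb.mul (hψ.comp measurable_snd)

theorem measurable_kerOp_iterate {ψ : X → ENNReal} (hψ : Measurable ψ) (j : ℕ) :
    Measurable ((kerOp μ b)^[j] ψ) := by
  induction j generalizing ψ with
  | zero => exact hψ
  | succ j ih => exact ih (measurable_kerOp μ hb hψ)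

theorem measurable_kerIter (j : ℕ) : Measurable fun q : X × X => kerIter μ b j q.1 q.2 := by
  induction j with
  | zero => exact hb
  | succ j ih =>
    simp_rw [kerIter_succ]
    refine Measurable.lintegral_prod_right'
      (f := fun q : (X × X) × X => b q.1.1 q.2 * kerIter μ b j q.2 q.1.2) ?_
    refine (hb.comp (f := fun q : (X × X) × X => (q.1.1, q.2)) (by fun_prop)).mul
      (ih.comp (f := fun q : (X × X) × X => (q.2, q.1.2)) (by fun_prop))

theorem kerOp_iterate_succ_apply {ψ : X → ENNReal} (hψ : Measurable ψ) (j : ℕ) (w : X) :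
    (kerOp μ b)^[j + 1] ψ w = ∫⁻ z, kerIter μ b j w z * ψ z ∂μ := by
  induction j generalizing w with
  | zero => rfl
  | succ j ih =>
    rw [Function.iterate_succ_apply']
    change ∫⁻ u, b w u * (kerOp μ b)^[j + 1] ψ u ∂μ = _
    simp_rw [ih, kerIter_succ]
    have hm := measurable_kerIter μ hb j
    have h1 : ∀ u, b w u * ∫⁻ z, kerIter μ b j u z * ψ z ∂μ =
        ∫⁻ z, b w u * (kerIter μ b j u z * ψ z) ∂μ := fun u =>
      (lintegral_const_mul _ ((hm.comp (measurable_prodMk_left (x := u))).mul hψ)).symm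
    simp_rw [h1]
    rw [lintegral_lintegral_swap]
    · refine lintegral_congr fun z => ?_
      rw [← lintegral_mul_const]
      · simp_rw [mul_assoc]
      · exact (hb.comp (measurable_prodMk_left (x := w))).mul
          (hm.comp (measurable_prodMk_right (y := z)))
    · refine Measurable.aemeasurable ?_
      exact (hb.comp (f := fun q : X × X => (w, q.1)) (by fun_prop)).mul
        (hm.mul (hψ.comp measurable_snd))

/-- The Chapman-Kolmogorov equation; index `j` stands for `j + 1` steps, hence the index `i + j +
1`. -/
theorem kerIter_add (i j : ℕ) (w z : X) :
    kerIter μ b (i + j + 1) w z = ∫⁻ u, kerIter μ b i w u * kerIter μ b j u z ∂μ := by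
  rw [kerIter, show i + j + 1 = (i + 1) + j by ring, Function.iterate_add_apply,
    kerOp_iterate_succ_apply μ hb]
  · rfl
  · exact measurable_kerOp_iterate μ hb (hb.comp measurable_prodMk_right) j

end

/-- One of the `j + 1` factors is bounded by `1`, the others are integrated. This is the only bound
available before the kernel has mixed. -/
theorem kerIter_le_pow (hb : Measurable (Function.uncurry b)) (hb1 : ∀ w z, b w z ≤ 1) {v : ENNReal} (hv : ∀ w, ∫⁻ z, b w z ∂μ ≤ v)
    (j : ℕ) (w z : X) : kerIter μ b j w z ≤ v ^ j := by
  induction j generalizing w with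
  | zero => simpa [kerIter_zero] using hb1 w z
  | succ j ih =>
    rw [kerIter_succ]
    calc ∫⁻ u, b w u * kerIter μ b j u z ∂μ ≤ ∫⁻ u, b w u * v ^ j ∂μ :=
          lintegral_mono fun u => mul_le_mul_right (ih u) _
      _ = (∫⁻ u, b w u ∂μ) * v ^ j :=
          lintegral_mul_const _ (hb.comp (measurable_prodMk_left (x := w)))
      _ ≤ v * v ^ j := by gcongr; exact hv w
      _ = _ := by ring

variable (b x) in
/-- The weighted number of paths from `x` through successive blocks of `N` points. -/
noncomputable def pathSum : (j : ℕ) → (Fin j → Fin N → X) → (X → ENNReal) → ENNReal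
  | 0, _, ψ => ψ x
  | j + 1, ω, ψ => ∑ a, pathSum j (Fin.init ω) (fun u => b u (ω (Fin.last j) a)) *
      ψ (ω (Fin.last j) a)

variable (hb : Measurable (Function.uncurry b))

include hb in
theorem measurable_pathSum_kernel (j : ℕ) : Measurable fun q : (Fin j → Fin N → X) × X =>
    pathSum b x j q.1 (fun u => b u q.2) := by
  induction j with
  | zero => exact hb.comp (f := fun q : (Fin 0 → Fin N → X) × X => (x, q.2)) (by fun_prop)
  | succ j ih =>
    simp only [pathSum]
    refine Finset.measurable_sum _ fun a _ => ?_
    refine (ih.comp (f := fun q : (Fin (j + 1) → Fin N → X) × X =>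
      (Fin.init q.1, q.1 (Fin.last j) a)) ?_).mul
      (hb.comp (f := fun q : (Fin (j + 1) → Fin N → X) × X => (q.1 (Fin.last j) a, q.2)) ?_)
    · refine Measurable.prodMk (measurable_pi_lambda _ fun i => ?_) (by fun_prop)
      simp only [Fin.init]
      fun_prop
    · fun_prop

include hb in
theorem measurable_pathSum (j : ℕ) {ψ : X → ENNReal} (hψ : Measurable ψ) :
    Measurable fun ω : Fin j → Fin N → X => pathSum b x j ω ψ := by
  cases j with
  | zero => exact measurable_const
  | succ j =>
    simp only [pathSum]
    refine Finset.measurable_sum _ fun a _ => ?_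
    refine ((measurable_pathSum_kernel hb j).comp (f := fun ω : Fin (j + 1) → Fin N → X =>
      (Fin.init ω, ω (Fin.last j) a)) ?_).mul
      (hψ.comp (f := fun ω : Fin (j + 1) → Fin N → X => ω (Fin.last j) a) ?_)
    · refine Measurable.prodMk (measurable_pi_lambda _ fun i => ?_) (by fun_prop)
      simp only [Fin.init]
      fun_prop
    · fun_prop

include hb in
-- Averaging over one more random point after the last block is the same as applying the operator to
-- the end weight; this drives the recursions for the moments.
theorem pathSum_kerOp [SFinite μ] (j : ℕ) (ω : Fin j → Fin N → X) {ψ : X → ENNReal}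
    (hψ : Measurable ψ) :
    pathSum b x j ω (kerOp μ b ψ) = ∫⁻ w, pathSum b x j ω (fun u => b u w) * ψ w ∂μ := by
  cases j with
  | zero => rfl
  | succ j =>
    simp only [pathSum, Finset.sum_mul]
    rw [lintegral_finsetSum]
    · refine Finset.sum_congr rfl fun a _ => ?_
      simp_rw [mul_assoc]
      rw [lintegral_const_mul]
      · rfl
      · exact (hb.comp measurable_prodMk_left).mul hψ
    · intro a _
      exact (measurable_const.mul (hb.comp measurable_prodMk_left)).mul hψ

omit [MeasurableSpace X] in
theorem pathSum_ne_zero_of_succ (j : ℕ) (ω : Fin (j + 1) → Fin N → X) {ψ : X → ENNReal}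
    (h : pathSum b x (j + 1) ω ψ ≠ 0) : ∃ a, ψ (ω (Fin.last j) a) ≠ 0 ∧
      pathSum b x j (Fin.init ω) (fun u => b u (ω (Fin.last j) a)) ≠ 0 := by
  simp only [pathSum, ne_eq, Finset.sum_eq_zero_iff, Finset.mem_univ, true_imp_iff,
    not_forall, mul_eq_zero, not_or] at h
  obtain ⟨a, h1, h2⟩ := h
  exact ⟨a, h2, h1⟩

end Kernel

/-! ### First and second moments of the number of paths. -/

section Moments

variable {X : Type*} [MeasurableSpace X] (μ : Measure X) [IsProbabilityMeasure μ]
  {b : X → X → ENNReal} {x : X} {N : ℕ}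

theorem lintegral_pi_sum {ι : Type*} [Fintype ι] {h : X → ENNReal} (hh : Measurable h) :
    ∫⁻ ω : ι → X, ∑ a, h (ω a) ∂(Measure.pi fun _ => μ) = Fintype.card ι * ∫⁻ w, h w ∂μ := by
  rw [lintegral_finsetSum (f := fun a (ω : ι → X) => h (ω a)) _
    fun a _ => hh.comp (measurable_pi_apply a)]
  have : ∀ a, ∫⁻ ω : ι → X, h (ω a) ∂(Measure.pi fun _ => μ) = ∫⁻ w, h w ∂μ := fun a => by
    rw [← lintegral_map hh (measurable_pi_apply a), (measurePreserving_eval _ a).map_eq]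
  simp [this]

/-- Pairs of different indices are independent and give the squared mean; the diagonal gives the
second term. -/
theorem lintegral_pi_sum_sq_le {ι : Type*} [Fintype ι] {h : X → ENNReal} (hh : Measurable h) :
    ∫⁻ ω : ι → X, (∑ a, h (ω a)) ^ 2 ∂(Measure.pi fun _ => μ) ≤
      Fintype.card ι ^ 2 * (∫⁻ w, h w ∂μ) ^ 2 + Fintype.card ι * ∫⁻ w, h w ^ 2 ∂μ := by
  classical
  have hm : ∀ a, Measurable fun ω : ι → X => h (ω a) := fun a => hh.comp (measurable_pi_apply a)
  have h1 : ∀ a c, ∫⁻ ω : ι → X, h (ω a) * h (ω c) ∂(Measure.pi fun _ => μ) ≤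
      (∫⁻ w, h w ∂μ) ^ 2 + if a = c then ∫⁻ w, h w ^ 2 ∂μ else 0 := by
    intro a c
    split_ifs with hac
    · subst hac
      refine le_add_left ?_
      simp_rw [← pow_two]
      rw [← lintegral_map (f := fun w => h w ^ 2) (hh.pow_const 2) (measurable_pi_apply a),
        (measurePreserving_eval _ a).map_eq]
    · have := lintegral_pi_prod (fun _ : ι => μ)
        (f := fun i => if i = a ∨ i = c then h else fun _ => 1) (fun i => by
          split_ifs <;> fun_prop)
      have e1 : ∀ g : ι → ENNReal, (∀ i, ¬ (i = a ∨ i = c) → g i = 1) → ∏ i, g i = g a * g c := by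
        intro g hg
        rw [← Finset.prod_subset (Finset.subset_univ {a, c}) (fun i _ hi => hg i (by simpa using hi)),
          Finset.prod_pair hac]
      rw [e1 _ (fun i hi => by simp [hi])] at this
      have e2 : ∀ ω : ι → X, ∏ i, (if i = a ∨ i = c then h else fun _ => 1) (ω i) =
          h (ω a) * h (ω c) := fun ω => by
        rw [e1 _ (fun i hi => by simp [hi])]; simp
      simp_rw [e2] at this
      rw [this, add_zero, pow_two]
      simp
  simp_rw [pow_two (∑ a, h _), Finset.sum_mul_sum]
  rw [lintegral_finsetSum (f := fun a (ω : ι → X) => ∑ c, h (ω a) * h (ω c)) _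
    fun a _ => Finset.measurable_sum _ fun c _ => (hm a).mul (hm c)]
  calc _ = ∑ a, ∑ c, ∫⁻ ω : ι → X, h (ω a) * h (ω c) ∂(Measure.pi fun _ => μ) :=
        Finset.sum_congr rfl fun a _ => lintegral_finsetSum _ fun c _ => (hm a).mul (hm c)
    _ ≤ ∑ a : ι, ∑ c : ι, ((∫⁻ w, h w ∂μ) ^ 2 + if a = c then ∫⁻ w, h w ^ 2 ∂μ else 0) :=
        Finset.sum_le_sum fun a _ => Finset.sum_le_sum fun c _ => h1 a c
    _ = _ := by
      simp only [Finset.sum_add_distrib, Finset.sum_const, Finset.card_univ, nsmul_eq_mul,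
        Finset.sum_ite_eq, Finset.mem_univ, if_true]
      ring

variable (hb : Measurable (Function.uncurry b))
include hb

theorem lintegral_pathSum (j : ℕ) {ψ : X → ENNReal} (hψ : Measurable ψ) :
    ∫⁻ ω : Fin j → Fin N → X, pathSum b x j ω ψ ∂(Measure.pi fun _ => Measure.pi fun _ => μ) =
      N ^ j * (kerOp μ b)^[j] ψ x := by
  induction j generalizing ψ with
  | zero => simp [pathSum]
  | succ j ih =>
    have hF := measurable_pathSum_kernel (x := x) (N := N) hb j
    have hs := lintegral_pi_fin_succ (Measure.pi fun _ : Fin N => μ) j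
      (g := fun q : (Fin j → Fin N → X) × (Fin N → X) =>
        ∑ a, pathSum b x j q.1 (fun u => b u (q.2 a)) * ψ (q.2 a)) (by
        refine Finset.measurable_sum _ fun a _ => ?_
        exact (hF.comp (f := fun q : (Fin j → Fin N → X) × (Fin N → X) => (q.1, q.2 a))
          (by fun_prop)).mul (hψ.comp (by fun_prop)))
    refine hs.trans ?_
    have h1 : ∀ ω : Fin j → Fin N → X, ∫⁻ ξ : Fin N → X,
        ∑ a, pathSum b x j ω (fun u => b u (ξ a)) * ψ (ξ a) ∂(Measure.pi fun _ => μ) =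
        N * pathSum b x j ω (kerOp μ b ψ) := by
      intro ω
      rw [lintegral_pi_sum μ (h := fun w => pathSum b x j ω (fun u => b u w) * ψ w)
        ((hF.comp measurable_prodMk_left).mul hψ), pathSum_kerOp μ hb j ω hψ, Fintype.card_fin]
    simp_rw [h1]
    rw [lintegral_const_mul _ (measurable_pathSum hb j (measurable_kerOp μ hb hψ)),
      ih (measurable_kerOp μ hb hψ), Function.iterate_succ_apply]
    ring

/-- Integrates the last block: either the two paths use different points there, and the points
average out to `kerOp`, or they share a point `w`, and two paths from `x` to `w` remain. -/
theorem lintegral_pathSum_sq_succ_le (j : ℕ) {ψ : X → ENNReal} (hψ : Measurable ψ) :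
    ∫⁻ ω : Fin (j + 1) → Fin N → X, pathSum b x (j + 1) ω ψ ^ 2
        ∂(Measure.pi fun _ => Measure.pi fun _ => μ) ≤
      N ^ 2 * ∫⁻ ω : Fin j → Fin N → X, pathSum b x j ω (kerOp μ b ψ) ^ 2
        ∂(Measure.pi fun _ => Measure.pi fun _ => μ) +
      N * ∫⁻ w, (∫⁻ ω : Fin j → Fin N → X, pathSum b x j ω (fun u => b u w) ^ 2
        ∂(Measure.pi fun _ => Measure.pi fun _ => μ)) * ψ w ^ 2 ∂μ := by
  have hF := measurable_pathSum_kernel (x := x) (N := N) hb j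
  have hs := lintegral_pi_fin_succ (Measure.pi fun _ : Fin N => μ) j
    (g := fun q : (Fin j → Fin N → X) × (Fin N → X) =>
      (∑ a, pathSum b x j q.1 (fun u => b u (q.2 a)) * ψ (q.2 a)) ^ 2) (by
      refine (Finset.measurable_sum _ fun a _ => ?_).pow_const 2
      exact (hF.comp (f := fun q : (Fin j → Fin N → X) × (Fin N → X) => (q.1, q.2 a))
        (by fun_prop)).mul (hψ.comp (by fun_prop)))
  refine hs.trans_le ?_
  have h1 : ∀ ω : Fin j → Fin N → X, ∫⁻ ξ : Fin N → X,
      (∑ a, pathSum b x j ω (fun u => b u (ξ a)) * ψ (ξ a)) ^ 2 ∂(Measure.pi fun _ => μ) ≤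
      N ^ 2 * pathSum b x j ω (kerOp μ b ψ) ^ 2 +
        N * ∫⁻ w, pathSum b x j ω (fun u => b u w) ^ 2 * ψ w ^ 2 ∂μ := by
    intro ω
    have := lintegral_pi_sum_sq_le μ (ι := Fin N)
      (h := fun w => pathSum b x j ω (fun u => b u w) * ψ w)
      ((hF.comp measurable_prodMk_left).mul hψ)
    rw [← pathSum_kerOp μ hb j ω hψ, Fintype.card_fin] at this
    simpa only [mul_pow] using this
  have hm : Measurable fun q : (Fin j → Fin N → X) × X =>
      pathSum b x j q.1 (fun u => b u q.2) ^ 2 * ψ q.2 ^ 2 :=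
    (hF.pow_const 2).mul ((hψ.comp measurable_snd).pow_const 2)
  refine (lintegral_mono h1).trans_eq ?_
  rw [lintegral_add_left (((measurable_pathSum hb j (measurable_kerOp μ hb hψ)).pow_const
      2).const_mul _), lintegral_const_mul _ ((measurable_pathSum hb j
      (measurable_kerOp μ hb hψ)).pow_const 2), lintegral_const_mul _ hm.lintegral_prod_right',
    lintegral_lintegral_swap hm.aemeasurable]
  congr 2
  refine lintegral_congr fun w => ?_
  have hF' : Measurable fun ω : Fin j → Fin N → X => pathSum b x j ω (fun u => b u w) ^ 2 :=
    (hF.comp measurable_prodMk_right).pow_const 2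
  exact lintegral_mul_const (ψ w ^ 2) hF'

/-- A bound for the second moment of the number of paths, in terms of uniform bounds `B` of the
iterated kernels. -/
theorem lintegral_pathSum_sq_le {k : ℕ} {B E : ℕ → ENNReal}
    (hB : ∀ i w z, kerIter μ b i w z ≤ B i)
    (hE : ∀ j < k, (N : ENNReal) ^ (2 * j) * B j +
      ∑ i ∈ Finset.range j, (N : ENNReal) ^ (2 * i + 1) * E (j - 1 - i) * B i ≤ E j)
    {j : ℕ} (hj : j ≤ k) {ψ : X → ENNReal} (hψ : Measurable ψ) {σ : ℕ → ENNReal}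
    (hσ : ∀ i w, (kerOp μ b)^[i] ψ w ≤ σ i) :
    ∫⁻ ω : Fin j → Fin N → X, pathSum b x j ω ψ ^ 2
        ∂(Measure.pi fun _ => Measure.pi fun _ => μ) ≤
      ((N : ENNReal) ^ (2 * j) * σ j +
        ∑ i ∈ Finset.range j, (N : ENNReal) ^ (2 * i + 1) * E (j - 1 - i) * σ i) *
        (kerOp μ b)^[j] ψ x := by
  induction j generalizing ψ σ with
  | zero =>
    have := hσ 0 x
    simp only [Function.iterate_zero, id] at this
    simp only [pathSum, lintegral_const, measure_univ, mul_one]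
    rw [pow_two]
    simp only [mul_zero, pow_zero, one_mul, Finset.range_zero, Finset.sum_empty, add_zero,
      Function.iterate_zero, id]
    gcongr
  | succ j ih =>
    refine (lintegral_pathSum_sq_succ_le μ hb j hψ).trans ?_
    have h1 := ih (by omega) (measurable_kerOp μ hb hψ) (σ := fun i => σ (i + 1))
      (fun i w => by rw [← Function.iterate_succ_apply]; exact hσ (i + 1) w)
    -- The induction hypothesis with end weight `b · w`. Its factor is what `E j` bounds, so pairs
    -- of paths that meet at `w` cost `E j` times the mean kernel.
    have h2 : ∀ w, ∫⁻ ω : Fin j → Fin N → X, pathSum b x j ω (fun u => b u w) ^ 2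
        ∂(Measure.pi fun _ => Measure.pi fun _ => μ) ≤ E j * kerIter μ b j x w := by
      intro w
      refine (ih (by omega) (hb.comp measurable_prodMk_right) (σ := B)
        (fun i z => hB i z w)).trans ?_
      exact mul_le_mul_left (hE j (by omega)) _
    have h3 : ∫⁻ w, (∫⁻ ω : Fin j → Fin N → X, pathSum b x j ω (fun u => b u w) ^ 2
        ∂(Measure.pi fun _ => Measure.pi fun _ => μ)) * ψ w ^ 2 ∂μ ≤
        E j * σ 0 * (kerOp μ b)^[j + 1] ψ x := by
      rw [kerOp_iterate_succ_apply μ hb hψ, ← lintegral_const_mul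
        (f := fun w => kerIter μ b j x w * ψ w) _
        (((measurable_kerIter μ hb j).comp measurable_prodMk_left).mul hψ)]
      refine lintegral_mono fun w => ?_
      calc _ ≤ (E j * kerIter μ b j x w) * (σ 0 * ψ w) := by
            rw [pow_two]
            gcongr
            · exact h2 w
            · exact hσ 0 w
        _ = _ := by ring
    refine (add_le_add (mul_le_mul_right h1 _) (mul_le_mul_right h3 _)).trans_eq ?_
    rw [← Function.iterate_succ_apply, Finset.sum_range_succ', add_mul, add_mul, add_mul,
      mul_add]
    rw [Finset.sum_mul, Finset.mul_sum, Finset.sum_mul]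
    rw [add_assoc]
    congr 1
    · ring
    · congr 1
      · refine Finset.sum_congr rfl fun i _ => ?_
        rw [show j + 1 - 1 - (i + 1) = j - 1 - i by omega]
        ring
      · simp only [Nat.add_sub_cancel, Nat.sub_zero, mul_zero, zero_add, pow_one]
        ring

end Moments


/-! ### The second moment method for paths between two points. -/

section PathProbability

/-- The numerical recursion behind the second moment method. -/
theorem second_moment_recursion {v H N : ℝ} {k₀ k : ℕ} (hv : 0 < v) (hH : 0 < H)
    (hvH : v * H ≤ 1) (hk₀ : 1 ≤ k₀) (hN : 0 < N) (hkN : 6 * k ≤ N * v) (hk : k₀ ≤ k)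
    {j : ℕ} (hj : j ≤ k) :
    N ^ (2 * j) * (if j < k₀ then v ^ j else v ^ (j + 1) * H) +
      ∑ i ∈ Finset.range j, N ^ (2 * i + 1) *
        ((N ^ 2 * v) ^ (j - 1 - i) * (4 * (v * H) + 2 * (k₀ / (N * v)) ^ ((j - 1 - i) / k₀))) *
        (if i < k₀ then v ^ i else v ^ (i + 1) * H) ≤
    (N ^ 2 * v) ^ j * (4 * (v * H) + 2 * (k₀ / (N * v)) ^ (j / k₀)) := by
  set τ : ℝ := k₀ / (N * v) with hτ
  set y := v * H with hy
  have hNv : 0 < N * v := by positivity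
  have hy0 : 0 < y := by positivity
  have hk₀' : (0 : ℝ) < k₀ := by exact_mod_cast hk₀
  have hkk : (k₀ : ℝ) ≤ k := by exact_mod_cast hk
  have hτ0 : 0 < τ := by positivity
  have hτ6 : τ ≤ 1 / 6 := by
    rw [hτ, div_le_iff₀ hNv]; linarith
  have hτ1 : τ ≤ 1 := by linarith
  set e : ℕ → ℝ := fun i => 4 * y + 2 * τ ^ (i / k₀) with he
  have he6 : ∀ i, e i ≤ 6 := fun i => by
    have : τ ^ (i / k₀) ≤ 1 := pow_le_one₀ hτ0.le hτ1
    simp only [he]; linarith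
  have he0 : ∀ i, 0 ≤ e i := fun i => by positivity
  have hterm : ∀ i ∈ Finset.range j, N ^ (2 * i + 1) * ((N ^ 2 * v) ^ (j - 1 - i) *
      e (j - 1 - i)) * (if i < k₀ then v ^ i else v ^ (i + 1) * H) =
      (N ^ 2 * v) ^ j * ((1 / (N * v)) * (e (j - 1 - i) * if i < k₀ then 1 else y)) := by
    intro i hi
    have hij : i < j := Finset.mem_range.1 hi
    have h1 : (N ^ 2 * v) ^ j = (N ^ 2 * v) ^ (j - 1 - i) * (N ^ 2 * v) ^ i * (N ^ 2 * v) := by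
      rw [← pow_add, ← pow_succ]; congr 1; omega
    have h2 : (N ^ 2 * v) ^ i = N ^ (2 * i) * v ^ i := by rw [mul_pow, pow_mul]
    rw [h1, h2, hy]
    split_ifs <;> field_simp <;> ring
  rw [Finset.sum_congr rfl hterm, ← Finset.mul_sum, ← Finset.mul_sum]
  have hfirst : N ^ (2 * j) * (if j < k₀ then v ^ j else v ^ (j + 1) * H) =
      (N ^ 2 * v) ^ j * (if j < k₀ then 1 else y) := by
    rw [mul_pow, ← pow_mul, hy]; split_ifs <;> ring
  rw [hfirst, ← mul_add]
  refine mul_le_mul_of_nonneg_left ?_ (by positivity)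
  change _ ≤ e j
  have hjk : (j : ℝ) ≤ k := by exact_mod_cast hj
  -- Before the mixing time `k₀` the crude value `6` for the bracket suffices. Later, the first `k₀`
  -- summands carry a factor `τ` and drive the geometric decay, while the others are small by the
  -- factor `v * H`.
  by_cases hjk₀ : j < k₀
  · have hsum : ∑ i ∈ Finset.range j, (e (j - 1 - i) * if i < k₀ then 1 else y) ≤ j * 6 := by
      have := Finset.sum_le_card_nsmul (Finset.range j)
        (fun i => e (j - 1 - i) * if i < k₀ then 1 else y) 6 (fun i hi => by
          have hij : i < j := Finset.mem_range.1 hi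
          rw [if_pos (by omega), mul_one]; exact he6 _)
      simpa using this
    have hdiv : j / k₀ = 0 := Nat.div_eq_of_lt hjk₀
    rw [if_pos hjk₀]
    simp only [he, hdiv, pow_zero]
    have : 1 / (N * v) * ∑ i ∈ Finset.range j, (e (j - 1 - i) * if i < k₀ then 1 else y) ≤ 1 := by
      calc _ ≤ 1 / (N * v) * (j * 6) := by gcongr
        _ ≤ 1 := by rw [one_div_mul_eq_div, div_le_one hNv]; linarith
    linarith
  · push Not at hjk₀
    obtain ⟨q, hq⟩ : ∃ q, j / k₀ = q + 1 :=
      ⟨j / k₀ - 1, by have := Nat.div_pos hjk₀ hk₀; omega⟩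
    have hb : ∀ i ∈ Finset.range j, (e (j - 1 - i) * if i < k₀ then 1 else y) ≤
        (if i < k₀ then 4 * y + 2 * τ ^ q else 0) + 6 * y := by
      intro i hi
      split_ifs with hik
      · have h1 : q ≤ (j - 1 - i) / k₀ := by
          rw [Nat.le_div_iff_mul_le hk₀]
          have h2 := Nat.div_mul_le_self j k₀
          rw [hq, add_mul, one_mul] at h2
          omega
        have h3 : τ ^ ((j - 1 - i) / k₀) ≤ τ ^ q := pow_le_pow_of_le_one hτ0.le hτ1 h1
        simp only [he, mul_one]; linarith
      · have := mul_le_mul_of_nonneg_right (he6 (j - 1 - i)) hy0.le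
        linarith
    have hcard : ((Finset.range j).filter (· < k₀)).card = k₀ := by
      have : (Finset.range j).filter (· < k₀) = Finset.range k₀ := by
        ext i; simp only [Finset.mem_filter, Finset.mem_range]; omega
      rw [this, Finset.card_range]
    have hsum := Finset.sum_le_sum hb
    rw [Finset.sum_add_distrib, ← Finset.sum_filter, Finset.sum_const, hcard, Finset.sum_const,
      Finset.card_range, nsmul_eq_mul, nsmul_eq_mul] at hsum
    have h4 : 1 / (N * v) * ∑ i ∈ Finset.range j, (e (j - 1 - i) * if i < k₀ then 1 else y) ≤
        τ * (4 * y + 2 * τ ^ q) + y := by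
      calc _ ≤ 1 / (N * v) * (k₀ * (4 * y + 2 * τ ^ q) + j * (6 * y)) := by gcongr
        _ = τ * (4 * y + 2 * τ ^ q) + (6 * j / (N * v)) * y := by rw [hτ]; ring
        _ ≤ _ := by
          gcongr
          refine mul_le_of_le_one_left hy0.le ?_
          rw [div_le_one hNv]; linarith
    rw [if_neg (by omega)]
    simp only [he, hq]
    have h5 : τ * (4 * y) ≤ 1 / 6 * (4 * y) := by gcongr
    rw [pow_succ]
    linarith

variable {X : Type*} [MeasurableSpace X] (μ : Measure X) [IsProbabilityMeasure μ]
  {b : X → X → ENNReal} {x : X} {N : ℕ}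

/-- Cauchy-Schwarz applied to `f` and the indicator of its support. -/
theorem sq_lintegral_le_measure_ne_zero {Ω : Type*} [MeasurableSpace Ω] (P : Measure Ω)
    {f : Ω → ENNReal} (hf : Measurable f) :
    (∫⁻ ω, f ω ∂P) ^ 2 ≤ (∫⁻ ω, f ω ^ 2 ∂P) * P {ω | f ω ≠ 0} := by
  have hs : MeasurableSet {ω | f ω ≠ 0} := hf (measurableSet_singleton 0).compl
  have h := ENNReal.lintegral_mul_le_Lp_mul_Lq P Real.HolderConjugate.two_two hf.aemeasurable
    (g := Set.indicator {ω | f ω ≠ 0} fun _ => 1) (measurable_const.indicator hs).aemeasurable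
  have h1 : ∀ ω, (f * Set.indicator {ω | f ω ≠ 0} fun _ => (1 : ENNReal)) ω = f ω := by
    intro ω
    by_cases h0 : f ω = 0 <;> simp [Set.indicator, h0]
  have h2 : ∀ ω, (Set.indicator {ω | f ω ≠ 0} (fun _ => (1 : ENNReal)) ω) ^ (2 : ℝ) =
      Set.indicator {ω | f ω ≠ 0} (fun _ => (1 : ENNReal)) ω := by
    intro ω
    by_cases h0 : f ω = 0 <;> simp [Set.indicator, h0]
  simp_rw [h1, h2] at h
  rw [lintegral_indicator hs, setLIntegral_const, one_mul] at h
  simp only [ENNReal.rpow_ofNat] at h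
  calc (∫⁻ ω, f ω ∂P) ^ 2 ≤ ((∫⁻ ω, f ω ^ 2 ∂P) ^ (1 / 2 : ℝ) *
        P {ω | f ω ≠ 0} ^ (1 / 2 : ℝ)) ^ 2 := by gcongr
    _ = _ := by
      rw [mul_pow, ← ENNReal.rpow_natCast, ← ENNReal.rpow_mul, ← ENNReal.rpow_natCast,
        ← ENNReal.rpow_mul]
      norm_num

/-- If the iterated kernels are close to constant, then a path from `x` to `y` exists with
probability not much less than one. -/
theorem pathSum_ne_zero_ge (hb : Measurable (Function.uncurry b)) (hb1 : ∀ w z, b w z ≤ 1)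
    {v H : ℝ} (hv : 0 < v) (hbv : ∀ w, ∫⁻ z, b w z ∂μ ≤ ENNReal.ofReal v) (hH : 0 < H)
    (hvH : v * H ≤ 1) {k₀ q : ℕ} (hk₀ : 1 ≤ k₀) (hq : 1 ≤ q) {y : X}
    (hup : ∀ i ≥ k₀, ∀ w z, kerIter μ b i w z ≤ ENNReal.ofReal (v ^ (i + 1) * H))
    (hlow : ENNReal.ofReal (v ^ (k₀ * q + 1) / H) ≤ kerIter μ b (k₀ * q) x y) (hN : 1 ≤ N)
    (hkN : 6 * (k₀ * q : ℕ) ≤ N * v) (hτ : (k₀ / (N * v)) ^ q ≤ v * H) :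
    ENNReal.ofReal (1 / (6 * H ^ 2)) ≤
      (Measure.pi fun _ : Fin (k₀ * q) => Measure.pi fun _ : Fin N => μ)
        {ω | pathSum b x (k₀ * q) ω (fun u => b u y) ≠ 0} := by
  set k := k₀ * q with hk
  have hN0 : (0 : ℝ) < N := by exact_mod_cast hN
  have hkk : k₀ ≤ k := Nat.le_mul_of_pos_right _ hq
  set B : ℕ → ENNReal := fun i => ENNReal.ofReal (if i < k₀ then v ^ i else v ^ (i + 1) * H)
  set e : ℕ → ℝ := fun j => (N ^ 2 * v) ^ j * (4 * (v * H) + 2 * (k₀ / (N * v)) ^ (j / k₀)) with he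
  set E : ℕ → ENNReal := fun j => ENNReal.ofReal (e j) with hEdef
  have hB : ∀ i w z, kerIter μ b i w z ≤ B i := by
    intro i w z
    by_cases hi : i < k₀
    · simp only [B, if_pos hi]
      rw [ENNReal.ofReal_pow hv.le]
      exact kerIter_le_pow μ hb hb1 hbv i w z
    · simp only [B, if_neg hi]
      exact hup i (by omega) w z
  have he0 : ∀ j, 0 ≤ e j := fun j => by positivity
  have hE : ∀ j ≤ k, (N : ENNReal) ^ (2 * j) * B j +
      ∑ i ∈ Finset.range j, (N : ENNReal) ^ (2 * i + 1) * E (j - 1 - i) * B i ≤ E j := by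
    intro j hj
    have hb0 : ∀ i, 0 ≤ (if i < k₀ then v ^ i else v ^ (i + 1) * H) := fun i => by
      split_ifs <;> positivity
    have hNe : (N : ENNReal) = ENNReal.ofReal N := (ENNReal.ofReal_natCast N).symm
    have h1 : ∀ i, (N : ENNReal) ^ (2 * i + 1) * E (j - 1 - i) * B i =
        ENNReal.ofReal ((N : ℝ) ^ (2 * i + 1) * e (j - 1 - i) *
          (if i < k₀ then v ^ i else v ^ (i + 1) * H)) := by
      intro i
      rw [ENNReal.ofReal_mul (mul_nonneg (by positivity) (he0 _)),
        ENNReal.ofReal_mul (by positivity), ENNReal.ofReal_pow hN0.le, ← hNe]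
    simp_rw [h1]
    rw [← ENNReal.ofReal_sum_of_nonneg (fun i _ => mul_nonneg (mul_nonneg (by positivity)
      (he0 _)) (hb0 _)), hNe, ← ENNReal.ofReal_pow hN0.le, ← ENNReal.ofReal_mul (by positivity),
      ← ENNReal.ofReal_add (mul_nonneg (by positivity) (hb0 _))
        (Finset.sum_nonneg fun i _ => mul_nonneg (mul_nonneg (by positivity) (he0 _)) (hb0 _))]
    exact ENNReal.ofReal_le_ofReal (second_moment_recursion hv hH hvH hk₀ hN0 hkN hkk hj)
  have hby : Measurable fun u => b u y := hb.comp measurable_prodMk_right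
  have hsq := (lintegral_pathSum_sq_le (x := x) μ hb hB (fun j hj => hE j hj.le) le_rfl hby
    (σ := B) (fun i w => hB i w y)).trans (mul_le_mul_left (hE k le_rfl) _)
  have hfirst := lintegral_pathSum (x := x) (N := N) μ hb k hby
  change _ = (N : ENNReal) ^ k * kerIter μ b k x y at hfirst
  change _ ≤ E k * kerIter μ b k x y at hsq
  have hcs := sq_lintegral_le_measure_ne_zero
    (Measure.pi fun _ : Fin k => Measure.pi fun _ : Fin N => μ)
    (measurable_pathSum (x := x) (N := N) hb k hby)
  rw [hfirst] at hcs
  set P := (Measure.pi fun _ : Fin k => Measure.pi fun _ : Fin N => μ)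
        {ω | pathSum b x k ω (fun u => b u y) ≠ 0} with hP
  have hPtop : P ≠ ⊤ := measure_ne_top _ _
  set g := kerIter μ b k x y with hg
  have hgtop : g ≠ ⊤ := ((hB k x y).trans_lt ENNReal.ofReal_lt_top).ne
  have hfin := hcs.trans (mul_le_mul_left hsq P)
  have hreal := ENNReal.toReal_mono (by finiteness) hfin
  simp only [ENNReal.toReal_mul, ENNReal.toReal_pow, ENNReal.toReal_natCast, hEdef,
    ENNReal.toReal_ofReal (he0 k)] at hreal
  have hg0 : v ^ (k + 1) / H ≤ g.toReal := by
    have := ENNReal.toReal_mono hgtop hlow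
    rwa [ENNReal.toReal_ofReal (by positivity)] at this
  have hgpos : 0 < g.toReal := lt_of_lt_of_le (by positivity) hg0
  -- For `k = k₀ * q` the decaying term is `τ ^ q ≤ v * H`, so the bracket is at most `6 * (v * H)`.
  have hek : e k ≤ (N ^ 2 * v) ^ k * (6 * (v * H)) := by
    simp only [he]
    rw [hk, Nat.mul_div_cancel_left _ hk₀]
    gcongr
    linarith
  -- The mean `N^k g` enters squared on the left and once on the right; what remains is `v^(k+1) /
  -- H` against `6 v^(k+1) H`.
  have hPr : 1 / (6 * H ^ 2) ≤ P.toReal := by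
    have h1 : ((N : ℝ) ^ k * g.toReal) ^ 2 ≤
        (N ^ 2 * v) ^ k * (6 * (v * H)) * g.toReal * P.toReal := hreal.trans (by gcongr)
    have h2 : g.toReal ≤ v ^ k * (6 * (v * H)) * P.toReal := by
      have h3 : 0 < (N : ℝ) ^ (2 * k) * g.toReal := by positivity
      refine le_of_mul_le_mul_left ?_ h3
      calc _ = ((N : ℝ) ^ k * g.toReal) ^ 2 := by ring
        _ ≤ _ := h1
        _ = _ := by rw [mul_pow]; ring
    have h4 := hg0.trans h2
    rw [div_le_iff₀ hH] at h4
    rw [div_le_iff₀ (by positivity)]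
    have h5 : 0 < v ^ (k + 1) := by positivity
    refine le_of_mul_le_mul_left ?_ h5
    calc v ^ (k + 1) * 1 ≤ v ^ k * (6 * (v * H)) * P.toReal * H := by linarith
      _ = _ := by ring
  rw [← ENNReal.ofReal_toReal hPtop]
  exact ENNReal.ofReal_le_ofReal hPr

end PathProbability


/-! ### Convergence of iterated ball kernels. -/

section BallKernel

variable {X : Type*} [PseudoMetricSpace X]

/-- The indicator kernel of balls of diameter `s`. -/
noncomputable def ballKernel (s : ℝ) (w z : X) : ENNReal :=
  (Metric.closedBall w (s / 2)).indicator 1 z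

theorem ballKernel_eq (s : ℝ) (w z : X) :
    ballKernel s w z = if dist w z ≤ s / 2 then 1 else 0 := by
  classical
  rw [ballKernel, Set.indicator_apply]
  simp [Metric.mem_closedBall, dist_comm]

theorem ballKernel_comm (s : ℝ) (w z : X) : ballKernel s w z = ballKernel s z w := by
  rw [ballKernel_eq, ballKernel_eq, dist_comm]

theorem ballKernel_le_one (s : ℝ) (w z : X) : ballKernel s w z ≤ 1 := by
  rw [ballKernel_eq]; split_ifs <;> simp

variable [SecondCountableTopology X] [MeasurableSpace X] [OpensMeasurableSpace X]

theorem measurable_ballKernel (s : ℝ) : Measurable (Function.uncurry (ballKernel (X := X) s)) := by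
  have : Function.uncurry (ballKernel (X := X) s) =
      fun q => if dist q.1 q.2 ≤ s / 2 then 1 else 0 := by
    funext q; exact ballKernel_eq s q.1 q.2
  rw [this]
  exact Measurable.ite (measurableSet_le (by fun_prop) measurable_const) measurable_const
    measurable_const

theorem measurable_ballKernel_right (s : ℝ) (w : X) : Measurable (ballKernel s w) :=
  (measurable_ballKernel s).comp (measurable_prodMk_left (x := w))

variable (μ : Measure X) {s : ℝ}

theorem kerIter_ballKernel_comm [SFinite μ] (i : ℕ) (w z : X) :
    kerIter μ (ballKernel s) i w z = kerIter μ (ballKernel s) i z w := by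
  induction i generalizing w z with
  | zero => exact ballKernel_comm s w z
  | succ i ih =>
    have := kerIter_add μ (measurable_ballKernel s) i 0 z w
    rw [add_zero] at this
    rw [kerIter_succ, this]
    refine lintegral_congr fun u => ?_
    rw [ih u z, ballKernel_comm s w u, mul_comm]; rfl

theorem measurable_kerIter_ballKernel_right [SFinite μ] (i : ℕ) (w : X) :
    Measurable fun u => kerIter μ (ballKernel s) i w u :=
  (measurable_kerIter μ (measurable_ballKernel s) i).comp (measurable_prodMk_left (x := w))

theorem measurable_kerIter_ballKernel_left [SFinite μ] (i : ℕ) (z : X) :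
    Measurable fun u => kerIter μ (ballKernel s) i u z := by
  simp_rw [kerIter_ballKernel_comm μ i _ z]
  exact measurable_kerIter_ballKernel_right μ i z

theorem lintegral_ballKernel_mul (w : X) (f : X → ENNReal) :
    ∫⁻ u, ballKernel s w u * f u ∂μ = ∫⁻ u in Metric.closedBall w (s / 2), f u ∂μ := by
  classical
  rw [← lintegral_indicator Metric.isClosed_closedBall.measurableSet]
  refine lintegral_congr fun u => ?_
  rw [ballKernel, Set.indicator_apply, Set.indicator_apply]
  split_ifs <;> simp

/-- The iterated kernel is close to its mean value. -/
def KernelNear (s : ℝ) (i : ℕ) (θ : ℝ) : Prop :=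
  ∀ w z : X, ENNReal.ofReal (s ^ (i + 1) * (1 - θ)) ≤ kerIter μ (ballKernel s) i w z ∧
    kerIter μ (ballKernel s) i w z ≤ ENNReal.ofReal (s ^ (i + 1) * (1 + θ))

theorem kernelNear_zero (h0 : 0 < s) (h1 : s ≤ 1) {θ : ℝ} (hθ : 1 / s ≤ θ) :
    KernelNear μ s 0 θ := by
  have h2 : 1 ≤ 1 / s := by rw [le_div_iff₀ h0]; linarith
  intro w z
  constructor
  · rw [ENNReal.ofReal_of_nonpos]
    · exact bot_le
    · have : 1 - θ ≤ 0 := by linarith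
      exact mul_nonpos_of_nonneg_of_nonpos (by positivity) this
  · refine (ballKernel_le_one s w z).trans ?_
    rw [← ENNReal.ofReal_one]
    refine ENNReal.ofReal_le_ofReal ?_
    rw [div_le_iff₀ h0] at hθ
    rw [zero_add, pow_one]
    linarith

variable [IsProbabilityMeasure μ]
  (hvol : ∀ w, μ (Metric.closedBall w (s / 2)) = ENNReal.ofReal s)
include hvol

theorem lintegral_ballKernel (w : X) : ∫⁻ u, ballKernel s w u ∂μ = ENNReal.ofReal s := by
  have := lintegral_ballKernel_mul μ (s := s) w (fun _ => 1)
  simpa [hvol] using this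

theorem lintegral_kerIter_ballKernel (h0 : 0 ≤ s) (i : ℕ) (z : X) :
    ∫⁻ u, kerIter μ (ballKernel s) i z u ∂μ = ENNReal.ofReal (s ^ (i + 1)) := by
  induction i generalizing z with
  | zero => simpa [kerIter_zero] using lintegral_ballKernel μ hvol z
  | succ i ih =>
    have hm := measurable_kerIter μ (measurable_ballKernel (X := X) s) i
    simp_rw [kerIter_succ]
    rw [lintegral_lintegral_swap]
    · have h2 : ∀ u, ∫⁻ y, ballKernel s z u * kerIter μ (ballKernel s) i u y ∂μ =
          ballKernel s z u * ENNReal.ofReal (s ^ (i + 1)) := fun u => by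
        rw [← ih u]
        exact lintegral_const_mul _ (measurable_kerIter_ballKernel_right μ i u)
      simp_rw [h2]
      rw [lintegral_mul_const _ (measurable_ballKernel_right s z), lintegral_ballKernel μ hvol,
        ← ENNReal.ofReal_mul h0, pow_succ' s (i + 1)]
    · refine Measurable.aemeasurable ?_
      exact ((measurable_ballKernel s).comp (f := fun q : X × X => (z, q.2))
        (by fun_prop)).mul (hm.comp (f := fun q : X × X => (q.2, q.1)) (by fun_prop))

variable {μ}

/-- Averaging over a ball does not increase the relative error. -/
theorem KernelNear.succ (h0 : 0 < s) {i : ℕ} {θ : ℝ} (h : KernelNear μ s i θ) :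
    KernelNear μ s (i + 1) θ := by
  intro w z
  rw [kerIter_succ, lintegral_ballKernel_mul]
  constructor
  · calc _ = ∫⁻ u in Metric.closedBall w (s / 2), ENNReal.ofReal (s ^ (i + 1) * (1 - θ)) ∂μ := by
          rw [setLIntegral_const, hvol, ← ENNReal.ofReal_mul' h0.le]
          congr 1; ring
      _ ≤ _ := lintegral_mono fun u => (h u z).1
  · calc _ ≤ ∫⁻ u in Metric.closedBall w (s / 2), ENNReal.ofReal (s ^ (i + 1) * (1 + θ)) ∂μ :=
          lintegral_mono fun u => (h u z).2
      _ = _ := by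
          rw [setLIntegral_const, hvol, ← ENNReal.ofReal_mul' h0.le]
          congr 1; ring

/-- The integral over the whole space is known exactly, so the integral over the ball errs only by
the error on its complement, of measure `1 - s`. The gain of `1 - s` matters when `s` is close to
`1`, as in high dimension. -/
theorem KernelNear.contract (h0 : 0 < s) (h1 : s ≤ 1) {i : ℕ} {θ : ℝ} (hθ : 0 ≤ θ)
    (h : KernelNear μ s i θ) : KernelNear μ s (i + 1) ((1 - s) / s * θ) := by
  intro w z
  rw [kerIter_succ, lintegral_ballKernel_mul]
  set S := Metric.closedBall w (s / 2) with hS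
  have hSm : MeasurableSet S := Metric.isClosed_closedBall.measurableSet
  set f : X → ENNReal := fun u => kerIter μ (ballKernel s) i u z with hf
  have hsum : (∫⁻ u in S, f u ∂μ) + ∫⁻ u in Sᶜ, f u ∂μ = ENNReal.ofReal (s ^ (i + 1)) := by
    rw [lintegral_add_compl f hSm, hf]
    simp_rw [kerIter_ballKernel_comm μ i _ z]
    exact lintegral_kerIter_ballKernel μ hvol h0.le i z
  have hvolc : μ Sᶜ = ENNReal.ofReal (1 - s) := by
    rw [measure_compl hSm (measure_ne_top _ _), hS, hvol, measure_univ,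
      ENNReal.ofReal_sub _ h0.le, ENNReal.ofReal_one]
  set A := ∫⁻ u in S, f u ∂μ
  set W := ∫⁻ u in Sᶜ, f u ∂μ
  have htop : A + W ≠ ⊤ := by rw [hsum]; exact ENNReal.ofReal_ne_top
  obtain ⟨hA, hW⟩ := ENNReal.add_ne_top.1 htop
  have hsum' : A.toReal + W.toReal = s ^ (i + 1) := by
    rw [← ENNReal.toReal_add hA hW, hsum, ENNReal.toReal_ofReal (by positivity)]
  have hW1 : s ^ (i + 1) * (1 - θ) * (1 - s) ≤ W.toReal := by
    rw [← ENNReal.ofReal_le_iff_le_toReal hW, ENNReal.ofReal_mul' (by linarith), ← hvolc,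
      ← setLIntegral_const]
    exact lintegral_mono fun u => (h u z).1
  have hW2 : W.toReal ≤ s ^ (i + 1) * (1 + θ) * (1 - s) := by
    refine ENNReal.toReal_le_of_le_ofReal (mul_nonneg (by positivity) (by linarith)) ?_
    rw [ENNReal.ofReal_mul' (by linarith), ← hvolc, ← setLIntegral_const]
    exact lintegral_mono fun u => (h u z).2
  have e1 : s ^ (i + 1 + 1) * (1 - (1 - s) / s * θ) =
      s ^ (i + 1) - s ^ (i + 1) * (1 + θ) * (1 - s) := by
    rw [pow_succ s (i + 1)]; field_simp; ring
  have e2 : s ^ (i + 1 + 1) * (1 + (1 - s) / s * θ) =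
      s ^ (i + 1) - s ^ (i + 1) * (1 - θ) * (1 - s) := by
    rw [pow_succ s (i + 1)]; field_simp; ring
  constructor
  · rw [ENNReal.ofReal_le_iff_le_toReal hA, e1]; linarith
  · rw [← ENNReal.ofReal_toReal hA]
    refine ENNReal.ofReal_le_ofReal ?_
    rw [e2]; linarith

/-- Doeblin's contraction: the constant part of the kernel integrates exactly, and only the
remaining fraction `1 - δ` of the mass transports the error. -/
theorem KernelNear.of_minorant (h0 : 0 < s) {i j : ℕ} {θ δ : ℝ} (hθ : 0 ≤ θ)
    (hδ0 : 0 ≤ δ) (hδ1 : δ ≤ 1)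
    (hδ : ∀ w z : X, ENNReal.ofReal (δ * s ^ (j + 1)) ≤ kerIter μ (ballKernel s) j w z)
    (h : KernelNear μ s i θ) : KernelNear μ s (j + i + 1) ((1 - δ) * θ) := by
  intro w z
  rw [kerIter_add μ (measurable_ballKernel s)]
  set c := ENNReal.ofReal (δ * s ^ (j + 1)) with hc
  set r : X → ENNReal := fun u => kerIter μ (ballKernel s) j w u - c with hr
  set f : X → ENNReal := fun u => kerIter μ (ballKernel s) i u z with hf
  have hrm : Measurable r := (measurable_kerIter_ballKernel_right μ j w).sub measurable_const
  have hfm : Measurable f := measurable_kerIter_ballKernel_left μ i z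
  have hfint : ∫⁻ u, f u ∂μ = ENNReal.ofReal (s ^ (i + 1)) := by
    rw [hf]
    simp_rw [kerIter_ballKernel_comm μ i _ z]
    exact lintegral_kerIter_ballKernel μ hvol h0.le i z
  have hkr : ∀ u, kerIter μ (ballKernel s) j w u = r u + c := fun u =>
    (tsub_add_cancel_of_le (hδ w u)).symm
  have hrow := lintegral_kerIter_ballKernel μ hvol h0.le j w
  have hrint : ∫⁻ u, r u ∂μ = ENNReal.ofReal ((1 - δ) * s ^ (j + 1)) := by
    have h2 : ∫⁻ u, r u ∂μ + c = ENNReal.ofReal (s ^ (j + 1)) := by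
      rw [← hrow, lintegral_congr hkr, lintegral_add_right _ measurable_const]; simp
    have h3 : ENNReal.ofReal (s ^ (j + 1)) = ENNReal.ofReal ((1 - δ) * s ^ (j + 1)) + c := by
      rw [hc, ← ENNReal.ofReal_add (mul_nonneg (by linarith) (by positivity)) (by positivity)]
      congr 1; ring
    rw [h3] at h2
    exact (ENNReal.add_left_inj ENNReal.ofReal_ne_top).1 h2
  have hcf : ∫⁻ u, c * f u ∂μ = ENNReal.ofReal (δ * s ^ (j + 1) * s ^ (i + 1)) := by
    rw [lintegral_const_mul _ hfm, hfint, ENNReal.ofReal_mul (by positivity)]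
  have hmain : ∫⁻ u, kerIter μ (ballKernel s) j w u * f u ∂μ =
      ∫⁻ u, r u * f u ∂μ + ENNReal.ofReal (δ * s ^ (j + 1) * s ^ (i + 1)) := by
    rw [← hcf, ← lintegral_add_right _ (hfm.const_mul c)]
    refine lintegral_congr fun u => ?_
    rw [hkr, add_mul]
  rw [hmain]
  have hpow : s ^ (j + i + 1 + 1) = s ^ (j + 1) * s ^ (i + 1) := by ring
  have hd : 0 ≤ (1 - δ) * s ^ (j + 1) := mul_nonneg (by linarith) (by positivity)
  have hconst : ∀ t : ℝ, ∫⁻ u, r u * ENNReal.ofReal t ∂μ =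
      ENNReal.ofReal ((1 - δ) * s ^ (j + 1) * t) := by
    intro t
    rw [lintegral_mul_const _ hrm, hrint, ENNReal.ofReal_mul hd]
  constructor
  · calc _ ≤ ENNReal.ofReal ((1 - δ) * s ^ (j + 1) * (s ^ (i + 1) * (1 - θ))) +
          ENNReal.ofReal (δ * s ^ (j + 1) * s ^ (i + 1)) := by
          refine le_trans (ENNReal.ofReal_le_ofReal (le_of_eq ?_)) ENNReal.ofReal_add_le
          rw [hpow]; ring
      _ ≤ _ := by
          gcongr
          rw [← hconst]
          exact lintegral_mono fun u => mul_le_mul_right (h u z).1 _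
  · calc _ ≤ ENNReal.ofReal ((1 - δ) * s ^ (j + 1) * (s ^ (i + 1) * (1 + θ))) +
          ENNReal.ofReal (δ * s ^ (j + 1) * s ^ (i + 1)) := by
          gcongr
          rw [← hconst]
          exact lintegral_mono fun u => mul_le_mul_right (h u z).2 _
      _ = _ := by
          rw [← ENNReal.ofReal_add (mul_nonneg hd (by positivity)) (by positivity), hpow]
          congr 1; ring

end BallKernel

/-! ### Kernels on the circle and, by products, on the torus. -/

section CircleKernel

variable {s : ℝ}

instance isProbabilityMeasure_unitAddCircle :
    IsProbabilityMeasure (volume : Measure UnitAddCircle) :=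
  ⟨by rw [AddCircle.measure_univ, ENNReal.ofReal_one]⟩

theorem circle_volume_ball (h1 : s ≤ 1) (w : UnitAddCircle) :
    volume (Metric.closedBall w (s / 2)) = ENNReal.ofReal s := by
  rw [AddCircle.volume_closedBall, mul_div_cancel₀ _ two_ne_zero, min_eq_right h1]

theorem circle_exists_between {a : ℝ} (ha : 0 ≤ a) (w z : UnitAddCircle) :
    ∃ c, dist w c ≤ a ∧ dist c z ≤ max (dist w z - a) 0 := by
  obtain ⟨t, ht1, ht2⟩ := unitAddCircle_exists_coe (z - w)
  have hd : dist w z = |t| := by rw [dist_comm, dist_eq_norm, ht2]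
  by_cases h : |t| ≤ a
  · exact ⟨z, hd ▸ h, by simp⟩
  · push Not at h
    have ht0 : 0 < |t| := ha.trans_lt h
    refine ⟨w + ((a / |t| * t : ℝ) : UnitAddCircle), ?_, ?_⟩
    · rw [dist_self_add_right]
      refine (unitAddCircle_norm_coe_le _).trans ?_
      rw [abs_mul, abs_div, abs_abs, abs_of_nonneg ha, div_mul_cancel₀ _ ht0.ne']
    · rw [dist_comm, dist_eq_norm]
      have : z - (w + ((a / |t| * t : ℝ) : UnitAddCircle)) =
          (((1 - a / |t|) * t : ℝ) : UnitAddCircle) := by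
        rw [← sub_sub, ← ht1, ← AddCircle.coe_sub]; congr 1; ring
      rw [this]
      refine (unitAddCircle_norm_coe_le _).trans (le_max_of_le_left ?_)
      have h1 : 0 ≤ 1 - a / |t| := by rw [sub_nonneg, div_le_one ht0]; exact h.le
      rw [abs_mul, abs_of_nonneg h1, hd]
      apply le_of_eq; field_simp

/-- Walk along an arc: move by `3 s / 8` and allow an error of `s / 8`. This stays inside the ball,
leaves a choice of measure `s / 4`, and gains `s / 4` per step. -/
theorem kerIter_ballKernel_ge (h0 : 0 < s) (h1 : s ≤ 1) (i : ℕ) (w z : UnitAddCircle)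
    (h : dist w z ≤ s / 2 + i * (s / 4)) :
    ENNReal.ofReal ((s / 4) ^ i) ≤ kerIter volume (ballKernel s) i w z := by
  induction i generalizing w with
  | zero =>
    rw [kerIter_zero, ballKernel_eq, if_pos (by simpa using h)]; simp
  | succ i ih =>
    obtain ⟨c, hc1, hc2⟩ := circle_exists_between (a := 3 * s / 8) (by positivity) w z
    rw [kerIter_succ, lintegral_ballKernel_mul]
    have hsub : Metric.closedBall c (s / 4 / 2) ⊆ Metric.closedBall w (s / 2) := by
      refine Metric.closedBall_subset_closedBall' ?_
      rw [dist_comm]; linarith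
    refine le_trans ?_ (lintegral_mono_set hsub)
    calc ENNReal.ofReal ((s / 4) ^ (i + 1)) =
          ∫⁻ u in Metric.closedBall c (s / 4 / 2), ENNReal.ofReal ((s / 4) ^ i) := by
          rw [setLIntegral_const, circle_volume_ball (by linarith),
            ← ENNReal.ofReal_mul (by positivity), pow_succ]
      _ ≤ _ := by
          refine setLIntegral_mono' Metric.isClosed_closedBall.measurableSet fun u hu => ih u ?_
          rw [Metric.mem_closedBall] at hu
          have t := dist_triangle u c z
          push_cast at h
          have hi : (0 : ℝ) ≤ i * (s / 4) := by positivity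
          rcases max_cases (dist w z - 3 * s / 8) 0 with ⟨e, _⟩ | ⟨e, _⟩ <;> rw [e] at hc2 <;>
            linarith

theorem exists_kernelNear {s₀ : ℝ} (hs₀ : 0 < s₀) {η : ℝ} (hη : 0 < η) :
    ∃ k₀ : ℕ, 1 ≤ k₀ ∧ ∀ s, s₀ ≤ s → s ≤ 1 → ∀ i ≥ k₀, KernelNear (volume : Measure UnitAddCircle) s i (η * (1 - s)) := by
  -- So many steps of net length `s / 4` reach every point, as distances are at most `1 / 2`.
  set j := ⌈2 / s₀⌉₊ with hj
  set δ : ℝ := (1 / 4) ^ j with hδ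
  have hδ0 : 0 < δ := by positivity
  have hδ1 : δ ≤ 1 := pow_le_one₀ (by norm_num) (by norm_num)
  -- The number of contractions by `1 - δ`; the factor `s₀ ^ 2` compensates the initial error `1 /
  -- s₀` and the final factor `1 / s`.
  obtain ⟨t, ht⟩ := exists_pow_lt_of_lt_one (show 0 < η * s₀ ^ 2 by positivity)
    (show 1 - δ < 1 by linarith)
  refine ⟨t * (j + 1) + 1, by omega, fun s hss hs1 i hi => ?_⟩
  have hs : 0 < s := hs₀.trans_le hss
  have hminor : ∀ w z : UnitAddCircle, ENNReal.ofReal (δ * s ^ (j + 1)) ≤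
      kerIter volume (ballKernel s) j w z := by
    intro w z
    refine le_trans (ENNReal.ofReal_le_ofReal ?_) (kerIter_ballKernel_ge hs hs1 j w z ?_)
    · rw [hδ, pow_succ, ← mul_assoc, ← mul_pow, one_div_mul_eq_div]
      exact mul_le_of_le_one_right (by positivity) hs1
    · have h2 : 2 / s₀ ≤ j := Nat.le_ceil _
      rw [div_le_iff₀ hs₀] at h2
      have h3 : 2 ≤ j * s := h2.trans (by gcongr)
      have h4 := unitAddCircle_norm_le_half (w - z)
      rw [← dist_eq_norm] at h4
      linarith
  have hnn : ∀ t : ℕ, 0 ≤ (1 - δ) ^ t * (1 / s₀) := fun t =>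
    mul_nonneg (pow_nonneg (by linarith) _) (by positivity)
  have hdoeb : ∀ t : ℕ, KernelNear (volume : Measure UnitAddCircle) s (t * (j + 1)) ((1 - δ) ^ t * (1 / s₀)) := by
    intro t
    induction t with
    | zero =>
      rw [zero_mul]
      exact kernelNear_zero _ hs hs1 (by simpa using one_div_le_one_div_of_le hs₀ hss)
    | succ t ih =>
      have := KernelNear.of_minorant (circle_volume_ball hs1) hs (hnn t) hδ0.le hδ1 hminor ih
      rw [show (t + 1) * (j + 1) = j + t * (j + 1) + 1 by ring, pow_succ']
      rwa [mul_assoc]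
  have hmono : ∀ d : ℕ, KernelNear (volume : Measure UnitAddCircle) s (t * (j + 1) + d) ((1 - δ) ^ t * (1 / s₀)) := by
    intro d
    induction d with
    | zero => exact hdoeb t
    | succ d ih => exact ih.succ (circle_volume_ball hs1) hs
  obtain ⟨d, rfl⟩ : ∃ d, i = t * (j + 1) + d + 1 := ⟨i - (t * (j + 1) + 1), by omega⟩
  -- The last step is a `contract`, to obtain an error proportional to `1 - s`.
  have hc := (hmono d).contract (circle_volume_ball hs1) hs hs1 (hnn t)
  have hle : (1 - s) / s * ((1 - δ) ^ t * (1 / s₀)) ≤ η * (1 - s) := by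
    have h1 : (1 - s) / s ≤ (1 - s) / s₀ := div_le_div_of_nonneg_left (by linarith) hs₀ hss
    calc _ ≤ (1 - s) / s₀ * (η * s₀ ^ 2 * (1 / s₀)) := by
          have : 0 ≤ (1 - s) / s₀ := div_nonneg (by linarith) hs₀.le
          gcongr
      _ = _ := by field_simp
  intro w z
  have hp : 0 ≤ s ^ (t * (j + 1) + d + 1 + 1) := by positivity
  refine ⟨le_trans (ENNReal.ofReal_le_ofReal ?_) (hc w z).1,
    (hc w z).2.trans (ENNReal.ofReal_le_ofReal ?_)⟩ <;> gcongr

theorem ballKernel_torus {m : ℕ} (h0 : 0 ≤ s) (w z : UnitAddTorus (Fin m)) :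
    ballKernel s w z = ∏ c, ballKernel s (w c) (z c) := by
  simp only [ballKernel_eq]
  rw [Finset.prod_ite_zero]
  simp [dist_pi_le_iff (show 0 ≤ s / 2 by positivity)]

/-- Balls of the maximum metric are products, so the iterated kernels factorise and estimates on the
circle serve all dimensions. -/
theorem kerIter_torus {m : ℕ} (h0 : 0 ≤ s) (i : ℕ) (w z : UnitAddTorus (Fin m)) :
    kerIter volume (ballKernel s) i w z =
      ∏ c, kerIter volume (ballKernel s) i (w c) (z c) := by
  induction i generalizing w with
  | zero => exact ballKernel_torus h0 w z
  | succ i ih =>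
    simp_rw [kerIter_succ, ih, ballKernel_torus h0, ← Finset.prod_mul_distrib]
    exact lintegral_pi_prod (fun _ : Fin m => (volume : Measure UnitAddCircle))
      (f := fun c u => ballKernel s (w c) u * kerIter volume (ballKernel s) i u (z c)) fun c =>
        (measurable_ballKernel_right s (w c)).mul
          (measurable_kerIter_ballKernel_left volume i (z c))

/-- The iterated ball kernels on tori of all dimensions are nearly constant. -/
theorem exists_kerIter_torus_near {s₀ : ℝ} (hs₀ : 0 < s₀) {η : ℝ} (hη : 0 < η) (hη1 : η ≤ 1 / 2) :
    ∃ k₀ : ℕ, 1 ≤ k₀ ∧ ∀ s, s₀ ≤ s → s ≤ 1 → ∀ i ≥ k₀, ∀ (m : ℕ) (w z : UnitAddTorus (Fin m)),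
      ENNReal.ofReal ((s ^ m) ^ (i + 1) * Real.exp (-(2 * η * (m * (1 - s))))) ≤
        kerIter volume (ballKernel s) i w z ∧
      kerIter volume (ballKernel s) i w z ≤
        ENNReal.ofReal ((s ^ m) ^ (i + 1) * Real.exp (2 * η * (m * (1 - s)))) := by
  obtain ⟨k₀, hk₀, h⟩ := exists_kernelNear hs₀ hη
  refine ⟨k₀, hk₀, fun s hs hs1 i hi m w z => ?_⟩
  have hs0 : 0 < s := hs₀.trans_le hs
  have h' := h s hs hs1 i hi
  set u := η * (1 - s) with hu
  have hu0 : 0 ≤ u := mul_nonneg hη.le (by linarith)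
  have hu1 : u ≤ 1 / 2 := by nlinarith
  have hpow : (s ^ m) ^ (i + 1) = (s ^ (i + 1)) ^ m := by rw [← pow_mul, ← pow_mul, mul_comm]
  rw [kerIter_torus hs0.le]
  have e1 : Real.exp (-(2 * u)) ≤ 1 - u := by
    have h1 := Real.add_one_le_exp (2 * u)
    rw [Real.exp_neg, inv_le_comm₀ (Real.exp_pos _) (by linarith)]
    refine le_trans ?_ h1
    rw [inv_le_iff_one_le_mul₀ (by linarith)]
    nlinarith
  have e2 : 1 + u ≤ Real.exp (2 * u) := by
    have h1 := Real.add_one_le_exp (2 * u); linarith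
  constructor
  · calc _ = ∏ c : Fin m, ENNReal.ofReal (s ^ (i + 1) * Real.exp (-(2 * u))) := by
          rw [Finset.prod_const, Finset.card_univ, Fintype.card_fin,
            ← ENNReal.ofReal_pow (by positivity), mul_pow, hpow, ← Real.exp_nat_mul, hu]
          congr 3; ring
      _ ≤ _ := Finset.prod_le_prod' fun c _ => le_trans
          (ENNReal.ofReal_le_ofReal (by gcongr)) (h' (w c) (z c)).1
  · calc _ ≤ ∏ c : Fin m, ENNReal.ofReal (s ^ (i + 1) * Real.exp (2 * u)) :=
          Finset.prod_le_prod' fun c _ => le_trans (h' (w c) (z c)).2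
            (ENNReal.ofReal_le_ofReal (by gcongr))
      _ = _ := by
          rw [Finset.prod_const, Finset.card_univ, Fintype.card_fin,
            ← ENNReal.ofReal_pow (by positivity), mul_pow, hpow, ← Real.exp_nat_mul, hu]
          congr 3; ring

end CircleKernel


/-! ### Coins along a path. -/

section PathCoins

variable {V : Type*} [DecidableEq V]

/-- The coins that decide about the edges along a list of nodes. -/
def coinsAlong (b : V → ℕ) : List V → Finset (V × V)
  | u :: v :: l => insert (if b u < b v then (v, u) else (u, v)) (coinsAlong b (v :: l))
  | _ => ∅

theorem card_coinsAlong_le (b : V → ℕ) (u : V) (l : List V) :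
    (coinsAlong b (u :: l)).card ≤ l.length := by
  induction l generalizing u with
  | nil => simp [coinsAlong]
  | cons v l ih =>
    rw [coinsAlong, List.length_cons]
    exact (Finset.card_insert_le _ _).trans (Nat.succ_le_succ (ih v))

theorem mem_of_mem_coinsAlong (b : V → ℕ) {l : List V} {e : V × V} (h : e ∈ coinsAlong b l) :
    e.1 ∈ l ∧ e.2 ∈ l := by
  induction l with
  | nil => simp [coinsAlong] at h
  | cons u l ih =>
    cases l with
    | nil => simp [coinsAlong] at h
    | cons v l =>
      rw [coinsAlong, Finset.mem_insert] at h
      rcases h with rfl | h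
      · split_ifs <;> simp
      · exact ⟨List.mem_cons_of_mem _ (ih h).1, List.mem_cons_of_mem _ (ih h).2⟩

theorem mem_or_mem_of_mem_coinsAlong_append (b : V → ℕ) {l : List V} (hl : l ≠ []) {y : V}
    {e : V × V} (h : e ∈ coinsAlong b (l ++ [y])) : e.1 ∈ l ∨ e.2 ∈ l := by
  induction l with
  | nil => exact absurd rfl hl
  | cons u l ih =>
    cases l with
    | nil =>
      simp only [List.cons_append, List.nil_append, coinsAlong, Finset.mem_insert,
        Finset.notMem_empty, or_false] at h
      rw [h]; split_ifs <;> simp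
    | cons v l =>
      simp only [List.cons_append, coinsAlong, Finset.mem_insert] at h
      rcases h with rfl | h
      · split_ifs <;> simp
      · rcases ih (by simp) h with h | h
        · exact Or.inl (List.mem_cons_of_mem _ h)
        · exact Or.inr (List.mem_cons_of_mem _ h)

/-- Every edge of a path with an inner node touches one. Paths between the same ends with disjoint
sets of inner nodes therefore use disjoint coins. -/
theorem mem_or_mem_of_mem_coinsAlong (b : V → ℕ) {l : List V} (hl : l ≠ []) {x y : V}
    {e : V × V} (h : e ∈ coinsAlong b (x :: (l ++ [y]))) : e.1 ∈ l ∨ e.2 ∈ l := by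
  obtain ⟨z, l, rfl⟩ := List.exists_cons_of_ne_nil hl
  rw [List.cons_append, coinsAlong, Finset.mem_insert] at h
  rcases h with rfl | h
  · split_ifs <;> simp
  · exact mem_or_mem_of_mem_coinsAlong_append b hl h

theorem edist_le_of_coinsAlong {G : SimpleGraph V} (b : V → ℕ) (c : V × V → Prop)
    {R : V → V → Prop} (hG : ∀ u v, R u v → c (if b u < b v then (v, u) else (u, v)) → G.Adj u v)
    {u y : V} {l : List V} (hl : (u :: (l ++ [y])).IsChain R)
    (hc : ∀ e ∈ coinsAlong b (u :: (l ++ [y])), c e) : G.edist u y ≤ (l.length + 1 : ℕ) := by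
  induction l generalizing u with
  | nil =>
    simp only [List.nil_append, coinsAlong] at hl hc
    have : G.Adj u y := hG u y (by simpa using hl) (hc _ (by simp))
    simp [SimpleGraph.edist_eq_one_iff_adj.2 this]
  | cons v l ih =>
    rw [List.cons_append, List.isChain_cons_cons] at hl
    rw [List.cons_append, coinsAlong] at hc
    have h1 : G.Adj u v := hG u v hl.1 (hc _ (Finset.mem_insert_self _ _))
    have h2 := ih hl.2 fun e he => hc e (Finset.mem_insert_of_mem he)
    refine (G.edist_triangle (v := v)).trans ?_
    rw [SimpleGraph.edist_eq_one_iff_adj.2 h1, List.length_cons]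
    refine (add_le_add_right h2 1).trans_eq ?_
    push_cast; ring

end PathCoins

/-! ### Geometric paths through disjoint groups of nodes. -/

section GeometricPaths

/-- A nonzero count has a nonzero summand, that is, an actual path. Injectivity of `F` makes
consecutive nodes distinct. -/
theorem exists_chain_of_pathSum_ne_zero {V X : Type*} [PseudoMetricSpace X] {s : ℝ} {N : ℕ}
    (pos : V → X) {k : ℕ} {F : Fin k → Fin N → V}
    (hF : Function.Injective fun q : Fin k × Fin N => F q.1 q.2) {x y : V} (hxy : x ≠ y)
    (hx : ∀ a c, F a c ≠ x) (hy : ∀ a c, F a c ≠ y)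
    (h : pathSum (ballKernel s) (pos x) k (fun a c => pos (F a c))
      (fun u => ballKernel s u (pos y)) ≠ 0) :
    ∃ l : List V, l.length = k ∧ (∀ v ∈ l, ∃ a c, F a c = v) ∧
      (x :: (l ++ [y])).IsChain fun u v => dist (pos u) (pos v) ≤ s / 2 ∧ u ≠ v := by
  have hb : ∀ u v : X, ballKernel s u v ≠ 0 → dist u v ≤ s / 2 := by
    intro u v h
    by_contra h'
    exact h (by rw [ballKernel_eq, if_neg h'])
  induction k generalizing y with
  | zero =>
    refine ⟨[], rfl, by simp, ?_⟩
    simp only [pathSum] at h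
    simpa using ⟨hb _ _ h, hxy⟩
  | succ k ih =>
    obtain ⟨a, h1, h2⟩ := pathSum_ne_zero_of_succ k _ h
    obtain ⟨l, hl1, hl2, hl3⟩ := ih (F := Fin.init F) (y := F (Fin.last k) a)
      (fun q q' hq => by
        have := @hF (q.1.castSucc, q.2) (q'.1.castSucc, q'.2) hq
        simp only [Prod.mk.injEq, Fin.castSucc_inj] at this
        exact Prod.ext this.1 this.2)
      (hx _ _).symm (fun a c => hx _ _) (fun a' c e => by
        have := @hF (a'.castSucc, c) (Fin.last k, a) e
        simp only [Prod.mk.injEq] at this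
        exact (Fin.castSucc_lt_last a').ne this.1) h2
    refine ⟨l ++ [F (Fin.last k) a], by simp [hl1], ?_, ?_⟩
    · intro v hv
      rcases List.mem_append.1 hv with hv | hv
      · obtain ⟨a', c, h'⟩ := hl2 v hv
        exact ⟨a'.castSucc, c, h'⟩
      · exact ⟨_, a, (List.mem_singleton.1 hv).symm⟩
    · have e : x :: (l ++ [F (Fin.last k) a] ++ [y]) = (x :: (l ++ [F (Fin.last k) a])) ++ [y] := by
        simp
      rw [e, List.isChain_append]
      refine ⟨hl3, by simp, fun u hu v hv => ?_⟩
      have e2 : x :: (l ++ [F (Fin.last k) a]) = (x :: l) ++ [F (Fin.last k) a] := by simp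
      rw [e2, List.getLast?_concat] at hu
      simp only [Option.mem_def, Option.some.injEq, List.head?_cons] at hu hv
      subst hu hv
      exact ⟨hb _ _ h1, hy _ _⟩

theorem measurePreserving_curry {ι κ X : Type*} [Fintype ι] [Fintype κ] [MeasurableSpace X]
    (ν : Measure X) [IsProbabilityMeasure ν] :
    MeasurePreserving (fun (ω : ι × κ → X) i k => ω (i, k))
      (Measure.pi fun _ => ν) (Measure.pi fun _ => Measure.pi fun _ => ν) := by
  have h := measurePreserving_uncurry (ι := ι) (κ := κ) ν
  have hm : Measurable fun (ω : ι × κ → X) i k => ω (i, k) := by fun_prop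
  refine ⟨hm, ?_⟩
  rw [← h.map_eq, Measure.map_map hm h.measurable]
  exact Measure.map_id

theorem pi_le_of_update_le {ι X : Type*} [Fintype ι] [DecidableEq ι] [MeasurableSpace X]
    (μ : Measure X) [IsProbabilityMeasure μ] (i : ι) {A : Set (ι → X)} (hA : MeasurableSet A)
    {ε : ENNReal} (h : ∀ y, (Measure.pi fun _ => μ) {ω | Function.update ω i y ∈ A} ≤ ε) :
    (Measure.pi fun _ => μ) A ≤ ε := by
  have hf : Measurable (A.indicator fun _ => (1 : ENNReal)) := measurable_const.indicator hA
  have hm := measurable_update_prod (X := X) i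
  rw [← lintegral_indicator_one hA]
  change ∫⁻ ω, A.indicator (fun _ => (1 : ENNReal)) ω ∂_ ≤ ε
  rw [lintegral_pi_update μ i hf, lintegral_lintegral_swap
    (f := fun ω y => A.indicator (fun _ => (1 : ENNReal)) (Function.update ω i y))
    (hf.comp hm).aemeasurable]
  calc _ = ∫⁻ y, (Measure.pi fun _ => μ) {ω | Function.update ω i y ∈ A} ∂μ := by
        refine lintegral_congr fun y => ?_
        have hs : MeasurableSet {ω : ι → X | Function.update ω i y ∈ A} :=
          (hm.comp (measurable_prodMk_right (y := y))) hA
        rw [← lintegral_indicator_one hs]; rfl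
    _ ≤ ∫⁻ _, ε ∂μ := lintegral_mono h
    _ = ε := by simp

theorem pi_forall_le_pow {ι Y : Type*} [Fintype ι] [MeasurableSpace Y] (P : Measure Y)
    [IsProbabilityMeasure P] {S : Set Y} {δ : ℝ} (hδ1 : δ ≤ 1) (hS : MeasurableSet S)
    (h : ENNReal.ofReal δ ≤ P S) :
    (Measure.pi fun _ : ι => P) {ω | ∀ q, ω q ∉ S} ≤
      ENNReal.ofReal ((1 - δ) ^ Fintype.card ι) := by
  have e : {ω : ι → Y | ∀ q, ω q ∉ S} = Set.univ.pi fun _ => Sᶜ := by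
    ext; simp
  rw [e, Measure.pi_pi, Finset.prod_const, Finset.card_univ, ENNReal.ofReal_pow (by linarith)]
  gcongr
  rw [prob_compl_eq_one_sub hS]
  by_cases h0 : 0 ≤ δ
  · rw [ENNReal.ofReal_sub _ h0, ENNReal.ofReal_one]
    gcongr
  · refine tsub_le_self.trans ?_
    rw [← ENNReal.ofReal_one]
    exact ENNReal.ofReal_le_ofReal (by linarith)

variable {n m : ℕ}

theorem measurePreserving_positions [NeZero n] (p : unitInterval) {ι κ ℓ : Type*} [Fintype ι]
    [Fintype κ] [Fintype ℓ] {e : ι × κ × ℓ → Fin n} (he : Function.Injective e) :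
    MeasurePreserving (fun (M : Fin n → Mark n m) q a c => (M (e (q, a, c))).2.1)
      (Measure.pi fun _ => markLaw n m p)
      (Measure.pi fun _ => Measure.pi fun _ => Measure.pi fun _ => volume) := by
  have hunif : IsProbabilityMeasure (uniformOn (Set.univ : Set (Fin n))) :=
    isProbabilityMeasure_uniformOn Set.finite_univ Set.univ_nonempty
  have h1 : MeasurePreserving (fun μ : Mark n m => μ.2.1) (markLaw n m p) volume :=
    measurePreserving_fst.comp measurePreserving_snd
  have h2 := measurePreserving_pi (fun _ : Fin n => markLaw n m p) (fun _ => volume) fun _ => h1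
  have h3 : MeasurePreserving (fun ω : Fin n → UnitAddTorus (Fin m) => ω ∘ e)
      (Measure.pi fun _ => volume) (Measure.pi fun _ => volume) :=
    ⟨by fun_prop, map_precomp_pi volume he⟩
  have h4 := measurePreserving_curry (ι := ι) (κ := κ × ℓ)
    (volume : Measure (UnitAddTorus (Fin m)))
  have h5 := measurePreserving_pi (fun _ : ι => Measure.pi fun _ : κ × ℓ =>
    (volume : Measure (UnitAddTorus (Fin m)))) _
    (fun _ => measurePreserving_curry (ι := κ) (κ := ℓ) (volume : Measure (UnitAddTorus (Fin m))))
  exact h5.comp (h4.comp (h3.comp h2))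

/-- A given pair of nodes is joined by a geometric path through one of many groups of nodes. -/
theorem marks_no_path_le [NeZero n] (p : unitInterval) {Q k N : ℕ} {s δ : ℝ} (hδ1 : δ ≤ 1)
    (hpath : ∀ x y : UnitAddTorus (Fin m), ENNReal.ofReal δ ≤
      (Measure.pi fun _ : Fin k => Measure.pi fun _ : Fin N => volume)
        {ω | pathSum (ballKernel s) x k ω (fun u => ballKernel s u y) ≠ 0})
    {e : Fin Q × Fin k × Fin N → Fin n} (he : Function.Injective e) {i j : Fin n} (hij : i ≠ j)
    (hi : ∀ q, e q ≠ i) (hj : ∀ q, e q ≠ j) :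
    (Measure.pi fun _ => markLaw n m p) {M | ∀ q, ¬ ∃ l : List (Fin n), l.length = k ∧
      (∀ v ∈ l, ∃ a c, e (q, a, c) = v) ∧ (i :: (l ++ [j])).IsChain fun u v =>
        dist (M u).2.1 (M v).2.1 ≤ s / 2 ∧ u ≠ v} ≤ ENNReal.ofReal ((1 - δ) ^ Q) := by
  classical
  set A := {M : Fin n → Mark n m | ∀ q, ¬ ∃ l : List (Fin n), l.length = k ∧
      (∀ v ∈ l, ∃ a c, e (q, a, c) = v) ∧ (i :: (l ++ [j])).IsChain fun u v =>
        dist (M u).2.1 (M v).2.1 ≤ s / 2 ∧ u ≠ v} with hA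
  let φ : (Fin n → Mark n m) → Fin n → Fin n → Prop := fun M u v =>
    dist (M u).2.1 (M v).2.1 ≤ s / 2
  have hφ : Measurable φ := by
    refine measurable_pi_lambda _ fun u => measurable_pi_lambda _ fun v => ?_
    refine measurableSet_setOfPred.1 (measurableSet_le (f := fun M : Fin n → Mark n m =>
      dist (M u).2.1 (M v).2.1) (by fun_prop) measurable_const)
  have hAm : MeasurableSet A :=
    hφ (MeasurableSet.of_discrete (s := {d : Fin n → Fin n → Prop | ∀ q, ¬ ∃ l : List (Fin n),
      l.length = k ∧ (∀ v ∈ l, ∃ a c, e (q, a, c) = v) ∧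
        (i :: (l ++ [j])).IsChain fun u v => d u v ∧ u ≠ v}))
  -- Fix the marks of both ends; the groups avoid them and keep their independent positions.
  refine pi_le_of_update_le _ i hAm fun y => ?_
  have hA' : MeasurableSet {M | Function.update M i y ∈ A} :=
    ((measurable_update_prod i).comp (measurable_prodMk_right (y := y))) hAm
  refine pi_le_of_update_le _ j hA' fun y' => ?_
  have hb := measurable_ballKernel (X := UnitAddTorus (Fin m)) s
  have hSm : MeasurableSet {ω : Fin k → Fin N → UnitAddTorus (Fin m) |
      pathSum (ballKernel s) y.2.1 k ω (fun u => ballKernel s u y'.2.1) ≠ 0} :=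
    (measurable_pathSum hb k (hb.comp measurable_prodMk_right)) (measurableSet_singleton 0).compl
  have hle := pi_forall_le_pow (ι := Fin Q) _ hδ1 hSm (hpath y.2.1 y'.2.1)
  rw [Fintype.card_fin] at hle
  refine le_trans ?_ hle
  have hmp := measurePreserving_positions (m := m) p he
  have hSm' : MeasurableSet {ω : Fin Q → Fin k → Fin N → UnitAddTorus (Fin m) | ∀ q, ω q ∉
      {ω | pathSum (ballKernel s) y.2.1 k ω (fun u => ballKernel s u y'.2.1) ≠ 0}} := by
    rw [Set.ofPred_forall]
    exact MeasurableSet.iInter fun q => hSm.compl.preimage (measurable_pi_apply q)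
  rw [← hmp.measure_preimage hSm'.nullMeasurableSet]
  refine measure_mono fun M hM q hq => hM q ?_
  set M' := Function.update (Function.update M j y') i y with hM'
  have h1 : M' i = y := Function.update_self ..
  have h2 : M' j = y' := by
    rw [hM', Function.update_of_ne hij.symm, Function.update_self]
  have h3 : ∀ a c, M' (e (q, a, c)) = M (e (q, a, c)) := fun a c => by
    rw [hM', Function.update_of_ne (hi _), Function.update_of_ne (hj _)]
  refine exists_chain_of_pathSum_ne_zero (s := s) (fun u => (M' u).2.1)
    (F := fun a c => e (q, a, c)) (fun q₁ q₂ h => ?_) hij (fun a c => hi _) (fun a c => hj _) ?_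
  · have := he h
    simp only [Prod.mk.injEq, true_and] at this
    exact Prod.ext this.1 this.2
  · simp only [h1, h2, h3]
    exact hq

/-- The probability that the diameter is not small, in terms of the probability that geometric
paths of a given length exist. -/
theorem marks_groups_le {α β : ℝ} [NeZero n] (p : unitInterval) (hα : 0 ≤ α) {b : Fin n → ℕ}
    (hb : Function.Injective b) {T Q k N : ℕ} (hk : 1 ≤ k) {s δ : ℝ}
    (hs : radius α β n m n = s / 2) (hδ1 : δ ≤ 1)
    (hpath : ∀ x y : UnitAddTorus (Fin m), ENNReal.ofReal δ ≤
      (Measure.pi fun _ : Fin k => Measure.pi fun _ : Fin N => volume)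
        {ω | pathSum (ballKernel s) x k ω (fun u => ballKernel s u y) ≠ 0})
    {e : Fin (T + 2) × Fin Q × Fin k × Fin N → Fin n} (he : Function.Injective e) :
    (Measure.pi fun _ => markLaw n m p) {M | ∃ G ∈ {G : SimpleGraph (Fin n) |
      ¬ G.ediam ≤ (k + 1 : ℕ)}, Compatible α β (lowRank n) (hiRank n) b M G} ≤
      ENNReal.ofReal (n ^ 2 * (T + 2) * (1 - δ) ^ Q) +
        ENNReal.ofReal (n ^ 2 * (1 - (p : ℝ) ^ (k + 1)) ^ T) := by
  classical
  let D := Fin n → Fin n → Prop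
  let φ : (Fin n → Fin n × UnitAddTorus (Fin m)) → D := fun g u v =>
    dist (g u).2 (g v).2 ≤ s / 2
  have hφ : Measurable φ := measurable_pi_lambda _ fun u => measurable_pi_lambda _ fun v =>
    measurableSet_setOfPred.1 (measurableSet_dist_le u v _)
  let good : D → Fin n × Fin n → Fin (T + 2) → List (Fin n) → Prop := fun d i t l =>
    l.length = k ∧ (∀ v ∈ l, ∃ q, e (t, q) = v) ∧
      (i.1 :: (l ++ [i.2])).IsChain fun u v => d u v ∧ u ≠ v
  let free : Fin n × Fin n → Fin (T + 2) → Prop := fun i t => ∀ q, e (t, q) ≠ i.1 ∧ e (t, q) ≠ i.2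
  let S : D → Fin n × Fin n → Finset (Fin (T + 2)) := fun d i =>
    Finset.univ.filter fun t => free i t ∧ ∃ l, good d i t l
  -- The path is selected by means of the distances alone, hence independently of the coins.
  let P : D → Fin n × Fin n → Fin (T + 2) → List (Fin n) := fun d i t =>
    if h : ∃ l, good d i t l then h.choose else []
  have hP : ∀ d i t, t ∈ S d i → free i t ∧ good d i t (P d i t) := by
    intro d i t ht
    rw [Finset.mem_filter] at ht
    refine ⟨ht.2.1, ?_⟩
    simp only [P, dif_pos ht.2.2]
    exact ht.2.2.choose_spec
  let E : D → Fin n × Fin n → Fin (T + 2) → Finset (Fin n × Fin n) := fun d i t =>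
    coinsAlong b (i.1 :: (P d i t ++ [i.2]))
  have hcoins := marks_le_of_coins_le p hφ (fun d => {c | ∃ i, T ≤ (S d i).card ∧
    ∀ a ∈ S d i, ∃ e ∈ E d i a, c e = false}) _ (fun d => coins_union_le p
      (fun i => T ≤ (S d i).card) (S d) (E d) (k + 1) T (fun i _ t ht t' ht' htt' => ?_)
      (fun i _ t ht => ?_) fun i h => h)
  rotate_left
  · obtain ⟨hf, hl, hm, -⟩ := hP d i t ht
    obtain ⟨hf', hl', hm', -⟩ := hP d i t' ht'
    rw [Function.onFun, Finset.disjoint_left]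
    intro c hc hc'
    have hne : P d i t ≠ [] := by
      rw [← List.length_pos_iff, hl]; exact hk
    have h1 := mem_or_mem_of_mem_coinsAlong b hne hc
    have h2 := mem_of_mem_coinsAlong b hc'
    have key : ∀ v ∈ P d i t, v ∉ i.1 :: (P d i t' ++ [i.2]) := by
      intro v hv hv'
      obtain ⟨q, rfl⟩ := hm v hv
      simp only [List.mem_cons, List.mem_append, List.not_mem_nil, or_false] at hv'
      rcases hv' with h | h | h
      · exact (hf q).1 h
      · obtain ⟨q', hq'⟩ := hm' _ h
        exact htt' (congrArg Prod.fst (he hq')).symm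
      · exact (hf q).2 h
    rcases h1 with h | h
    · exact key _ h h2.1
    · exact key _ h h2.2
  · obtain ⟨-, hl, -, -⟩ := hP d i t ht
    refine (card_coinsAlong_le b _ _).trans ?_
    rw [List.length_append, hl]; rfl
  let A : (Fin n × Fin n) × Fin (T + 2) → Set (Fin n → Mark n m) := fun z =>
    {M | z.1.1 ≠ z.1.2 ∧ free z.1 z.2 ∧
      ¬ ∃ l, good (φ fun j => ((M j).1, (M j).2.1)) z.1 z.2 l}
  have hA : ∀ z, (Measure.pi fun _ => markLaw n m p) (A z) ≤ ENNReal.ofReal ((1 - δ) ^ Q) := by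
    intro z
    by_cases hz : z.1.1 ≠ z.1.2 ∧ free z.1 z.2
    · refine le_trans (measure_mono fun M hM => ?_) (marks_no_path_le (m := m) p hδ1 hpath
        (e := fun q => e (z.2, q)) (fun q q' h => congrArg Prod.snd (he h)) hz.1
        (fun q => (hz.2 q).1) (fun q => (hz.2 q).2))
      rintro q ⟨l, h1, h2, h3⟩
      exact hM.2.2 ⟨l, h1, fun v hv => (h2 v hv).elim fun a h => h.elim fun c h => ⟨_, h⟩, h3⟩
    · have : A z = ∅ := by
        ext M
        simp only [Set.mem_empty_iff_false, iff_false]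
        exact fun hM => hz ⟨hM.1, hM.2.1⟩
      rw [this, measure_empty]; exact bot_le
  have hAll : (Measure.pi fun _ => markLaw n m p) (⋃ z, A z) ≤
      ENNReal.ofReal (n ^ 2 * (T + 2) * (1 - δ) ^ Q) := by
    refine (measure_iUnion_fintype_le _ _).trans ((Finset.sum_le_sum fun z _ => hA z).trans ?_)
    rw [Finset.sum_const, Finset.card_univ, nsmul_eq_mul, ENNReal.ofReal_mul (by positivity)]
    simp only [Fintype.card_prod, Fintype.card_fin]
    rw [← ENNReal.ofReal_natCast]
    gcongr
    push_cast
    rw [pow_two]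
  rw [Fintype.card_prod, Fintype.card_fin, Nat.cast_mul, ← pow_two] at hcoins
  refine le_trans (measure_mono ?_) ((measure_union_le _ _).trans (add_le_add hAll hcoins))
  rintro M ⟨G, hG, hcomp⟩
  by_contra hcon
  rw [Set.mem_union, not_or] at hcon
  obtain ⟨g1, g2⟩ := hcon
  refine hG (SimpleGraph.ediam_le_of_edist_le fun i j => ?_)
  by_cases hij : i = j
  · subst hij; simp
  set d := φ fun j => ((M j).1, (M j).2.1) with hd
  have hcard : T ≤ (S d (i, j)).card := by
    have hsub : (Finset.univ.filter fun t => free (i, j) t) ⊆ S d (i, j) := by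
      intro t ht
      rw [Finset.mem_filter] at ht ⊢
      refine ⟨ht.1, ht.2, ?_⟩
      by_contra hno
      exact g1 (Set.mem_iUnion.2 ⟨((i, j), t), hij, ht.2, hno⟩)
    refine le_trans ?_ (Finset.card_le_card hsub)
    -- Each end spoils at most one of the `T + 2` families of groups, so `T` of them remain.
    have hbad : ∀ u : Fin n, (Finset.univ.filter fun t : Fin (T + 2) =>
        ∃ q, e (t, q) = u).card ≤ 1 := by
      intro u
      rw [Finset.card_le_one]
      intro t ht t' ht'
      rw [Finset.mem_filter] at ht ht'
      obtain ⟨q, hq⟩ := ht.2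
      obtain ⟨q', hq'⟩ := ht'.2
      exact congrArg Prod.fst (he (hq.trans hq'.symm))
    have hcov : (Finset.univ : Finset (Fin (T + 2))) ⊆
        (Finset.univ.filter fun t => free (i, j) t) ∪
          ((Finset.univ.filter fun t : Fin (T + 2) => ∃ q, e (t, q) = i) ∪
            (Finset.univ.filter fun t : Fin (T + 2) => ∃ q, e (t, q) = j)) := by
      intro t _
      simp only [Finset.mem_union, Finset.mem_filter, Finset.mem_univ, true_and, free]
      by_contra hno
      push Not at hno
      obtain ⟨⟨q, hq⟩, h1, h2⟩ := hno
      exact h2 q (hq (h1 q))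
    have h1 := (Finset.card_le_card hcov).trans ((Finset.card_union_le _ _).trans
      (add_le_add_right (Finset.card_union_le _ _) _))
    rw [Finset.card_univ, Fintype.card_fin] at h1
    have := hbad i
    have := hbad j
    omega
  have hopen : ¬ ∀ a ∈ S d (i, j), ∃ e ∈ E d (i, j) a, (M e.1).2.2 e.2 = false := fun h =>
    g2 ⟨(i, j), hcard, h⟩
  push Not at hopen
  obtain ⟨t, ht, hopen⟩ := hopen
  obtain ⟨-, hl, -, hch⟩ := hP d (i, j) t ht
  have := edist_le_of_coinsAlong (G := G) b (fun e => (M e.1).2.2 e.2 = true) (fun u v huv hc => ?_)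
    hch (fun e he => by simpa using hopen e he)
  · rwa [hl] at this
  · have hduv : dist (M u).2.1 (M v).2.1 ≤ radius α β n m n := hs ▸ huv.1
    split_ifs at hc with hbuv
    · exact hcomp.adj_of_le_radius hα hbuv (by rwa [dist_comm]) hc
    · have : b v < b u := lt_of_le_of_ne (not_lt.1 hbuv) fun h => huv.2 (hb h).symm
      exact (hcomp.adj_of_le_radius hα this hduv hc).symm

end GeometricPaths


/-! ### Large dimension: paths of bounded length. -/

section LargeDimension

variable {α β : ℝ}

theorem one_sub_exp_neg_le (t : ℝ) : 1 - Real.exp (-t) ≤ t := by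
  have := Real.add_one_le_exp (-t); linarith

set_option maxHeartbeats 1000000 in
-- All nodes are treated as if they had the smallest radius. Since `m ≥ A log n`, the corresponding
-- side `s` is bounded below, so the mixing time `k₀` and the path length do not depend on `n` and
-- `m`.
theorem marks_large_dimension_le (hα : α ∈ Set.Ioo (0 : ℝ) 1) (hβ : β ∈ Set.Ioo (0 : ℝ) (1 - α))
    (p : unitInterval) (hp : 0 < p) {A : ℝ} (hA : 0 < A) : ∃ K N₀ : ℕ, ∀ n ≥ N₀,
    ∀ m : ℕ, 1 ≤ m → A * Real.log n ≤ m → ∀ b : Fin n → ℕ, Function.Injective b →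
    (Measure.pi fun _ => markLaw n m p) {M | ∃ G ∈ {G : SimpleGraph (Fin n) | ¬ G.ediam ≤ (K : ℕ)},
      Compatible α β (lowRank n) (hiRank n) b M G} ≤
      ENNReal.ofReal (2 * Real.exp (-Real.log n ^ 2)) := by
  obtain ⟨hα0, hα1⟩ := hα
  obtain ⟨hβ0, hβ1⟩ := hβ
  have hp0 : (0 : ℝ) < p := hp
  have hp1 : (p : ℝ) ≤ 1 := p.2.2
  set c : ℝ := α + β with hc
  have hc0 : 0 < c := by linarith
  have hc1 : c < 1 := by linarith
  -- Leaves `1 - 2 ε - c ≥ 6 ε`, so that groups of `n^(1 - 2 ε)` nodes still have mean degree of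
  -- order `n^(6 ε)`; `ε ≤ c` is used for `v * H ≤ 1`.
  set ε : ℝ := min ((1 - c) / 8) c with hε
  have hε0 : 0 < ε := lt_min (by linarith) hc0
  have hε1 : ε ≤ (1 - c) / 8 := min_le_left _ _
  have hε2 : ε ≤ c := min_le_right _ _
  set s₀ := Real.exp (-(c / A)) with hs₀
  set η := ε / 8 with hη
  have hη0 : 0 < η := by positivity
  have hη1 : η ≤ 1 / 2 := by linarith
  obtain ⟨k₀, hk₀, hker⟩ := exists_kerIter_torus_near (Real.exp_pos (-(c / A))) hη0 hη1
  -- Makes `n^(-ε q)` at most `v = n^(-c)`, as needed for `τ ^ q ≤ v * H`.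
  set q := ⌈c / ε⌉₊ with hq
  have hq1 : 1 ≤ q := Nat.ceil_pos.2 (by positivity)
  have hqε : c ≤ ε * q := by
    have := Nat.le_ceil (c / ε)
    rw [div_le_iff₀ hε0] at this
    linarith
  set k := k₀ * q with hk
  have hk1 : 1 ≤ k := Nat.mul_pos hk₀ hq1
  set c₁ : ℝ := 2 / (p : ℝ) ^ (k + 1) with hc₁
  have hc₁0 : 0 < c₁ := by positivity
  have ev : ∀ᶠ L : ℝ in Filter.atTop, 3 ≤ L ∧
      2 * k₀ * L ^ 0 ≤ Real.exp (5 * ε * L) ∧ 12 * k * L ^ 0 ≤ Real.exp (6 * ε * L) ∧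
      (4 * k * (c₁ + 3)) * L ^ 2 ≤ Real.exp (ε * L) ∧ 24 * L ^ 2 ≤ Real.exp (ε / 2 * L) ∧
      (c₁ + 3) * L ^ 2 ≤ Real.exp (1 * L) := by
    filter_upwards [Filter.eventually_ge_atTop 3,
      eventually_mul_pow_le_exp (2 * k₀) 0 (show 0 < 5 * ε by positivity),
      eventually_mul_pow_le_exp (12 * k) 0 (show 0 < 6 * ε by positivity),
      eventually_mul_pow_le_exp (4 * k * (c₁ + 3)) 2 hε0,
      eventually_mul_pow_le_exp 24 2 (show 0 < ε / 2 by positivity),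
      eventually_mul_pow_le_exp (c₁ + 3) 2 one_pos]
      with L h1 h2 h3 h4 h5 h6 using ⟨h1, h2, h3, h4, h5, h6⟩
  obtain ⟨N₀, hN₀⟩ := exists_forall_log_of_eventually ev
  refine ⟨k + 1, max N₀ 2, fun n hn m hm hmA b hb => ?_⟩
  obtain ⟨hL3, hLk₀, hLk, hLs, hLd, hLT⟩ := hN₀ n (le_of_max_le_left hn)
  have hn2 : 2 ≤ n := le_of_max_le_right hn
  have : NeZero n := ⟨by omega⟩
  have hn0 : (0 : ℝ) < n := by exact_mod_cast (by omega : 0 < n)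
  set L := Real.log n with hLdef
  have hL0 : 0 < L := by linarith
  have hL2 : 3 * L ≤ L ^ 2 := by rw [pow_two]; exact mul_le_mul_of_nonneg_right hL3 hL0.le
  have hnexp : (n : ℝ) = Real.exp L := (Real.exp_log hn0).symm
  have hm0 : (0 : ℝ) < m := by exact_mod_cast hm
  rw [pow_zero, mul_one] at hLk₀ hLk
  set s := Real.exp (-(c * L / m)) with hs
  have hs1 : s ≤ 1 := Real.exp_le_one_iff.2 (by rw [neg_nonpos]; positivity)
  have hss₀ : Real.exp (-(c / A)) ≤ s := by
    rw [hs, Real.exp_le_exp, neg_le_neg_iff, div_le_div_iff₀ hm0 hA]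
    calc c * L * A = c * (A * L) := by ring
      _ ≤ c * m := by gcongr
  have hrad : radius α β n m n = s / 2 := by
    rw [hnexp, radius_exp (by omega), hs]
    congr 2
    rw [← hLdef, hc]; ring
  set v := s ^ m with hv
  have hvexp : v = Real.exp (-(c * L)) := by
    rw [hv, hs, ← Real.exp_nat_mul]; congr 1; field_simp
  have hv0 : 0 < v := by rw [hvexp]; positivity
  set H := Real.exp (ε / 4 * L) with hH
  have hH0 : 0 < H := Real.exp_pos _
  -- The defect `1 - s` is at most `c L / m`, so the kernel errors of all coordinates together
  -- amount to a factor `n^(ε / 4)`.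
  have hms : 2 * η * (m * (1 - s)) ≤ ε / 4 * L := by
    have h1 : m * (1 - s) ≤ c * L := by
      calc m * (1 - s) ≤ m * (c * L / m) := by
            gcongr; exact one_sub_exp_neg_le _
        _ = c * L := by field_simp
    have h2 : c * L ≤ L := mul_le_of_le_one_left hL0.le hc1.le
    calc 2 * η * (m * (1 - s)) ≤ 2 * η * L := by gcongr; exact h1.trans h2
      _ = ε / 4 * L := by rw [hη]; ring
  have hvH : v * H ≤ 1 := by
    rw [hvexp, hH, ← Real.exp_add, Real.exp_le_one_iff]
    have : ε * L ≤ c * L := by gcongr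
    linarith [mul_pos hε0 hL0]
  set N := ⌊Real.exp ((1 - 2 * ε) * L)⌋₊ with hN
  have hNexp1 : 1 ≤ Real.exp ((1 - 2 * ε) * L) := Real.one_le_exp (by
    apply mul_nonneg _ hL0.le; linarith)
  have hN1 : 1 ≤ N := (Nat.one_le_floor_iff _).2 hNexp1
  have hN2 : (N : ℝ) ≤ Real.exp ((1 - 2 * ε) * L) := Nat.floor_le (by positivity)
  have hN3 : Real.exp ((1 - 2 * ε) * L) / 2 ≤ N := by
    have h1 := Nat.lt_floor_add_one (Real.exp ((1 - 2 * ε) * L))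
    have h2 : (1 : ℝ) ≤ N := by exact_mod_cast hN1
    linarith
  have hNv : Real.exp (6 * ε * L) / 2 ≤ N * v := by
    calc Real.exp (6 * ε * L) / 2 ≤ Real.exp ((1 - 2 * ε) * L - c * L) / 2 := by
          gcongr
          have : 8 * ε * L ≤ (1 - c) * L := by gcongr; linarith
          linarith
      _ = Real.exp ((1 - 2 * ε) * L) / 2 * v := by
          rw [hvexp, Real.exp_sub, Real.exp_neg]; ring
      _ ≤ N * v := by gcongr
  have hNv0 : 0 < N * v := lt_of_lt_of_le (by positivity) hNv
  have hτ : ((k₀ : ℝ) / (N * v)) ^ q ≤ v * H := by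
    have h1 : (k₀ : ℝ) / (N * v) ≤ Real.exp (-(ε * L)) := by
      rw [div_le_iff₀ hNv0]
      calc (k₀ : ℝ) ≤ Real.exp (5 * ε * L) / 2 := by linarith
        _ = Real.exp (-(ε * L)) * (Real.exp (6 * ε * L) / 2) := by
          rw [← mul_div_assoc, ← Real.exp_add]; congr 2; ring
        _ ≤ _ := by gcongr
    have h2 : v ≤ v * H := le_mul_of_one_le_right hv0.le (Real.one_le_exp (by positivity))
    refine le_trans (pow_le_pow_left₀ (by positivity) h1 q) (le_trans ?_ h2)
    rw [hvexp, ← Real.exp_nat_mul, Real.exp_le_exp]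
    have : c * L ≤ ε * q * L := by gcongr
    linarith
  set δ : ℝ := 1 / (6 * H ^ 2) with hδ
  have hH1 : 1 ≤ H := Real.one_le_exp (by positivity)
  have hδ1 : δ ≤ 1 := by
    rw [hδ, div_le_one (by positivity)]
    have := one_le_pow₀ hH1 (n := 2)
    linarith
  have hbv : ∀ w : UnitAddTorus (Fin m), ∫⁻ z, ballKernel s w z ≤ ENNReal.ofReal v := by
    intro w
    have h1 : ∫⁻ z, ballKernel s w z = volume (Metric.closedBall w (s / 2)) := by
      have := lintegral_ballKernel_mul (X := UnitAddTorus (Fin m)) volume (s := s) w (fun _ => 1)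
      simpa using this
    rw [h1]
    have h2 := torus_volume_closedBall w (r := s / 2) (by positivity) (by linarith)
    rw [mul_div_cancel₀ _ two_ne_zero] at h2
    rw [hv, ← h2, Measure.real, ENNReal.ofReal_toReal (measure_ne_top _ _)]
  have hpath : ∀ x y : UnitAddTorus (Fin m), ENNReal.ofReal δ ≤
      (Measure.pi fun _ : Fin k => Measure.pi fun _ : Fin N => volume)
        {ω | pathSum (ballKernel s) x k ω (fun u => ballKernel s u y) ≠ 0} := by
    intro x y
    refine pathSum_ne_zero_ge volume (measurable_ballKernel s) (ballKernel_le_one s) hv0 hbv hH0 hvH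
      hk₀ hq1 (fun i hi w z => ?_) ?_ hN1 ?_ hτ
    · refine ((hker s hss₀ hs1 i hi m w z).2).trans (ENNReal.ofReal_le_ofReal ?_)
      rw [← hv]
      exact mul_le_mul_of_nonneg_left (Real.exp_le_exp.2 hms) (by positivity)
    · refine le_trans (ENNReal.ofReal_le_ofReal ?_)
        (hker s hss₀ hs1 (k₀ * q) (Nat.le_mul_of_pos_right _ hq1) m x y).1
      rw [← hv, div_eq_mul_inv, hH, ← Real.exp_neg]
      gcongr
    · refine le_trans ?_ hNv
      rw [← hk]; linarith
  set T := ⌈c₁ * L ^ 2⌉₊ with hT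
  have hT1 : c₁ * L ^ 2 ≤ T := Nat.le_ceil _
  have hT2 : (T : ℝ) ≤ c₁ * L ^ 2 + 1 := (Nat.ceil_lt_add_one (by positivity)).le
  have hL1 : 1 ≤ L ^ 2 := by linarith
  have hT3 : (T : ℝ) + 2 ≤ (c₁ + 3) * L ^ 2 := by
    rw [add_mul]; linarith
  -- Each group succeeds with probability `δ` of order `n^(-ε / 2)`; with `n^ε` groups `Q * δ`
  -- exceeds `4 L²`.
  set Q := ⌈Real.exp (ε * L)⌉₊ with hQ
  have hQ1 : Real.exp (ε * L) ≤ Q := Nat.le_ceil _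
  have hQ2 : (Q : ℝ) ≤ 2 * Real.exp (ε * L) := by
    have h1 := (Nat.ceil_lt_add_one (Real.exp_pos (ε * L)).le).le
    have h2 : 1 ≤ Real.exp (ε * L) := Real.one_le_exp (by positivity)
    rw [hQ]; linarith
  have hslots : Fintype.card (Fin (T + 2) × Fin Q × Fin k × Fin N) ≤ Fintype.card (Fin n) := by
    simp only [Fintype.card_prod, Fintype.card_fin]
    have : (((T + 2) * (Q * (k * N)) : ℕ) : ℝ) ≤ n := by
      push_cast
      calc ((T : ℝ) + 2) * (Q * (k * N)) ≤ ((c₁ + 3) * L ^ 2) *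
            (2 * Real.exp (ε * L) * (k * Real.exp ((1 - 2 * ε) * L))) := by gcongr
        _ = (4 * k * (c₁ + 3) * L ^ 2) * (Real.exp (ε * L) * Real.exp ((1 - 2 * ε) * L)) / 2 := by
            ring
        _ ≤ Real.exp (ε * L) * (Real.exp (ε * L) * Real.exp ((1 - 2 * ε) * L)) / 2 := by gcongr
        _ = n / 2 := by
            rw [← Real.exp_add, ← Real.exp_add, hnexp]; congr 2; ring
        _ ≤ n := by linarith
    exact_mod_cast this
  obtain ⟨e⟩ := Function.Embedding.nonempty_of_card_le hslots
  refine (marks_groups_le p hα0.le hb hk1 hrad hδ1 hpath e.injective).trans ?_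
  have hexp : ∀ (x : ℝ) (j : ℕ), x ≤ 1 → (1 - x) ^ j ≤ Real.exp (-(j * x)) := by
    intro x j hx
    have h1 : 1 - x ≤ Real.exp (-x) := by
      have := Real.add_one_le_exp (-x); linarith
    refine (pow_le_pow_left₀ (by linarith) h1 j).trans_eq ?_
    rw [← Real.exp_nat_mul]; congr 1; ring
  have hn2exp : (n : ℝ) ^ 2 = Real.exp (2 * L) := by
    rw [hnexp, ← Real.exp_nat_mul]; norm_cast
  rw [← ENNReal.ofReal_add (mul_nonneg (by positivity) (pow_nonneg (by linarith) _))
    (mul_nonneg (by positivity) (pow_nonneg (by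
      have := pow_le_one₀ hp0.le hp1 (n := k + 1); linarith) _))]
  refine ENNReal.ofReal_le_ofReal ?_
  rw [two_mul]
  refine add_le_add ?_ ?_
  · have h1 : 4 * L ^ 2 ≤ Q * δ := by
      calc 4 * L ^ 2 ≤ Real.exp (ε / 2 * L) / 6 := by linarith
        _ = Real.exp (ε * L) * δ := by
          have h2 : Real.exp (ε * L) = Real.exp (ε / 2 * L) * H ^ 2 := by
            rw [hH, ← Real.exp_nat_mul, ← Real.exp_add]; congr 1; push_cast; ring
          rw [h2, hδ]; field_simp
        _ ≤ _ := by gcongr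
    calc (n : ℝ) ^ 2 * (T + 2) * (1 - δ) ^ Q
        ≤ Real.exp (2 * L) * Real.exp (1 * L) * Real.exp (-(4 * L ^ 2)) := by
          rw [hn2exp]
          have h5 : (1 - δ) ^ Q ≤ Real.exp (-(4 * L ^ 2)) :=
            (hexp δ Q hδ1).trans (Real.exp_le_exp.2 (by linarith))
          have h6 : (T : ℝ) + 2 ≤ Real.exp (1 * L) := hT3.trans hLT
          have h7 : 0 ≤ (1 - δ) ^ Q := pow_nonneg (by linarith) _
          gcongr
      _ ≤ Real.exp (-L ^ 2) := by
          rw [← Real.exp_add, ← Real.exp_add, Real.exp_le_exp]; linarith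
  · have h1 : 2 * L ^ 2 ≤ T * (p : ℝ) ^ (k + 1) := by
      calc 2 * L ^ 2 = c₁ * L ^ 2 * (p : ℝ) ^ (k + 1) := by rw [hc₁]; field_simp
        _ ≤ _ := by gcongr
    calc (n : ℝ) ^ 2 * (1 - (p : ℝ) ^ (k + 1)) ^ T
        ≤ Real.exp (2 * L) * Real.exp (-(2 * L ^ 2)) := by
          rw [hn2exp]
          gcongr
          exact (hexp _ T (pow_le_one₀ hp0.le hp1)).trans (Real.exp_le_exp.2 (by linarith))
      _ ≤ Real.exp (-L ^ 2) := by
          rw [← Real.exp_add, Real.exp_le_exp]; linarith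

end LargeDimension


/-! ### Lower bound: lengths of chains and of paths. -/

section ChainLength

variable {X : Type*} [PseudoMetricSpace X]

/-- The length of the polygonal chain that starts at a point and runs through a list of points. -/
noncomputable def chainLen : X → List X → ℝ
  | _, [] => 0
  | x, y :: l => dist x y + chainLen y l

theorem chainLen_le_dist_add (x y : X) (l : List X) :
    chainLen x l ≤ dist x y + chainLen y l := by
  cases l with
  | nil => simp [chainLen]
  | cons z l =>
    have := dist_triangle x y z
    simp only [chainLen]; linarith

theorem chainLen_le_of_sublist (x : X) {l₁ l₂ : List X} (h : l₁.Sublist l₂) :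
    chainLen x l₁ ≤ chainLen x l₂ := by
  induction h generalizing x with
  | slnil => exact le_rfl
  | cons y _ ih => exact (chainLen_le_dist_add x y _).trans (add_le_add_right (ih y) _)
  | cons_cons y _ ih => exact add_le_add_right (ih y) _

theorem dist_le_chainLen_of_mem (x : X) {l : List X} {y : X} (h : y ∈ l) :
    dist x y ≤ chainLen x l := by
  have := chainLen_le_of_sublist x (List.singleton_sublist.2 h)
  simpa [chainLen] using this

variable {V : Type*} (pos : V → X) {rad : V → ℝ}

/-- Every radius occurs in at most two steps; the extra `rad u` is what the induction needs. -/
theorem chainLen_le_sum_rad (hrad : ∀ u, 0 ≤ rad u) {u : V} {l : List V}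
    (h : (u :: l).IsChain fun v w => dist (pos v) (pos w) ≤ rad v + rad w) :
    chainLen (pos u) (l.map pos) + rad u ≤ 2 * ((u :: l).map rad).sum := by
  induction l generalizing u with
  | nil => simp only [List.map_nil, chainLen, List.map_cons, List.sum_cons, List.sum_nil]
           linarith [hrad u]
  | cons v l ih =>
    rw [List.isChain_cons_cons] at h
    have := ih h.2
    simp only [List.map_cons, chainLen, List.sum_cons] at this ⊢
    linarith [h.1]

theorem sum_rad_le {ι : Type*} [Fintype ι] {cls : ι → V → Prop} [∀ i, DecidablePred (cls i)]
    {σ : ι → ℝ} {b₀ : ℝ} (h : ∀ u, rad u ≤ b₀ + ∑ i, if cls i u then σ i else 0) (l : List V) :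
    (l.map rad).sum ≤ l.length * b₀ + ∑ i, (l.filter fun u => cls i u).length * σ i := by
  induction l with
  | nil => simp
  | cons u l ih =>
    have hi : ∀ i, (((u :: l).filter fun u => cls i u).length : ℝ) * σ i =
        (l.filter fun u => cls i u).length * σ i + if cls i u then σ i else 0 := by
      intro i
      by_cases hc : cls i u
      · simp [hc]; ring
      · simp [hc]
    simp_rw [hi, Finset.sum_add_distrib]
    simp only [List.map_cons, List.sum_cons, List.length_cons]
    push_cast
    linarith [h u]

/-- If no point of a class can be visited too often by short chains, then paths with few nodes are
short. -/
theorem chainLen_path_le {ι : Type*} [Fintype ι] {cls : ι → V → Prop}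
    [∀ i, DecidablePred (cls i)] {σ : ι → ℝ} {b₀ Λ : ℝ} {k : ι → ℕ} {x : X}
    (hσ : ∀ i, 0 ≤ σ i) (hΛ : 0 ≤ Λ) (hrad0 : ∀ u, 0 ≤ rad u)
    (hrad : ∀ u, rad u ≤ b₀ + ∑ i, if cls i u then σ i else 0)
    (hgood : ∀ i, ∀ l : List V, l.Nodup → l.length = k i → (∀ u ∈ l, cls i u) →
      Λ < chainLen x (l.map pos))
    (hsum : ∑ i, k i * σ i ≤ Λ / 16) {u : V} (hu : dist x (pos u) ≤ Λ / 4) {l : List V}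
    (hnd : (u :: l).Nodup) (hch : (u :: l).IsChain fun v w => dist (pos v) (pos w) ≤ rad v + rad w)
    (hlen : ((l.length : ℝ) + 1) * b₀ ≤ Λ / 16) (hb₀ : 0 ≤ b₀) :
    chainLen x ((u :: l).map pos) ≤ Λ / 2 := by
  induction l using List.reverseRecOn with
  | nil => simp only [List.map_cons, List.map_nil, chainLen]; linarith
  | append_singleton l w ih =>
    have hpre : (u :: l) <+: (u :: (l ++ [w])) := by
      rw [← List.cons_append]; exact List.prefix_append _ _
    have ih' := ih (hnd.sublist hpre.sublist) (hch.prefix hpre) (by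
      refine le_trans ?_ hlen
      rw [List.length_append]
      push_cast
      nlinarith [List.length_singleton (a := w)])
    -- By induction the path without its last node is short, so it has fewer than `k i` nodes of
    -- class `i`; the last node adds at most one.
    have hcount : ∀ i, (((u :: (l ++ [w])).filter fun v => cls i v).length : ℝ) ≤ k i := by
      intro i
      have h1 : ((u :: l).filter fun v => cls i v).length < k i := by
        by_contra hcon
        push Not at hcon
        set l' := ((u :: l).filter fun v => cls i v).take (k i)
        have hsub : l'.Sublist (u :: l) := (List.take_sublist _ _).trans List.filter_sublist
        have h2 := hgood i l' ((hnd.sublist hpre.sublist).sublist hsub)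
          (by rw [List.length_take, min_eq_left hcon]) (fun v hv => by
            have := List.mem_of_mem_take hv
            simpa using (List.mem_filter.1 this).2)
        have h3 := chainLen_le_of_sublist x (hsub.map pos)
        linarith
      have h2 : ((u :: (l ++ [w])).filter fun v => cls i v).length ≤
          ((u :: l).filter fun v => cls i v).length + 1 := by
        rw [← List.cons_append, List.filter_append, List.length_append]
        exact Nat.add_le_add_left (List.length_filter_le _ _) _
      exact_mod_cast h2.trans h1
    have h1 := chainLen_le_sum_rad pos hrad0 hch
    have h2 := sum_rad_le hrad (u :: (l ++ [w]))
    have h3 : ∑ i, (((u :: (l ++ [w])).filter fun v => cls i v).length : ℝ) * σ i ≤ Λ / 16 :=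
      (Finset.sum_le_sum fun i _ => mul_le_mul_of_nonneg_right (hcount i) (hσ i)).trans hsum
    have h4 := hrad0 u
    rw [List.length_cons] at h2
    push_cast at h2
    rw [List.map_cons, chainLen]
    linarith

end ChainLength

/-! ### Separated starting points. -/

section BoxCentres

/-- The centres of `2 ^ m` disjoint boxes. -/
noncomputable def boxCentre {m : ℕ} (B : Fin m → Bool) : UnitAddTorus (Fin m) :=
  fun c => if B c then ((1 / 2 : ℝ) : UnitAddCircle) else 0

theorem dist_boxCentre {m : ℕ} {B B' : Fin m → Bool} (h : B ≠ B') :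
    1 / 2 ≤ dist (boxCentre B) (boxCentre B') := by
  obtain ⟨c, hc⟩ := Function.ne_iff.1 h
  refine le_trans ?_ (dist_le_pi_dist _ _ c)
  have hhalf : ‖((1 / 2 : ℝ) : UnitAddCircle)‖ = 1 / 2 := by
    simpa using AddCircle.norm_half_period_eq (1 : ℝ)
  simp only [boxCentre]
  cases h1 : B c <;> cases h2 : B' c
  · exact absurd (h1.trans h2.symm) hc
  · simp only [Bool.false_eq_true, if_false, if_true, dist_zero_left]; exact hhalf.ge
  · simp only [Bool.false_eq_true, if_false, if_true, dist_zero_right]; exact hhalf.ge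
  · exact absurd (h1.trans h2.symm) hc

/-- If all paths from a node near the centre of a box are short, then the diameter is large. -/
theorem le_diam_of_box {V : Type*} [Nontrivial V] [Finite V] {m : ℕ} (hm : 1 ≤ m)
    {G : SimpleGraph V} (hG : G.Connected) (pos : V → UnitAddTorus (Fin m)) {Λ b₀ : ℝ}
    (hΛ0 : 0 < Λ) (hΛ : Λ ≤ 1 / 2) (hb₀ : 0 < b₀) (hnet : ∀ z, ∃ u, dist (pos u) z ≤ Λ / 4)
    {B : Fin m → Bool} (h : ∀ (u : V) (l : List V), dist (boxCentre B) (pos u) ≤ Λ / 4 →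
      (u :: l).Nodup → (u :: l).IsChain G.Adj → ((l.length : ℝ) + 1) * b₀ ≤ Λ / 16 →
      chainLen (boxCentre B) ((u :: l).map pos) ≤ Λ / 2) :
    Λ / (32 * b₀) ≤ G.diam := by
  by_contra hcon
  push Not at hcon
  have hd1 : 1 ≤ G.diam := Nat.one_le_iff_ne_zero.2 (SimpleGraph.connected_iff_diam_ne_zero.1 hG)
  have hd1' : (1 : ℝ) ≤ G.diam := by exact_mod_cast hd1
  rw [lt_div_iff₀ (by positivity)] at hcon
  -- Any other box would do. A path to a node near its centre covers distance at least `1 / 2 - Λ /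
  -- 4`, more than `Λ / 2`.
  set B' : Fin m → Bool := fun c => !(B c)
  have hBB' : B ≠ B' := Function.ne_iff.2 ⟨⟨0, hm⟩, by simp [B']⟩
  obtain ⟨u, hu⟩ := hnet (boxCentre B)
  obtain ⟨w, hw⟩ := hnet (boxCentre B')
  obtain ⟨p, hp, hlen⟩ := hG.exists_path_of_dist u w
  have hle : p.length ≤ G.diam := by
    rw [hlen]
    exact SimpleGraph.dist_le_diam (SimpleGraph.connected_iff_ediam_ne_top.1 hG)
  have hle' : (p.length : ℝ) ≤ G.diam := by exact_mod_cast hle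
  have hsupp : p.support = u :: p.support.tail := p.cons_tail_support.symm
  have hlt : p.support.tail.length = p.length := by simp
  have hnd : (u :: p.support.tail).Nodup := by rw [← hsupp]; exact hp.support_nodup
  have hch : (u :: p.support.tail).IsChain G.Adj := by rw [← hsupp]; exact p.isChain_adj_support
  rw [dist_comm] at hu
  have := h u _ hu hnd hch (by rw [hlt]; nlinarith)
  have hmem : pos w ∈ (u :: p.support.tail).map pos := by
    rw [← hsupp]; exact List.mem_map_of_mem p.end_mem_support
  have h1 := dist_le_chainLen_of_mem (boxCentre B) hmem
  have h2 := dist_boxCentre hBB'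
  have h3 := dist_triangle (boxCentre B) (pos w) (boxCentre B')
  linarith

end BoxCentres


/-! ### Exponential weights of chains. -/

section ChainWeight

variable {V X Y : Type*} [MeasurableSpace X] [MeasurableSpace Y]

/-- The product of a kernel along the chain of points which starts in `x` and runs through the
positions of the marks `ω u`, for `u` in a list. -/
noncomputable def chainWeight (φ : X → Y → ENNReal) (pos : Y → X) (ω : V → Y) :
    X → List V → ENNReal
  | _, [] => 1
  | x, u :: l => φ x (ω u) * chainWeight φ pos ω (pos (ω u)) l

variable {φ : X → Y → ENNReal} {pos : Y → X}

theorem measurable_chainWeight (hφ : Measurable fun z : X × Y => φ z.1 z.2) (hpos : Measurable pos)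
    (l : List V) : Measurable fun z : (V → Y) × X => chainWeight φ pos z.1 z.2 l := by
  induction l with
  | nil => exact measurable_const
  | cons u l ih =>
    have hu : Measurable fun z : (V → Y) × X => z.1 u := (measurable_pi_apply u).comp measurable_fst
    exact (hφ.comp (measurable_snd.prodMk hu)).mul
      (ih.comp (measurable_fst.prodMk (hpos.comp hu)))

theorem chainWeight_update [DecidableEq V] {u : V} {l : List V} (hu : u ∉ l) (ω : V → Y) (y : Y)
    (x : X) : chainWeight φ pos (Function.update ω u y) x l = chainWeight φ pos ω x l := by
  induction l generalizing x with
  | nil => rfl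
  | cons v l ih =>
    rw [List.mem_cons, not_or] at hu
    simp only [chainWeight, Function.update_of_ne (Ne.symm hu.1), ih hu.2]

/-- The nodes after the first are integrated first, with a bound that is uniform in their starting
point; so each node costs a factor `q`. -/
theorem lintegral_chainWeight_mul_le [Fintype V] [DecidableEq V] (μ : Measure Y)
    [IsProbabilityMeasure μ] (hφ : Measurable fun z : X × Y => φ z.1 z.2) (hpos : Measurable pos)
    {q : ENNReal} (hq : ∀ x, ∫⁻ y, φ x y ∂μ ≤ q) {l : List V} (hl : l.Nodup)
    {g : (V → Y) → ENNReal} (hg : Measurable g)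
    (hgu : ∀ u ∈ l, ∀ ω y, g (Function.update ω u y) = g ω) (x : X) :
    ∫⁻ ω, chainWeight φ pos ω x l * g ω ∂Measure.pi (fun _ => μ) ≤
      q ^ l.length * ∫⁻ ω, g ω ∂Measure.pi (fun _ => μ) := by
  induction l generalizing x with
  | nil => simp [chainWeight]
  | cons u l ih =>
    rw [List.nodup_cons] at hl
    have hm : Measurable fun ω : V → Y => chainWeight φ pos ω x (u :: l) * g ω :=
      ((measurable_chainWeight hφ hpos (u :: l)).comp (measurable_id.prodMk measurable_const)).mul hg
    rw [lintegral_pi_update μ u hm]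
    have hφx : Measurable (φ x) := hφ.comp (measurable_const.prodMk measurable_id)
    have hm2 : Measurable fun z : (V → Y) × Y => φ x z.2 * (chainWeight φ pos z.1 (pos z.2) l * g z.1) :=
      (hφx.comp measurable_snd).mul (((measurable_chainWeight hφ hpos l).comp
        (measurable_fst.prodMk (hpos.comp measurable_snd))).mul (hg.comp measurable_fst))
    have he : ∀ ω y, chainWeight φ pos (Function.update ω u y) x (u :: l) *
        g (Function.update ω u y) = φ x y * (chainWeight φ pos ω (pos y) l * g ω) := by
      intro ω y
      rw [hgu u List.mem_cons_self, chainWeight, Function.update_self, chainWeight_update hl.1,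
        mul_assoc]
    simp only [he]
    rw [lintegral_lintegral_swap hm2.aemeasurable]
    calc ∫⁻ y, ∫⁻ ω, φ x y * (chainWeight φ pos ω (pos y) l * g ω) ∂Measure.pi (fun _ => μ) ∂μ
        ≤ ∫⁻ y, φ x y * (q ^ l.length * ∫⁻ ω, g ω ∂Measure.pi (fun _ => μ)) ∂μ := by
          refine lintegral_mono fun y => ?_
          have hm3 : Measurable fun ω : V → Y => chainWeight φ pos ω (pos y) l * g ω :=
            ((measurable_chainWeight hφ hpos l).comp (measurable_id.prodMk measurable_const)).mul hg
          rw [lintegral_const_mul _ hm3]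
          exact mul_le_mul_right (ih hl.2 (fun v hv => hgu v (List.mem_cons_of_mem _ hv)) _) _
      _ ≤ q * (q ^ l.length * ∫⁻ ω, g ω ∂Measure.pi (fun _ => μ)) := by
          rw [lintegral_mul_const _ hφx]
          exact mul_le_mul_left (hq x) _
      _ = _ := by rw [List.length_cons, pow_succ', mul_assoc]

/-- Chains through disjoint sets of nodes can be integrated one after the other, each with the
others as the factor `g`. -/
theorem lintegral_prod_chainWeight_le [Fintype V] [DecidableEq V] (μ : Measure Y)
    [IsProbabilityMeasure μ] {β : Type*} [DecidableEq β] {φ : β → X → Y → ENNReal}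
    (hφ : ∀ b, Measurable fun z : X × Y => φ b z.1 z.2) (hpos : Measurable pos)
    {q : β → ENNReal} (hq : ∀ b x, ∫⁻ y, φ b x y ∂μ ≤ q b) {l : β → List V}
    (hl : ∀ b, (l b).Nodup) (hd : ∀ b b', b ≠ b' → (l b).Disjoint (l b')) (x : β → X)
    (s : Finset β) :
    ∫⁻ ω, ∏ b ∈ s, chainWeight (φ b) pos ω (x b) (l b) ∂Measure.pi (fun _ => μ) ≤
      ∏ b ∈ s, q b ^ (l b).length := by
  induction s using Finset.induction_on with
  | empty => simp
  | insert b s hb ih =>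
    simp only [Finset.prod_insert hb]
    refine (lintegral_chainWeight_mul_le μ (hφ b) hpos (hq b) (hl b) ?_ ?_ (x b)).trans
      (mul_le_mul_right ih _)
    · exact Finset.measurable_prod _ fun c _ => (measurable_chainWeight (hφ c) hpos (l c)).comp
        (measurable_id.prodMk measurable_const)
    · intro u hu ω y
      refine Finset.prod_congr rfl fun c hc => chainWeight_update (fun h => ?_) ω y _
      exact hd b c (fun e => hb (e ▸ hc)) hu h

end ChainWeight

/-! ### First moment bound for short chains from many points. -/

section ShortChain

variable {V X Y : Type*} [PseudoMetricSpace X] [MeasurableSpace X] [OpensMeasurableSpace X]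
  [SecondCountableTopology X] [MeasurableSpace Y]

/-- Exponential weight of a step from `x` to the position of a mark with property `P`. -/
noncomputable def expKernel (pos : Y → X) (P : Y → Prop) [DecidablePred P] (lam : ℝ) (x : X)
    (y : Y) : ENNReal :=
  if P y then ENNReal.ofReal (Real.exp (-lam * dist x (pos y))) else 0

theorem measurable_expKernel {pos : Y → X} (hpos : Measurable pos) {P : Y → Prop} [DecidablePred P]
    (hP : MeasurableSet {y | P y}) (lam : ℝ) :
    Measurable fun z : X × Y => expKernel pos P lam z.1 z.2 := by
  refine Measurable.ite (measurable_snd hP) ?_ measurable_const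
  exact ENNReal.measurable_ofReal.comp (Real.measurable_exp.comp
    ((measurable_fst.dist (hpos.comp measurable_snd)).const_mul _))

theorem chainWeight_expKernel {pos : Y → X} {P : Y → Prop} [DecidablePred P] {lam : ℝ} {ω : V → Y}
    {l : List V} (h : ∀ u ∈ l, P (ω u)) (x : X) :
    chainWeight (expKernel pos P lam) pos ω x l =
      ENNReal.ofReal (Real.exp (-lam * chainLen x (l.map fun u => pos (ω u)))) := by
  induction l generalizing x with
  | nil => simp [chainWeight, chainLen]
  | cons u l ih =>
    rw [chainWeight, ih (fun v hv => h v (List.mem_cons_of_mem _ hv)), expKernel,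
      if_pos (h u List.mem_cons_self), ← ENNReal.ofReal_mul (Real.exp_pos _).le, ← Real.exp_add,
      List.map_cons, chainLen, mul_add]

/-- First moment bound for the event that every one of the points `x b` is the start of a short
chain through the marks of some class `i`. -/
theorem pi_forall_exists_chain_le [Fintype V] [DecidableEq V] (μ : Measure Y)
    [IsProbabilityMeasure μ] {β ι : Type*} [Fintype β] [DecidableEq β] [Fintype ι]
    {pos : Y → X} (hpos : Measurable pos) {P : ι → Y → Prop} [∀ i, DecidablePred (P i)]
    (hP : ∀ i, MeasurableSet {y | P i y}) {lam : ι → ℝ} (hlam : ∀ i, 0 ≤ lam i) {q : ι → ENNReal}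
    (hq : ∀ i x, ∫⁻ y, expKernel pos (P i) (lam i) x y ∂μ ≤ q i) {x : β → X} {Λ : ℝ}
    (hx : ∀ b b', b ≠ b' → 2 * Λ < dist (x b) (x b')) (k : ι → ℕ) :
    Measure.pi (fun _ : V => μ) {ω | ∀ b, ∃ i, ∃ l : List V, l.Nodup ∧ l.length = k i ∧
      (∀ u ∈ l, P i (ω u)) ∧ chainLen (x b) (l.map fun u => pos (ω u)) ≤ Λ} ≤
    (∑ i, (Fintype.card V : ENNReal) ^ k i * (ENNReal.ofReal (Real.exp (lam i * Λ)) * q i ^ k i)) ^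
      Fintype.card β := by
  classical
  let W := Σ i : ι, (Fin (k i) → V)
  let A : β → W → Set (V → Y) := fun b w => {ω | (List.ofFn w.2).Nodup ∧
    (∀ u ∈ List.ofFn w.2, P w.1 (ω u)) ∧
    chainLen (x b) ((List.ofFn w.2).map fun u => pos (ω u)) ≤ Λ}
  let θ : W → ENNReal := fun w => ENNReal.ofReal (Real.exp (lam w.1 * Λ)) * q w.1 ^ k w.1
  have hsub : {ω : V → Y | ∀ b, ∃ i, ∃ l : List V, l.Nodup ∧ l.length = k i ∧
      (∀ u ∈ l, P i (ω u)) ∧ chainLen (x b) (l.map fun u => pos (ω u)) ≤ Λ} ⊆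
      ⋃ f : β → W, {ω | ∀ b, ω ∈ A b (f b)} := by
    intro ω hω
    have : ∀ b, ∃ w : W, ω ∈ A b w := by
      intro b
      obtain ⟨i, l, hnd, hlen, hc, hch⟩ := hω b
      refine ⟨⟨i, fun j => l.get (j.cast hlen.symm)⟩, ?_⟩
      have : List.ofFn (fun j : Fin (k i) => l.get (j.cast hlen.symm)) = l := by
        apply List.ext_get
        · simp [hlen]
        · intro a h1 h2; simp
      exact ⟨by rw [this]; exact hnd, by rw [this]; exact hc, by rw [this]; exact hch⟩
    choose f hf using this
    exact Set.mem_iUnion.2 ⟨f, hf⟩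
  have hf : ∀ f : β → W, Measure.pi (fun _ : V => μ) {ω | ∀ b, ω ∈ A b (f b)} ≤ ∏ b, θ (f b) := by
    intro f
    -- A single outcome in the event suffices for disjointness: short chains from centres more than
    -- `2 * Λ` apart share no node.
    by_cases hemp : {ω : V → Y | ∀ b, ω ∈ A b (f b)} = ∅
    · rw [hemp]; simp
    obtain ⟨ω₀, hω₀⟩ := Set.nonempty_iff_ne_empty.2 hemp
    have hnd : ∀ b, (List.ofFn (f b).2).Nodup := fun b => (hω₀ b).1
    have hd : ∀ b b', b ≠ b' → (List.ofFn (f b).2).Disjoint (List.ofFn (f b').2) := by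
      intro b b' hb u hu hu'
      have h1 := (dist_le_chainLen_of_mem (x b) (List.mem_map_of_mem
        (f := fun u => pos (ω₀ u)) hu)).trans (hω₀ b).2.2
      have h2 := (dist_le_chainLen_of_mem (x b') (List.mem_map_of_mem
        (f := fun u => pos (ω₀ u)) hu')).trans (hω₀ b').2.2
      have := dist_triangle_right (x b) (x b') (pos (ω₀ u))
      linarith [hx b b' hb]
    let F : (V → Y) → ENNReal := fun ω => ∏ b, chainWeight (expKernel pos (P (f b).1) (lam (f b).1))
      pos ω (x b) (List.ofFn (f b).2)
    have hF : Measurable F := Finset.measurable_prod _ fun b _ =>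
      (measurable_chainWeight (measurable_expKernel hpos (hP _) _) hpos _).comp
        (measurable_id.prodMk measurable_const)
    let c : ENNReal := ∏ b, ENNReal.ofReal (Real.exp (lam (f b).1 * Λ))
    have hle : ∀ ω ∈ {ω : V → Y | ∀ b, ω ∈ A b (f b)}, 1 ≤ c * F ω := by
      intro ω hω
      simp only [c, F, ← Finset.prod_mul_distrib]
      refine Finset.one_le_prod' fun b _ => ?_
      rw [chainWeight_expKernel (hω b).2.1, ← ENNReal.ofReal_mul (Real.exp_pos _).le,
        ← Real.exp_add, ENNReal.one_le_ofReal]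
      refine Real.one_le_exp ?_
      have := mul_le_mul_of_nonneg_left (hω b).2.2 (hlam (f b).1)
      linarith
    calc Measure.pi (fun _ : V => μ) {ω | ∀ b, ω ∈ A b (f b)}
        ≤ Measure.pi (fun _ : V => μ) {ω | 1 ≤ c * F ω} := measure_mono hle
      _ ≤ ∫⁻ ω, c * F ω ∂Measure.pi (fun _ : V => μ) := by
          have := mul_meas_ge_le_lintegral (μ := Measure.pi (fun _ : V => μ)) (hF.const_mul c) 1
          rwa [one_mul] at this
      _ = c * ∫⁻ ω, F ω ∂Measure.pi (fun _ : V => μ) := lintegral_const_mul _ hF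
      _ ≤ c * ∏ b, q (f b).1 ^ (List.ofFn (f b).2).length := by
          refine mul_le_mul_right ?_ _
          exact lintegral_prod_chainWeight_le μ (fun b => measurable_expKernel hpos (hP _) _) hpos
            (fun b => hq (f b).1) hnd hd x Finset.univ
      _ = _ := by simp only [c, θ, List.length_ofFn, Finset.prod_mul_distrib]
  calc _ ≤ _ := measure_mono hsub
    _ ≤ ∑ f : β → W, ∏ b, θ (f b) := (measure_iUnion_fintype_le _ _).trans
        (Finset.sum_le_sum fun f _ => hf f)
    -- The sum over all choices factorises, which gives one power of the single-box bound per box.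
    _ = (∑ w : W, θ w) ^ Fintype.card β := by
        have := Finset.prod_univ_sum (fun _ : β => (Finset.univ : Finset W)) (fun _ w => θ w)
        rw [Finset.prod_const, Finset.card_univ] at this
        rw [this, Fintype.piFinset_univ]
    _ = _ := by
        congr 1
        rw [Fintype.sum_sigma]
        refine Finset.sum_congr rfl fun i _ => ?_
        simp only [θ, Finset.sum_const, Finset.card_univ, Fintype.card_fun, Fintype.card_fin,
          nsmul_eq_mul, Nat.cast_pow]

end ShortChain


/-! ### Exponential moments of distances in the torus. -/

theorem lintegral_exp_neg_mul_abs {a : ℝ} (ha : 0 < a) :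
    ∫⁻ t : ℝ, ENNReal.ofReal (Real.exp (-a * |t|)) = ENNReal.ofReal (2 / a) := by
  have h1 : ∫⁻ t in Set.Iic (0 : ℝ), ENNReal.ofReal (Real.exp (-a * |t|)) =
      ENNReal.ofReal (1 / a) := by
    rw [setLIntegral_congr_fun (g := fun t => ENNReal.ofReal (Real.exp (a * t))) measurableSet_Iic
      fun t ht => by simp only [abs_of_nonpos (Set.mem_Iic.1 ht)]; ring_nf,
      ← ofReal_integral_eq_lintegral_ofReal (integrableOn_exp_mul_Iic ha 0)
        (ae_of_all _ fun t => (Real.exp_pos _).le), integral_exp_mul_Iic ha]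
    simp
  have h2 : ∫⁻ t in Set.Ioi (0 : ℝ), ENNReal.ofReal (Real.exp (-a * |t|)) =
      ENNReal.ofReal (1 / a) := by
    rw [setLIntegral_congr_fun (g := fun t => ENNReal.ofReal (Real.exp (-a * t))) measurableSet_Ioi
      fun t ht => by simp only [abs_of_pos (Set.mem_Ioi.1 ht)],
      ← ofReal_integral_eq_lintegral_ofReal (integrableOn_exp_mul_Ioi (neg_lt_zero.2 ha) 0)
        (ae_of_all _ fun t => (Real.exp_pos _).le), integral_exp_mul_Ioi (neg_lt_zero.2 ha)]
    simp
  rw [← lintegral_add_compl _ measurableSet_Iic, Set.compl_Iic, h1, h2,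
    ← ENNReal.ofReal_add (by positivity) (by positivity)]
  ring_nf

theorem lintegral_circle_exp_neg_dist_le (x : UnitAddCircle) {a : ℝ} (ha : 0 < a) :
    ∫⁻ y : UnitAddCircle, ENNReal.ofReal (Real.exp (-a * dist x y)) ≤ ENNReal.ofReal (2 / a) := by
  have h1 : ∫⁻ y : UnitAddCircle, ENNReal.ofReal (Real.exp (-a * dist x y)) =
      ∫⁻ y : UnitAddCircle, ENNReal.ofReal (Real.exp (-a * ‖y‖)) := by
    simp only [dist_eq_norm]
    exact lintegral_sub_left_eq_self (fun y : UnitAddCircle =>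
      ENNReal.ofReal (Real.exp (-a * ‖y‖))) x
  rw [h1, ← UnitAddCircle.lintegral_preimage (-(1 / 2)), ← lintegral_exp_neg_mul_abs ha]
  refine le_trans (le_of_eq ?_) (setLIntegral_le_lintegral (Set.Ioc (-(1 / 2)) (-(1 / 2) + 1)) _)
  refine setLIntegral_congr_fun measurableSet_Ioc fun t ht => ?_
  have : ‖(t : UnitAddCircle)‖ = |t| := by
    rw [AddCircle.norm_coe_eq_abs_iff (1 : ℝ) one_ne_zero, abs_one]
    exact abs_le.2 ⟨ht.1.le, by linarith [ht.2]⟩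
  simp only [this]

/-- The maximum of the coordinate distances is at least their average, and the exponential of the
average factorises. -/
theorem lintegral_torus_exp_neg_dist_le {m : ℕ} (hm : 1 ≤ m) (x : UnitAddTorus (Fin m)) {a : ℝ}
    (ha : 0 < a) :
    ∫⁻ y : UnitAddTorus (Fin m), ENNReal.ofReal (Real.exp (-a * dist x y)) ≤
      ENNReal.ofReal ((2 * m / a) ^ m) := by
  have hm0 : (0 : ℝ) < m := by exact_mod_cast hm
  calc ∫⁻ y : UnitAddTorus (Fin m), ENNReal.ofReal (Real.exp (-a * dist x y))
      ≤ ∫⁻ y : UnitAddTorus (Fin m),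
          ∏ c, ENNReal.ofReal (Real.exp (-(a / m) * dist (x c) (y c))) := by
        refine lintegral_mono fun y => ?_
        rw [← ENNReal.ofReal_prod_of_nonneg fun _ _ => (Real.exp_pos _).le, ← Real.exp_sum,
          ← Finset.mul_sum]
        refine ENNReal.ofReal_le_ofReal (Real.exp_le_exp.2 ?_)
        have h := Finset.sum_le_card_nsmul Finset.univ (fun c => dist (x c) (y c)) (dist x y)
          fun c _ => dist_le_pi_dist x y c
        rw [Finset.card_univ, Fintype.card_fin, nsmul_eq_mul] at h
        have h2 := mul_le_mul_of_nonneg_left h (div_pos ha hm0).le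
        have h3 : a / m * (m * dist x y) = a * dist x y := by field_simp
        linarith
    _ = ∏ c : Fin m, ∫⁻ y, ENNReal.ofReal (Real.exp (-(a / m) * dist (x c) y)) :=
        lintegral_pi_prod (fun _ : Fin m => (volume : Measure UnitAddCircle))
          (f := fun c y => ENNReal.ofReal (Real.exp (-(a / m) * dist (x c) y)))
          fun c => by fun_prop
    _ ≤ ∏ _c : Fin m, ENNReal.ofReal (2 / (a / m)) :=
        Finset.prod_le_prod' fun c _ => lintegral_circle_exp_neg_dist_le _ (div_pos ha hm0)
    _ = _ := by
        rw [Finset.prod_const, Finset.card_univ, Fintype.card_fin,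
          ← ENNReal.ofReal_pow (by positivity)]
        congr 2
        field_simp

theorem uniformOn_rank_le {n : ℕ} {t : ℝ} (ht : 0 ≤ t) :
    uniformOn Set.univ {R : Fin n | (R : ℝ) + 1 ≤ t} ≤ ENNReal.ofReal (t / n) := by
  rcases Nat.eq_zero_or_pos n with rfl | hn
  · have : {R : Fin 0 | (R : ℝ) + 1 ≤ t} = ∅ := Set.eq_empty_of_isEmpty _
    rw [this]; simp
  have hn' : (0 : ℝ) < n := by exact_mod_cast hn
  have hc : {R : Fin n | (R : ℝ) + 1 ≤ t} =
      ((Finset.univ.filter fun R : Fin n => (R : ℝ) + 1 ≤ t : Finset (Fin n)) : Set (Fin n)) := by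
    ext; simp
  have hcard : (Finset.univ.filter fun R : Fin n => (R : ℝ) + 1 ≤ t).card ≤ ⌊t⌋₊ := by
    calc (Finset.univ.filter fun R : Fin n => (R : ℝ) + 1 ≤ t).card
        ≤ (Finset.range ⌊t⌋₊).card := by
          refine Finset.card_le_card_of_injOn (fun R => (R : ℕ)) (fun R hR => ?_)
            (Fin.val_injective.injOn)
          have hR' : (R : ℝ) + 1 ≤ t := by simpa using hR
          rw [Finset.coe_range, Set.mem_Iio, ← Nat.succ_le_iff]
          exact Nat.le_floor (by push_cast; exact hR')
      _ = _ := Finset.card_range _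
  rw [hc, uniformOn_univ, Measure.count_apply_finset, Fintype.card_fin,
    ENNReal.ofReal_div_of_pos hn', ENNReal.ofReal_natCast]
  refine ENNReal.div_le_div_right ?_ _
  rw [← ENNReal.ofReal_natCast]
  exact ENNReal.ofReal_le_ofReal ((Nat.cast_le.2 hcard).trans (Nat.floor_le ht))

theorem lintegral_expKernel_markLaw_le {n m : ℕ} [NeZero n] (p : unitInterval) (hm : 1 ≤ m)
    {t a : ℝ} (ht : 0 ≤ t) (ha : 0 < a) (x : UnitAddTorus (Fin m))
    [DecidablePred fun M : Mark n m => (M.1 : ℝ) + 1 ≤ t] :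
    ∫⁻ M, expKernel (fun M : Mark n m => M.2.1) (fun M => (M.1 : ℝ) + 1 ≤ t) a x M
      ∂markLaw n m p ≤ ENNReal.ofReal (t / n * (2 * m / a) ^ m) := by
  have hA : MeasurableSet {R : Fin n | (R : ℝ) + 1 ≤ t} := MeasurableSet.of_discrete
  have he : ∀ M : Mark n m,
      expKernel (fun M : Mark n m => M.2.1) (fun M => (M.1 : ℝ) + 1 ≤ t) a x M =
      Set.indicator {R : Fin n | (R : ℝ) + 1 ≤ t} 1 M.1 *
        (ENNReal.ofReal (Real.exp (-a * dist x M.2.1)) * 1) := by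
    intro M
    by_cases h : (M.1 : ℝ) + 1 ≤ t <;> simp [expKernel, h]
  simp only [he]
  have hd : Measurable fun y : UnitAddTorus (Fin m) =>
      ENNReal.ofReal (Real.exp (-a * dist x y)) := by fun_prop
  rw [markLaw, lintegral_prod_mul (Measurable.of_discrete.aemeasurable)
    (g := fun z : UnitAddTorus (Fin m) × (Fin n → Bool) =>
      ENNReal.ofReal (Real.exp (-a * dist x z.1)) * 1)
    ((hd.comp measurable_fst).mul measurable_const).aemeasurable,
    lintegral_prod_mul hd.aemeasurable (g := fun _ => 1) aemeasurable_const, lintegral_one,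
    measure_univ, mul_one, lintegral_indicator_one hA, ENNReal.ofReal_mul (by positivity)]
  exact mul_le_mul' (uniformOn_rank_le ht) (lintegral_torus_exp_neg_dist_le hm x ha)


/-! ### Classes of small rank and the conditional lower bound. -/

variable {α β : ℝ} {n m : ℕ}

/-- The probability that the centre of every box is the start of a short chain through nodes of
bounded rank. -/
theorem marks_forall_box_le [NeZero n] (p : unitInterval) (hm : 1 ≤ m) {I : ℕ} {t : ℕ → ℝ}
    (ht : ∀ i, 0 < t i) {k : ℕ → ℕ} {Λ lam : ℝ} (hΛ0 : 0 < Λ) (hΛ : Λ < 1 / 4) (hlam : 0 ≤ lam)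
    (hkt : ∀ i, 2 * Real.exp 3 * Λ * t i ^ (1 / (m : ℝ)) ≤ k i) (hk : ∀ i, lam + 1 ≤ k i)
    (hI : (I : ℝ) ≤ Real.exp (2 * m + lam)) :
    (Measure.pi fun _ => markLaw n m p) {M | ∀ B : Fin m → Bool, ∃ i : Fin I,
      ∃ l : List (Fin n), l.Nodup ∧ l.length = k i ∧ (∀ u ∈ l, ((M u).1 : ℝ) + 1 ≤ t i) ∧
      chainLen (boxCentre B) (l.map fun u => (M u).2.1) ≤ Λ} ≤
      ENNReal.ofReal (Real.exp (-(lam * 2 ^ m))) := by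
  classical
  have hn0 : (0 : ℝ) < n := by exact_mod_cast NeZero.pos n
  have hm1 : (1 : ℝ) ≤ m := by exact_mod_cast hm
  have hm0 : (0 : ℝ) < m := by linarith
  have hk0 : ∀ i, (0 : ℝ) < k i := fun i => by linarith [hk i]
  have key := pi_forall_exists_chain_le (V := Fin n) (markLaw n m p) (β := Fin m → Bool)
    (ι := Fin I) (pos := fun M : Mark n m => M.2.1) (by fun_prop)
    (P := fun i M => (M.1 : ℝ) + 1 ≤ t i)
    (fun i => (MeasurableSet.of_discrete (s := {R : Fin n | (R : ℝ) + 1 ≤ t i})).preimage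
      (f := fun M : Mark n m => M.1) (by fun_prop))
    -- With this rate the kernel bound per node is `t / n * (2 Λ / k)^m`, and the prefactor `exp
    -- (lam Λ)` costs `exp m` per node.
    (lam := fun i => m * k i / Λ) (fun i => by have := hk0 i; positivity)
    (q := fun i => ENNReal.ofReal (t i / n * (2 * m / (m * k i / Λ)) ^ m))
    (fun i x => lintegral_expKernel_markLaw_le p hm (ht i).le
      (div_pos (mul_pos hm0 (hk0 i)) hΛ0) x)
    (x := boxCentre) (Λ := Λ) (fun B B' h => by linarith [dist_boxCentre h]) (fun i => k i)
  refine key.trans ?_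
  have hterm : ∀ i : Fin I, (Fintype.card (Fin n) : ENNReal) ^ k i *
      (ENNReal.ofReal (Real.exp (m * k i / Λ * Λ)) *
        ENNReal.ofReal (t i / n * (2 * m / (m * k i / Λ)) ^ m) ^ k i) ≤
      ENNReal.ofReal (Real.exp (-(2 * (m + lam)))) := by
    intro i
    have hki := hk0 i
    have hti := ht i
    have h0 : 0 ≤ t i / n * (2 * m / (m * k i / Λ)) ^ m := by positivity
    have e1 : ENNReal.ofReal (Real.exp (m * k i / Λ * Λ)) =
        ENNReal.ofReal (Real.exp m) ^ k i := by
      rw [div_mul_cancel₀ _ hΛ0.ne', mul_comm, Real.exp_nat_mul,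
        ENNReal.ofReal_pow (Real.exp_pos _).le]
    rw [e1, Fintype.card_fin, ← mul_pow, ← mul_pow, ← ENNReal.ofReal_natCast,
      ← ENNReal.ofReal_mul (Real.exp_pos _).le, ← ENNReal.ofReal_mul hn0.le,
      ← ENNReal.ofReal_pow (by positivity)]
    refine ENNReal.ofReal_le_ofReal ?_
    have hroot : (t i ^ (1 / (m : ℝ))) ^ m = t i := by
      rw [← Real.rpow_natCast, ← Real.rpow_mul hti.le, one_div_mul_cancel hm0.ne', Real.rpow_one]
    -- After the union over `n` nodes, one node of the chain costs `t * (2 e Λ / k)^m`; the factor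
    -- `exp 3` in `hkt` brings this down to `exp (-2 m)`.
    have hbase : (n : ℝ) * (Real.exp m * (t i / n * (2 * m / (m * k i / Λ)) ^ m)) ≤
        Real.exp (-(2 * m)) := by
      have e2 : (n : ℝ) * (Real.exp m * (t i / n * (2 * m / (m * k i / Λ)) ^ m)) =
          (t i ^ (1 / (m : ℝ)) * Real.exp 1 * (2 * Λ / k i)) ^ m := by
        have e3 : 2 * (m : ℝ) / (m * k i / Λ) = 2 * Λ / k i := by field_simp
        rw [e3, mul_pow, mul_pow, hroot, ← Real.exp_nat_mul, mul_one]
        field_simp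
      rw [e2]
      have e4 : Real.exp (-(2 * (m : ℝ))) = (Real.exp (-2)) ^ m := by
        rw [← Real.exp_nat_mul]; congr 1; ring
      rw [e4]
      refine pow_le_pow_left₀ (by positivity) ?_ m
      rw [← mul_div_assoc, div_le_iff₀ hki]
      have h1 := mul_le_mul_of_nonneg_left (hkt i) (Real.exp_pos (-2)).le
      have e5 : Real.exp (-2) * Real.exp 3 = Real.exp 1 := by rw [← Real.exp_add]; norm_num
      calc t i ^ (1 / (m : ℝ)) * Real.exp 1 * (2 * Λ)
          = Real.exp (-2) * (2 * Real.exp 3 * Λ * t i ^ (1 / (m : ℝ))) := by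
            rw [← e5]; ring
        _ ≤ _ := h1
    refine (pow_le_pow_left₀ (by positivity) hbase (k i)).trans ?_
    rw [← Real.exp_nat_mul]
    refine Real.exp_le_exp.2 ?_
    have h2 := mul_le_mul_of_nonneg_left (hk i) hm0.le
    have h3 := mul_nonneg hlam (sub_nonneg.2 hm1)
    nlinarith
  have hpow : (Fintype.card (Fin m → Bool)) = 2 ^ m := by simp
  have e6 : Real.exp (-(lam * 2 ^ m)) = Real.exp (-lam) ^ (2 ^ m) := by
    rw [← Real.exp_nat_mul]; congr 1; push_cast; ring
  rw [hpow, e6, ENNReal.ofReal_pow (Real.exp_pos _).le]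
  refine pow_le_pow_left₀ (by positivity) ((Finset.sum_le_sum fun i _ => hterm i).trans ?_) _
  rw [Finset.sum_const, Finset.card_univ, Fintype.card_fin, nsmul_eq_mul,
    ← ENNReal.ofReal_natCast, ← ENNReal.ofReal_mul (by positivity)]
  refine ENNReal.ofReal_le_ofReal ((mul_le_mul_of_nonneg_right hI (Real.exp_pos _).le).trans ?_)
  rw [← Real.exp_add]
  exact Real.exp_le_exp.2 (by linarith)

/-- The radius of influence of the nodes of rank between consecutive thresholds `t i`,
`t (i + 1)`. -/
noncomputable def classRadius (α β : ℝ) (n m : ℕ) (t : ℕ → ℝ) (i : ℕ) : ℝ :=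
  if i = 0 then radius α β n m 1 else radius α β n m (t i / 8)

/-- The classes are nested. A node is charged to the first class that contains it: its rank then
exceeds the previous threshold up to the factor `8`. In the class with index `0` only rank `1` is a
safe lower bound, as small ranks do not concentrate. -/
theorem radius_lowRank_le (hα : 0 ≤ α) (hn : 1 ≤ n) (hc : 8 ≤ rankCutoff n) {t : ℕ → ℝ}
    (ht0 : t 0 = rankCutoff n) (ht : Monotone t) {I : ℕ} (hI : 1 ≤ I) (R : Fin n) :
    radius α β n m (lowRank n R) ≤ radius α β n m (t I / 8) +
      ∑ i : Fin I, if (R : ℝ) + 1 ≤ t (i + 1) then classRadius α β n m t i else 0 := by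
  have htp : ∀ i, 0 < t i := fun i => lt_of_lt_of_le (by linarith) (ht (Nat.zero_le i))
  have hcr : ∀ i, 0 ≤ classRadius α β n m t i := by
    intro i; unfold classRadius; split_ifs
    · exact (radius_pos hn one_pos).le
    · exact (radius_pos hn (by linarith [htp i])).le
  have hbig : ∀ i, t i < (R : ℝ) + 1 →
      radius α β n m (lowRank n R) ≤ radius α β n m (t i / 8) := by
    intro i hi
    have : rankCutoff n ≤ (R : ℝ) + 1 := (ht0 ▸ ht (Nat.zero_le i)).trans hi.le
    refine radius_anti hα (by linarith [htp i]) ?_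
    rw [lowRank, if_pos this]; linarith
  have hsum0 : 0 ≤ ∑ i : Fin I, if (R : ℝ) + 1 ≤ t (i + 1) then classRadius α β n m t i else 0 :=
    Finset.sum_nonneg fun i _ => by split_ifs; exacts [hcr i, le_rfl]
  by_cases hR : (R : ℝ) + 1 ≤ t I
  · have hex : ∃ j, (R : ℝ) + 1 ≤ t j := ⟨I, hR⟩
    obtain ⟨i, hi, hiR, hile⟩ : ∃ i < I, (R : ℝ) + 1 ≤ t (i + 1) ∧
        radius α β n m (lowRank n R) ≤ classRadius α β n m t i := by
      classical
      rcases Nat.eq_zero_or_pos (Nat.find hex - 1) with h0 | h0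
      · refine ⟨0, hI, (Nat.find_spec hex).trans (ht (by omega)), ?_⟩
        rw [classRadius, if_pos rfl]
        refine radius_anti hα one_pos ?_
        unfold lowRank; split_ifs with h
        · linarith
        · exact le_rfl
      · have hle := Nat.find_min' hex hR
        refine ⟨Nat.find hex - 1, by omega, ?_, ?_⟩
        · rw [Nat.sub_add_cancel (by omega)]; exact Nat.find_spec hex
        · rw [classRadius, if_neg h0.ne']
          exact hbig _ (not_le.1 (Nat.find_min hex (by omega)))
    have h1 := Finset.single_le_sum (f := fun i : Fin I =>
      if (R : ℝ) + 1 ≤ t (i + 1) then classRadius α β n m t i else 0)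
      (fun i _ => by split_ifs; exacts [hcr i, le_rfl]) (Finset.mem_univ (⟨i, hi⟩ : Fin I))
    simp only [hiR, if_true] at h1
    have := (radius_pos (α := α) (β := β) (m := m) hn (show 0 < t I / 8 by linarith [htp I])).le
    linarith
  · linarith [hbig I (not_le.1 hR)]

/-- The probability that the diameter of a connected graph is small, in terms of the parameters of
the classes of nodes of small rank. -/
theorem marks_small_diam_le [NeZero n] (p : unitInterval) (hn : 2 ≤ n) (hm : 1 ≤ m) (hα : 0 ≤ α)
    (hc : 8 ≤ rankCutoff n) {t : ℕ → ℝ} (ht0 : t 0 = rankCutoff n) (ht : Monotone t) {I : ℕ}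
    (hI : 1 ≤ I) {k : ℕ → ℕ} {Λ lam : ℝ} (hΛ0 : 0 < Λ) (hΛ : Λ < 1 / 4) (hlam : 0 ≤ lam)
    (hkt : ∀ i, 2 * Real.exp 3 * Λ * t (i + 1) ^ (1 / (m : ℝ)) ≤ k i) (hk : ∀ i, lam + 1 ≤ k i)
    (hIlam : (I : ℝ) ≤ Real.exp (2 * m + lam))
    (hsum : ∑ i : Fin I, k i * classRadius α β n m t i ≤ Λ / 16) {b : Fin n → ℕ}
    (hb : Function.Injective b) :
    (Measure.pi fun _ => markLaw n m p) {M | ∃ G ∈ {G : SimpleGraph (Fin n) |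
      G.Connected ∧ ¬ Λ / (32 * radius α β n m (t I / 8)) ≤ G.diam},
      Compatible α β (lowRank n) (hiRank n) b M G} ≤
      ENNReal.ofReal (Real.exp (-(lam * 2 ^ m))) + ENNReal.ofReal ((2 / (Λ / 8)) ^ m *
      Real.exp ((1 : ℕ) - n * (n / (2 * n) * (2 * (Λ / 8)) ^ m) / 2)) := by
  have hn1 : 1 ≤ n := by omega
  have hnt : Nontrivial (Fin n) := Fin.nontrivial_iff_two_le.2 hn
  have htp : ∀ i, 0 < t i := fun i => lt_of_lt_of_le (by linarith) (ht (Nat.zero_le i))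
  have h1 := marks_forall_box_le (n := n) p hm (I := I) (t := fun i => t (i + 1))
    (fun i => htp _) hΛ0 hΛ hlam hkt hk hIlam
  have h2 := marks_net_count_le (n := n) (m := m) p Finset.univ (r := n) (ρ := Λ / 8)
    (by exact_mod_cast hn1) le_rfl (by linarith) (by linarith) 1
  rw [Finset.card_univ, Fintype.card_fin] at h2
  refine le_trans (measure_mono ?_) ((measure_union_le _ _).trans (add_le_add h1 h2))
  rintro M ⟨G, ⟨hG, hdiam⟩, hcomp⟩
  by_contra hM
  rw [Set.mem_union, not_or] at hM
  obtain ⟨hM1, hM2⟩ := hM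
  rw [Set.mem_ofPred_eq] at hM1 hM2
  push Not at hM1 hM2
  obtain ⟨B, hB⟩ := hM1
  refine hdiam (le_diam_of_box hm hG (fun u => (M u).2.1) hΛ0 (by linarith)
    (radius_pos hn1 (by linarith [htp I])) (fun z => ?_) (B := B) fun u l hu hnd hch hlen => ?_)
  · obtain ⟨u, hu⟩ := Finset.card_pos.1 (hM2 z)
    exact ⟨u, by have := (Finset.mem_filter.1 hu).2.2; linarith⟩
  · classical
    have hcr : ∀ i, 0 ≤ classRadius α β n m t i := by
      intro i; unfold classRadius; split_ifs
      · exact (radius_pos hn1 one_pos).le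
      · exact (radius_pos hn1 (by linarith [htp i])).le
    refine chainLen_path_le (fun u => (M u).2.1)
      (rad := fun u => radius α β n m (lowRank n (M u).1))
      (cls := fun (i : Fin I) u => ((M u).1 : ℝ) + 1 ≤ t (i + 1))
      (σ := fun i => classRadius α β n m t i) (k := fun i => k i) (fun i => hcr i) hΛ0.le
      (fun u => (radius_pos hn1 (lowRank_pos _)).le)
      (fun u => radius_lowRank_le hα hn1 hc ht0 ht hI _) (fun i l => hB i l) hsum hu hnd ?_ hlen
      (radius_pos hn1 (by linarith [htp I])).le
    -- An edge is at most as long as the radius of its older end, hence as the sum of both radii.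
    refine hch.imp fun v w hvw => ?_
    have hv := (radius_pos (α := α) (β := β) (m := m) hn1 (lowRank_pos (M v).1)).le
    have hw := (radius_pos (α := α) (β := β) (m := m) hn1 (lowRank_pos (M w).1)).le
    rcases lt_or_gt_of_ne (hb.ne hvw.ne) with h | h
    · have := (hcomp v w h).1 hvw
      rw [dist_comm] at this
      linarith
    · have := (hcomp w v h).1 hvw.symm
      linarith


theorem geom_sum_le_inv {r : ℝ} (h0 : 0 ≤ r) (h1 : r < 1) (n : ℕ) :
    ∑ i ∈ Finset.range n, r ^ i ≤ (1 - r)⁻¹ := by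
  have h := geom_sum_mul_neg r n
  have h2 : 0 ≤ r ^ n := pow_nonneg h0 n
  rw [inv_eq_one_div, le_div_iff₀ (by linarith)]
  linarith

/-! ### Thresholds `log⁵ n * 2^(i m)` and the total radius of the classes. -/

variable {α β : ℝ} {n m : ℕ}

/-- The thresholds between the classes of nodes of small rank. -/
noncomputable def classThreshold (n m : ℕ) (i : ℕ) : ℝ :=
  Real.exp (5 * Real.log (Real.log n) + i * (m * Real.log 2))

theorem radius_classThreshold_le (hα0 : 0 ≤ α) (hα1 : α ≤ 1) (hn : 1 ≤ n) (hm : 1 ≤ m) (i : ℕ) :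
    radius α β n m (classThreshold n m i / 8) ≤ 4 * Real.exp (-(α * (5 * Real.log (Real.log n) +
      i * (m * Real.log 2)) + β * Real.log n) / m) := by
  have hm1 : (1 : ℝ) ≤ m := by exact_mod_cast hm
  have e1 : classThreshold n m i / 8 = Real.exp (5 * Real.log (Real.log n) +
      i * (m * Real.log 2) - Real.log 8) := by
    rw [Real.exp_sub, Real.exp_log (by norm_num), classThreshold]
  have hlog : 0 ≤ Real.log 8 := Real.log_nonneg (by norm_num)
  have h8 : Real.exp (α * Real.log 8 / m) ≤ 8 := by
    calc Real.exp (α * Real.log 8 / m) ≤ Real.exp (Real.log 8) := by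
          refine Real.exp_le_exp.2 ((div_le_self (by positivity) hm1).trans ?_)
          exact mul_le_of_le_one_left hlog hα1
      _ = 8 := Real.exp_log (by norm_num)
  rw [e1, radius_exp hn]
  have e2 : -(α * (5 * Real.log (Real.log n) + i * (m * Real.log 2) - Real.log 8) +
      β * Real.log n) / m = -(α * (5 * Real.log (Real.log n) + i * (m * Real.log 2)) +
      β * Real.log n) / m + α * Real.log 8 / m := by ring
  rw [e2, Real.exp_add]
  have := mul_le_mul_of_nonneg_left h8 (Real.exp_pos (-(α * (5 * Real.log (Real.log n) +
    i * (m * Real.log 2)) + β * Real.log n) / m)).le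
  linarith

theorem classThreshold_rpow (hm : 1 ≤ m) (i : ℕ) : classThreshold n m (i + 1) ^ (1 / (m : ℝ)) =
    2 * Real.exp ((5 * Real.log (Real.log n) + i * (m * Real.log 2)) / m) := by
  have hm0 : (m : ℝ) ≠ 0 := by positivity
  rw [classThreshold, ← Real.exp_mul, ← Real.exp_log (show (0 : ℝ) < 2 by norm_num),
    ← Real.exp_add, Real.exp_log (by norm_num)]
  congr 1
  push_cast
  field_simp
  ring

/-- The product grows like `threshold^((1 - α) / m) * n^(-β / m)`, hence by `2^(1 - α)` per class,
and `hI` bounds it at the last class. The class with index `0` uses the radius of rank `1` and is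
small because `n^β` beats powers of `log n`. -/
theorem classThreshold_mul_classRadius_le (hα0 : 0 ≤ α) (hα1 : α < 1) (hn : 1 ≤ n) (hm : 1 ≤ m)
    {E D : ℝ} (hβ : 5 * Real.log (Real.log n) ≤ β * Real.log n / 2)
    (hD : D ≤ β * Real.log n / m) {I i : ℕ} (hi : i ≤ I)
    (hI : (1 - α) * (5 * Real.log (Real.log n) + I * (m * Real.log 2)) ≤
      β * Real.log n - m * E) :
    classThreshold n m (i + 1) ^ (1 / (m : ℝ)) * classRadius α β n m (classThreshold n m) i ≤
      8 * Real.exp (-E) * Real.exp (-((1 - α) * Real.log 2)) ^ (I - i) +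
        if i = 0 then Real.exp (-(D / 2)) else 0 := by
  have hm0 : (0 : ℝ) < m := by exact_mod_cast hm
  rw [classThreshold_rpow hm, classRadius]
  split_ifs with h0
  · subst h0
    have e1 : radius α β n m 1 = Real.exp (-(β * Real.log n) / m) / 2 := by
      have := radius_exp (α := α) (β := β) (m := m) hn 0
      rwa [Real.exp_zero, mul_zero, zero_add] at this
    rw [e1]
    refine le_add_of_nonneg_of_le (by positivity) ?_
    calc 2 * Real.exp ((5 * Real.log (Real.log n) + (0 : ℕ) * (m * Real.log 2)) / m) *
          (Real.exp (-(β * Real.log n) / m) / 2)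
        = Real.exp ((5 * Real.log (Real.log n) - β * Real.log n) / m) := by
          rw [mul_div_assoc', mul_assoc, mul_div_cancel_left₀ _ two_ne_zero, ← Real.exp_add]
          congr 1; push_cast; ring
      _ ≤ _ := by
          refine Real.exp_le_exp.2 ?_
          rw [div_le_iff₀ hm0]
          rw [le_div_iff₀ hm0] at hD
          linarith
  · have h1 := radius_classThreshold_le (β := β) hα0 hα1.le hn hm i
    rw [add_zero]
    refine (mul_le_mul_of_nonneg_left h1 (by positivity)).trans ?_
    have hI' : ((I - i : ℕ) : ℝ) = I - i := Nat.cast_sub hi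
    calc 2 * Real.exp ((5 * Real.log (Real.log n) + i * (m * Real.log 2)) / m) *
          (4 * Real.exp (-(α * (5 * Real.log (Real.log n) + i * (m * Real.log 2)) +
            β * Real.log n) / m))
        = 8 * Real.exp (((1 - α) * (5 * Real.log (Real.log n) + i * (m * Real.log 2)) -
            β * Real.log n) / m) := by
          rw [mul_mul_mul_comm, ← Real.exp_add]
          norm_num
          ring
      _ ≤ 8 * Real.exp (-E + (I - i : ℕ) * (-((1 - α) * Real.log 2))) := by
          refine mul_le_mul_of_nonneg_left (Real.exp_le_exp.2 ?_) (by norm_num)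
          rw [div_le_iff₀ hm0, hI']
          linarith
      _ = _ := by rw [Real.exp_add, Real.exp_nat_mul]; ring

/-- The radii alone decrease geometrically; this handles the constant part `lam + 2` of the node
counts. -/
theorem classRadius_le (hα0 : 0 ≤ α) (hα1 : α < 1) (hn : 1 ≤ n) (hm : 1 ≤ m)
    (hL : 0 ≤ Real.log (Real.log n)) (i : ℕ) :
    classRadius α β n m (classThreshold n m) i ≤
      4 * Real.exp (-(β * Real.log n / m)) * Real.exp (-(α * Real.log 2)) ^ i := by
  have hm0 : (0 : ℝ) < m := by exact_mod_cast hm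
  rw [classRadius]
  split_ifs with h0
  · subst h0
    have e1 : radius α β n m 1 = Real.exp (-(β * Real.log n / m)) / 2 := by
      have := radius_exp (α := α) (β := β) (m := m) hn 0
      rw [Real.exp_zero, mul_zero, zero_add] at this
      rw [this, neg_div]
    rw [e1, pow_zero]
    linarith [Real.exp_pos (-(β * Real.log n / m))]
  · refine (radius_classThreshold_le (β := β) hα0 hα1.le hn hm i).trans ?_
    rw [mul_assoc, ← Real.exp_nat_mul, ← Real.exp_add]
    refine mul_le_mul_of_nonneg_left (Real.exp_le_exp.2 ?_) (by norm_num)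
    rw [div_le_iff₀ hm0]
    have h1 : β * Real.log n / m * m = β * Real.log n := div_mul_cancel₀ _ hm0.ne'
    have h2 := mul_nonneg hα0 hL
    linarith

/-- The total radius of all classes of nodes of small rank, weighted with the number of nodes of
each class on a short path. -/
theorem sum_mul_classRadius_le (hα0 : 0 < α) (hα1 : α < 1) (hn : 1 ≤ n) (hm : 1 ≤ m)
    {E D lam : ℝ} (hlam : 0 ≤ lam) (hL : 0 ≤ Real.log (Real.log n))
    (hβ : 5 * Real.log (Real.log n) ≤ β * Real.log n / 2)
    (hD : D ≤ β * Real.log n / m) {I : ℕ} {k : ℕ → ℕ}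
    (hk : ∀ i, (k i : ℝ) ≤ 9 * classThreshold n m (i + 1) ^ (1 / (m : ℝ)) + (lam + 2))
    (hI : (1 - α) * (5 * Real.log (Real.log n) + I * (m * Real.log 2)) ≤
      β * Real.log n - m * E) :
    ∑ i : Fin I, k i * classRadius α β n m (classThreshold n m) i ≤
      72 * Real.exp (-E) * (1 - Real.exp (-((1 - α) * Real.log 2)))⁻¹ + 9 * Real.exp (-(D / 2)) +
        (lam + 2) * (4 * Real.exp (-(β * Real.log n / m)) *
          (1 - Real.exp (-(α * Real.log 2)))⁻¹) := by
  have hlog2 : 0 < Real.log 2 := Real.log_pos (by norm_num)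
  set r := Real.exp (-((1 - α) * Real.log 2)) with hr
  set s := Real.exp (-(α * Real.log 2)) with hs
  have hr0 : 0 ≤ r := (Real.exp_pos _).le
  have hr1 : r < 1 := Real.exp_lt_one_iff.2 (neg_lt_zero.2 (mul_pos (by linarith) hlog2))
  have hs0 : 0 ≤ s := (Real.exp_pos _).le
  have hs1 : s < 1 := Real.exp_lt_one_iff.2 (neg_lt_zero.2 (mul_pos hα0 hlog2))
  have hcr : ∀ i, 0 ≤ classRadius α β n m (classThreshold n m) i := by
    intro i; unfold classRadius; split_ifs
    · exact (radius_pos hn one_pos).le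
    · exact (radius_pos hn (div_pos (Real.exp_pos _) (by norm_num))).le
  rw [Fin.sum_univ_eq_sum_range (fun i => k i * classRadius α β n m (classThreshold n m) i)]
  have hterm : ∀ i ∈ Finset.range I, k i * classRadius α β n m (classThreshold n m) i ≤
      72 * Real.exp (-E) * r ^ (I - i) + (if i = 0 then 9 * Real.exp (-(D / 2)) else 0) +
      (lam + 2) * (4 * Real.exp (-(β * Real.log n / m)) * s ^ i) := by
    intro i hi
    have h1 := classThreshold_mul_classRadius_le hα0.le hα1 hn hm hβ hD
      (Finset.mem_range.1 hi).le hI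
    have h2 := mul_le_mul_of_nonneg_left (classRadius_le (β := β) hα0.le hα1 hn hm hL i)
      (show 0 ≤ lam + 2 by linarith)
    have h3 := mul_le_mul_of_nonneg_right (hk i) (hcr i)
    rw [← hr] at h1
    rw [← hs] at h2
    split_ifs at h1 ⊢ <;> linarith
  refine (Finset.sum_le_sum hterm).trans ?_
  rw [Finset.sum_add_distrib, Finset.sum_add_distrib, ← Finset.mul_sum, ← Finset.mul_sum,
    ← Finset.mul_sum]
  -- Summed backwards from the last class, the dominant one.
  have hA : ∑ i ∈ Finset.range I, r ^ (I - i) ≤ (1 - r)⁻¹ := by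
    refine le_trans ?_ (geom_sum_le_inv hr0 hr1 I)
    rw [← Finset.sum_range_reflect (fun i => r ^ i)]
    refine Finset.sum_le_sum fun i hi => ?_
    have := Finset.mem_range.1 hi
    exact pow_le_pow_of_le_one hr0 hr1.le (by omega)
  have hB : ∑ i ∈ Finset.range I, (if i = 0 then 9 * Real.exp (-(D / 2)) else 0) ≤
      9 * Real.exp (-(D / 2)) := by
    rw [Finset.sum_ite_eq' (Finset.range I) 0 fun _ => 9 * Real.exp (-(D / 2))]
    split_ifs
    · exact le_rfl
    · positivity
  have hC := geom_sum_le_inv hs0 hs1 I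
  exact add_le_add (add_le_add (mul_le_mul_of_nonneg_left hA (by positivity)) hB)
    (mul_le_mul_of_nonneg_left (mul_le_mul_of_nonneg_left hC (by positivity)) (by linarith))


/-! ### Lower bound: choice of the parameters. -/

variable {α β : ℝ}

theorem eventually_mul_pow_le_exp_sqrt (C : ℝ) (k : ℕ) {ε : ℝ} (hε : 0 < ε) :
    ∀ᶠ L : ℝ in Filter.atTop, C * L ^ k ≤ Real.exp (ε * √L) := by
  have h := Real.tendsto_sqrt_atTop.eventually (eventually_mul_pow_le_exp C (2 * k) hε)
  filter_upwards [h, Filter.eventually_ge_atTop 0] with L hL h0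
  rwa [pow_mul, Real.sq_sqrt h0] at hL

theorem half_le_log_two : 1 / 2 ≤ Real.log 2 := by linarith [Real.log_two_gt_d9]

/-- One of the terms is large on either side of `m = √L`. So `2^m * n^(β / m)` beats every power of
`log n`, uniformly in `m`. -/
theorem mul_sqrt_le_add_div {β L m : ℝ} (hβ0 : 0 < β) (hβ1 : β < 1) (hL : 0 ≤ L) (hm : 0 < m) :
    β / 2 * √L ≤ m * Real.log 2 + β * L / m := by
  have h2 := half_le_log_two
  have hs := Real.sqrt_nonneg L
  have hsq := Real.mul_self_sqrt hL
  rcases le_total (√L) m with h | h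
  · have : 0 ≤ β * L / m := by positivity
    have h3 : √L * (1 / 2) ≤ m * Real.log 2 := mul_le_mul h h2 (by norm_num) hm.le
    have h4 : β / 2 * √L ≤ 1 / 2 * √L := mul_le_mul_of_nonneg_right (by linarith) hs
    linarith
  · have h3 : β * √L ≤ β * L / m := by
      rw [le_div_iff₀ hm]
      calc β * √L * m ≤ β * √L * √L := mul_le_mul_of_nonneg_left h (by positivity)
        _ = β * L := by rw [mul_assoc, hsq]
    have h4 : 0 ≤ m * Real.log 2 := mul_nonneg hm.le (by linarith)
    have h5 : 0 ≤ β * √L := by positivity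
    linarith

/-- Controls the union over at most `2 L` classes: either `2 ^ m ≥ L`, or `L ^ 2 / 2 ^ m ≥ L`. -/
theorem two_mul_le_exp_add_div {L : ℝ} (hL : 2 ≤ L) (m : ℕ) :
    2 * L ≤ Real.exp (2 * m + L ^ 2 / 2 ^ m) := by
  have h2m : (0 : ℝ) < 2 ^ m := by positivity
  rcases le_total L (2 ^ m) with h | h
  · have h1 : (2 : ℝ) ^ m ≤ Real.exp m := by
      rw [← mul_one (m : ℝ), Real.exp_nat_mul]
      exact pow_le_pow_left₀ (by norm_num) (by linarith [Real.add_one_le_exp (1 : ℝ)]) m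
    calc 2 * L ≤ L * L := by gcongr
      _ ≤ Real.exp m * Real.exp m :=
          mul_le_mul (h.trans h1) (h.trans h1) (by linarith) (Real.exp_pos _).le
      _ ≤ _ := by
          rw [← Real.exp_add]
          refine Real.exp_le_exp.2 ?_
          have : 0 ≤ L ^ 2 / 2 ^ m := by positivity
          linarith
  · have h1 : L ≤ L ^ 2 / 2 ^ m := by
      rw [le_div_iff₀ h2m, sq]
      gcongr
    calc 2 * L ≤ Real.exp 1 * L := by
          have := Real.add_one_le_exp (1 : ℝ)
          gcongr; linarith
      _ ≤ Real.exp 1 * Real.exp (L - 1) := by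
          gcongr
          linarith [Real.add_one_le_exp (L - 1)]
      _ = Real.exp L := by rw [← Real.exp_add]; congr 1; ring
      _ ≤ _ := Real.exp_le_exp.2 (by
          have : (0 : ℝ) ≤ m := by positivity
          linarith)

/-- The probability that some point of the torus is far from all nodes. -/
theorem net_bound_le {L : ℝ} {n m : ℕ} (hn : 0 < (n : ℝ)) (hnL : (n : ℝ) = Real.exp L)
    (hmL : (m : ℝ) ≤ L / 20) (hL1 : 1 ≤ L) (hL : 12 * L ^ 2 ≤ Real.exp (1 / 2 * L)) :
    (2 / ((1 / 5 : ℝ) / 8)) ^ m *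
      Real.exp ((1 : ℕ) - n * (n / (2 * n) * (2 * ((1 / 5 : ℝ) / 8)) ^ m) / 2) ≤
      Real.exp (-L ^ 2) := by
  have he := Real.exp_one_gt_d9
  have h80 : (80 : ℝ) ≤ Real.exp 5 := by
    have : Real.exp 5 = Real.exp 1 ^ 5 := by rw [← Real.exp_nat_mul]; norm_num
    rw [this]
    calc (80 : ℝ) ≤ 2.7 ^ 5 := by norm_num
      _ ≤ _ := pow_le_pow_left₀ (by norm_num) (by linarith) 5
  have h20 : Real.exp (-4) ≤ (1 / 20 : ℝ) := by
    have : Real.exp 4 = Real.exp 1 ^ 4 := by rw [← Real.exp_nat_mul]; norm_num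
    rw [Real.exp_neg, this, inv_eq_one_div]
    refine one_div_le_one_div_of_le (by norm_num) ?_
    calc (20 : ℝ) ≤ 2.7 ^ 4 := by norm_num
      _ ≤ _ := pow_le_pow_left₀ (by norm_num) (by linarith) 4
  have e1 : (2 / ((1 / 5 : ℝ) / 8)) ^ m ≤ Real.exp (m * 5) := by
    rw [Real.exp_nat_mul]
    exact pow_le_pow_left₀ (by norm_num) (by norm_num; linarith) m
  have e2 : Real.exp (1 / 2 * L) ≤ n * (2 * ((1 / 5 : ℝ) / 8)) ^ m := by
    calc Real.exp (1 / 2 * L) ≤ Real.exp (L + m * (-4)) := Real.exp_le_exp.2 (by linarith)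
      _ = n * Real.exp (-4) ^ m := by rw [Real.exp_add, Real.exp_nat_mul, hnL]
      _ ≤ _ := by
          refine mul_le_mul_of_nonneg_left (pow_le_pow_left₀ (Real.exp_pos _).le ?_ m) hn.le
          norm_num; linarith
  have e3 : (n : ℝ) * (n / (2 * n) * (2 * ((1 / 5 : ℝ) / 8)) ^ m) / 2 =
      n * (2 * ((1 / 5 : ℝ) / 8)) ^ m / 4 := by
    field_simp; norm_num
  rw [e3]
  refine (mul_le_mul_of_nonneg_right e1 (Real.exp_pos _).le).trans ?_
  rw [← Real.exp_add]
  refine Real.exp_le_exp.2 ?_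
  have h1 : L ≤ L ^ 2 := by rw [sq]; exact le_mul_of_one_le_left (by linarith) hL1
  push_cast
  linarith

set_option maxHeartbeats 1000000 in
-- The classes end at a rank with `rank^(1 - α)` of order `n^β * exp (-m E)`, where visits to nodes
-- of small rank no longer shorten paths. A path then advances at most by the radius at that rank
-- per node, and this radius is of order `n^(-β / ((1 - α) m))`. No power of `log n` is lost.
theorem marks_diam_lower_le (hα : α ∈ Set.Ioo (0 : ℝ) 1) (hβ : β ∈ Set.Ioo (0 : ℝ) (1 - α))
    (p : unitInterval) : ∃ A > (0 : ℝ), ∃ c > (0 : ℝ), ∃ N₀ : ℕ, ∀ n ≥ N₀,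
    ∀ m : ℕ, 1 ≤ m → (m : ℝ) ≤ A * Real.log n → ∀ b : Fin n → ℕ, Function.Injective b →
    (Measure.pi fun _ => markLaw n m p) {M | ∃ G ∈ {G : SimpleGraph (Fin n) |
      G.Connected ∧ ¬ c * (n : ℝ) ^ (β / ((1 - α) * m)) ≤ G.diam},
      Compatible α β (lowRank n) (hiRank n) b M G} ≤
      ENNReal.ofReal (2 * Real.exp (-Real.log n ^ 2)) := by
  obtain ⟨hα0, hα1⟩ := hα
  obtain ⟨hβ0, hβ1⟩ := hβ
  have hγ : 0 < 1 - α := by linarith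
  have hβ1' : β < 1 := by linarith
  have hlog2 : 1 / 2 ≤ Real.log 2 := half_le_log_two
  have hlog2' : Real.log 2 ≤ 1 := by linarith [Real.log_two_lt_d9]
  set r := Real.exp (-((1 - α) * Real.log 2)) with hr
  set s := Real.exp (-(α * Real.log 2)) with hs
  have hr1 : r < 1 := Real.exp_lt_one_iff.2 (neg_lt_zero.2 (mul_pos (by linarith) (by linarith)))
  have hs1 : s < 1 := Real.exp_lt_one_iff.2 (neg_lt_zero.2 (mul_pos hα0 (by linarith)))
  have hr0 : 0 < r := Real.exp_pos _
  have hs0 : 0 < s := Real.exp_pos _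
  -- With `Λ = 1 / 5` the total allowed is `Λ / 16 = 1 / 80 = 1 / 320 + 1 / 320 + 1 / 160`; this `E`
  -- makes the first part `1 / 320`.
  set E := -Real.log ((1 - r) / 23040) with hE
  have hE0 : 0 ≤ E := by
    rw [hE, neg_nonneg]
    exact Real.log_nonpos (by apply div_nonneg <;> linarith) (by linarith)
  have hexpE : Real.exp (-E) = (1 - r) / 23040 := by
    rw [hE, neg_neg, Real.exp_log (by apply div_pos <;> linarith)]
  set S := 4 * (1 - s)⁻¹ with hS
  have hS0 : 0 < S := mul_pos (by norm_num) (inv_pos.2 (by linarith))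
  -- Lower bound for `β * L / m` when `m ≤ A L` with `A = β / D`: `20` serves the class with index
  -- `0`, `640 * S` the constant part of the counts, and `4 * E` leaves room for at least one class.
  set D := 4 * E + 20 + 640 * S with hD
  have hD0 : 20 ≤ D := by linarith
  set c := Real.exp (-(α * E / (1 - α) + α * Real.log 2)) / 640 with hc
  obtain ⟨N₀, hN₀⟩ := exists_forall_log_of_eventually
    ((Filter.eventually_ge_atTop (8 : ℝ)).and ((eventually_mul_pow_le_exp 12 2 (show (0 : ℝ) < 1 / 2
      by norm_num)).and ((eventually_mul_pow_le_exp_sqrt (320 * S) 2 (show 0 < β / 2 by linarith)).and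
      (Real.isLittleO_log_id_atTop.bound (show (0 : ℝ) < β / 20 by linarith)))))
  refine ⟨β / D, by positivity, c, by positivity, max N₀ 2, fun n hn m hm hmA b hb => ?_⟩
  obtain ⟨hL8, hL1, hL2, hL3⟩ := hN₀ n (le_of_max_le_left hn)
  have hn2 : 2 ≤ n := le_of_max_le_right hn
  have hn1 : 1 ≤ n := by omega
  have : NeZero n := ⟨by omega⟩
  have hn0 : (0 : ℝ) < n := by exact_mod_cast hn1
  have hm1 : (1 : ℝ) ≤ m := by exact_mod_cast hm
  have hm0 : (0 : ℝ) < m := by linarith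
  obtain ⟨L, hL⟩ : ∃ L, L = Real.log n := ⟨_, rfl⟩
  have hnL : (n : ℝ) = Real.exp L := by rw [hL, Real.exp_log hn0]
  rw [← hL] at hL8 hL1 hL2 hL3 hmA
  have hℓ0 : 0 ≤ Real.log L := Real.log_nonneg (by linarith)
  have hℓ : Real.log L ≤ β / 20 * L := by
    rw [Real.norm_eq_abs, Real.norm_eq_abs, abs_of_nonneg hℓ0, id, abs_of_nonneg (by linarith)] at hL3
    exact hL3
  have hβL : 0 < β * L := by apply mul_pos <;> linarith
  have hDm : D * m ≤ β * L := by
    have := mul_le_mul_of_nonneg_left hmA (show 0 ≤ D by linarith)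
    have e : D * (β / D * L) = β * L := by field_simp
    linarith
  have hEm : 4 * (m * E) + 20 * m ≤ β * L := by
    have : 0 ≤ 640 * S * m := by positivity
    rw [hD] at hDm; linarith
  have hβLL : β * L ≤ L := mul_le_of_le_one_left (by linarith) hβ1'.le
  -- the number of classes
  have hml : m * Real.log 2 ≤ m := mul_le_of_le_one_right hm0.le hlog2'
  have hml0 : 1 / 2 * m ≤ m * Real.log 2 := by rw [mul_comm]; gcongr
  have hml1 : 0 < m * Real.log 2 := by linarith
  -- The logarithm of the target rank; `I` is the largest number of doublings of the `m`-th root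
  -- that stays below it.
  obtain ⟨ρ, hρ⟩ : ∃ ρ, ρ = (β * L - m * E) / (1 - α) := ⟨_, rfl⟩
  have hργ : (1 - α) * ρ = β * L - m * E := by rw [hρ]; field_simp
  have hmE : 0 ≤ m * E := by positivity
  have hρ1 : β * L - m * E ≤ ρ := by
    rw [← hργ]; exact mul_le_of_le_one_left (by rw [hρ]; apply div_nonneg <;> linarith) (by linarith)
  have hρ2 : ρ ≤ L := by
    rw [hρ, div_le_iff₀ hγ]
    have : β * L ≤ (1 - α) * L := mul_le_mul_of_nonneg_right hβ1.le (by linarith)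
    linarith
  obtain ⟨I, hI⟩ : ∃ I, I = ⌊(ρ - 5 * Real.log L) / (m * Real.log 2)⌋₊ := ⟨_, rfl⟩
  have hI1 : 1 ≤ I := by
    rw [hI, Nat.one_le_floor_iff, le_div_iff₀ hml1]
    linarith
  have hI2 : 5 * Real.log L + I * (m * Real.log 2) ≤ ρ := by
    have := Nat.floor_le (a := (ρ - 5 * Real.log L) / (m * Real.log 2))
      (div_nonneg (by linarith) hml1.le)
    rw [← hI, le_div_iff₀ hml1] at this
    linarith
  have hI3 : ρ ≤ 5 * Real.log L + I * (m * Real.log 2) + m * Real.log 2 := by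
    have := (Nat.lt_floor_add_one ((ρ - 5 * Real.log L) / (m * Real.log 2))).le
    rw [← hI, div_le_iff₀ hml1] at this
    linarith
  have hI4 : (I : ℝ) ≤ 2 * L := by
    have h1 : (I : ℝ) * (1 / 2) ≤ I * (m * Real.log 2) :=
      mul_le_mul_of_nonneg_left (by linarith) (by positivity)
    linarith
  -- the parameters of the first moment bound
  obtain ⟨lam, hlam⟩ : ∃ lam, lam = L ^ 2 / 2 ^ m := ⟨_, rfl⟩
  have hlam0 : 0 ≤ lam := by rw [hlam]; positivity
  have ht0 : classThreshold n m 0 = rankCutoff n := by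
    rw [classThreshold, rankCutoff, Nat.cast_zero, zero_mul, add_zero, ← hL]
    have := Real.exp_nat_mul (Real.log L) 5
    rw [Real.exp_log (by linarith)] at this
    exact_mod_cast this
  have htm : Monotone (classThreshold n m) := by
    refine monotone_nat_of_le_succ fun i => Real.exp_le_exp.2 ?_
    push_cast
    linarith
  have hcut : 8 ≤ rankCutoff n := by
    rw [rankCutoff, ← hL]
    calc (8 : ℝ) ≤ 8 ^ 5 := by norm_num
      _ ≤ L ^ 5 := by gcongr
  have hx0 : ∀ i, 0 ≤ classThreshold n m (i + 1) ^ (1 / (m : ℝ)) := fun i =>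
    Real.rpow_nonneg (Real.exp_pos _).le _
  let k : ℕ → ℕ := fun i => ⌈9 * classThreshold n m (i + 1) ^ (1 / (m : ℝ)) + (lam + 1)⌉₊
  have hk1 : ∀ i, 9 * classThreshold n m (i + 1) ^ (1 / (m : ℝ)) + (lam + 1) ≤ k i :=
    fun i => Nat.le_ceil _
  have hk2 : ∀ i, (k i : ℝ) ≤ 9 * classThreshold n m (i + 1) ^ (1 / (m : ℝ)) + (lam + 2) := by
    intro i
    have := Nat.ceil_lt_add_one (show 0 ≤ 9 * classThreshold n m (i + 1) ^ (1 / (m : ℝ)) +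
      (lam + 1) by have := hx0 i; positivity)
    have h2 : (k i : ℝ) < _ := this
    linarith
  have hexp3 : 2 * Real.exp 3 * (1 / 5) ≤ 9 := by
    have : Real.exp 3 = Real.exp 1 ^ 3 := by rw [← Real.exp_nat_mul]; norm_num
    have h2 : Real.exp 1 ^ 3 ≤ 2.8 ^ 3 :=
      pow_le_pow_left₀ (Real.exp_pos _).le (by linarith [Real.exp_one_lt_d9]) 3
    rw [this]; norm_num at h2 ⊢; linarith
  have hsum := sum_mul_classRadius_le (α := α) (β := β) (n := n) (m := m) hα0 hα1 hn1 hm (E := E)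
    (D := D) (lam := lam) hlam0 (by rw [← hL]; exact hℓ0) (by rw [← hL]; linarith)
    (by rw [← hL, le_div_iff₀ hm0]; exact hDm) (I := I) hk2
    (by rw [← hL, ← hργ]; exact mul_le_mul_of_nonneg_left hI2 hγ.le)
  rw [← hr, ← hs, ← hL, hexpE] at hsum
  have hpart1 : 72 * ((1 - r) / 23040) * (1 - r)⁻¹ = 1 / 320 := by
    have : (1 - r) ≠ 0 := by linarith
    field_simp; norm_num
  have hpart2 : 9 * Real.exp (-(D / 2)) ≤ 1 / 320 := by
    have h10 : Real.exp 10 = Real.exp 1 ^ 10 := by rw [← Real.exp_nat_mul]; norm_num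
    have h1 : (2880 : ℝ) ≤ Real.exp 10 := by
      rw [h10]
      calc (2880 : ℝ) ≤ 2.7 ^ 10 := by norm_num
        _ ≤ _ := pow_le_pow_left₀ (by norm_num) (by linarith [Real.exp_one_gt_d9]) 10
    have h2 : Real.exp (-(D / 2)) ≤ 1 / 2880 := by
      rw [Real.exp_neg, inv_eq_one_div]
      exact one_div_le_one_div_of_le (by norm_num) (h1.trans (Real.exp_le_exp.2 (by linarith)))
    linarith
  have hpart3 : (lam + 2) * (4 * Real.exp (-(β * L / m)) * (1 - s)⁻¹) ≤ 1 / 160 := by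
    have e1 : (lam + 2) * (4 * Real.exp (-(β * L / m)) * (1 - s)⁻¹) =
        lam * S * Real.exp (-(β * L / m)) + 2 * S * Real.exp (-(β * L / m)) := by rw [hS]; ring
    have h1 : 640 * S ≤ Real.exp (β * L / m) := by
      have h2 : D ≤ β * L / m := by rw [le_div_iff₀ hm0]; exact hDm
      have h3 := Real.add_one_le_exp (β * L / m)
      linarith
    have h2 : 320 * (lam * S) ≤ Real.exp (β * L / m) := by
      have h3 := hL2.trans (Real.exp_le_exp.2 (mul_sqrt_le_add_div hβ0 hβ1' (by linarith) hm0))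
      rw [Real.exp_add, mul_comm (m : ℝ), ← Real.rpow_def_of_pos (by norm_num), Real.rpow_natCast] at h3
      rw [hlam]
      have h2m : (0 : ℝ) < 2 ^ m := by positivity
      have e4 : 320 * (L ^ 2 / 2 ^ m * S) = 320 * S * L ^ 2 / 2 ^ m := by ring
      rw [e4, div_le_iff₀ h2m]
      linarith
    rw [e1, Real.exp_neg, ← div_eq_mul_inv, ← div_eq_mul_inv, ← add_div,
      div_le_iff₀ (Real.exp_pos _)]
    linarith
  have hmain := marks_small_diam_le (α := α) (β := β) (n := n) (m := m) p hn2 hm hα0.le hcut ht0 htm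
    hI1 (k := k) (Λ := 1 / 5) (lam := lam) (by norm_num) (by norm_num) hlam0
    (fun i => (mul_le_mul_of_nonneg_right hexp3 (hx0 i)).trans (by linarith [hk1 i]))
    (fun i => by have := hx0 i; linarith [hk1 i])
    (hI4.trans (by rw [hlam]; exact two_mul_le_exp_add_div (by linarith) m))
    (by linarith) hb
  -- By `hI3` the last threshold misses the target `exp ρ` by at most a factor `2^m`, which after
  -- the `m`-th root only affects the constant `c`.
  have hdiam : c * (n : ℝ) ^ (β / ((1 - α) * m)) ≤
      1 / 5 / (32 * radius α β n m (classThreshold n m I / 8)) := by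
    have hrp : 0 < radius α β n m (classThreshold n m I / 8) :=
      radius_pos hn1 (div_pos (Real.exp_pos _) (by norm_num))
    rw [le_div_iff₀ (by positivity)]
    have h1 := radius_classThreshold_le (β := β) hα0.le hα1.le hn1 hm I
    rw [← hL] at h1
    have e1 : (n : ℝ) ^ (β / ((1 - α) * m)) = Real.exp (β * L / ((1 - α) * m)) := by
      rw [hnL, ← Real.exp_mul]; congr 1; ring
    rw [e1]
    calc c * Real.exp (β * L / ((1 - α) * m)) *
          (32 * radius α β n m (classThreshold n m I / 8))
        ≤ c * Real.exp (β * L / ((1 - α) * m)) * (32 * (4 * Real.exp (-(α * (5 * Real.log L +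
            I * (m * Real.log 2)) + β * L) / m))) := by gcongr
      _ = 1 / 5 * Real.exp (-(α * E / (1 - α) + α * Real.log 2) + β * L / ((1 - α) * m) +
            -(α * (5 * Real.log L + I * (m * Real.log 2)) + β * L) / m) := by
          rw [Real.exp_add, Real.exp_add, hc]; ring
      _ ≤ 1 / 5 * 1 := by
          refine mul_le_mul_of_nonneg_left (Real.exp_le_one_iff.2 ?_) (by norm_num)
          have h2 := mul_le_mul_of_nonneg_left hI3 hα0.le
          have e2 : -(α * E / (1 - α) + α * Real.log 2) + β * L / ((1 - α) * m) +
              -(α * (5 * Real.log L + I * (m * Real.log 2)) + β * L) / m =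
              (α * (ρ - (5 * Real.log L + I * (m * Real.log 2) + m * Real.log 2))) / m := by
            rw [hρ]; field_simp; ring
          rw [e2]
          exact div_nonpos_of_nonpos_of_nonneg (by linarith) hm0.le
      _ = 1 / 5 := mul_one _
  refine le_trans (measure_mono ?_) (hmain.trans ?_)
  · rintro M ⟨G, ⟨hG, hd⟩, hcomp⟩
    exact ⟨G, ⟨hG, fun h => hd (hdiam.trans h)⟩, hcomp⟩
  · have h1 := net_bound_le hn0 hnL (by linarith : (m : ℝ) ≤ L / 20) (by linarith) hL1
    have h2 : Real.exp (-(lam * 2 ^ m)) = Real.exp (-L ^ 2) := by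
      rw [hlam, div_mul_cancel₀ _ (by positivity)]
    rw [h2, ← ENNReal.ofReal_add (Real.exp_pos _).le (by positivity), ← hL]
    exact ENNReal.ofReal_le_ofReal (by linarith)


/-! ### Both bounds for the stationary graph. -/

variable {α β : ℝ}

theorem connected_and_diam_le_of_ediam_le {n k : ℕ} [NeZero n] {G : SimpleGraph (Fin n)}
    (h : G.ediam ≤ (k : ℕ)) : G.Connected ∧ G.diam ≤ k :=
  ⟨SimpleGraph.connected_of_ediam_ne_top (ne_top_of_le_ne_top (ENat.natCast_ne_top k) h),
    ENat.toNat_le_of_le_natCast h⟩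

/-- The threshold `A` of the small dimensions is handed to the large ones, so all `m` are covered.
In large dimension the bounded diameter suffices, as the powers of `n` and `log n` are at least `1`.
-/
theorem exists_stationary_not_diam_le (hα : α ∈ Set.Ioo (0 : ℝ) 1)
    (hβ : β ∈ Set.Ioo (0 : ℝ) (1 - α)) (p : unitInterval) (hp : 0 < p) :
    ∃ C > (0 : ℝ), ∃ N : ℕ, ∀ n ≥ N, ∀ m : ℕ, 1 ≤ m →
      ∀ π : Measure (State n m), IsStationary α β p π →
        π {s | s.2.2 ∈ {G : SimpleGraph (Fin n) | ¬ (G.Connected ∧ (G.diam : ℝ) ≤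
          C * ((n : ℝ) ^ (β / ((1 - α) * m)) * Real.log n ^ (2 * α / ((1 - α) * m))))}} ≤
        ENNReal.ofReal (7 * Real.exp (-Real.log n ^ 2)) := by
  obtain ⟨A, hA, C, hC, N₁, h₁⟩ := marks_small_dimension_le hα hβ p hp
  obtain ⟨K, N₂, h₂⟩ := marks_large_dimension_le hα hβ p hp hA
  obtain ⟨N₃, h₃⟩ := exists_stationary_le (α := α) (β := β) hα.1.le
  obtain ⟨N₄, h₄⟩ := exists_forall_log_of_eventually (Filter.eventually_ge_atTop (1 : ℝ))
  have hγ : 0 < 1 - α := by linarith [hα.2]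
  refine ⟨max C K, lt_max_of_lt_left hC, max (max N₁ N₂) (max N₃ (max N₄ 1)),
    fun n hn m hm π hπ => ?_⟩
  simp only [ge_iff_le, max_le_iff] at hn
  obtain ⟨⟨hn1, hn2⟩, hn3, hn4, hn5⟩ := hn
  have : NeZero n := ⟨by omega⟩
  have hL := h₄ n hn4
  have hx1 : 1 ≤ (n : ℝ) ^ (β / ((1 - α) * m)) * Real.log n ^ (2 * α / ((1 - α) * m)) := by
    refine one_le_mul_of_one_le_of_one_le
      (Real.one_le_rpow (by exact_mod_cast hn5) (div_nonneg hβ.1.le (by positivity)))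
      (Real.one_le_rpow hL (div_nonneg (by linarith [hα.1]) (by positivity)))
  set x := (n : ℝ) ^ (β / ((1 - α) * m)) * Real.log n ^ (2 * α / ((1 - α) * m)) with hx
  have key : ∀ (k : ℕ) (c : ℝ), 0 ≤ c → c ≤ 6 → (k : ℝ) ≤ max C K * x →
      (∀ b : Fin n → ℕ, Function.Injective b → (Measure.pi fun _ => markLaw n m p)
        {M | ∃ G ∈ {G : SimpleGraph (Fin n) | ¬ G.ediam ≤ (k : ℕ)},
          Compatible α β (lowRank n) (hiRank n) b M G} ≤
        ENNReal.ofReal (c * Real.exp (-Real.log n ^ 2))) →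
      π {s | s.2.2 ∈ {G : SimpleGraph (Fin n) | ¬ (G.Connected ∧ (G.diam : ℝ) ≤ max C K * x)}} ≤
        ENNReal.ofReal (7 * Real.exp (-Real.log n ^ 2)) := by
    intro k c hc0 hc hk hb
    refine le_trans (measure_mono fun s hs => ?_) ((h₃ n hn3 m p π hπ _ _ hb).trans ?_)
    · intro h
      have := connected_and_diam_le_of_ediam_le h
      exact hs ⟨this.1, (Nat.cast_le.2 this.2).trans hk⟩
    · rw [← ENNReal.ofReal_add (by positivity) (Real.exp_pos _).le]
      refine ENNReal.ofReal_le_ofReal ?_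
      have := mul_le_mul_of_nonneg_right hc (Real.exp_pos (-Real.log n ^ 2)).le
      linarith
  rcases le_total (m : ℝ) (A * Real.log n) with hmA | hmA
  · refine key _ 6 (by norm_num) le_rfl ?_ (h₁ n hn1 m hm hmA)
    refine (Nat.floor_le (by positivity)).trans ?_
    exact mul_le_mul_of_nonneg_right (le_max_left _ _) (by linarith)
  · refine key K 2 (by norm_num) (by norm_num) ?_ (h₂ n hn2 m hm hmA)
    calc (K : ℝ) ≤ max C K * 1 := by rw [mul_one]; exact le_max_right _ _
      _ ≤ _ := mul_le_mul_of_nonneg_left hx1 (le_max_of_le_left hC.le)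

/-- For `m ≥ A log n` the power of `n` is bounded, and a connected graph with two nodes has diameter
at least `1`. The factor in `log n` is at most `1`, so it only weakens the bound. -/
theorem exists_stationary_not_le_diam (hα : α ∈ Set.Ioo (0 : ℝ) 1)
    (hβ : β ∈ Set.Ioo (0 : ℝ) (1 - α)) (p : unitInterval) :
    ∃ c > (0 : ℝ), ∃ N : ℕ, ∀ n ≥ N, ∀ m : ℕ, 1 ≤ m →
      ∀ π : Measure (State n m), IsStationary α β p π →
        π {s | s.2.2 ∈ {G : SimpleGraph (Fin n) | G.Connected ∧
          ¬ c * ((n : ℝ) ^ (β / ((1 - α) * m)) * Real.log n ^ (-α / m)) ≤ G.diam}} ≤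
        ENNReal.ofReal (3 * Real.exp (-Real.log n ^ 2)) := by
  obtain ⟨A, hA, c, hc, N₁, h₁⟩ := marks_diam_lower_le hα hβ p
  obtain ⟨N₃, h₃⟩ := exists_stationary_le (α := α) (β := β) hα.1.le
  obtain ⟨N₄, h₄⟩ := exists_forall_log_of_eventually (Filter.eventually_ge_atTop (1 : ℝ))
  have hγ : 0 < 1 - α := by linarith [hα.2]
  set d := Real.exp (-(β / ((1 - α) * A))) with hd
  have hd0 : 0 < d := Real.exp_pos _
  refine ⟨min c d, lt_min hc hd0, max N₁ (max N₃ (max N₄ 2)), fun n hn m hm π hπ => ?_⟩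
  simp only [ge_iff_le, max_le_iff] at hn
  obtain ⟨hn1, hn3, hn4, hn5⟩ := hn
  have hnt : Nontrivial (Fin n) := Fin.nontrivial_iff_two_le.2 hn5
  have hn0 : (0 : ℝ) < n := by exact_mod_cast (by omega : 0 < n)
  have hm0 : (0 : ℝ) < m := by exact_mod_cast hm
  have hL := h₄ n hn4
  have hlog : Real.log n ^ (-α / m) ≤ 1 := Real.rpow_le_one_of_one_le_of_nonpos hL
    (div_nonpos_of_nonpos_of_nonneg (by linarith [hα.1]) hm0.le)
  have hlog0 : 0 ≤ Real.log n ^ (-α / m) := Real.rpow_nonneg (by linarith) _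
  have hx0 : 0 ≤ (n : ℝ) ^ (β / ((1 - α) * m)) := by positivity
  have hle : ∀ a, min c d ≤ a → min c d * ((n : ℝ) ^ (β / ((1 - α) * m)) *
      Real.log n ^ (-α / m)) ≤ a * (n : ℝ) ^ (β / ((1 - α) * m)) := fun a ha =>
    mul_le_mul ha (mul_le_of_le_one_right hx0 hlog) (mul_nonneg hx0 hlog0)
      ((lt_min hc hd0).le.trans ha)
  rcases le_total (m : ℝ) (A * Real.log n) with hmA | hmA
  · refine le_trans (measure_mono fun s hs => ?_)
      ((h₃ n hn3 m p π hπ _ _ (h₁ n hn1 m hm hmA)).trans ?_)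
    · exact ⟨hs.1, fun h => hs.2 ((hle c (min_le_left _ _)).trans h)⟩
    · rw [← ENNReal.ofReal_add (by positivity) (Real.exp_pos _).le]
      exact ENNReal.ofReal_le_ofReal (by linarith)
  · have hemp : {s : State n m | s.2.2 ∈ {G : SimpleGraph (Fin n) | G.Connected ∧
        ¬ min c d * ((n : ℝ) ^ (β / ((1 - α) * m)) * Real.log n ^ (-α / m)) ≤ G.diam}} = ∅ := by
      refine Set.eq_empty_of_forall_notMem fun s hs => hs.2 ?_
      have h1 : 1 ≤ s.2.2.diam :=
        Nat.one_le_iff_ne_zero.2 (SimpleGraph.connected_iff_diam_ne_zero.1 hs.1)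
      refine (hle d (min_le_right _ _)).trans (le_trans ?_ (Nat.one_le_cast.2 h1))
      rw [hd, Real.rpow_def_of_pos hn0, ← Real.exp_add]
      refine Real.exp_le_one_iff.2 ?_
      rw [neg_add_nonpos_iff, mul_div_assoc', div_le_div_iff₀ (by positivity) (by positivity)]
      have := mul_le_mul_of_nonneg_left hmA (mul_pos hβ.1 hγ).le
      linarith
    rw [hemp, measure_empty]
    exact zero_le

/-- With high probability the graph is connected, with diameter between the two bounds. -/
theorem exists_stationary_diam_bounds (hα : α ∈ Set.Ioo (0 : ℝ) 1)
    (hβ : β ∈ Set.Ioo (0 : ℝ) (1 - α)) (p : unitInterval) (hp : 0 < p) :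
    ∃ c > (0 : ℝ), ∃ C > (0 : ℝ), ∃ N : ℕ, ∀ n ≥ N, ∀ m : ℕ, 1 ≤ m →
      ∀ π : Measure (State n m), IsStationary α β p π →
        1 - Real.exp (-(1 / 2) * Real.log n ^ 2) ≤ π.real {s | s.2.2.Connected ∧
          c * ((n : ℝ) ^ (β / ((1 - α) * m)) * Real.log n ^ (-α / m)) ≤ s.2.2.diam ∧
          (s.2.2.diam : ℝ) ≤
            C * ((n : ℝ) ^ (β / ((1 - α) * m)) * Real.log n ^ (2 * α / ((1 - α) * m)))} := by
  obtain ⟨C, hC, N₁, h₁⟩ := exists_stationary_not_diam_le hα hβ p hp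
  obtain ⟨c, hc, N₂, h₂⟩ := exists_stationary_not_le_diam hα hβ p
  obtain ⟨N₃, h₃⟩ := exists_forall_log_of_eventually (Filter.eventually_ge_atTop (5 : ℝ))
  refine ⟨c, hc, C, hC, max N₁ (max N₂ N₃), fun n hn m hm π hπ => ?_⟩
  simp only [ge_iff_le, max_le_iff] at hn
  have hprob := hπ.1
  have hL := h₃ n hn.2.2
  have hu := h₁ n hn.1 m hm π hπ
  have hl := h₂ n hn.2.1 m hm π hπ
  set U := {s : State n m | s.2.2 ∈ {G : SimpleGraph (Fin n) | ¬ (G.Connected ∧ (G.diam : ℝ) ≤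
    C * ((n : ℝ) ^ (β / ((1 - α) * m)) * Real.log n ^ (2 * α / ((1 - α) * m))))}} with hU
  set W := {s : State n m | s.2.2 ∈ {G : SimpleGraph (Fin n) | G.Connected ∧
    ¬ c * ((n : ℝ) ^ (β / ((1 - α) * m)) * Real.log n ^ (-α / m)) ≤ G.diam}} with hW
  set T := {s : State n m | s.2.2.Connected ∧
    c * ((n : ℝ) ^ (β / ((1 - α) * m)) * Real.log n ^ (-α / m)) ≤ s.2.2.diam ∧
    (s.2.2.diam : ℝ) ≤
      C * ((n : ℝ) ^ (β / ((1 - α) * m)) * Real.log n ^ (2 * α / ((1 - α) * m)))} with hT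
  have hcover : Set.univ ⊆ T ∪ (U ∪ W) := by
    intro s _
    by_cases hsU : s ∈ U
    · exact Or.inr (Or.inl hsU)
    by_cases hsW : s ∈ W
    · exact Or.inr (Or.inr hsW)
    have h1 := not_not.1 hsU
    exact Or.inl ⟨h1.1, not_not.1 fun h => hsW ⟨h1.1, h⟩, h1.2⟩
  have hU' : π.real U ≤ 7 * Real.exp (-Real.log n ^ 2) :=
    ENNReal.toReal_le_of_le_ofReal (by positivity) hu
  have hW' : π.real W ≤ 3 * Real.exp (-Real.log n ^ 2) :=
    ENNReal.toReal_le_of_le_ofReal (by positivity) hl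
  have h1 : 1 ≤ π.real T + (π.real U + π.real W) := by
    calc (1 : ℝ) = π.real Set.univ := probReal_univ.symm
      _ ≤ π.real (T ∪ (U ∪ W)) := measureReal_mono hcover
      _ ≤ _ := (measureReal_union_le _ _).trans (by gcongr; exact measureReal_union_le _ _)
  have h2 : 10 * Real.exp (-Real.log n ^ 2) ≤ Real.exp (-(1 / 2) * Real.log n ^ 2) := by
    have h3 : (10 : ℝ) ≤ Real.exp (1 / 2 * Real.log n ^ 2) := by
      have := Real.add_one_le_exp (1 / 2 * Real.log n ^ 2)
      nlinarith
    calc 10 * Real.exp (-Real.log n ^ 2)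
        ≤ Real.exp (1 / 2 * Real.log n ^ 2) * Real.exp (-Real.log n ^ 2) := by gcongr
      _ = _ := by rw [← Real.exp_add]; congr 1; ring
  linarith

/-- For `m ≤ K log L` the quantity `K * (log L / m)` is at least `1` and absorbs the logarithms of
the constants. -/
theorem abs_log_diam_sub_le (hα : α ∈ Set.Ioo (0 : ℝ) 1) {c C K L d m : ℝ} (hc : 0 < c)
    (hC : 0 < C) (hK : 0 < K) (hL : 0 < L) (hm : 0 < m) (hmK : m ≤ K * Real.log L)
    (h₁ : c * (Real.exp L ^ (β / ((1 - α) * m)) * L ^ (-α / m)) ≤ d)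
    (h₂ : d ≤ C * (Real.exp L ^ (β / ((1 - α) * m)) * L ^ (2 * α / ((1 - α) * m)))) :
    |Real.log d - β / ((1 - α) * m) * L| ≤
      ((|Real.log c| + |Real.log C|) * K + 2 * α / (1 - α) + α) * (Real.log L / m) := by
  have hγ : 0 < 1 - α := by linarith [hα.2]
  have hlog : ∀ a x : ℝ, 0 < a → Real.log (a * (Real.exp L ^ (β / ((1 - α) * m)) * L ^ x)) =
      Real.log a + (β / ((1 - α) * m) * L + x * Real.log L) := by
    intro a x ha
    rw [Real.log_mul ha.ne' (by positivity), Real.log_mul (by positivity) (by positivity),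
      Real.log_rpow (Real.exp_pos _), Real.log_rpow hL, Real.log_exp]
  have hd : 0 < d := lt_of_lt_of_le (by positivity) h₁
  have h₁' := Real.log_le_log (by positivity) h₁
  have h₂' := Real.log_le_log hd h₂
  rw [hlog _ _ hc] at h₁'
  rw [hlog _ _ hC] at h₂'
  have h1 : 1 ≤ K * (Real.log L / m) := by rwa [mul_div_assoc', one_le_div hm]
  have hℓ : 0 ≤ Real.log L / m :=
    div_nonneg (pos_of_mul_pos_right (hm.trans_le hmK) hK.le).le hm.le
  have h2 : |Real.log c| + |Real.log C| ≤
      (|Real.log c| + |Real.log C|) * (K * (Real.log L / m)) :=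
    le_mul_of_one_le_right (by positivity) h1
  have e1 : -α / m * Real.log L = -(α * (Real.log L / m)) := by ring
  have e2 : 2 * α / ((1 - α) * m) * Real.log L = 2 * α / (1 - α) * (Real.log L / m) := by
    field_simp
  have h3 : 0 ≤ α * (Real.log L / m) := mul_nonneg hα.1.le hℓ
  have h4 : 0 ≤ 2 * α / (1 - α) * (Real.log L / m) :=
    mul_nonneg (div_nonneg (by linarith [hα.1]) hγ.le) hℓ
  rw [e1] at h₁'
  rw [e2] at h₂'
  have h5 := neg_abs_le (Real.log c)
  have h6 := le_abs_self (Real.log C)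
  have h7 := abs_nonneg (Real.log c)
  have h8 := abs_nonneg (Real.log C)
  rw [abs_le]
  constructor <;> linarith

theorem rpow_mul_rpow_le_exp (hα : α ∈ Set.Ioo (0 : ℝ) 1) (hβ : 0 < β) {K L m : ℝ} (hK : 0 < K)
    (hL : 0 < L) (hm : 0 < m) (hmK : K * L ≤ m) :
    Real.exp L ^ (β / ((1 - α) * m)) * L ^ (2 * α / ((1 - α) * m)) ≤
      Real.exp ((β + 2 * α) / ((1 - α) * K)) := by
  have hγ : 0 < 1 - α := by linarith [hα.2]
  rw [← Real.exp_mul, Real.rpow_def_of_pos hL, ← Real.exp_add]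
  refine Real.exp_le_exp.2 ?_
  have h1 : Real.log L * (2 * α / ((1 - α) * m)) ≤ L * (2 * α / ((1 - α) * m)) :=
    mul_le_mul_of_nonneg_right (Real.log_le_self hL.le)
      (div_nonneg (by linarith [hα.1]) (by positivity))
  have h2 : L * ((β + 2 * α) / ((1 - α) * m)) ≤ (β + 2 * α) / ((1 - α) * K) := by
    rw [mul_div_assoc', div_le_div_iff₀ (by positivity) (by positivity)]
    have h3 : 0 ≤ (β + 2 * α) * (1 - α) := mul_nonneg (by linarith [hα.1]) hγ.le
    have := mul_le_mul_of_nonneg_left hmK h3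
    linarith
  have e : L * ((β + 2 * α) / ((1 - α) * m)) =
      L * (β / ((1 - α) * m)) + L * (2 * α / ((1 - α) * m)) := by ring
  linarith

end GeoP

/-- The diameter of the geo-protean graph. "With extreme probability" is: with probability at least
`1 - exp (-κ * log² n)`, for a constant `κ > 0` and all large `n`. All constants are uniform in the
dimension `m`, so that `m` may depend on `n`. -/
theorem theorem3p3 (α β : ℝ) (hα : α ∈ Set.Ioo (0 : ℝ) 1) (hβ : β ∈ Set.Ioo (0 : ℝ) (1 - α))
    (p : unitInterval) (hp : 0 < p) :
    (∀ n m : ℕ, 1 ≤ n → 1 ≤ m → ∃! π : Measure (GeoP.State n m), GeoP.IsStationary α β p π) ∧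
    (∃ c > (0 : ℝ), ∃ C > (0 : ℝ), ∃ κ > (0 : ℝ), ∃ N : ℕ, ∀ n ≥ N, ∀ m : ℕ, 1 ≤ m →
      ∀ π : Measure (GeoP.State n m), GeoP.IsStationary α β p π →
        1 - Real.exp (-κ * Real.log n ^ 2) ≤ π.real {s | s.2.2.Connected ∧
          c * ((n : ℝ) ^ (β / ((1 - α) * m)) * Real.log n ^ (-α / m)) ≤ s.2.2.diam ∧
          (s.2.2.diam : ℝ) ≤
            C * ((n : ℝ) ^ (β / ((1 - α) * m)) * Real.log n ^ (2 * α / ((1 - α) * m)))}) ∧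
    (∀ K > (0 : ℝ), ∃ C > (0 : ℝ), ∃ κ > (0 : ℝ), ∃ N : ℕ, ∀ n ≥ N, ∀ m : ℕ, 1 ≤ m →
      (m : ℝ) ≤ K * Real.log (Real.log n) →
      ∀ π : Measure (GeoP.State n m), GeoP.IsStationary α β p π →
        1 - Real.exp (-κ * Real.log n ^ 2) ≤ π.real {s | s.2.2.Connected ∧
          |Real.log s.2.2.diam - β / ((1 - α) * m) * Real.log n| ≤
            C * (Real.log (Real.log n) / m)}) ∧
    (∀ K > (0 : ℝ), ∃ M : ℕ, ∃ κ > (0 : ℝ), ∃ N : ℕ, ∀ n ≥ N, ∀ m : ℕ, 1 ≤ m →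
      K * Real.log n ≤ m →
      ∀ π : Measure (GeoP.State n m), GeoP.IsStationary α β p π →
        1 - Real.exp (-κ * Real.log n ^ 2) ≤ π.real {s | s.2.2.Connected ∧
          s.2.2.diam ≤ M}) := by
  obtain ⟨c, hc, C, hC, N, h⟩ := GeoP.exists_stationary_diam_bounds hα hβ p hp
  obtain ⟨N', hN'⟩ := GeoP.exists_forall_log_of_eventually (Filter.eventually_gt_atTop (0 : ℝ))
  have hγ : 0 < 1 - α := by linarith [hα.2]
  refine ⟨fun n m hn _ => GeoP.existsUnique_isStationary α β p hn,
    ⟨c, hc, C, hC, 1 / 2, by norm_num, N, h⟩, fun K hK => ?_, fun K hK => ?_⟩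
  -- Both remaining parts hold on the event of the two-sided bound, with the same `κ`.
  · refine ⟨(|Real.log c| + |Real.log C|) * K + 2 * α / (1 - α) + α, ?_, 1 / 2, by norm_num,
      max N (max N' 1), fun n hn m hm hmK π hπ => ?_⟩
    · have h1 : 0 ≤ 2 * α / (1 - α) := div_nonneg (by linarith [hα.1]) hγ.le
      have h2 : 0 ≤ (|Real.log c| + |Real.log C|) * K := by positivity
      linarith [hα.1]
    · simp only [ge_iff_le, max_le_iff] at hn
      have hprob := hπ.1
      refine (h n hn.1 m hm π hπ).trans (measureReal_mono ?_)
      rintro s ⟨hs, h1, h2⟩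
      have hn0 : (0 : ℝ) < n := by exact_mod_cast hn.2.2
      have e : (n : ℝ) = Real.exp (Real.log n) := (Real.exp_log hn0).symm
      refine ⟨hs, GeoP.abs_log_diam_sub_le hα hc hC hK (hN' n hn.2.1) (by exact_mod_cast hm) hmK
        ?_ ?_⟩
      · rw [← e]; exact h1
      · rw [← e]; exact h2
  · refine ⟨⌊C * Real.exp ((β + 2 * α) / ((1 - α) * K))⌋₊, 1 / 2, by norm_num, max N (max N' 1),
      fun n hn m hm hmK π hπ => ?_⟩
    simp only [ge_iff_le, max_le_iff] at hn
    have hprob := hπ.1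
    refine (h n hn.1 m hm π hπ).trans (measureReal_mono ?_)
    rintro s ⟨hs, -, h2⟩
    have hn0 : (0 : ℝ) < n := by exact_mod_cast hn.2.2
    have h3 := GeoP.rpow_mul_rpow_le_exp hα hβ.1 hK (hN' n hn.2.1)
      (show (0 : ℝ) < m by exact_mod_cast hm) hmK
    rw [Real.exp_log hn0] at h3
    exact ⟨hs, Nat.le_floor (h2.trans (mul_le_mul_of_nonneg_left h3 hC.le))⟩
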